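/- Geometries. A geometry over a finite set $I$ is a triple $\Gamma=(V,\tau,*)$ with a map $\tau:V\to I$ and a symmetric relation $*$ on $V$ such that vertices $x,y$ with $\tau(x)=\tau(y)$ satisfy $x*y$ if and only if $x=y$. A flag is a set of pairwise incident vertices; its corank is $|I\setminus\tau(X)|$; the residue of a flag $X$ is the geometry over $I\setminus\tau(X)$ on the vertices outside $X$ that are incident to all of $X$. A geometry is thick if every flag of corank $1$ lies in at least three maximal flags. A generalized $n$-gon is a thick rank $2$ geometry whose incidence graph has girth $2n$ and diameter $n$. For a Coxeter diagram $M=(m_{i,j})_{i,j\in I}$, a geometry of type $M$ is a thick geometry over $I$ in which residues of flags of corank $2$ are connected and the residue of every flag of type $I\setminus\{i,j\}$ ($i\ne j$) is a generalized $m_{i,j}$-gon. Local flags. For types $i\neq j$, call a flag $X$ $\{i,j\}$-local if $i,j\notin\tau(X)$ and every type in $I\setminus\{i,j\}$ adjacent to $i$ or $j$ in $M$ lies in $\tau(X)$; then $\Gamma_X^{ij}$ denotes the restriction of the residue of $X$ to the vertices of types $i$ and $j$. A geometry is intermediate if (F) vertices of distinct non-adjacent types are always incident; (P) for adjacent $i,j$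 and every $\{i,j\}$-local flag $X$, the graph $\Gamma_X^{ij}$ has no cycle of length $2t$ with $t<m_{i,j}$; (D) if $i\neq j$ and $m_{i,j}\ge4$, the restriction of $\Gamma$ to the types $i$ and $j$ has no cycle of length $4$. Procedure B. Let $i,j$ be adjacent types, $m=m_{i,j}$, $X$ an $\{i,j\}$-local flag, and $x,y$ vertices of $\Gamma_X^{ij}$, of the same type if $m$ is odd and of different types if $m$ is even, at distance at least $m+1$ (possibly infinite) in $\Gamma_X^{ij}$. Procedure B adds a path of length $m-1$ from $x$ to $y$ with $m-2$ new inner vertices of alternating types $i,j$; a new vertex is incident only to its neighbours on the path, to the vertices of $X$, and to the vertices of types distinct from and not adjacent to its own type. A geometry is obtained from $\Gamma_0$ by Procedure B if it is the union of a chain starting with $\Gamma_0$ in which each step is an application of Procedure B (or trivial), and Procedure B cannot be applied to it any more. Language. The language $L$ has a unary predicate $V_i$ for every type $i$, a symbol for incidence, functions $f_k(x_1,\dots,x_r,y,z)$ for $k\in\mathbb N$, $1\le r\le |I|-2$, and binary functions $g_{i,j}$ for types with $m_{i,j}\ge4$. If $X=\{x_1,\dots,x_r\}$ is an $\{i,j\}$-local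 flag for some $i\neq j$ and there is a unique shortest path $(a_0=y,a_1,\dots,a_l=z)$ in $\Gamma_X^{ij}$, then $f_k(x_1,\dots,x_r,y,z)=a_k$ for $k\le l$; in every other case the value is $x_1$. (In rank $3$ one has $r=1$ and $\Gamma_X^{ij}$ is the whole residue of $x_1$.) If $x\ne y$ are of type $i$ and are both incident with a vertex $z$ of type $j$, then $g_{i,j}(x,y)=z$; otherwise $g_{i,j}(x,y)=x$. Theorem. Let $M$ be of type $\mathsf C_3$, $\mathsf H_3$ or $\mathsf F_4$, and let $\mathcal C$ be the class of all $L$-structures isomorphic to a finitely generated $L$-substructure of a geometry of type $M$ that is obtained from a finite intermediate geometry by Procedure B. Then $\mathcal C$ has the hereditary property, the joint embedding property and the amalgamation property, and it has a countable Fraïssé limit. For every Fraïssé limit $F(\mathcal C)$, that is, every countable $L$-structure which has age $\mathcal C$ and in which every embedding of a finitely generated substructure into the whole structure extends to an automorphism, the following hold. (1) $F(\mathcal C)$ is the $L$-structure of a geometry of type $M$. (2) This geometry has flags of every type $J\subseteq I$, and the automorphism group of $F(\mathcal C)$ is transitive on the flags of each type. (3) If $M$ is of type $\mathsf C_3$,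 then $F(\mathcal C)$ has $L$-substructures that are isomorphic, as geometries, to the Neumaier geometry (whose points are the $7$ points, whose lines are the $35$ triples of points, and whose planes are the $15$ Fano planes of one orbit of the alternating group of degree $7$, with every point incident to every plane), and the automorphism group is transitive on these $L$-substructures. (4) Every isomorphism between finitely generated $L$-substructures of $F(\mathcal C)$ extends to an automorphism of $F(\mathcal C)$. -/

import Mathlib

open Set CategoryTheory FirstOrder FirstOrder.Language

/-! ### Incidence geometries -/

/-- A geometry over `I` with vertex set `V`: a type map and a symmetric incidence relation such
that two vertices of the same type are incident if and only if they are equal. -/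
structure IncGeometry (I V : Type) where
  typ : V → I
  inc : V → V → Prop
  symm : ∀ {x y : V}, inc x y → inc y x
  inc_iff_eq : ∀ {x y : V}, typ x = typ y → (inc x y ↔ x = y)

namespace IncGeometry

variable {I V : Type} (Γ : IncGeometry I V)

/-- A flag is a set of pairwise incident vertices. -/
def IsFlag (X : Set V) : Prop := ∀ x ∈ X, ∀ y ∈ X, Γ.inc x y

/-- The corank of `X`: the number of types that do not occur in `X`. -/
noncomputable def corank (X : Set V) : ℕ∞ := ((Γ.typ '' X)ᶜ).encard

/-- The vertices outside `X` that are incident to every vertex of `X`. -/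
def residueSet (X : Set V) : Set V := {v | v ∉ X ∧ ∀ x ∈ X, Γ.inc x v}

theorem typ_notMem_of_mem_residueSet {X : Set V} {v : V} (hv : v ∈ Γ.residueSet X) :
    Γ.typ v ∉ Γ.typ '' X := by
  rintro ⟨x, hx, hxv⟩
  exact hv.1 ((Γ.inc_iff_eq hxv).1 (hv.2 x hx) ▸ hx)

/-- The residue of `X`, a geometry over the types that do not occur in `X`. -/
def residue (X : Set V) : IncGeometry {i : I // i ∉ Γ.typ '' X} (Γ.residueSet X) where
  typ v := ⟨Γ.typ v.1, Γ.typ_notMem_of_mem_residueSet v.2⟩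
  inc u v := Γ.inc u.1 v.1
  symm h := Γ.symm h
  inc_iff_eq h := (Γ.inc_iff_eq (congrArg Subtype.val h)).trans Subtype.ext_iff.symm

/-- The geometry induced on a set of vertices. -/
def induce (S : Set V) : IncGeometry I S where
  typ v := Γ.typ v.1
  inc u v := Γ.inc u.1 v.1
  symm h := Γ.symm h
  inc_iff_eq h := (Γ.inc_iff_eq h).trans Subtype.ext_iff.symm

/-- The incidence graph. -/
def graph : SimpleGraph V where
  Adj u v := u ≠ v ∧ Γ.inc u v
  symm := ⟨fun _ _ h => ⟨h.1.symm, Γ.symm h.2⟩⟩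
  loopless := ⟨fun _ h => h.1 rfl⟩

/-- The incidence graph restricted to the vertices in `W` (the other vertices are isolated). -/
def graphOn (W : Set V) : SimpleGraph V where
  Adj u v := u ∈ W ∧ v ∈ W ∧ u ≠ v ∧ Γ.inc u v
  symm := ⟨fun _ _ h => ⟨h.2.1, h.1, h.2.2.1.symm, Γ.symm h.2.2.2⟩⟩
  loopless := ⟨fun _ h => h.2.2.1 rfl⟩

/-- The residue of every flag of corank 2 is connected. -/
def ResiduallyConnected : Prop :=
  ∀ X : Set V, Γ.IsFlag X → Γ.corank X = 2 → (Γ.residue X).graph.Connected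

/-- Every flag of corank 1 is contained in at least three maximal flags. -/
def IsThick : Prop :=
  ∀ X : Set V, Γ.IsFlag X → Γ.corank X = 1 → 3 ≤ {Y | Maximal Γ.IsFlag Y ∧ X ⊆ Y}.encard

/-- A generalized `n`-gon (`n` finite): a thick rank 2 geometry whose incidence graph has girth `2n`
and diameter `n`. -/
def IsGeneralizedPolygon (n : ℕ) : Prop :=
  Nat.card I = 2 ∧ Γ.IsThick ∧ Γ.graph.egirth = 2 * n ∧ Γ.graph.ediam = n

/-- Geometries of type `M`, for a Coxeter matrix `M` with finite entries. -/
def IsOfType (M : CoxeterMatrix I) : Prop :=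
  Γ.IsThick ∧ Γ.ResiduallyConnected ∧
    ∀ (i j : I), i ≠ j → ∀ X : Set V, Γ.IsFlag X → Γ.typ '' X = {i, j}ᶜ →
      (Γ.residue X).IsGeneralizedPolygon (M i j)

/-! ### Intermediate geometries and Procedure B -/

/-- The restriction of the residue of `X` to the vertices of types `i` and `j`. -/
def localSet (X : Set V) (i j : I) : Set V :=
  {v | v ∈ Γ.residueSet X ∧ (Γ.typ v = i ∨ Γ.typ v = j)}

/-- `X` is a flag, `i` and `j` are distinct types that do not occur in `X`, and every other type
that is adjacent to `i` or `j` in the Coxeter diagram occurs in `X`. -/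
def IsLocalFlag (M : CoxeterMatrix I) (X : Set V) (i j : I) : Prop :=
  Γ.IsFlag X ∧ i ≠ j ∧ i ∉ Γ.typ '' X ∧ j ∉ Γ.typ '' X ∧
    ∀ h : I, h ≠ i → h ≠ j → (M h i ≠ 2 ∨ M h j ≠ 2) → h ∈ Γ.typ '' X

/-- The graph has no cycle of length `2t`. -/
def WithoutGons (G : SimpleGraph V) (t : ℕ) : Prop :=
  ∀ (v : V) (c : G.Walk v v), c.IsCycle → c.length ≠ 2 * t

/-- (F): vertices whose types are distinct and not adjacent in the diagram are incident. -/
def PropertyF (M : CoxeterMatrix I) : Prop :=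
  ∀ u v : V, M (Γ.typ u) (Γ.typ v) = 2 → Γ.inc u v

/-- (P): for adjacent types `i`, `j` and a flag `X` that contains all other types adjacent to `i` or
`j`, the residue of `X` restricted to the types `i` and `j` has no `t`-gons with `t < M i j`. -/
def PropertyP (M : CoxeterMatrix I) : Prop :=
  ∀ (i j : I) (X : Set V), M i j ≠ 2 → Γ.IsLocalFlag M X i j →
    ∀ t < M i j, WithoutGons (Γ.graphOn (Γ.localSet X i j)) t

/-- (D): if `M i j ≥ 4`, there are no digons on the types `i` and `j`. -/
def PropertyD (M : CoxeterMatrix I) : Prop :=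
  ∀ i j : I, i ≠ j → 4 ≤ M i j → WithoutGons (Γ.graphOn {v | Γ.typ v = i ∨ Γ.typ v = j}) 2

/-- Intermediate geometries. -/
def IsIntermediate (M : CoxeterMatrix I) : Prop :=
  Γ.PropertyF M ∧ Γ.PropertyP M ∧ Γ.PropertyD M

/-- Procedure B can be applied, in the geometry induced on `S`, to the flag `X`, the adjacent types
`i`, `j`, and the vertices `x`, `y`. -/
def ViableB (M : CoxeterMatrix I) (S X : Set V) (i j : I) (x y : V) : Prop :=
  M i j ≠ 2 ∧ X ⊆ S ∧ Γ.IsLocalFlag M X i j ∧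
    x ∈ Γ.localSet X i j ∩ S ∧ y ∈ Γ.localSet X i j ∩ S ∧
    (Odd (M i j) → Γ.typ x = Γ.typ y) ∧ (Even (M i j) → Γ.typ x ≠ Γ.typ y) ∧
    (M i j : ℕ∞) + 1 ≤ (Γ.graphOn (Γ.localSet X i j ∩ S)).edist x y

/-- The geometry induced on `S'` arises from the one induced on `S` by one application of
Procedure B: a path `a 0, …, a (m - 1)`, with `m = M i j`, of new vertices of alternating types
`i` and `j` is added between two old vertices `a 0` and `a (m - 1)`; a new vertex is incident only
to its neighbours on the path, to the flag `X`, and to the vertices prescribed by (F)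
(and to itself). -/
def StepB (M : CoxeterMatrix I) (S S' : Set V) : Prop :=
  ∃ (X : Set V) (i j : I) (a : ℕ → V),
    Γ.ViableB M S X i j (a 0) (a (M i j - 1)) ∧
    S' = S ∪ a '' Ioo 0 (M i j - 1) ∧
    (∀ k ∈ Ioo 0 (M i j - 1), a k ∉ S) ∧
    InjOn a (Ioo 0 (M i j - 1)) ∧
    (∀ k < M i j, Γ.typ (a k) = i ∨ Γ.typ (a k) = j) ∧
    (∀ k < M i j - 1, Γ.typ (a k) ≠ Γ.typ (a (k + 1))) ∧
    ∀ k ∈ Ioo 0 (M i j - 1), ∀ w ∈ S', w ≠ a k →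
      (Γ.inc (a k) w ↔
        w = a (k - 1) ∨ w = a (k + 1) ∨ w ∈ X ∨ M (Γ.typ (a k)) (Γ.typ w) = 2)

/-- `Γ` is obtained from a finite intermediate geometry by applying Procedure B exhaustively:
`Γ` is the union of a chain of geometries that starts with a finite intermediate one and in which
every step is an application of Procedure B (or trivial), and Procedure B can no longer be applied
to `Γ`. -/
def IsBuiltByB (M : CoxeterMatrix I) : Prop :=
  (∃ S : ℕ → Set V, (S 0).Finite ∧ (Γ.induce (S 0)).IsIntermediate M ∧
    (∀ n, S (n + 1) = S n ∨ Γ.StepB M (S n) (S (n + 1))) ∧ ⋃ n, S n = univ) ∧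
  ∀ (X : Set V) (i j : I) (x y : V), ¬ Γ.ViableB M univ X i j x y

end IncGeometry

/-! ### The first-order language -/

/-- The function symbols: `f_k(x₁, …, x_r, y, z)` for `1 ≤ r ≤ |I| - 2`, and `g_{i,j}(x, y)` for
types with `M i j ≥ 4`. In rank 3 only `r = 1` occurs, so the `f_k` are ternary. -/
inductive GeomFun {I : Type} (M : CoxeterMatrix I) : ℕ → Type
  | path (r k : ℕ) (hr : 1 ≤ r ∧ r + 2 ≤ Nat.card I) : GeomFun M (r + 2)
  | meet (i j : I) (h : 4 ≤ M i j) : GeomFun M 2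

/-- The relation symbols: one unary predicate for each type, and the incidence relation. -/
inductive GeomRel (I : Type) : ℕ → Type
  | vertex (i : I) : GeomRel I 1
  | incident : GeomRel I 2

/-- The language of geometries with diagram `M`. -/
def geomLanguage {I : Type} (M : CoxeterMatrix I) : FirstOrder.Language.{0, 0} where
  Functions := GeomFun M
  Relations := GeomRel I

instance {I : Type} [Countable I] (M : CoxeterMatrix I) :
    Countable (Σ n, (geomLanguage M).Functions n) := by
  let F : (Σ n, GeomFun M n) → (ℕ × ℕ) ⊕ (I × I) := fun s =>
    match s with
    | ⟨_, .path r k _⟩ => Sum.inl (r, k)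
    | ⟨_, .meet i j _⟩ => Sum.inr (i, j)
  have hF : Function.Injective F := by
    rintro ⟨_, a⟩ ⟨_, b⟩ h
    cases a <;> cases b <;> simp_all [F]
    obtain ⟨rfl, rfl⟩ := h
    rfl
  exact hF.countable

namespace IncGeometry

variable {I V : Type} (Γ : IncGeometry I V)

/-- `v` is the vertex `a_k` of the unique shortest path `a_0 = y, …, a_l = z` between `y` and `z` in
the residue of the flag `X`, restricted to two types `i` and `j` as in (P). If the diagram has
rank 3 and `X` is a single vertex, then the two types are all the types of the residue, and the
restriction is void. -/
def IsPathVertex (M : CoxeterMatrix I) (X : Set V) (k : ℕ) (y z v : V) : Prop :=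
  ∃ i j : I, Γ.IsLocalFlag M X i j ∧ y ∈ Γ.localSet X i j ∧ z ∈ Γ.localSet X i j ∧
    ∃ p : (Γ.graphOn (Γ.localSet X i j)).Walk y z,
      (∀ q : (Γ.graphOn (Γ.localSet X i j)).Walk y z, q ≠ p → p.length < q.length) ∧
      k ≤ p.length ∧ v = p.getVert k

/-- `z` is a vertex of type `j` incident with the two distinct vertices `x` and `y` of type `i`. -/
def IsMeet (i j : I) (x y z : V) : Prop :=
  x ≠ y ∧ Γ.typ x = i ∧ Γ.typ y = i ∧ Γ.typ z = j ∧ Γ.inc x z ∧ Γ.inc y z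

open Classical in
/-- A geometry as a first-order structure. Each function takes its first argument as value where
the vertex that it is meant to give does not exist. -/
@[reducible]
noncomputable def toStructure (M : CoxeterMatrix I) : (geomLanguage M).Structure V where
  funMap
    | .path r k _, v =>
      let X : Set V := range fun a : Fin r => v (Fin.castAdd 2 a)
      let y : V := v (Fin.natAdd r 0)
      let z : V := v (Fin.natAdd r 1)
      if h : ∃ u, Γ.IsPathVertex M X k y z u then h.choose else v 0
    | .meet i j _, v => if h : ∃ z, Γ.IsMeet i j (v 0) (v 1) z then h.choose else v 0
  RelMap
    | .vertex i, v => Γ.typ (v 0) = i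
    | .incident, v => Γ.inc (v 0) (v 1)

end IncGeometry

/-- The class of all finitely generated structures that embed into a geometry of type `M` obtained
from a finite intermediate geometry by Procedure B. -/
def geomClass {I : Type} (M : CoxeterMatrix I) : Set (Bundled.{0} (geomLanguage M).Structure) :=
  {A | Structure.FG (geomLanguage M) A ∧
    ∃ (V : Type) (Γ : IncGeometry I V), Γ.IsOfType M ∧ Γ.IsBuiltByB M ∧
      letI := Γ.toStructure M
      Nonempty (A ↪[geomLanguage M] V)}

/-! ### The Neumaier geometry -/

/-- A Fano plane on `Fin 7`, given by its seven lines. -/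
def fanoPlane : Finset (Finset (Fin 7)) :=
  Finset.univ.image fun i : Fin 7 => {i, i + 1, i + 3}

/-- The planes of the Neumaier geometry: the images of one Fano plane under the alternating group
of degree 7. -/
def IsNeumaierPlane (P : Finset (Finset (Fin 7))) : Prop :=
  ∃ σ ∈ alternatingGroup (Fin 7), P = fanoPlane.image fun l => l.image σ

/-- The vertices of the Neumaier geometry: the 7 points, the 35 triples of points as lines, and
15 Fano planes. -/
inductive NeumaierVertex : Type
  | point (p : Fin 7)
  | line (l : Finset (Fin 7)) (hl : l.card = 3)
  | plane (P : Finset (Finset (Fin 7))) (hP : IsNeumaierPlane P)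

/-- The type of a vertex: 0 for points, 1 for lines, 2 for planes. -/
def NeumaierVertex.typ : NeumaierVertex → Fin 3
  | .point _ => 0
  | .line _ _ => 1
  | .plane _ _ => 2

/-- Incidence in the Neumaier geometry: natural between points and lines and between lines and
planes, and every point is incident with every plane. -/
def NeumaierVertex.inc : NeumaierVertex → NeumaierVertex → Prop
  | .point p, .point q => p = q
  | .point p, .line l _ => p ∈ l
  | .line l _, .point p => p ∈ l
  | .line l _, .line l' _ => l = l'
  | .line l _, .plane P _ => l ∈ P
  | .plane P _, .line l _ => l ∈ P
  | .plane P _, .plane Q _ => P = Q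
  | .point _, .plane _ _ => True
  | .plane _ _, .point _ => True

/-- For a bijection `e` from `I` to the nodes 0, 1, 2 of the diagram `C₃` (with the double bond
between 1 and 2), the geometry that `Γ` induces on `S` is isomorphic to the Neumaier geometry. -/
def IncGeometry.IsNeumaierOn {I V : Type} (Γ : IncGeometry I V) (e : I ≃ Fin 3) (S : Set V) :
    Prop :=
  ∃ φ : NeumaierVertex ≃ S, (∀ u, e (Γ.typ (φ u)) = u.typ) ∧
    ∀ u v, Γ.inc (φ u) (φ v) ↔ NeumaierVertex.inc u v

/-- `M` has the same Coxeter diagram as `N`, up to naming the nodes. -/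
def CoxeterMatrix.HasDiagram {I J : Type} (M : CoxeterMatrix I) (N : CoxeterMatrix J) : Prop :=
  ∃ e : I ≃ J, M.reindex e = N

/-! Procedure B is a free construction in the spirit of free generalized polygons, and the theorem
rests on the fact that the geometries which it produces amalgamate freely.

Two simplifications make it manageable. A local flag is reduced to its tight part, the vertices
whose types are adjacent to `i` or `j`; by (F) the other vertices have no influence. The distance
condition is removed from Procedure B, which leaves free steps. A new vertex has, apart from the
flag and what (F) prescribes, only its two neighbours on the new path, so a new cycle must run
through the whole path; hence a free step between distant vertices preserves (F), (P) and (D)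
(`FreeStep.isIntermediateOn`). Conversely, if the result has (P), the endpoints were distant
(`FreeStep.le_edist`). The diagram enters through `CoxeterMatrix.IsGood`: of two bonds that share a
type, at least one has label at least 4, so that (D) is available.

In a geometry of type `M` obtained by Procedure B, a shortest path in a local graph is unique
exactly if its length is less than `M i j`. Therefore substructures are the same as closed sets,
that is, sets containing the short paths between their elements and the vertices determined by (D)
(`IsClosedIn.funMap_mem`, `isClosedIn_of_funMap_mem`), and embeddings of structures are isomorphisms
of geometries onto closed sets (`IsoOn.exists_strEmb`).

For amalgamation, two intermediate geometries are glued over a common closed part without further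
incidences than those forced by (F). The result is intermediate and both parts are closed in it
(`IsAmalgam.isIntermediateOn`, `IsAmalgam.isClosedIn`). If the common part is finitely generated,
then from some stage on every new path is either contained in it or avoids it
(`IsClosedIn.exists_isFreeIn`), and the two chains can be interleaved to a chain for the amalgam
that starts with a finite set (`IsAmalgam.exists_isFreeChain`). The amalgam is usually neither
saturated nor thick. Its finite first stage is therefore completed to a thick saturated geometry,
into which the amalgam is mapped step by step along paths of the completion
(`exists_isFreeIn_embedding`); saturated closed parts, such as the two given geometries, stay closed
(`IsFreeIn.isClosedIn_image`). Thickness of the completion is forced by adding twelve vertices of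
every type before Procedure B is run, followed by a count (`hasCompletions_of_three`,
`hasCompletions_of_four`).

Every member of the class embeds in every completion of some finite geometry, so there are only
countably many isomorphism types, and a Fraïssé limit is a direct limit (`exists_isFraisseLimit`). A
finitely generated substructure of the limit lies in a thick saturated geometry, and finite pieces
of that geometry can be copied into the limit over the substructure (`exists_local_model`). This
makes the limit itself thick, saturated and intermediate, hence of type `M`. Flags are finite closed
sets, so their transitivity is ultrahomogeneity. The Neumaier geometry is intermediate and already
saturated; it is thus closed in a completion and occurs as a finite substructure of the limit. -/

/-! ### Paths and cycles as sequences of vertices -/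

namespace SimpleGraph

variable {V : Type*} {G : SimpleGraph V}

/-- A path of length `l`, given by the sequence `b` of its vertices. -/
structure IsPathSeq (G : SimpleGraph V) (l : ℕ) (b : ℕ → V) : Prop where
  adj : ∀ k < l, G.Adj (b k) (b (k + 1))
  inj : InjOn b (Iic l)

/-- A cycle of length `n`, given by the `n`-periodic sequence `v` of its vertices. -/
structure IsCycleSeq (G : SimpleGraph V) (n : ℕ) (v : ℕ → V) : Prop where
  three_le : 3 ≤ n
  periodic : ∀ k, v (k + n) = v k
  adj : ∀ k, G.Adj (v k) (v (k + 1))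
  inj : InjOn v (Iio n)

/-- There are no cycles of length less than `2 * m`. -/
def NoShortCycle (G : SimpleGraph V) (m : ℕ) : Prop :=
  ∀ n v, G.IsCycleSeq n v → 2 * m ≤ n

namespace IsCycleSeq

variable {n : ℕ} {v : ℕ → V}

theorem apply_add_mul (h : G.IsCycleSeq n v) (r q : ℕ) : v (r + n * q) = v r := by
  induction q generalizing r with
  | zero => simp
  | succ q ih => rw [Nat.mul_succ, ← Nat.add_assoc, h.periodic, ih]

theorem apply_mod (h : G.IsCycleSeq n v) (k : ℕ) : v (k % n) = v k := by
  conv_rhs => rw [← Nat.mod_add_div k n, h.apply_add_mul]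

theorem eq_iff (h : G.IsCycleSeq n v) {k l : ℕ} : v k = v l ↔ k ≡ l [MOD n] := by
  have hn : 0 < n := by have := h.three_le; omega
  rw [← h.apply_mod k, ← h.apply_mod l]
  exact ⟨fun e => h.inj (Nat.mod_lt _ hn) (Nat.mod_lt _ hn) e, fun e => congrArg v e⟩

theorem rotate (h : G.IsCycleSeq n v) (r : ℕ) : G.IsCycleSeq n (fun k => v (k + r)) where
  three_le := h.three_le
  periodic k := by rw [show k + n + r = k + r + n by ring]; exact h.periodic _
  adj k := by rw [show k + 1 + r = k + r + 1 by ring]; exact h.adj _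
  inj k hk l hl e := by
    have := Nat.ModEq.add_right_cancel' r (h.eq_iff.1 e)
    exact Nat.ModEq.eq_of_lt_of_lt this hk hl

/-- Multiplication by `n - 1` is negation modulo `n`, so this traverses the cycle backwards without
negative indices. -/
theorem reverse (h : G.IsCycleSeq n v) : G.IsCycleSeq n (fun k => v ((n - 1) * k)) where
  three_le := h.three_le
  periodic k := by
    rw [h.eq_iff, Nat.mul_add]
    simp [Nat.ModEq]
  adj k := by
    have h3 := h.three_le
    have := h.adj ((n - 1) * (k + 1))
    have e : v ((n - 1) * (k + 1) + 1) = v ((n - 1) * k) := by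
      rw [show (n - 1) * (k + 1) + 1 = (n - 1) * k + n by rw [Nat.mul_succ]; omega, h.periodic]
    rw [e] at this
    exact this.symm
  inj k hk l hl e := by
    have h3 := h.three_le
    have hc : n.gcd (n - 1) = 1 := by
      have := (Nat.coprime_self_sub_right (m := 1) (n := n) (by omega)).2 (Nat.coprime_one_right n)
      exact this
    have := Nat.ModEq.cancel_left_of_coprime hc (h.eq_iff.1 e)
    exact Nat.ModEq.eq_of_lt_of_lt this hk hl

theorem exists_reverse (h : G.IsCycleSeq n v) (s : ℕ) :
    ∃ u, G.IsCycleSeq n u ∧ u 0 = v (s + 1) ∧ u 1 = v s := by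
  obtain ⟨t, rfl⟩ : ∃ t, n = t + 3 := ⟨n - 3, by have := h.three_le; omega⟩
  -- Modulo `n = t + 3`, the factor `t + 2` is `-1`; rotating by `(t + 2) * (s + 1)` makes the
  -- reversed cycle start at `s + 1`.
  refine ⟨_, h.reverse.rotate ((t + 2) * (s + 1)), ?_, ?_⟩
  · rw [← h.apply_add_mul (s + 1) ((t + 1) * (s + 1))]
    congr 1
    rw [show t + 3 - 1 = t + 2 by omega]
    ring
  · rw [← h.apply_add_mul s (1 + (t + 1) * (s + 1))]
    congr 1
    rw [show t + 3 - 1 = t + 2 by omega]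
    ring

theorem mono {G' : SimpleGraph V} (h : G.IsCycleSeq n v)
    (hG : ∀ k, G'.Adj (v k) (v (k + 1))) : G'.IsCycleSeq n v :=
  ⟨h.three_le, h.periodic, hG, h.inj⟩

theorem add_two_ne (h : G.IsCycleSeq n v) (k : ℕ) : v (k + 2) ≠ v k := by
  intro e
  have h3 := h.three_le
  have := h.eq_iff.1 (show v (k + 2) = v (k + 0) from e)
  have := Nat.ModEq.add_left_cancel' k this
  rw [Nat.ModEq, Nat.zero_mod, Nat.mod_eq_of_lt (by omega)] at this
  omega

end IsCycleSeq

theorem Walk.IsCycle.isCycleSeq {u : V} {c : G.Walk u u} (hc : c.IsCycle) :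
    G.IsCycleSeq c.length (fun k => c.getVert (k % c.length)) := by
  have h3 := hc.three_le_length
  refine ⟨h3, fun k => by simp, fun k => ?_, fun k hk l hl e => ?_⟩
  · have hk := Nat.mod_lt k (show 0 < c.length by omega)
    have := c.adj_getVert_succ hk
    rcases Nat.lt_or_ge (k % c.length + 1) c.length with h | h
    · rwa [show (k + 1) % c.length = k % c.length + 1 by
        rw [Nat.add_mod, Nat.mod_eq_of_lt (show 1 < c.length by omega), Nat.mod_eq_of_lt h] ]
    · have e : k % c.length + 1 = c.length := by omega
      have e' : (k + 1) % c.length = 0 := by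
        rw [Nat.add_mod, Nat.mod_eq_of_lt (show 1 < c.length by omega), e, Nat.mod_self]
      rw [e, Walk.getVert_length] at this
      simpa [e'] using this
  · simp only [mem_Iio] at hk hl
    simp only [Nat.mod_eq_of_lt hk, Nat.mod_eq_of_lt hl] at e
    exact hc.getVert_injOn' (by simp; omega) (by simp; omega) e

theorem exists_walk_of_adj {l : ℕ} {b : ℕ → V} (h : ∀ k < l, G.Adj (b k) (b (k + 1))) :
    ∃ p : G.Walk (b 0) (b l), p.length = l ∧ ∀ k ≤ l, p.getVert k = b k := by
  induction l with
  | zero => exact ⟨Walk.nil, rfl, fun k hk => by simp [Nat.le_zero.1 hk]⟩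
  | succ l ih =>
    obtain ⟨p, hp, hb⟩ := ih fun k hk => h k (by omega)
    refine ⟨p.concat (h l (by omega)), by simp [hp], fun k hk => ?_⟩
    rcases Nat.lt_or_ge l k with hlk | hlk
    · obtain rfl : k = l + 1 := by omega
      exact Walk.getVert_of_length_le _ (by simp [hp])
    · rw [Walk.concat_eq_append, Walk.getVert_append]
      rcases Nat.lt_or_ge k p.length with hk' | hk'
      · simp [hk', hb k hlk]
      · obtain rfl : k = l := by omega
        simp [hp]

namespace IsPathSeq

variable {l : ℕ} {b : ℕ → V}

theorem exists_walk (h : G.IsPathSeq l b) : ∃ p : G.Walk (b 0) (b l), p.IsPath ∧ p.length = l ∧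
    ∀ k ≤ l, p.getVert k = b k := by
  obtain ⟨p, hp, hb⟩ := exists_walk_of_adj h.adj
  refine ⟨p, (Walk.IsPath.getVert_injOn_iff p).1 ?_, hp, hb⟩
  intro k hk k' hk' e
  simp only [mem_ofPred_eq, hp] at hk hk'
  rw [hb k hk, hb k' hk'] at e
  exact h.inj hk hk' e

theorem mono {G' : SimpleGraph V} (h : G.IsPathSeq l b)
    (hG : ∀ k < l, G'.Adj (b k) (b (k + 1))) : G'.IsPathSeq l b := ⟨hG, h.inj⟩

theorem segment (h : G.IsPathSeq l b) {r s : ℕ} (hrs : r + s ≤ l) :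
    G.IsPathSeq s (fun k => b (r + k)) where
  adj k hk := by
    simp only [← Nat.add_assoc]
    exact h.adj _ (by omega)
  inj k hk k' hk' e := by
    simp only [mem_Iic] at hk hk'
    have := h.inj (show r + k ∈ Iic l by simp; omega) (show r + k' ∈ Iic l by simp; omega) e
    omega

theorem edist_le (h : G.IsPathSeq l b) : G.edist (b 0) (b l) ≤ l := by
  obtain ⟨p, -, hp, -⟩ := h.exists_walk
  exact p.edist_le.trans (by rw [hp])

end IsPathSeq

theorem Walk.IsPath.isPathSeq {u v : V} {p : G.Walk u v} (hp : p.IsPath) :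
    G.IsPathSeq p.length p.getVert :=
  ⟨fun _ hk => p.adj_getVert_succ hk, hp.getVert_injOn⟩

theorem Walk.exists_isPathSeq {u v : V} (p : G.Walk u v) :
    ∃ l b, l ≤ p.length ∧ G.IsPathSeq l b ∧ b 0 = u ∧ b l = v := by
  classical
  exact ⟨p.bypass.length, p.bypass.getVert, p.length_bypass_le_length,
    p.bypass_isPath.isPathSeq, by simp, by simp⟩

theorem exists_isPathSeq_of_edist_lt {u v : V} {m : ℕ} (h : G.edist u v < m) :
    ∃ l b, l < m ∧ G.IsPathSeq l b ∧ b 0 = u ∧ b l = v := by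
  obtain ⟨p, hp⟩ := exists_walk_of_edist_ne_top (ne_top_of_lt h)
  obtain ⟨l, b, hl, hb, h0, h1⟩ := p.exists_isPathSeq
  refine ⟨l, b, ?_, hb, h0, h1⟩
  rw [← hp] at h
  exact hl.trans_lt (by exact_mod_cast h)

/-- A cyclic sequence gives a cycle. -/
theorem IsCycleSeq.exists_isCycle {n : ℕ} {v : ℕ → V} (h : G.IsCycleSeq n v) :
    ∃ c : G.Walk (v 0) (v 0), c.IsCycle ∧ c.length = n := by
  have h3 := h.three_le
  have hb : G.IsPathSeq (n - 1) v :=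
    ⟨fun k _ => h.adj k, fun k hk l hl e => h.inj (by simp at hk ⊢; omega)
      (by simp at hl ⊢; omega) e⟩
  obtain ⟨p, hp, hl, hv⟩ := hb.exists_walk
  have hadj : G.Adj (v (n - 1)) (v 0) := by
    have := h.adj (n - 1)
    rw [show n - 1 + 1 = 0 + n by omega, h.periodic] at this
    exact this
  let c := p.concat hadj
  have hc : c.length = n := by simp [c, hl]; omega
  refine ⟨c, ?_, hc⟩
  -- After reversal the closing edge comes first, where `Walk.cons_isCycle_iff` applies.
  have : c.reverse.IsCycle := by
    simp only [c, Walk.reverse_concat]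
    rw [Walk.cons_isCycle_iff]
    refine ⟨hp.reverse, fun he => ?_⟩
    rw [Walk.edges_reverse, List.mem_reverse] at he
    obtain ⟨i, hi, he⟩ : ∃ i < p.length, s(p.getVert i, p.getVert (i + 1)) = s(v 0, v (n - 1)) := by
      obtain ⟨i, hi, he⟩ := List.mem_iff_getElem.1 he
      refine ⟨i, by simpa using hi, ?_⟩
      rw [← he, Walk.getElem_edges]
    rw [hl] at hi
    rw [hv i (by omega), hv (i + 1) (by omega), Sym2.eq_iff] at he
    rcases he with ⟨e1, e2⟩ | ⟨e1, e2⟩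
    · have := h.inj (show i ∈ Iio n by simp; omega) (show 0 ∈ Iio n by simp; omega) e1
      have := h.inj (show i + 1 ∈ Iio n by simp; omega) (show n - 1 ∈ Iio n by simp; omega) e2
      omega
    · have := h.inj (show i ∈ Iio n by simp; omega) (show n - 1 ∈ Iio n by simp; omega) e1
      omega
  simpa using this.reverse

theorem Walk.IsCycle.two_mul_le_length {m : ℕ} (hG : G.NoShortCycle m) {u : V} {c : G.Walk u u}
    (hc : c.IsCycle) : 2 * m ≤ c.length := hG _ _ hc.isCycleSeq

/-- In a graph without short cycles, short paths are determined by their endpoints. -/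
theorem NoShortCycle.path_unique {m : ℕ} (hG : G.NoShortCycle m) {l l' : ℕ} {b b' : ℕ → V}
    (hb : G.IsPathSeq l b) (hb' : G.IsPathSeq l' b') (h0 : b 0 = b' 0) (h1 : b l = b' l')
    (hl : l + l' < 2 * m) : l = l' ∧ ∀ k ≤ l, b k = b' k := by
  obtain ⟨p, hp, hpl, hpb⟩ := hb.exists_walk
  obtain ⟨q, hq, hql, hqb⟩ := hb'.exists_walk
  have key : ∀ u v (e0 : b 0 = u) (e1 : b l = v) (q : G.Walk u v), q.IsPath → q.length = l' →
      (p.copy e0 e1) = q := by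
    rintro _ _ rfl rfl q hq hql
    by_contra hne
    obtain ⟨w, -, -, c, hc, hcl⟩ := hp.exists_isCycle_length_le_add_of_ne hq hne
    have := hc.two_mul_le_length hG
    omega
  have e := key _ _ h0 h1 q hq hql
  have hll : l = l' := by rw [← hpl, ← hql, ← e, Walk.length_copy]
  refine ⟨hll, fun k hk => ?_⟩
  rw [← hpb k hk, ← hqb k (hll ▸ hk), ← e, Walk.getVert_copy]

theorem NoShortCycle.anti {G' : SimpleGraph V} {m : ℕ} (hG : G.NoShortCycle m) (h : G' ≤ G) :
    G'.NoShortCycle m := fun n v hv => hG n v (hv.mono fun k => h (hv.adj k))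

/-- Along a walk, a 2-colouring alternates. -/
theorem apply_eq_iff_even {α : Type*} {t : V → α} {x y : α}
    (ht : ∀ u v, G.Adj u v → t u ≠ t v ∧ (t u = x ∨ t u = y) ∧ (t v = x ∨ t v = y)) {l : ℕ}
    {b : ℕ → V} (h : ∀ k < l, G.Adj (b k) (b (k + 1))) : t (b l) = t (b 0) ↔ Even l := by
  induction l with
  | zero => simp
  | succ l ih =>
    have ih := ih fun k hk => h k (by omega)
    have h1 := ht _ _ (h l (by omega))
    have h0 := (ht _ _ (h 0 (by omega))).2.1
    rw [Nat.even_add_one, ← ih]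
    grind

/-- Cycles of a 2-coloured graph have even length, so only the lengths `2 * k` need to be excluded.
-/
theorem noShortCycle_of_bipartite {α : Type*} {t : V → α} {x y : α}
    (ht : ∀ u v, G.Adj u v → t u ≠ t v ∧ (t u = x ∨ t u = y) ∧ (t v = x ∨ t v = y)) {m : ℕ}
    (h : ∀ k < m, ∀ n v, G.IsCycleSeq n v → n ≠ 2 * k) : G.NoShortCycle m := by
  intro n v hv
  by_contra hlt
  have he : Even n := (apply_eq_iff_even ht (l := n) fun k _ => hv.adj k).1 (by
    have := hv.periodic 0
    rw [Nat.zero_add] at this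
    rw [this])
  obtain ⟨k, rfl⟩ := he
  exact h k (by omega) _ v hv (by ring)

end SimpleGraph

/-! ### Good diagrams, tight flags and free steps -/

/-- The properties of a Coxeter diagram on which the free constructions rest. Two types `i`, `j`
are adjacent in the diagram if `3 ≤ M i j`. -/
structure CoxeterMatrix.IsGood {I : Type} (M : CoxeterMatrix I) : Prop where
  two_le : ∀ i j, i ≠ j → 2 ≤ M i j
  four_le : ∀ i j h, M i j = 3 → 3 ≤ M j h → i ≠ h → 4 ≤ M j h
  eq_of_adj : ∀ i j h, M i j = 3 → 3 ≤ M j h → i ≠ h →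
    ∀ k, k ≠ i → k ≠ j → (3 ≤ M k i ∨ 3 ≤ M k j) → k = h

theorem CoxeterMatrix.ne_of_three_le {I : Type} {M : CoxeterMatrix I} {i j : I} (h : 3 ≤ M i j) :
    i ≠ j := by
  rintro rfl
  simp at h

theorem CoxeterMatrix.IsGood.eq_two_or {I : Type} {M : CoxeterMatrix I} (hM : M.IsGood) {i j : I}
    (h : i ≠ j) : M i j = 2 ∨ 3 ≤ M i j := by
  have := hM.two_le i j h
  omega

namespace IncGeometry

variable {I V : Type} (Γ : IncGeometry I V) (M : CoxeterMatrix I)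

variable {Γ} in
theorem inc_self (v : V) : Γ.inc v v := (Γ.inc_iff_eq rfl).2 rfl

variable {Γ} in
theorem IsFlag.eq_of_typ_eq {X : Set V} (hX : Γ.IsFlag X) {x y : V} (hx : x ∈ X) (hy : y ∈ X)
    (h : Γ.typ x = Γ.typ y) : x = y := (Γ.inc_iff_eq h).1 (hX x hx y hy)

/-- An `{i, j}`-local flag for adjacent types `i`, `j`, all of whose vertices have a type that is
adjacent to `i` or `j`. -/
structure IsTightFlag (X : Set V) (i j : I) : Prop where
  isFlag : Γ.IsFlag X
  adj : 3 ≤ M i j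
  typ_ne : ∀ x ∈ X, Γ.typ x ≠ i ∧ Γ.typ x ≠ j
  typ_adj : ∀ x ∈ X, 3 ≤ M (Γ.typ x) i ∨ 3 ≤ M (Γ.typ x) j
  exists_typ : ∀ h, h ≠ i → h ≠ j → (3 ≤ M h i ∨ 3 ≤ M h j) → ∃ x ∈ X, Γ.typ x = h

/-- The graph on the vertices of types `i` and `j` in `S` that are incident to `X`. -/
def localGraph (X : Set V) (i j : I) (S : Set V) : SimpleGraph V :=
  Γ.graphOn (Γ.localSet X i j ∩ S)

/-- Property (F) for the geometry induced on `S`. -/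
def PropFOn (S : Set V) : Prop :=
  ∀ u ∈ S, ∀ v ∈ S, M (Γ.typ u) (Γ.typ v) = 2 → Γ.inc u v

/-- Property (P) for the geometry induced on `S`. -/
def PropPOn (S : Set V) : Prop :=
  ∀ (i j : I) (X : Set V), X ⊆ S → Γ.IsTightFlag M X i j →
    (Γ.localGraph X i j S).NoShortCycle (M i j)

/-- Property (D) for the geometry induced on `S`. -/
def PropDOn (S : Set V) : Prop :=
  ∀ x ∈ S, ∀ x' ∈ S, ∀ z ∈ S, ∀ z' ∈ S, Γ.typ x = Γ.typ x' → Γ.typ z = Γ.typ z' →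
    4 ≤ M (Γ.typ x) (Γ.typ z) → Γ.inc x z → Γ.inc x z' → Γ.inc x' z → Γ.inc x' z' →
    x = x' ∨ z = z'

/-- The geometry induced on `S` is intermediate. -/
structure IsIntermediateOn (S : Set V) : Prop where
  propF : Γ.PropFOn M S
  propP : Γ.PropPOn M S
  propD : Γ.PropDOn M S

/-- A free step: as in Procedure B, a path of new vertices is added to `S` in the residue of `X`,
with no condition on the distance of its endpoints. -/
structure FreeStep (S S' X : Set V) (i j : I) (a : ℕ → V) : Prop where
  tight : Γ.IsTightFlag M X i j
  subset : X ⊆ S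
  first_mem : a 0 ∈ Γ.localSet X i j ∩ S
  last_mem : a (M i j - 1) ∈ Γ.localSet X i j ∩ S
  eq_union : S' = S ∪ a '' Ioo 0 (M i j - 1)
  notMem : ∀ k ∈ Ioo 0 (M i j - 1), a k ∉ S
  inj : InjOn a (Iic (M i j - 1))
  typ_mem : ∀ k < M i j, Γ.typ (a k) = i ∨ Γ.typ (a k) = j
  typ_ne : ∀ k < M i j - 1, Γ.typ (a k) ≠ Γ.typ (a (k + 1))
  inc_iff : ∀ k ∈ Ioo 0 (M i j - 1), ∀ w ∈ S', w ≠ a k → (Γ.inc (a k) w ↔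
    w = a (k - 1) ∨ w = a (k + 1) ∨ w ∈ X ∨ M (Γ.typ (a k)) (Γ.typ w) = 2)

variable {Γ M}

namespace IsTightFlag

variable {X : Set V} {i j : I}

protected theorem symm (h : Γ.IsTightFlag M X i j) : Γ.IsTightFlag M X j i where
  isFlag := h.isFlag
  adj := M.symmetric i j ▸ h.adj
  typ_ne x hx := (h.typ_ne x hx).symm
  typ_adj x hx := (h.typ_adj x hx).symm
  exists_typ k hi hj hk := h.exists_typ k hj hi hk.symm

/-- The requirement `v ∉ X` is automatic, since no vertex of `X` has type `i` or `j`. -/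
theorem mem_localSet (h : Γ.IsTightFlag M X i j) {v : V} :
    v ∈ Γ.localSet X i j ↔ (Γ.typ v = i ∨ Γ.typ v = j) ∧ ∀ x ∈ X, Γ.inc x v := by
  refine ⟨fun hv => ⟨hv.2, hv.1.2⟩, fun hv => ⟨⟨fun hX => ?_, hv.2⟩, hv.1⟩⟩
  have := h.typ_ne v hX
  tauto

end IsTightFlag

theorem localSet_comm (X : Set V) (i j : I) : Γ.localSet X i j = Γ.localSet X j i := by
  ext v
  simp only [localSet, mem_ofPred_eq, or_comm]

theorem localGraph_comm (X : Set V) (i j : I) (S : Set V) :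
    Γ.localGraph X i j S = Γ.localGraph X j i S := by
  rw [localGraph, localGraph, localSet_comm]

theorem localGraph_adj_typ {X : Set V} {i j : I} {S : Set V} {u v : V}
    (h : (Γ.localGraph X i j S).Adj u v) :
    Γ.typ u ≠ Γ.typ v ∧ (Γ.typ u = i ∨ Γ.typ u = j) ∧ (Γ.typ v = i ∨ Γ.typ v = j) :=
  ⟨fun e => h.2.2.1 ((Γ.inc_iff_eq e).1 h.2.2.2), h.1.1.2, h.2.1.1.2⟩

theorem localGraph_mono {X : Set V} {i j : I} {S T : Set V} (h : S ⊆ T) :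
    Γ.localGraph X i j S ≤ Γ.localGraph X i j T :=
  fun _ _ hu => ⟨⟨hu.1.1, h hu.1.2⟩, ⟨hu.2.1.1, h hu.2.1.2⟩, hu.2.2⟩

theorem localGraph_adj {X : Set V} {i j : I} {S : Set V} {u v : V} :
    (Γ.localGraph X i j S).Adj u v ↔ u ∈ Γ.localSet X i j ∩ S ∧ v ∈ Γ.localSet X i j ∩ S ∧
      u ≠ v ∧ Γ.inc u v := Iff.rfl

theorem IsIntermediateOn.mono {S T : Set V} (h : Γ.IsIntermediateOn M T) (hST : S ⊆ T) :
    Γ.IsIntermediateOn M S where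
  propF u hu v hv := h.propF u (hST hu) v (hST hv)
  propP i j X hX hT := (h.propP i j X (hX.trans hST) hT).anti (localGraph_mono hST)
  propD x hx x' hx' z hz z' hz' := h.propD x (hST hx) x' (hST hx') z (hST hz) z' (hST hz')

namespace FreeStep

variable {S S' X : Set V} {i j : I} {a : ℕ → V}

protected theorem symm (h : Γ.FreeStep M S S' X i j a) : Γ.FreeStep M S S' X j i a := by
  obtain ⟨h1, h2, h3, h4, h5, h6, h7, h8, h9, h10⟩ := h
  rw [M.symmetric i j] at *
  rw [localSet_comm] at h3 h4
  exact ⟨h1.symm, h2, h3, h4, h5, h6, h7, fun k hk => (h8 k hk).symm, h9, h10⟩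

theorem three_le (h : Γ.FreeStep M S S' X i j a) : 3 ≤ M i j := h.tight.adj

theorem subset_right (h : Γ.FreeStep M S S' X i j a) : S ⊆ S' := by
  rw [h.eq_union]; exact subset_union_left

theorem mem_right (h : Γ.FreeStep M S S' X i j a) {k : ℕ} (hk : k ≤ M i j - 1) : a k ∈ S' := by
  rcases Nat.eq_zero_or_pos k with rfl | h0
  · exact h.subset_right h.first_mem.2
  · rcases hk.eq_or_lt with rfl | h1
    · exact h.subset_right h.last_mem.2
    · rw [h.eq_union]; exact Or.inr ⟨k, ⟨h0, h1⟩, rfl⟩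

theorem mem_right_iff (h : Γ.FreeStep M S S' X i j a) {v : V} :
    v ∈ S' ↔ v ∈ S ∨ ∃ k ∈ Ioo 0 (M i j - 1), a k = v := by
  rw [h.eq_union]; rfl

/-- The path of a free step, traversed backwards. -/
protected theorem reverse (h : Γ.FreeStep M S S' X i j a) :
    Γ.FreeStep M S S' X i j (fun k => a (M i j - 1 - k)) where
  tight := h.tight
  subset := h.subset
  first_mem := h.last_mem
  last_mem := by simpa using h.first_mem
  eq_union := by
    rw [h.eq_union]
    congr 1
    ext v
    simp only [mem_image, mem_Ioo]
    constructor
    · rintro ⟨k, hk, rfl⟩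
      exact ⟨M i j - 1 - k, by omega, by congr 1; omega⟩
    · rintro ⟨k, hk, rfl⟩
      exact ⟨M i j - 1 - k, by omega, by congr 1⟩
  notMem k hk := h.notMem _ (by simp only [mem_Ioo] at hk ⊢; omega)
  inj k hk l hl e := by
    simp only [mem_Iic] at hk hl
    have := h.inj (show M i j - 1 - k ∈ Iic (M i j - 1) by simp)
      (show M i j - 1 - l ∈ Iic (M i j - 1) by simp) e
    omega
  typ_mem k hk := h.typ_mem _ (by omega)
  typ_ne k hk := by
    have := h.typ_ne (M i j - 1 - (k + 1)) (by omega)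
    rw [show M i j - 1 - (k + 1) + 1 = M i j - 1 - k by omega] at this
    exact this.symm
  inc_iff k hk w hw hne := by
    simp only [mem_Ioo] at hk
    rw [h.inc_iff _ (by simp only [mem_Ioo]; omega) w hw hne,
      show M i j - 1 - k + 1 = M i j - 1 - (k - 1) by omega,
      show M i j - 1 - k - 1 = M i j - 1 - (k + 1) by omega]
    tauto

theorem typ_eq_of_add_one (h : Γ.FreeStep M S S' X i j a) {k : ℕ} (hk : k < M i j - 1)
    (hi : Γ.typ (a k) = i) : Γ.typ (a (k + 1)) = j := by
  have h1 := h.typ_ne k hk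
  have := h.typ_mem (k + 1) (by omega)
  grind

theorem typ_eq_of_sub_one (h : Γ.FreeStep M S S' X i j a) {k : ℕ} (hk : k ∈ Ioo 0 (M i j - 1))
    (hi : Γ.typ (a k) = i) : Γ.typ (a (k - 1)) = j := by
  simp only [mem_Ioo] at hk
  have h1 := h.typ_ne (k - 1) (by omega)
  rw [show k - 1 + 1 = k by omega] at h1
  have := h.typ_mem (k - 1) (by omega)
  grind

/-- A new vertex has at most two neighbours of the other type of the path. -/
theorem eq_of_inc (h : Γ.FreeStep M S S' X i j a) {k : ℕ} (hk : k ∈ Ioo 0 (M i j - 1)) {w : V}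
    (hw : w ∈ S') (hi : Γ.typ w = i ∨ Γ.typ w = j) (hne : w ≠ a k) (hinc : Γ.inc (a k) w) :
    w = a (k - 1) ∨ w = a (k + 1) := by
  rcases (h.inc_iff k hk w hw hne).1 hinc with e | e | e | e
  · exact Or.inl e
  · exact Or.inr e
  · have := h.tight.typ_ne w e; tauto
  · exfalso
    have h3 := h.three_le
    have h3' : 3 ≤ M j i := M.symmetric i j ▸ h3
    have ht : Γ.typ (a k) ≠ Γ.typ w := fun e => hne ((Γ.inc_iff_eq e).1 hinc).symm
    simp only [mem_Ioo] at hk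
    rcases h.typ_mem k (by omega) with e1 | e1 <;> rcases hi with e2 | e2 <;>
      rw [e1, e2] at e ht <;> first | omega | exact ht rfl

/-- Every other neighbour of a new vertex that is not prescribed by (F) belongs to the flag. -/
theorem mem_flag_of_inc (h : Γ.FreeStep M S S' X i j a) {k : ℕ} (hk : k ∈ Ioo 0 (M i j - 1)) {w : V}
    (hw : w ∈ S') (hi : Γ.typ w ≠ i) (hj : Γ.typ w ≠ j) (hadj : 3 ≤ M (Γ.typ (a k)) (Γ.typ w))
    (hinc : Γ.inc (a k) w) : w ∈ X := by
  simp only [mem_Ioo] at hk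
  have h1 := h.typ_mem k (by omega)
  have h2 := h.typ_mem (k - 1) (by omega)
  have h3 := h.typ_mem (k + 1) (by omega)
  rcases (h.inc_iff k hk w hw (by rintro rfl; tauto)).1 hinc with rfl | rfl | e | e
  · tauto
  · tauto
  · exact e
  · omega

theorem mem_localSet (h : Γ.FreeStep M S S' X i j a) {k : ℕ} (hk : k ≤ M i j - 1) :
    a k ∈ Γ.localSet X i j := by
  rcases Nat.eq_zero_or_pos k with rfl | h0
  · exact h.first_mem.1
  · rcases hk.eq_or_lt with rfl | h1
    · exact h.last_mem.1
    · have h3 := h.three_le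
      rw [h.tight.mem_localSet]
      refine ⟨h.typ_mem k (by omega), fun x hx => Γ.symm ?_⟩
      refine (h.inc_iff k ⟨h0, h1⟩ x (h.subset_right (h.subset hx)) ?_).2 (Or.inr (Or.inr (Or.inl hx)))
      rintro rfl
      exact h.notMem k ⟨h0, h1⟩ (h.subset hx)

theorem isPathSeq (h : Γ.FreeStep M S S' X i j a) :
    (Γ.localGraph X i j S').IsPathSeq (M i j - 1) a where
  inj := h.inj
  adj k hk := by
    have h3 := h.three_le
    have hne : a k ≠ a (k + 1) := fun e => by
      have := h.inj (show k ∈ Iic (M i j - 1) by simp; omega)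
        (show k + 1 ∈ Iic (M i j - 1) by simp; omega) e
      omega
    refine ⟨⟨h.mem_localSet (by omega), h.mem_right (by omega)⟩,
      ⟨h.mem_localSet (by omega), h.mem_right (by omega)⟩, hne, ?_⟩
    rcases Nat.eq_zero_or_pos k with rfl | h0
    · exact Γ.symm ((h.inc_iff 1 (by simp only [mem_Ioo]; omega) _ (h.mem_right (by omega)) hne).2
        (Or.inl rfl))
    · exact (h.inc_iff k ⟨h0, hk⟩ _ (h.mem_right (by omega)) hne.symm).2 (Or.inr (Or.inl rfl))

/-- A vertex incident to both neighbours of a new vertex on the path. -/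
theorem mem_flag_of_inc_of_inc (hM : M.IsGood) (hD : Γ.PropDOn M S')
    (h : Γ.FreeStep M S S' X i j a) {k : ℕ} (hk : k ∈ Ioo 0 (M i j - 1)) {w : V} (hw : w ∈ S')
    (hi : Γ.typ w ≠ i) (hj : Γ.typ w ≠ j) (hadj : 3 ≤ M (Γ.typ (a (k - 1))) (Γ.typ w))
    (h1 : Γ.inc (a (k - 1)) w) (h2 : Γ.inc (a (k + 1)) w) : w ∈ X := by
  simp only [mem_Ioo] at hk
  wlog hki : Γ.typ (a k) = i generalizing i j
  · exact this h.symm hj hi (M.symmetric i j ▸ hk) ((h.typ_mem k (by omega)).resolve_left hki)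
  have t1 := h.typ_eq_of_sub_one hk hki
  have t2 := h.typ_eq_of_add_one hk.2 hki
  rw [t1] at hadj
  by_cases c1 : 0 < k - 1
  · exact h.mem_flag_of_inc (k := k - 1) (by simp only [mem_Ioo]; omega) hw hi hj (by rwa [t1]) h1
  by_cases c2 : k + 1 < M i j - 1
  · exact h.mem_flag_of_inc (k := k + 1) (by simp only [mem_Ioo]; omega) hw hi hj (by rwa [t2]) h2
  -- Now both neighbours of `a k` are old, so `a k` is the only new vertex. The other bond at `j`
  -- then has label at least 4, and (D) identifies `w` with the flag vertex of its type.
  have h3 : M i j = 3 := by omega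
  obtain ⟨x, hx, hxw⟩ := h.tight.exists_typ (Γ.typ w) hi hj (Or.inr (M.symmetric _ _ ▸ hadj))
  have h4 := hM.four_le i j _ h3 hadj hi.symm
  have e0 := (h.tight.mem_localSet.1 (h.mem_localSet (k := k - 1) (by omega))).2 x hx
  have e1 := (h.tight.mem_localSet.1 (h.mem_localSet (k := k + 1) (by omega))).2 x hx
  rcases hD _ (h.mem_right (k := k - 1) (by omega)) _ (h.mem_right (k := k + 1) (by omega))
    x (h.subset_right (h.subset hx)) w hw (t1.trans t2.symm) hxw (by rwa [t1, hxw]) (Γ.symm e0) h1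
    (Γ.symm e1) h2 with e | rfl
  · have := h.inj (show k - 1 ∈ Iic (M i j - 1) by simp only [mem_Iic]; omega)
      (show k + 1 ∈ Iic (M i j - 1) by simp only [mem_Iic]; omega) e
    omega
  · exact hx

/-- If a new vertex has two neighbours in a local graph, then this is the local graph of the step
and the neighbours are those on the path. -/
theorem eq_of_adj_of_adj (hM : M.IsGood) (hD : Γ.PropDOn M S') (h : Γ.FreeStep M S S' X i j a)
    {X' : Set V} {i' j' : I} (hX' : Γ.IsTightFlag M X' i' j') (hXS : X' ⊆ S') {k : ℕ}
    (hk : k ∈ Ioo 0 (M i j - 1)) {y y' : V} (hy : (Γ.localGraph X' i' j' S').Adj (a k) y)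
    (hy' : (Γ.localGraph X' i' j' S').Adj (a k) y') (hne : y ≠ y') :
    X' = X ∧ (i' = i ∧ j' = j ∨ i' = j ∧ j' = i) ∧
      (y = a (k - 1) ∧ y' = a (k + 1) ∨ y = a (k + 1) ∧ y' = a (k - 1)) := by
  have hk' := hk
  simp only [mem_Ioo] at hk'
  wlog hki : Γ.typ (a k) = i generalizing i j
  · have := this h.symm (M.symmetric i j ▸ hk) (M.symmetric i j ▸ hk')
      ((h.typ_mem k (by omega)).resolve_left hki)
    tauto
  wlog hki' : Γ.typ (a k) = i' generalizing i' j'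
  · have h2 := (localGraph_adj_typ hy).2.1.resolve_left hki'
    have := this hX'.symm (localGraph_comm X' i' j' S' ▸ hy)
      (localGraph_comm X' i' j' S' ▸ hy') h2
    tauto
  obtain rfl : i = i' := hki.symm.trans hki'
  have ty : Γ.typ y = j' := by have := localGraph_adj_typ hy; grind
  have ty' : Γ.typ y' = j' := by have := localGraph_adj_typ hy'; grind
  have hij' := M.ne_of_three_le hX'.adj
  -- Otherwise `y` and `y'` would be two vertices of the flag `X` with the same type.
  have hjj : j' = j := by
    by_contra hjj
    have e1 := h.mem_flag_of_inc hk hy.2.1.2 (ty ▸ hij'.symm) (ty ▸ hjj)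
      (by rw [hki, ty]; exact hX'.adj) hy.2.2.2
    have e2 := h.mem_flag_of_inc hk hy'.2.1.2 (ty' ▸ hij'.symm) (ty' ▸ hjj)
      (by rw [hki, ty']; exact hX'.adj) hy'.2.2.2
    exact hne (h.tight.isFlag.eq_of_typ_eq e1 e2 (ty.trans ty'.symm))
  subst hjj
  have hyy : y = a (k - 1) ∧ y' = a (k + 1) ∨ y = a (k + 1) ∧ y' = a (k - 1) := by
    have e1 := h.eq_of_inc hk hy.2.1.2 (Or.inr ty) hy.2.2.1.symm hy.2.2.2
    have e2 := h.eq_of_inc hk hy'.2.1.2 (Or.inr ty') hy'.2.2.1.symm hy'.2.2.2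
    grind
  have hinc : ∀ x ∈ X', Γ.inc (a (k - 1)) x ∧ Γ.inc (a (k + 1)) x := by
    intro x hx
    have e1 := Γ.symm ((hX'.mem_localSet.1 hy.2.1.1).2 x hx)
    have e2 := Γ.symm ((hX'.mem_localSet.1 hy'.2.1.1).2 x hx)
    rcases hyy with ⟨rfl, rfl⟩ | ⟨rfl, rfl⟩
    · exact ⟨e1, e2⟩
    · exact ⟨e2, e1⟩
  -- A vertex of `X'` is incident with `a k` and with both neighbours of `a k` on the path; one of
  -- these incidences is not prescribed by (F) and forces it into `X`.
  have hsub : X' ⊆ X := by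
    intro x hx
    have hxi := hX'.typ_ne x hx
    rcases hX'.typ_adj x hx with c | c
    · exact h.mem_flag_of_inc hk (hXS hx) hxi.1 hxi.2 (by rw [hki, M.symmetric]; exact c)
        (Γ.symm ((hX'.mem_localSet.1 hy.1.1).2 x hx))
    · exact h.mem_flag_of_inc_of_inc hM hD hk (hXS hx) hxi.1 hxi.2
        (by rw [h.typ_eq_of_sub_one hk hki, M.symmetric]; exact c) (hinc x hx).1 (hinc x hx).2
  -- Both flags have exactly the types adjacent to `i` or `j`, so the inclusion is an equality.
  refine ⟨hsub.antisymm fun x hx => ?_, Or.inl ⟨rfl, rfl⟩, hyy⟩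
  obtain ⟨x', hx', e⟩ := hX'.exists_typ (Γ.typ x) (h.tight.typ_ne x hx).1 (h.tight.typ_ne x hx).2
    (h.tight.typ_adj x hx)
  rwa [← h.tight.isFlag.eq_of_typ_eq (hsub hx') hx e]

/-- The local graph of a flag that contains a new vertex `a k`: the vertices of a type adjacent to
the type of `a k`. -/
theorem mem_or_of_mem_flag (h : Γ.FreeStep M S S' X i j a) {X' : Set V} {i' j' : I}
    (hX' : Γ.IsTightFlag M X' i' j') {k : ℕ} (hk : k ∈ Ioo 0 (M i j - 1)) (hkX : a k ∈ X')
    (hadj : 3 ≤ M (Γ.typ (a k)) i') {u : V} (hu : u ∈ Γ.localSet X' i' j' ∩ S')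
    (htu : Γ.typ u = i') :
    u ∈ X ∧ Γ.typ u ≠ i ∧ Γ.typ u ≠ j ∨
      (u = a (k - 1) ∨ u = a (k + 1)) ∧ (Γ.typ u = i ∨ Γ.typ u = j) := by
  have hinc := (hX'.mem_localSet.1 hu.1).2 _ hkX
  by_cases c : Γ.typ u = i ∨ Γ.typ u = j
  · refine Or.inr ⟨h.eq_of_inc hk hu.2 c ?_ hinc, c⟩
    rintro rfl
    exact M.ne_of_three_le hadj htu
  · push Not at c
    exact Or.inl ⟨h.mem_flag_of_inc hk hu.2 c.1 c.2 (by rwa [htu]) hinc, c⟩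

/-- The neighbours `y`, `y'` have a type adjacent to that of `a k`, so each lies in `X` or next to
`a k` on the path. As `X` has only one vertex of a type, they are `a (k - 1)` and `a (k + 1)`, and a
vertex incident with both of these is in `X`. -/
theorem mem_flag_of_mem_flag (hM : M.IsGood) (hD : Γ.PropDOn M S') (h : Γ.FreeStep M S S' X i j a)
    {X' : Set V} {i' j' : I} (hX' : Γ.IsTightFlag M X' i' j') {k : ℕ}
    (hk : k ∈ Ioo 0 (M i j - 1)) (hkX : a k ∈ X') (hadj : 3 ≤ M (Γ.typ (a k)) i') {y y' z : V}
    (hy : (Γ.localGraph X' i' j' S').Adj z y) (hy' : (Γ.localGraph X' i' j' S').Adj z y')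
    (hne : y ≠ y') (hz : Γ.typ z = j') : z ∈ X := by
  have hk' := hk
  simp only [mem_Ioo] at hk'
  have ty : Γ.typ y = i' := by have := localGraph_adj_typ hy; grind
  have ty' : Γ.typ y' = i' := by have := localGraph_adj_typ hy'; grind
  have e1 := h.mem_or_of_mem_flag hX' hk hkX hadj hy.2.1 ty
  have e2 := h.mem_or_of_mem_flag hX' hk hkX hadj hy'.2.1 ty'
  have hki := h.typ_mem k (by omega)
  have hki' := hX'.typ_ne _ hkX
  have hij' := M.ne_of_three_le hX'.adj
  have key : Γ.typ y = i ∨ Γ.typ y = j := by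
    by_contra hc
    have f1 : y ∈ X := by tauto
    have f2 : y' ∈ X := by rw [ty, ← ty'] at hc; tauto
    exact hne (h.tight.isFlag.eq_of_typ_eq f1 f2 (ty.trans ty'.symm))
  have hpair : Γ.inc (a (k - 1)) z ∧ Γ.inc (a (k + 1)) z := by
    have g1 := Γ.symm hy.2.2.2
    have g2 := Γ.symm hy'.2.2.2
    have : (y = a (k - 1) ∨ y = a (k + 1)) ∧ (y' = a (k - 1) ∨ y' = a (k + 1)) := by
      rw [ty, ← ty'] at key
      grind
    rcases this with ⟨rfl | rfl, rfl | rfl⟩ <;> first | exact absurd rfl hne | exact ⟨g1, g2⟩ |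
      exact ⟨g2, g1⟩
  have t1 : Γ.typ (a (k - 1)) = i' := by
    have : y = a (k - 1) ∨ y' = a (k - 1) := by rw [ty, ← ty'] at key; grind
    rcases this with rfl | rfl <;> assumption
  have h3 : 3 ≤ M (Γ.typ (a (k - 1))) (Γ.typ z) := by rw [t1, hz]; exact hX'.adj
  refine h.mem_flag_of_inc_of_inc hM hD hk hy.1.2 ?_ ?_ h3 hpair.1 hpair.2 <;> grind

/-- In the local graph of a flag that contains a new vertex there is no cycle. -/
theorem not_isCycleSeq_of_mem_flag (hM : M.IsGood) (hD : Γ.PropDOn M S')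
    (h : Γ.FreeStep M S S' X i j a) {X' : Set V} {i' j' : I} (hX' : Γ.IsTightFlag M X' i' j')
    {k : ℕ} (hk : k ∈ Ioo 0 (M i j - 1)) (hkX : a k ∈ X') {n : ℕ} {v : ℕ → V} :
    ¬ (Γ.localGraph X' i' j' S').IsCycleSeq n v := by
  intro hv
  wlog hadj : 3 ≤ M (Γ.typ (a k)) i' generalizing i' j'
  · exact this hX'.symm (localGraph_comm X' i' j' S' ▸ hv)
      ((hX'.typ_adj _ hkX).resolve_left hadj)
  wlog h0 : Γ.typ (v 0) = i' generalizing v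
  · refine this (hv.rotate 1) ?_
    have := localGraph_adj_typ (hv.adj 0)
    grind
  have t1 := localGraph_adj_typ (hv.adj 0)
  have t2 := localGraph_adj_typ (hv.adj 1)
  have t3 := localGraph_adj_typ (hv.adj 2)
  -- The vertices `v 1` and `v 3` of type `j'` both lie in the flag `X`, which has only one vertex
  -- of that type.
  have f1 := h.mem_flag_of_mem_flag hM hD hX' hk hkX hadj (hv.adj 1) (hv.adj 0).symm
    (hv.add_two_ne 0) (by grind)
  have f3 := h.mem_flag_of_mem_flag hM hD hX' hk hkX hadj (hv.adj 3) (hv.adj 2).symm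
    (hv.add_two_ne 2) (by grind)
  exact hv.add_two_ne 1 (h.tight.isFlag.eq_of_typ_eq f3 f1 (by grind))

/-- If the result of a free step has property (P), then the endpoints of the new path were at
distance greater than `M i j`. -/
theorem le_edist (h : Γ.FreeStep M S S' X i j a) (hP : Γ.PropPOn M S') :
    (M i j : ℕ∞) + 1 ≤ (Γ.localGraph X i j S).edist (a 0) (a (M i j - 1)) := by
  by_contra! hlt
  have h3 := h.three_le
  obtain ⟨l, b, hl, hb, hb0, hb1⟩ := SimpleGraph.exists_isPathSeq_of_edist_lt
    (m := M i j + 1) (by exact_mod_cast hlt)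
  have e1 := SimpleGraph.apply_eq_iff_even (fun _ _ => localGraph_adj_typ) hb.adj
  have e2 := SimpleGraph.apply_eq_iff_even (fun _ _ => localGraph_adj_typ) h.isPathSeq.adj
  rw [hb0, hb1, e2] at e1
  -- The new path joins the same vertices with length `M i j - 1`, so parity excludes the length `M
  -- i j`. What remains is short enough for uniqueness of paths.
  have hlm : l ≠ M i j := by
    rintro rfl
    obtain ⟨t, ht⟩ : ∃ t, M i j = t + 1 := ⟨M i j - 1, by omega⟩
    rw [ht, Nat.even_add_one, Nat.add_sub_cancel] at e1
    tauto
  have hb' := hb.mono fun k hk => localGraph_mono h.subset_right (hb.adj k hk)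
  obtain ⟨hll, hbb⟩ := (hP i j X (h.subset.trans h.subset_right) h.tight).path_unique hb'
    h.isPathSeq hb0 hb1 (by omega)
  have := (hb.adj 1 (by omega)).1.2
  rw [hbb 1 (by omega)] at this
  exact h.notMem 1 (by simp only [mem_Ioo]; omega) this

end FreeStep

end IncGeometry

/-! ### Procedure B preserves intermediate geometries -/

namespace IncGeometry

variable {I V : Type} {Γ : IncGeometry I V} {M : CoxeterMatrix I}

namespace FreeStep

variable {S S' X : Set V} {i j : I} {a : ℕ → V}

theorem propFOn (h : Γ.FreeStep M S S' X i j a) (hF : Γ.PropFOn M S) : Γ.PropFOn M S' := by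
  have key : ∀ k ∈ Ioo 0 (M i j - 1), ∀ w ∈ S', M (Γ.typ (a k)) (Γ.typ w) = 2 →
      Γ.inc (a k) w := by
    intro k hk w hw e
    refine (h.inc_iff k hk w hw ?_).2 (Or.inr (Or.inr (Or.inr e)))
    rintro rfl
    simp at e
  intro u hu v hv e
  rcases h.mem_right_iff.1 hu with hu' | ⟨k, hk, rfl⟩
  · rcases h.mem_right_iff.1 hv with hv' | ⟨k, hk, rfl⟩
    · exact hF u hu' v hv' e
    · exact Γ.symm (key k hk u hu (M.symmetric _ _ ▸ e))
  · exact key k hk v hv e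

/-- Two vertices of the same type next to `a k` are its neighbours on the path, since the flag has
only one vertex of each type. A second vertex incident with both would have to lie two places
further along the path. This fits only if the path has length 3 and its ends are incident, but the
ends are far apart. -/
theorem false_of_digon (h : Γ.FreeStep M S S' X i j a)
    (hd : (M i j : ℕ∞) + 1 ≤ (Γ.localGraph X i j S).edist (a 0) (a (M i j - 1)))
    {k : ℕ} (hk : k ∈ Ioo 0 (M i j - 1)) {x' z z' : V} (hx' : x' ∈ S') (hz : z ∈ S')
    (hz' : z' ∈ S') (hne : x' ≠ a k) (hzz : z ≠ z') (ht : Γ.typ x' = Γ.typ (a k))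
    (ht' : Γ.typ z = Γ.typ z') (h4 : 4 ≤ M (Γ.typ (a k)) (Γ.typ z)) (h1 : Γ.inc (a k) z)
    (h2 : Γ.inc (a k) z') (h3 : Γ.inc x' z) (h4' : Γ.inc x' z') : False := by
  wlog hki : Γ.typ (a k) = i generalizing i j
  · have hk' := hk
    simp only [mem_Ioo] at hk'
    refine this h.symm ?_ (M.symmetric i j ▸ hk) ((h.typ_mem k (by omega)).resolve_left hki)
    rw [localGraph_comm, M.symmetric j i]; exact hd
  have hzi : Γ.typ z ≠ i := by
    have := M.ne_of_three_le (show 3 ≤ M (Γ.typ (a k)) (Γ.typ z) by omega)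
    exact fun e => this (hki.trans e.symm)
  have hzj : Γ.typ z = j := by
    by_contra hzj
    have e1 := h.mem_flag_of_inc hk hz hzi hzj (by omega) h1
    have e2 := h.mem_flag_of_inc hk hz' (ht' ▸ hzi) (ht' ▸ hzj) (by rw [← ht']; omega) h2
    exact hzz (h.tight.isFlag.eq_of_typ_eq e1 e2 ht')
  have hnek : ∀ w, Γ.typ w = j → w ≠ a k := by
    rintro w hw rfl
    exact hzi (hzj.trans (hw.symm.trans hki))
  have hinc : Γ.inc x' (a (k - 1)) ∧ Γ.inc x' (a (k + 1)) := by
    have e1 := h.eq_of_inc hk hz (Or.inr hzj) (hnek _ hzj) h1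
    have e2 := h.eq_of_inc hk hz' (Or.inr (ht' ▸ hzj)) (hnek _ (ht' ▸ hzj)) h2
    rcases e1 with rfl | rfl <;> rcases e2 with rfl | rfl <;>
      first | exact absurd rfl hzz | exact ⟨h3, h4'⟩ | exact ⟨h4', h3⟩
  rw [hki, hzj] at h4
  rw [hki] at ht
  clear hz hz' hzz ht' h1 h2 h3 h4' hzi hzj
  -- As `4 ≤ M i j`, there are at least two new vertices; up to reversal of the path, `a (k - 1)` is
  -- new too.
  wlog c : 0 < k - 1 generalizing k a
  · have hk' := hk
    simp only [mem_Ioo] at hk'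
    have e0 : M i j - 1 - (M i j - 1 - k) = k := by omega
    refine this (a := fun k => a (M i j - 1 - k)) (k := M i j - 1 - k) (h := h.reverse) (hd := ?_)
      (hk := by simp only [mem_Ioo]; omega) (hne := by simpa only [e0] using hne)
      (hki := by simpa only [e0] using hki) (hnek := by simpa only [e0] using hnek)
      (hinc := ?_) (c := by omega)
    · simpa [SimpleGraph.edist_comm] using hd
    · rw [show M i j - 1 - (M i j - 1 - k - 1) = k + 1 by omega,
        show M i j - 1 - (M i j - 1 - k + 1) = k - 1 by omega]
      exact hinc.symm
  have hk' := hk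
  simp only [mem_Ioo] at hk'
  have tx : ∀ l, Γ.typ (a l) = j → x' ≠ a l := by
    rintro l hl rfl
    exact M.ne_of_three_le h.three_le (ht.symm.trans hl)
  have t1 := h.typ_eq_of_sub_one hk hki
  have t2 := h.typ_eq_of_add_one hk'.2 hki
  have hinj : ∀ r s, r ≤ M i j - 1 → s ≤ M i j - 1 → a r = a s → r = s :=
    fun r s hr hs e => h.inj hr hs e
  have ex : x' = a (k - 1 - 1) := by
    rcases h.eq_of_inc (k := k - 1) (by simp only [mem_Ioo]; omega) hx' (Or.inl ht) (tx _ t1)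
      (Γ.symm hinc.1) with e | e
    · exact e
    · rw [show k - 1 + 1 = k by omega] at e
      exact absurd e hne
  by_cases c2 : k + 1 < M i j - 1
  · rcases h.eq_of_inc (k := k + 1) (by simp only [mem_Ioo]; omega) hx' (Or.inl ht) (tx _ t2)
      (Γ.symm hinc.2) with e | e
    · exact hne e
    · have := hinj _ _ (by omega) (by omega) (ex.symm.trans e)
      omega
  · subst ex
    by_cases c3 : 0 < k - 1 - 1
    · rcases h.eq_of_inc (k := k - 1 - 1) (by simp only [mem_Ioo]; omega)
        (h.mem_right (k := k + 1) (by omega)) (Or.inr t2) (tx _ t2).symm hinc.2 with e | e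
      · have := hinj _ _ (by omega) (by omega) e
        omega
      · have := hinj _ _ (by omega) (by omega) e
        omega
    · rw [show k - 1 - 1 = 0 by omega, show k + 1 = M i j - 1 by omega] at hinc
      have hadj : (Γ.localGraph X i j S).Adj (a 0) (a (M i j - 1)) :=
        ⟨h.first_mem, h.last_mem, fun e => by have := hinj _ _ (by omega) (by omega) e; omega,
          hinc.2⟩
      rw [SimpleGraph.edist_eq_one_iff_adj.2 hadj] at hd
      have : M i j + 1 ≤ 1 := by exact_mod_cast hd
      omega

theorem propDOn (h : Γ.FreeStep M S S' X i j a)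
    (hd : (M i j : ℕ∞) + 1 ≤ (Γ.localGraph X i j S).edist (a 0) (a (M i j - 1)))
    (hD : Γ.PropDOn M S) : Γ.PropDOn M S' := by
  intro x hx x' hx' z hz z' hz' ht ht' h4 h1 h2 h3 h4'
  by_contra! hne
  rcases h.mem_right_iff.1 hx with kx | ⟨k, hk, rfl⟩
  swap
  · exact h.false_of_digon hd hk hx' hz hz' hne.1.symm hne.2 ht.symm ht' h4 h1 h2 h3 h4'
  rcases h.mem_right_iff.1 hx' with kx' | ⟨k, hk, rfl⟩
  swap
  · exact h.false_of_digon hd hk hx hz hz' hne.1 hne.2 ht ht' (ht ▸ h4) h3 h4' h1 h2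
  rw [M.symmetric] at h4
  rcases h.mem_right_iff.1 hz with kz | ⟨k, hk, rfl⟩
  swap
  · exact h.false_of_digon hd hk hz' hx hx' hne.2.symm hne.1 ht'.symm ht h4 (Γ.symm h1) (Γ.symm h3)
      (Γ.symm h2) (Γ.symm h4')
  rcases h.mem_right_iff.1 hz' with kz' | ⟨k, hk, rfl⟩
  swap
  · exact h.false_of_digon hd hk hz hx hx' hne.2 hne.1 ht' ht (ht' ▸ h4) (Γ.symm h2) (Γ.symm h4')
      (Γ.symm h1) (Γ.symm h3)
  rw [M.symmetric] at h4
  have := hD x kx x' kx' z kz z' kz' ht ht' h4 h1 h2 h3 h4'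
  tauto

/-- A cycle in the local graph of the step that contains a new vertex. -/
theorem two_mul_le_of_isCycleSeq (hM : M.IsGood) (hD : Γ.PropDOn M S')
    (h : Γ.FreeStep M S S' X i j a)
    (hd : (M i j : ℕ∞) + 1 ≤ (Γ.localGraph X i j S).edist (a 0) (a (M i j - 1)))
    {n : ℕ} {v : ℕ → V} (hv : (Γ.localGraph X i j S').IsCycleSeq n v) {r k : ℕ}
    (hk : k ∈ Ioo 0 (M i j - 1)) (hr : v r = a k) : 2 * M i j ≤ n := by
  have hnb : ∀ s k, k ∈ Ioo 0 (M i j - 1) → v (s + 1) = a k →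
      v s = a (k - 1) ∧ v (s + 2) = a (k + 1) ∨ v s = a (k + 1) ∧ v (s + 2) = a (k - 1) := by
    intro s k hk hs
    exact (h.eq_of_adj_of_adj hM hD h.tight (h.subset.trans h.subset_right) hk
      (hs ▸ (hv.adj s).symm) (hs ▸ hv.adj (s + 1)) (hv.add_two_ne s).symm).2.2
  have h3 := h.three_le
  have hn3 := hv.three_le
  -- With a new vertex the cycle contains both its neighbours on the path, so one can descend to `a
  -- 1`.
  have h1 : ∃ r, v r = a 1 := by
    have hk' := hk
    simp only [mem_Ioo] at hk'
    obtain ⟨k, rfl⟩ : ∃ k', k = k' + 1 := ⟨k - 1, by omega⟩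
    clear hk
    induction k generalizing r with
    | zero => exact ⟨r, hr⟩
    | succ k ih =>
      rw [← hv.periodic r, show r + n = r + n - 1 + 1 by omega] at hr
      rcases hnb _ _ hk' hr with e | e
      · exact ih e.1 (by omega)
      · exact ih e.2 (by omega)
  obtain ⟨r, hr⟩ := h1
  -- Rotate and orient the cycle so that it enters the path at `a 0`; it then has to follow the path
  -- to its end.
  obtain ⟨u, hu, hu0, hu1⟩ : ∃ u : ℕ → V, (Γ.localGraph X i j S').IsCycleSeq n u ∧ u 0 = a 0 ∧
      u 1 = a 1 := by
    rw [← hv.periodic r, show r + n = r + n - 1 + 1 by omega] at hr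
    rcases hnb _ 1 (by simp only [mem_Ioo]; omega) hr with e | e
    · exact ⟨_, hv.rotate (r + n - 1), by simpa using e.1, by simpa [Nat.add_comm] using hr⟩
    · obtain ⟨u, hu, h0, h1⟩ := hv.exists_reverse (r + n - 1 + 1)
      exact ⟨u, hu, h0.trans e.2, h1.trans hr⟩
  have hnb' : ∀ s k, k ∈ Ioo 0 (M i j - 1) → u (s + 1) = a k →
      u s = a (k - 1) ∧ u (s + 2) = a (k + 1) ∨ u s = a (k + 1) ∧ u (s + 2) = a (k - 1) := by
    intro s k hk hs
    exact (h.eq_of_adj_of_adj hM hD h.tight (h.subset.trans h.subset_right) hk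
      (hs ▸ (hu.adj s).symm) (hs ▸ hu.adj (s + 1)) (hu.add_two_ne s).symm).2.2
  have hinj : ∀ r s, r ≤ M i j - 1 → s ≤ M i j - 1 → a r = a s → r = s :=
    fun r s hr hs e => h.inj hr hs e
  have huk : ∀ k, k ≤ M i j - 2 → u k = a k ∧ u (k + 1) = a (k + 1) := by
    intro k
    induction k with
    | zero => exact fun _ => ⟨hu0, hu1⟩
    | succ k ih =>
      intro hk
      obtain ⟨e1, e2⟩ := ih (by omega)
      refine ⟨e2, ?_⟩
      rcases hnb' k (k + 1) (by simp only [mem_Ioo]; omega) e2 with e | e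
      · exact e.2
      · have := hinj _ _ (by omega) (by omega) (e1.symm.trans e.1)
        omega
  have hua : ∀ k ≤ M i j - 1, u k = a k := by
    intro k hk
    rcases Nat.eq_zero_or_pos k with rfl | h0
    · exact hu0
    · obtain ⟨k, rfl⟩ : ∃ k', k = k' + 1 := ⟨k - 1, by omega⟩
      exact (huk k (by omega)).2
  have hmn : M i j - 1 < n := by
    by_contra! hle
    have := hinj n 0 hle (by omega) (by rw [← hua n hle, ← hua 0 (by omega), ← hu.periodic 0,
      Nat.zero_add])
    omega
  have hS : ∀ t, M i j - 1 ≤ t → t ≤ n → u t ∈ S := by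
    intro t h1 h2
    have hmem := (hu.adj t).1.2
    rcases h.mem_right_iff.1 hmem with hh | ⟨k, hk, e⟩
    · exact hh
    · simp only [mem_Ioo] at hk
      rw [← hua k (by omega), hu.eq_iff] at e
      rcases h2.lt_or_eq with h2 | rfl
      · have := Nat.ModEq.eq_of_lt_of_lt e (by omega) h2
        omega
      · rw [Nat.ModEq, Nat.mod_self, Nat.mod_eq_of_lt (by omega)] at e
        omega
  have hw : ∀ t < n - (M i j - 1), (Γ.localGraph X i j S).Adj (u (M i j - 1 + t))
      (u (M i j - 1 + (t + 1))) := by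
    intro t ht
    have := hu.adj (M i j - 1 + t)
    exact ⟨⟨this.1.1, hS _ (by omega) (by omega)⟩, ⟨this.2.1.1, hS _ (by omega) (by omega)⟩, this.2.2⟩
  -- The rest of the cycle is an old walk between the ends of the path, so `n` is at least `(M i j -
  -- 1) + (M i j + 1)`.
  obtain ⟨p, hp, -⟩ := SimpleGraph.exists_walk_of_adj (b := fun t => u (M i j - 1 + t)) hw
  have := p.edist_le
  rw [hp] at this
  simp only [Nat.add_zero, Nat.add_sub_cancel' hmn.le] at this
  rw [hua _ le_rfl, show u n = a 0 by rw [← Nat.zero_add n, hu.periodic, hu0],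
    SimpleGraph.edist_comm] at this
  have := hd.trans this
  have : M i j + 1 ≤ n - (M i j - 1) := by exact_mod_cast this
  omega

/-- There are no cycles at all in the local graph of a flag that contains a new vertex. If the flag
is old but the cycle contains a new vertex, this vertex has two neighbours in the local graph, which
is therefore the local graph of the step. -/
theorem propPOn (hM : M.IsGood) (hD : Γ.PropDOn M S') (h : Γ.FreeStep M S S' X i j a)
    (hd : (M i j : ℕ∞) + 1 ≤ (Γ.localGraph X i j S).edist (a 0) (a (M i j - 1)))
    (hP : Γ.PropPOn M S) : Γ.PropPOn M S' := by
  intro i' j' X' hXS hX' n v hv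
  by_cases hXS' : X' ⊆ S
  swap
  · obtain ⟨x, hx, hxS⟩ := not_subset.1 hXS'
    obtain ⟨k, hk, rfl⟩ := (h.mem_right_iff.1 (hXS hx)).resolve_left hxS
    exact absurd hv (h.not_isCycleSeq_of_mem_flag hM hD hX' hk hx)
  by_cases hvS : ∀ r, v r ∈ S
  · exact hP i' j' X' hXS' hX' n v (hv.mono fun k =>
      ⟨⟨(hv.adj k).1.1, hvS _⟩, ⟨(hv.adj k).2.1.1, hvS _⟩, (hv.adj k).2.2⟩)
  · push Not at hvS
    obtain ⟨r, hr⟩ := hvS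
    obtain ⟨k, hk, hrk⟩ := (h.mem_right_iff.1 (hv.adj r).1.2).resolve_left hr
    have h3 := hv.three_le
    have e : v (r + (n - 1) + 1) = v r := by rw [← hv.periodic r]; congr 1; omega
    have ad := (hv.adj (r + (n - 1))).symm
    rw [e, ← hrk] at ad
    have hne : v (r + (n - 1)) ≠ v (r + 1) := by
      have := hv.add_two_ne (r + (n - 1))
      rw [show r + (n - 1) + 2 = r + 1 + n by omega, hv.periodic] at this
      exact this.symm
    obtain ⟨rfl, hij, -⟩ := h.eq_of_adj_of_adj hM hD hX' hXS hk ad (hrk ▸ hv.adj r) hne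
    rcases hij with ⟨rfl, rfl⟩ | ⟨rfl, rfl⟩
    · exact h.two_mul_le_of_isCycleSeq hM hD hd hv hk hrk.symm
    · rw [M.symmetric]
      exact h.two_mul_le_of_isCycleSeq hM hD hd (localGraph_comm X' i' j' S' ▸ hv) hk hrk.symm

/-- Procedure B preserves intermediate geometries. -/
theorem isIntermediateOn (hM : M.IsGood) (h : Γ.FreeStep M S S' X i j a)
    (hd : (M i j : ℕ∞) + 1 ≤ (Γ.localGraph X i j S).edist (a 0) (a (M i j - 1)))
    (hS : Γ.IsIntermediateOn M S) : Γ.IsIntermediateOn M S' :=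
  have hD := h.propDOn hd hS.propD
  ⟨h.propFOn hS.propF, h.propPOn hM hD hd hS.propP, hD⟩

end FreeStep

end IncGeometry

theorem Set.Finite.exists_subset_of_monotone {α : Type*} {C : ℕ → Set α} (hC : Monotone C)
    {F : Set α} (hF : F.Finite) (h : F ⊆ ⋃ n, C n) : ∃ n, F ⊆ C n := by
  induction F, hF using Set.Finite.induction_on with
  | empty => exact ⟨0, empty_subset _⟩
  | @insert x F _ _ ih =>
    obtain ⟨n, hn⟩ := ih ((subset_insert _ _).trans h)
    obtain ⟨m, hm⟩ := mem_iUnion.1 (h (mem_insert _ _))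
    exact ⟨max n m, insert_subset (hC (le_max_right _ _) hm) (hn.trans (hC (le_max_left _ _)))⟩

namespace IncGeometry

variable {I V V' : Type} {Γ : IncGeometry I V} {Γ' : IncGeometry I V'} {M : CoxeterMatrix I}

theorem IsFlag.finite [Finite I] {X : Set V} (hX : Γ.IsFlag X) : X.Finite :=
  Set.Finite.of_finite_image (f := Γ.typ) (toFinite _) fun _ hx _ hy e => hX.eq_of_typ_eq hx hy e

theorem IsFlag.mono {X Y : Set V} (hX : Γ.IsFlag X) (h : Y ⊆ X) : Γ.IsFlag Y :=
  fun x hx y hy => hX x (h hx) y (h hy)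

/-! ### Local flags and tight flags -/

theorem IsTightFlag.isLocalFlag (hM : M.IsGood) {X : Set V} {i j : I} (h : Γ.IsTightFlag M X i j) :
    Γ.IsLocalFlag M X i j := by
  refine ⟨h.isFlag, M.ne_of_three_le h.adj, ?_, ?_, fun k hi hj hk => ?_⟩
  · rintro ⟨x, hx, e⟩; exact (h.typ_ne x hx).1 e
  · rintro ⟨x, hx, e⟩; exact (h.typ_ne x hx).2 e
  · have h1 := hM.eq_two_or hi
    have h2 := hM.eq_two_or hj
    obtain ⟨x, hx, e⟩ := h.exists_typ k hi hj (by tauto)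
    exact ⟨x, hx, e⟩

/-- The vertices of a local flag whose type is not adjacent to `i` or `j` can be omitted. -/
theorem IsLocalFlag.exists_tight (hM : M.IsGood) {S X : Set V} {i j : I}
    (hF : Γ.PropFOn M S) (h : Γ.IsLocalFlag M X i j) (hij : M i j ≠ 2) (hXS : X ⊆ S) :
    ∃ Y ⊆ X, Γ.IsTightFlag M Y i j ∧ Γ.localSet Y i j ∩ S = Γ.localSet X i j ∩ S ∧
      ∀ x ∈ X, x ∉ Y → M (Γ.typ x) i = 2 ∧ M (Γ.typ x) j = 2 := by
  obtain ⟨hfl, hne, hi, hj, hfull⟩ := h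
  have hti : ∀ x ∈ X, Γ.typ x ≠ i := fun x hx e => hi ⟨x, hx, e⟩
  have htj : ∀ x ∈ X, Γ.typ x ≠ j := fun x hx e => hj ⟨x, hx, e⟩
  have hY : Γ.IsTightFlag M {x ∈ X | 3 ≤ M (Γ.typ x) i ∨ 3 ≤ M (Γ.typ x) j} i j := by
    refine ⟨hfl.mono (sep_subset _ _), (hM.eq_two_or hne).resolve_left hij,
      fun x hx => ⟨hti x hx.1, htj x hx.1⟩, fun x hx => hx.2, fun k hk hk' hkk => ?_⟩
    obtain ⟨x, hx, rfl⟩ := hfull k hk hk' (by omega)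
    exact ⟨x, ⟨hx, hkk⟩, rfl⟩
  have hout : ∀ x ∈ X, x ∉ {x ∈ X | 3 ≤ M (Γ.typ x) i ∨ 3 ≤ M (Γ.typ x) j} →
      M (Γ.typ x) i = 2 ∧ M (Γ.typ x) j = 2 := by
    intro x hx hxY
    have h1 := hM.eq_two_or (hti x hx)
    have h2 := hM.eq_two_or (htj x hx)
    have : ¬ (3 ≤ M (Γ.typ x) i ∨ 3 ≤ M (Γ.typ x) j) := fun h => hxY ⟨hx, h⟩
    omega
  refine ⟨_, sep_subset _ _, hY, ?_, hout⟩
  ext v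
  constructor
  · rintro ⟨hv, hvS⟩
    rw [hY.mem_localSet] at hv
    refine ⟨⟨⟨fun hvX => ?_, fun x hx => ?_⟩, hv.1⟩, hvS⟩
    · have := hti v hvX; have := htj v hvX; tauto
    · by_cases hxY : x ∈ {x ∈ X | 3 ≤ M (Γ.typ x) i ∨ 3 ≤ M (Γ.typ x) j}
      · exact hv.2 x hxY
      · have := hout x hx hxY
        refine hF x (hXS hx) v hvS ?_
        rcases hv.1 with e | e <;> rw [e] <;> tauto
  · rintro ⟨hv, hvS⟩
    exact ⟨hY.mem_localSet.2 ⟨hv.2, fun x hx => hv.1.2 x hx.1⟩, hvS⟩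

theorem localGraph_congr {X Y S : Set V} {i j : I}
    (h : Γ.localSet Y i j ∩ S = Γ.localSet X i j ∩ S) :
    Γ.localGraph Y i j S = Γ.localGraph X i j S := by
  rw [localGraph, localGraph, h]

/-! ### Isomorphisms between induced geometries -/

/-- The map `φ` is an isomorphism of the geometry induced on `S` with that induced on `φ '' S`. -/
structure IsoOn (Γ : IncGeometry I V) (Γ' : IncGeometry I V') (φ : V → V') (S : Set V) : Prop where
  inj : InjOn φ S
  typ : ∀ v ∈ S, Γ'.typ (φ v) = Γ.typ v
  inc : ∀ u ∈ S, ∀ v ∈ S, (Γ'.inc (φ u) (φ v) ↔ Γ.inc u v)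

namespace IsoOn

variable {φ : V → V'} {S : Set V}

theorem mono (h : IsoOn Γ Γ' φ S) {T : Set V} (hT : T ⊆ S) : IsoOn Γ Γ' φ T :=
  ⟨h.inj.mono hT, fun v hv => h.typ v (hT hv), fun u hu v hv => h.inc u (hT hu) v (hT hv)⟩

theorem isFlag_image (h : IsoOn Γ Γ' φ S) {X : Set V} (hX : X ⊆ S) :
    Γ'.IsFlag (φ '' X) ↔ Γ.IsFlag X := by
  constructor
  · exact fun hf x hx y hy => (h.inc x (hX hx) y (hX hy)).1
      (hf _ (mem_image_of_mem _ hx) _ (mem_image_of_mem _ hy))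
  · rintro hf _ ⟨x, hx, rfl⟩ _ ⟨y, hy, rfl⟩
    exact (h.inc x (hX hx) y (hX hy)).2 (hf x hx y hy)

theorem exists_typ_image (h : IsoOn Γ Γ' φ S) {X : Set V} (hX : X ⊆ S) (k : I) :
    (∃ x ∈ φ '' X, Γ'.typ x = k) ↔ ∃ x ∈ X, Γ.typ x = k := by
  constructor
  · rintro ⟨_, ⟨x, hx, rfl⟩, e⟩
    exact ⟨x, hx, (h.typ x (hX hx)).symm.trans e⟩
  · rintro ⟨x, hx, e⟩
    exact ⟨_, mem_image_of_mem _ hx, (h.typ x (hX hx)).trans e⟩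

theorem image_typ_image (h : IsoOn Γ Γ' φ S) {X : Set V} (hX : X ⊆ S) :
    Γ'.typ '' (φ '' X) = Γ.typ '' X := by
  rw [image_image]
  exact image_congr fun x hx => h.typ x (hX hx)

theorem isTightFlag_image (h : IsoOn Γ Γ' φ S) {X : Set V} {i j : I} (hX : X ⊆ S) :
    Γ'.IsTightFlag M (φ '' X) i j ↔ Γ.IsTightFlag M X i j := by
  have ht : ∀ x ∈ X, Γ'.typ (φ x) = Γ.typ x := fun x hx => h.typ x (hX hx)
  constructor
  · rintro ⟨h1, h2, h3, h4, h5⟩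
    refine ⟨(h.isFlag_image hX).1 h1, h2, fun x hx => ?_, fun x hx => ?_, fun k hi hj hk => ?_⟩
    · simpa only [ht x hx] using h3 _ (mem_image_of_mem φ hx)
    · simpa only [ht x hx] using h4 _ (mem_image_of_mem φ hx)
    · exact (h.exists_typ_image hX k).1 (h5 k hi hj hk)
  · rintro ⟨h1, h2, h3, h4, h5⟩
    refine ⟨(h.isFlag_image hX).2 h1, h2, ?_, ?_, fun k hi hj hk => ?_⟩
    · rintro _ ⟨x, hx, rfl⟩; simpa only [ht x hx] using h3 _ hx
    · rintro _ ⟨x, hx, rfl⟩; simpa only [ht x hx] using h4 _ hx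
    · exact (h.exists_typ_image hX k).2 (h5 k hi hj hk)

theorem mem_localSet_image (h : IsoOn Γ Γ' φ S) {X : Set V} {i j : I} (hX : X ⊆ S) {v : V}
    (hv : v ∈ S) : φ v ∈ Γ'.localSet (φ '' X) i j ↔ v ∈ Γ.localSet X i j := by
  simp only [localSet, residueSet, mem_ofPred_eq, h.inj.mem_image_iff hX hv, h.typ v hv,
    forall_mem_image]
  refine and_congr_left fun _ => and_congr_right fun _ => forall₂_congr fun x hx => ?_
  exact h.inc x (hX hx) v hv

theorem adj_image (h : IsoOn Γ Γ' φ S) {X T : Set V} {i j : I} (hX : X ⊆ S) (hT : T ⊆ S) {u v : V}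
    (hu : u ∈ S) (hv : v ∈ S) : (Γ'.localGraph (φ '' X) i j (φ '' T)).Adj (φ u) (φ v) ↔
      (Γ.localGraph X i j T).Adj u v := by
  simp only [localGraph_adj, mem_inter_iff, h.mem_localSet_image hX hu, h.mem_localSet_image hX hv,
    h.inj.mem_image_iff hT hu, h.inj.mem_image_iff hT hv, h.inc u hu v hv, ne_eq, h.inj.eq_iff hu hv]

theorem isPathSeq_image (h : IsoOn Γ Γ' φ S) {X T : Set V} {i j : I} (hX : X ⊆ S) (hT : T ⊆ S)
    {l : ℕ} {b : ℕ → V} (hb : ∀ k ≤ l, b k ∈ S) :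
    (Γ'.localGraph (φ '' X) i j (φ '' T)).IsPathSeq l (φ ∘ b) ↔
      (Γ.localGraph X i j T).IsPathSeq l b := by
  constructor
  · rintro ⟨h1, h2⟩
    exact ⟨fun k hk => (h.adj_image hX hT (hb k hk.le) (hb (k + 1) hk)).1 (h1 k hk),
      fun k hk l hl e => h2 hk hl (congrArg φ e)⟩
  · rintro ⟨h1, h2⟩
    exact ⟨fun k hk => (h.adj_image hX hT (hb k hk.le) (hb (k + 1) hk)).2 (h1 k hk),
      fun k hk l hl e => h2 hk hl (h.inj (hb k hk) (hb l hl) e)⟩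

theorem isCycleSeq_image (h : IsoOn Γ Γ' φ S) {X T : Set V} {i j : I} (hX : X ⊆ S) (hT : T ⊆ S)
    {n : ℕ} {b : ℕ → V} (hb : ∀ k, b k ∈ S) :
    (Γ'.localGraph (φ '' X) i j (φ '' T)).IsCycleSeq n (φ ∘ b) ↔
      (Γ.localGraph X i j T).IsCycleSeq n b := by
  constructor
  · rintro ⟨h0, h1, h2, h3⟩
    exact ⟨h0, fun k => h.inj (hb _) (hb _) (h1 k),
      fun k => (h.adj_image hX hT (hb k) (hb (k + 1))).1 (h2 k),
      fun k hk l hl e => h3 hk hl (congrArg φ e)⟩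
  · rintro ⟨h0, h1, h2, h3⟩
    exact ⟨h0, fun k => congrArg φ (h1 k),
      fun k => (h.adj_image hX hT (hb k) (hb (k + 1))).2 (h2 k),
      fun k hk l hl e => h3 hk hl (h.inj (hb k) (hb l) e)⟩

theorem isIntermediateOn_image (h : IsoOn Γ Γ' φ S) :
    Γ'.IsIntermediateOn M (φ '' S) ↔ Γ.IsIntermediateOn M S := by
  constructor
  · rintro ⟨hF, hP, hD⟩
    have hm : ∀ v ∈ S, φ v ∈ φ '' S := fun v hv => mem_image_of_mem _ hv
    refine ⟨fun u hu v hv e => ?_, fun i j X hX hT n v hv => ?_,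
      fun x hx x' hx' z hz z' hz' t t' h4 h1 h2 h3 h5 => ?_⟩
    · rw [← h.inc u hu v hv]
      exact hF _ (hm u hu) _ (hm v hv) (by rwa [h.typ u hu, h.typ v hv])
    · exact hP i j (φ '' X) (image_mono hX) ((h.isTightFlag_image hX).2 hT) n (φ ∘ v)
        ((h.isCycleSeq_image hX subset_rfl fun k => (hv.adj k).1.2).2 hv)
    · have := hD _ (hm x hx) _ (hm x' hx') _ (hm z hz) _ (hm z' hz')
      simp only [h.typ x hx, h.typ x' hx', h.typ z hz, h.typ z' hz', h.inc x hx z hz,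
        h.inc x hx z' hz', h.inc x' hx' z hz, h.inc x' hx' z' hz', h.inj.eq_iff hx hx',
        h.inj.eq_iff hz hz'] at this
      exact this t t' h4 h1 h2 h3 h5
  · rintro ⟨hF, hP, hD⟩
    refine ⟨?_, fun i j X hX hT n v hv => ?_, ?_⟩
    · rintro _ ⟨u, hu, rfl⟩ _ ⟨v, hv, rfl⟩ e
      rw [h.typ u hu, h.typ v hv] at e
      exact (h.inc u hu v hv).2 (hF u hu v hv e)
    · obtain ⟨Y, hY, rfl⟩ := subset_image_iff.1 hX
      have : ∀ k, ∃ u ∈ S, φ u = v k := fun k => (hv.adj k).1.2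
      choose u hu huv using this
      obtain rfl : φ ∘ u = v := funext huv
      exact hP i j Y hY ((h.isTightFlag_image hY).1 hT) n u
        ((h.isCycleSeq_image hY subset_rfl hu).1 hv)
    · rintro _ ⟨x, hx, rfl⟩ _ ⟨x', hx', rfl⟩ _ ⟨z, hz, rfl⟩ _ ⟨z', hz', rfl⟩
      simp only [h.typ x hx, h.typ x' hx', h.typ z hz, h.typ z' hz', h.inc x hx z hz,
        h.inc x hx z' hz', h.inc x' hx' z hz, h.inc x' hx' z' hz', h.inj.eq_iff hx hx',
        h.inj.eq_iff hz hz']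
      exact hD x hx x' hx' z hz z' hz'

end IsoOn

theorem isoOn_val (S : Set V) : IsoOn (Γ.induce S) Γ Subtype.val univ :=
  ⟨Subtype.val_injective.injOn, fun _ _ => rfl, fun _ _ _ _ => Iff.rfl⟩

/-! ### Intermediate geometries -/

theorem isCycleSeq_four {G : SimpleGraph V} {x z x' z' : V} (h1 : G.Adj x z) (h2 : G.Adj z x')
    (h3 : G.Adj x' z') (h4 : G.Adj z' x) (hx : x ≠ x') (hz : z ≠ z') :
    G.IsCycleSeq 4 (fun k => if k % 4 = 0 then x else if k % 4 = 1 then z else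
      if k % 4 = 2 then x' else z') where
  three_le := by omega
  periodic k := by simp
  adj k := by
    have h : k % 4 < 4 := Nat.mod_lt _ (by omega)
    rw [Nat.add_mod k 1]
    interval_cases k % 4 <;> simpa
  inj k hk l hl e := by
    simp only [mem_Iio] at hk hl
    have := h1.ne; have := h2.ne; have := h3.ne; have := h4.ne
    interval_cases k <;> interval_cases l <;> simp_all

/-- By (F), passing to the tight part of a local flag does not change the local graph; and a cycle
of length 4 on two types consists of two vertices of one type that are both incident with two
vertices of the other. -/
theorem isIntermediate_iff (hM : M.IsGood) : Γ.IsIntermediate M ↔ Γ.IsIntermediateOn M univ := by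
  have hgr : ∀ (X : Set V) (i j : I), Γ.localGraph X i j univ = Γ.graphOn (Γ.localSet X i j) :=
    fun X i j => by rw [localGraph, inter_univ]
  constructor
  · rintro ⟨hF, hP, hD⟩
    refine ⟨fun u _ v _ => hF u v, fun i j X _ hX => ?_,
      fun x _ x' _ z _ z' _ t t' h4 h1 h2 h3 h5 => ?_⟩
    · refine SimpleGraph.noShortCycle_of_bipartite (fun _ _ => localGraph_adj_typ)
        fun k hk n v hv => ?_
      obtain ⟨c, hc, rfl⟩ := hv.exists_isCycle
      rw [hgr] at c
      have h2 : M i j ≠ 2 := by have := hX.adj; omega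
      have := hP i j X h2 (hX.isLocalFlag hM) k hk
      rw [← hgr] at this
      exact this _ _ hc
    · by_contra! hne
      have hxz : ∀ {x z : V}, 4 ≤ M (Γ.typ x) (Γ.typ z) → x ≠ z := by
        rintro x _ h rfl; simp at h
      have hd := hD (Γ.typ x) (Γ.typ z) (M.ne_of_three_le (by omega)) h4
      obtain ⟨c, hc, hl⟩ := (isCycleSeq_four (G := Γ.graphOn
        {v | Γ.typ v = Γ.typ x ∨ Γ.typ v = Γ.typ z}) (x := x) (x' := x') (z := z) (z' := z')
        ⟨Or.inl rfl, Or.inr rfl, hxz h4, h1⟩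
        ⟨Or.inr rfl, Or.inl t.symm, (hxz (t ▸ h4)).symm, Γ.symm h3⟩
        ⟨Or.inl t.symm, Or.inr t'.symm, hxz (t ▸ t' ▸ h4), h5⟩
        ⟨Or.inr t'.symm, Or.inl rfl, (hxz (t' ▸ h4)).symm, Γ.symm h2⟩ hne.1 hne.2).exists_isCycle
      exact hd _ c hc hl
  · rintro ⟨hF, hP, hD⟩
    refine ⟨fun u v => hF u trivial v trivial, fun i j X h2 hX t ht v c hc hl => ?_,
      fun i j hne h4 v c hc hl => ?_⟩
    · obtain ⟨Y, hYX, hY, hloc, -⟩ := hX.exists_tight hM hF h2 (subset_univ X)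
      have := hP i j Y (subset_univ _) hY
      rw [localGraph_congr hloc, hgr] at this
      have := hc.two_mul_le_length this
      omega
    · have hcs := hc.isCycleSeq
      rw [hl] at hcs
      have ht : ∀ u w : V, (Γ.graphOn {v | Γ.typ v = i ∨ Γ.typ v = j}).Adj u w →
          Γ.typ u ≠ Γ.typ w ∧ (Γ.typ u = i ∨ Γ.typ u = j) ∧ (Γ.typ w = i ∨ Γ.typ w = j) :=
        fun u w h => ⟨fun e => h.2.2.1 ((Γ.inc_iff_eq e).1 h.2.2.2), h.1, h.2.1⟩
      have a0 := hcs.adj 0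
      have a1 := hcs.adj 1
      have a2 := hcs.adj 2
      have t0 := ht _ _ a0
      have t1 := ht _ _ a1
      have t2 := ht _ _ a2
      have n0 := hcs.add_two_ne 0
      have n1 := hcs.add_two_ne 1
      have a3 : (Γ.graphOn {v | Γ.typ v = i ∨ Γ.typ v = j}).Adj (c.getVert (3 % 4))
        (c.getVert (0 % 4)) := hcs.adj 3
      simp only [Nat.zero_add, Nat.reduceAdd] at a0 a1 a2 t0 t1 t2 n0 n1
      have hM4 : 4 ≤ M (Γ.typ (c.getVert (0 % 4))) (Γ.typ (c.getVert (1 % 4))) := by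
        rcases t0 with ⟨hn, e0 | e0, e1 | e1⟩
        · exact absurd (e0.trans e1.symm) hn
        · rwa [e0, e1]
        · rwa [e0, e1, M.symmetric]
        · exact absurd (e0.trans e1.symm) hn
      rcases hD _ trivial _ trivial _ trivial _ trivial (by grind) (by grind) hM4 a0.2.2.2
        (Γ.symm a3.2.2.2) (Γ.symm a1.2.2.2) a2.2.2.2 with e | e
      · exact n0 e.symm
      · exact n1 e.symm

theorem isIntermediate_induce_iff (hM : M.IsGood) {S : Set V} :
    (Γ.induce S).IsIntermediate M ↔ Γ.IsIntermediateOn M S := by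
  rw [isIntermediate_iff hM, ← (isoOn_val S).isIntermediateOn_image, image_univ, Subtype.range_val]

/-! ### Procedure B and free steps -/

/-- The vertices omitted from the local flag have types that are not adjacent to `i` or `j`, so
their incidences with the new path are already prescribed by (F). -/
theorem StepB.exists_freeStep (hM : M.IsGood) {S S' : Set V} (hF : Γ.PropFOn M S)
    (h : Γ.StepB M S S') : ∃ X i j a, Γ.FreeStep M S S' X i j a ∧
      (M i j : ℕ∞) + 1 ≤ (Γ.localGraph X i j S).edist (a 0) (a (M i j - 1)) := by
  obtain ⟨X, i, j, a, ⟨h2, hXS, hX, h0, h1, -, -, hd⟩, rfl, hn, hinj, ht, ht', hinc⟩ := h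
  obtain ⟨Y, hYX, hY, hloc, hout⟩ := hX.exists_tight hM hF h2 hXS
  have h3 := hY.adj
  rw [← hloc] at h0 h1 hd
  have hend : a 0 ≠ a (M i j - 1) := by
    intro e
    rw [e, SimpleGraph.edist_self] at hd
    simp at hd
  refine ⟨Y, i, j, a, ⟨hY, hYX.trans hXS, h0, h1, rfl, hn, ?_, ht, ht', ?_⟩, hd⟩
  · intro k hk l hl e
    simp only [mem_Iic] at hk hl
    by_contra hkl
    have hk' : k = 0 ∨ k = M i j - 1 ∨ k ∈ Ioo 0 (M i j - 1) := by simp only [mem_Ioo]; omega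
    have hl' : l = 0 ∨ l = M i j - 1 ∨ l ∈ Ioo 0 (M i j - 1) := by simp only [mem_Ioo]; omega
    rcases hk' with rfl | rfl | hk' <;> rcases hl' with rfl | rfl | hl'
    · exact hkl rfl
    · exact hend e
    · exact hn l hl' (e ▸ h0.2)
    · exact hend e.symm
    · exact hkl rfl
    · exact hn l hl' (e ▸ h1.2)
    · exact hn k hk' (e ▸ h0.2)
    · exact hn k hk' (e ▸ h1.2)
    · exact hkl (hinj hk' hl' e)
  · intro k hk w hw hne
    rw [hinc k hk w hw hne]
    have hk' := hk
    simp only [mem_Ioo] at hk'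
    have : w ∈ X → w ∈ Y ∨ M (Γ.typ (a k)) (Γ.typ w) = 2 := by
      intro hwX
      by_cases hwY : w ∈ Y
      · exact Or.inl hwY
      · have := hout w hwX hwY
        rw [M.symmetric]
        rcases ht k (by omega) with e | e <;> rw [e] <;> tauto
    have := @hYX w
    tauto

/-- Both conditions on the endpoints come for free: the distance condition from (P) for the result,
and the parity condition from the length of the alternating path. -/
theorem FreeStep.stepB (hM : M.IsGood) {S S' X : Set V} {i j : I} {a : ℕ → V}
    (h : Γ.FreeStep M S S' X i j a) (hP : Γ.PropPOn M S') : Γ.StepB M S S' := by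
  have h3 := h.three_le
  have e2 := SimpleGraph.apply_eq_iff_even (fun _ _ => localGraph_adj_typ) h.isPathSeq.adj
  have e3 : Even (M i j - 1) ↔ Odd (M i j) := by
    obtain ⟨t, ht⟩ : ∃ t, M i j = t + 1 := ⟨M i j - 1, by omega⟩
    rw [ht, Nat.add_sub_cancel, Nat.odd_add_one, Nat.not_odd_iff_even]
  refine ⟨X, i, j, a, ⟨by omega, h.subset, h.tight.isLocalFlag hM, h.first_mem, h.last_mem,
    fun ho => (e2.2 (e3.2 ho)).symm, fun he e => ?_, h.le_edist hP⟩, h.eq_union, h.notMem,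
    h.inj.mono fun k hk => hk.2.le, h.typ_mem, h.typ_ne, h.inc_iff⟩
  exact Nat.not_odd_iff_even.2 he (e3.1 (e2.1 e.symm))

/-- Procedure B cannot be applied to the geometry induced on `A`: vertices of suitable types in a
local graph are joined by a short path. -/
def IsSaturatedOn (Γ : IncGeometry I V) (M : CoxeterMatrix I) (A : Set V) : Prop :=
  ∀ (X : Set V) (i j : I), X ⊆ A → Γ.IsTightFlag M X i j → ∀ x ∈ Γ.localSet X i j ∩ A,
    ∀ y ∈ Γ.localSet X i j ∩ A, (Γ.typ y = Γ.typ x ↔ Odd (M i j)) →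
      ∃ l b, l < M i j ∧ (Γ.localGraph X i j A).IsPathSeq l b ∧ b 0 = x ∧ b l = y

theorem isSaturatedOn_univ (hM : M.IsGood)
    (h : ∀ (X : Set V) (i j : I) (x y : V), ¬ Γ.ViableB M univ X i j x y) :
    Γ.IsSaturatedOn M univ := by
  intro X i j _ hX x hx y hy hxy
  have h3 := hX.adj
  have hlt : (Γ.localGraph X i j univ).edist x y < (M i j + 1 : ℕ) := by
    by_contra hd
    rw [not_lt] at hd
    refine h X i j x y ⟨by omega, subset_univ _, hX.isLocalFlag hM, hx, hy,
      fun ho => (hxy.2 ho).symm, fun he e => ?_, by exact_mod_cast hd⟩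
    exact Nat.not_odd_iff_even.2 he (hxy.1 e.symm)
  obtain ⟨l, b, hl, hb, rfl, rfl⟩ := SimpleGraph.exists_isPathSeq_of_edist_lt hlt
  refine ⟨l, b, ?_, hb, rfl, rfl⟩
  have e1 := SimpleGraph.apply_eq_iff_even (fun _ _ => localGraph_adj_typ) hb.adj
  rw [hxy] at e1
  -- Failure of Procedure B gives distance at most `M i j`, and parity excludes equality.
  have : l ≠ M i j := by
    rintro rfl
    rw [← Nat.not_even_iff_odd] at e1
    tauto
  omega

theorem IsSaturatedOn.not_viableB (hM : M.IsGood) (hF : Γ.PropFOn M univ)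
    (h : Γ.IsSaturatedOn M univ) (X : Set V) (i j : I) (x y : V) :
    ¬ Γ.ViableB M univ X i j x y := by
  rintro ⟨h2, hXS, hX, h0, h1, ho, he, hd⟩
  obtain ⟨Y, hYX, hY, hloc, hout⟩ := hX.exists_tight hM hF h2 hXS
  rw [← hloc] at h0 h1 hd
  obtain ⟨l, b, hl, hb, rfl, rfl⟩ := h Y i j (subset_univ _) hY x h0 y h1
    ⟨fun e => by
      by_contra hno
      exact he (Nat.not_odd_iff_even.1 hno) e.symm, fun h => (ho h).symm⟩
  have := hd.trans hb.edist_le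
  have : M i j + 1 ≤ l := by exact_mod_cast this
  omega

/-! ### Chains -/

/-- Every step of the chain is trivial or free. -/
def IsFreeChain (Γ : IncGeometry I V) (M : CoxeterMatrix I) (C : ℕ → Set V) : Prop :=
  ∀ n, C (n + 1) = C n ∨ ∃ X i j a, Γ.FreeStep M (C n) (C (n + 1)) X i j a

theorem IsFreeChain.monotone {C : ℕ → Set V} (h : Γ.IsFreeChain M C) : Monotone C := by
  refine monotone_nat_of_le_succ fun n => ?_
  rcases h n with e | ⟨X, i, j, a, ha⟩
  · exact e.ge
  · exact ha.subset_right

/-- Each condition concerns only finitely many vertices: cycles are finite, and so are flags, as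
there are finitely many types. -/
theorem isIntermediateOn_iUnion [Finite I] {C : ℕ → Set V} (hC : Monotone C)
    (h : ∀ n, Γ.IsIntermediateOn M (C n)) : Γ.IsIntermediateOn M (⋃ n, C n) := by
  have key : ∀ F : Set V, F.Finite → F ⊆ ⋃ n, C n → ∃ n, F ⊆ C n :=
    fun F hF hs => hF.exists_subset_of_monotone hC hs
  refine ⟨fun u hu v hv => ?_, fun i j X hX hT n v hv => ?_,
    fun x hx x' hx' z hz z' hz' => ?_⟩
  · obtain ⟨n, hn⟩ := key {u, v} (toFinite _) (by simp [insert_subset_iff, hu, hv])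
    exact (h n).propF u (hn (by simp)) v (hn (by simp))
  · obtain ⟨r, hr⟩ := key (X ∪ v '' Iio n) (hT.isFlag.finite.union ((finite_Iio n).image v))
      (union_subset hX (by rintro _ ⟨k, -, rfl⟩; exact (hv.adj k).1.2))
    have hvr : ∀ k, v k ∈ C r := by
      intro k
      rw [← hv.apply_mod]
      exact hr (Or.inr ⟨k % n, Nat.mod_lt _ (by have := hv.three_le; omega), rfl⟩)
    refine (h r).propP i j X (subset_union_left.trans hr) hT n v (hv.mono fun k => ?_)
    exact ⟨⟨(hv.adj k).1.1, hvr _⟩, ⟨(hv.adj k).2.1.1, hvr _⟩, (hv.adj k).2.2⟩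
  · obtain ⟨n, hn⟩ := key {x, x', z, z'} (toFinite _) (by simp [insert_subset_iff, *])
    exact (h n).propD x (hn (by simp)) x' (hn (by simp)) z (hn (by simp)) z' (hn (by simp))

/-- Together with `IsFreeChain.isBuiltByB`, this allows one to forget Procedure B and to work with
free chains, intermediate geometries and saturation. -/
theorem IsBuiltByB.exists_chain [Finite I] (hM : M.IsGood) (h : Γ.IsBuiltByB M) :
    (∃ C, (C 0).Finite ∧ Γ.IsFreeChain M C ∧ ⋃ n, C n = univ) ∧ Γ.IsIntermediateOn M univ ∧
      Γ.IsSaturatedOn M univ := by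
  obtain ⟨⟨C, hfin, h0, hstep, huniv⟩, hsat⟩ := h
  have hint : ∀ n, Γ.IsIntermediateOn M (C n) := by
    intro n
    induction n with
    | zero => exact (isIntermediate_induce_iff hM).1 h0
    | succ n ih =>
      rcases hstep n with e | hB
      · rwa [e]
      · obtain ⟨X, i, j, a, ha, hd⟩ := hB.exists_freeStep hM ih.propF
        exact ha.isIntermediateOn hM hd ih
  have hchain : Γ.IsFreeChain M C := fun n => (hstep n).imp_right fun hB => by
    obtain ⟨X, i, j, a, ha, -⟩ := hB.exists_freeStep hM (hint n).propF
    exact ⟨X, i, j, a, ha⟩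
  exact ⟨⟨C, hfin, hchain, huniv⟩, huniv ▸ isIntermediateOn_iUnion hchain.monotone hint,
    isSaturatedOn_univ hM hsat⟩

/-- Distances need not be controlled along the chain, because (P) for the union restricts to every
stage and implies the distance conditions. -/
theorem IsFreeChain.isBuiltByB (hM : M.IsGood) {C : ℕ → Set V} (h : Γ.IsFreeChain M C)
    (hfin : (C 0).Finite) (huniv : ⋃ n, C n = univ) (hint : Γ.IsIntermediateOn M univ)
    (hsat : Γ.IsSaturatedOn M univ) : Γ.IsBuiltByB M := by
  refine ⟨⟨C, hfin, (isIntermediate_induce_iff hM).2 (hint.mono (subset_univ _)), fun n => ?_,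
    huniv⟩, hsat.not_viableB hM hint.propF⟩
  refine (h n).imp_right fun ⟨X, i, j, a, ha⟩ => ?_
  exact ha.stepB hM (hint.mono (subset_univ _)).propP

end IncGeometry

namespace IncGeometry

variable {I V V' : Type} {Γ : IncGeometry I V} {Γ' : IncGeometry I V'} {M : CoxeterMatrix I}

/-! ### Closed sets and free sets -/

/-- A set `A` of vertices is closed in `S` if it contains the short paths between its elements in
the local graphs of its flags, and the vertices determined by property (D). -/
structure IsClosedIn (Γ : IncGeometry I V) (M : CoxeterMatrix I) (A S : Set V) : Prop where
  subset : A ⊆ S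
  path : ∀ (X : Set V) (i j : I), X ⊆ A → Γ.IsTightFlag M X i j → ∀ l b, l < M i j →
    (Γ.localGraph X i j S).IsPathSeq l b → b 0 ∈ A → b l ∈ A → ∀ k ≤ l, b k ∈ A
  meet : ∀ x ∈ A, ∀ x' ∈ A, ∀ z ∈ S, x ≠ x' → Γ.typ x = Γ.typ x' → 4 ≤ M (Γ.typ x) (Γ.typ z) →
    Γ.inc x z → Γ.inc x' z → z ∈ A

theorem IsClosedIn.inter {A S T : Set V} (h : Γ.IsClosedIn M A S) (hT : T ⊆ S) :
    Γ.IsClosedIn M (A ∩ T) T where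
  subset := inter_subset_right
  path X i j hX hXt l b hl hb h0 h1 k hk := by
    have hbT : b k ∈ T := by
      rcases hk.lt_or_eq with hk | rfl
      · exact (hb.adj k hk).1.2
      · exact h1.2
    exact ⟨h.path X i j (hX.trans inter_subset_left) hXt l b hl
      (hb.mono fun k hk => localGraph_mono hT (hb.adj k hk)) h0.1 h1.1 k hk, hbT⟩
  meet x hx x' hx' z hz hne ht h4 h1 h2 :=
    ⟨h.meet x hx.1 x' hx'.1 z (hT hz) hne ht h4 h1 h2, hz⟩

theorem isClosedIn_self (S : Set V) : Γ.IsClosedIn M S S where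
  subset := subset_rfl
  path X i j _ _ l b _ hb _ h1 k hk := by
    rcases hk.lt_or_eq with hk | rfl
    · exact (hb.adj k hk).1.2
    · exact h1
  meet _ _ _ _ z hz _ _ _ _ _ := hz

theorem isClosedIn_empty (S : Set V) : Γ.IsClosedIn M ∅ S where
  subset := empty_subset _
  path _ _ _ _ _ _ _ _ _ h0 := absurd h0 (notMem_empty _)
  meet _ hx := absurd hx (notMem_empty _)

/-- `W` is a free subset with respect to the chain `C`: it starts from a closed set, and every new
path is either disjoint from `W` or contained in `W` together with the flag that it belongs to. -/
def IsFreeIn (Γ : IncGeometry I V) (M : CoxeterMatrix I) (W : Set V) (C : ℕ → Set V) : Prop :=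
  Γ.IsClosedIn M (W ∩ C 0) (C 0) ∧ ∀ n, C (n + 1) = C n ∨ ∃ X i j a,
    Γ.FreeStep M (C n) (C (n + 1)) X i j a ∧
      ((∀ k ∈ Ioo 0 (M i j - 1), a k ∉ W) ∨ (X ⊆ W ∧ ∀ k ≤ M i j - 1, a k ∈ W))

theorem IsFreeIn.isFreeChain {W : Set V} {C : ℕ → Set V} (h : Γ.IsFreeIn M W C) :
    Γ.IsFreeChain M C := fun n => (h.2 n).imp_right fun ⟨X, i, j, a, ha, _⟩ => ⟨X, i, j, a, ha⟩

theorem IsTightFlag.adj_typ {X : Set V} {i j : I} {S : Set V} (h : Γ.IsTightFlag M X i j) {u v : V}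
    (huv : (Γ.localGraph X i j S).Adj u v) : 3 ≤ M (Γ.typ u) (Γ.typ v) := by
  have h3 := h.adj
  have h3' : 3 ≤ M j i := M.symmetric i j ▸ h3
  obtain ⟨hn, e1 | e1, e2 | e2⟩ := localGraph_adj_typ huv <;> rw [e1, e2] at hn ⊢ <;>
    first | exact absurd rfl hn | assumption

/-- The neighbours of a new vertex that are not prescribed by (F). -/
theorem FreeStep.mem_of_inc {S S' X : Set V} {i j : I} {a : ℕ → V} {W : Set V}
    (h : Γ.FreeStep M S S' X i j a) (hXW : X ⊆ W) (haW : ∀ k ≤ M i j - 1, a k ∈ W) {k : ℕ}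
    (hk : k ∈ Ioo 0 (M i j - 1)) {w : V} (hw : w ∈ S') (hadj : 3 ≤ M (Γ.typ (a k)) (Γ.typ w))
    (hinc : Γ.inc (a k) w) : w ∈ W := by
  have hk' := hk
  simp only [mem_Ioo] at hk'
  by_cases c : Γ.typ w = i ∨ Γ.typ w = j
  · have hne : w ≠ a k := fun e => M.ne_of_three_le hadj (by rw [e])
    rcases h.eq_of_inc hk hw c hne hinc with rfl | rfl
    · exact haW _ (by omega)
    · exact haW _ (by omega)
  · push Not at c
    exact hXW (h.mem_flag_of_inc hk hw c.1 c.2 hadj hinc)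

namespace IsFreeIn

variable {W : Set V} {C : ℕ → Set V}

/-- Consider the first stage that contains `X'` and `b`. It is not stage 0, where `W` is closed. If
the path added at this stage were inside `W`, the incidences of its vertices would pull an inner
vertex of `b` into `W`. So the added path avoids `W`; then `X'` and the ends of `b` are old, and a
new vertex on `b` has two neighbours in the local graph of `X'`. Hence this is the local graph of
the step and `b` runs along the added path. -/
theorem exists_step_of_notMem [Finite I] (hM : M.IsGood) (hint : Γ.IsIntermediateOn M univ)
    (hC : ⋃ n, C n = univ) (hW : Γ.IsFreeIn M W C) {X' : Set V} {i' j' : I}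
    (hX' : Γ.IsTightFlag M X' i' j') (hXW : X' ⊆ W) {l : ℕ} {b : ℕ → V} (hl2 : 2 ≤ l)
    (hl : l < M i' j') (hb : (Γ.localGraph X' i' j' univ).IsPathSeq l b) (hb0 : b 0 ∈ W)
    (hbl : b l ∈ W) (hbk : ∀ k, 0 < k → k < l → b k ∉ W) :
    ∃ n a, Γ.FreeStep M (C n) (C (n + 1)) X' i' j' a ∧ (∀ k ∈ Ioo 0 (M i' j' - 1), a k ∉ W) ∧
      l = M i' j' - 1 ∧ ∀ k ≤ l, b k = a k := by
  classical
  have hmono := hW.isFreeChain.monotone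
  have hex : ∃ n, X' ∪ b '' Iic l ⊆ C n :=
    (hX'.isFlag.finite.union ((finite_Iic l).image b)).exists_subset_of_monotone hmono
      (hC ▸ subset_univ _)
  have hstage : ∀ n, X' ∪ b '' Iic l ⊆ C n → (Γ.localGraph X' i' j' (C n)).IsPathSeq l b := by
    intro n hn
    have : ∀ k ≤ l, b k ∈ C n := fun k hk => hn (Or.inr ⟨k, hk, rfl⟩)
    exact hb.mono fun k hk => ⟨⟨(hb.adj k hk).1.1, this k hk.le⟩,
      ⟨(hb.adj k hk).2.1.1, this (k + 1) hk⟩, (hb.adj k hk).2.2⟩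
  obtain ⟨n, hn, hmin⟩ : ∃ n, X' ∪ b '' Iic l ⊆ C n ∧ ∀ n' < n, ¬ X' ∪ b '' Iic l ⊆ C n' :=
    ⟨Nat.find hex, Nat.find_spec hex, fun n' => Nat.find_min hex⟩
  have hbn := hstage n hn
  rcases n with _ | s
  · have hXC : X' ⊆ W ∩ C 0 := subset_inter hXW (subset_union_left.trans hn)
    have := (hW.1.path X' i' j' hXC hX' l b hl hbn ⟨hb0, hn (Or.inr ⟨0, by simp, rfl⟩)⟩
      ⟨hbl, hn (Or.inr ⟨l, by simp, rfl⟩)⟩ 1 (by omega)).1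
    exact absurd this (hbk 1 (by omega) (by omega))
  rcases hW.2 s with e | ⟨X, i, j, a, ha, hfree⟩
  · exact absurd (e ▸ hn) (hmin s (by omega))
  have hD : Γ.PropDOn M (C (s + 1)) := (hint.mono (subset_univ _)).propD
  have hXS : X' ⊆ C (s + 1) := subset_union_left.trans hn
  have hnew := hmin s (by omega)
  rcases hfree with hfree | ⟨hXW', haW⟩
  swap
  · exfalso
    -- A vertex that is new at this stage is an end of `b` or belongs to `X'`; in either case an
    -- inner vertex of `b` is forced into `W`.
    have hz : b 1 ∉ W := hbk 1 (by omega) (by omega)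
    by_cases hXs : X' ⊆ C s
    · have : ∃ r ≤ l, b r ∉ C s := by
        by_contra! hcon
        exact hnew (union_subset hXs (by rintro _ ⟨r, hr, rfl⟩; exact hcon r hr))
      obtain ⟨r, hr, hrs⟩ := this
      obtain ⟨k, hk, hkr⟩ := (ha.mem_right_iff.1 (hn (Or.inr ⟨r, hr, rfl⟩))).resolve_left hrs
      have hrW : b r ∈ W := hkr ▸ haW k (by simp only [mem_Ioo] at hk; omega)
      have hr' : r = 0 ∨ r = l := by
        by_contra! hc
        exact hbk r (by omega) (by omega) hrW
      have key : ∀ w, (Γ.localGraph X' i' j' (C (s + 1))).Adj (b r) w → w ∈ W := fun w hw =>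
        ha.mem_of_inc hXW' haW hk hw.2.1.2 (by rw [hkr]; exact hX'.adj_typ hw)
          (by rw [hkr]; exact hw.2.2.2)
      rcases hr' with rfl | rfl
      · exact hz (key _ (hbn.adj 0 (by omega)))
      · have := hbn.adj (r - 1) (by omega)
        rw [show r - 1 + 1 = r by omega] at this
        exact hbk (r - 1) (by omega) (by omega) (key _ this.symm)
    · obtain ⟨x, hx, hxs⟩ := not_subset.1 hXs
      obtain ⟨k, hk, rfl⟩ := (ha.mem_right_iff.1 (hXS hx)).resolve_left hxs
      have hk' := hk
      simp only [mem_Ioo] at hk'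
      have hne : b 0 ≠ b 2 := fun e => by
        have := hb.inj (show 0 ∈ Iic l by simp) (show 2 ∈ Iic l by simpa) e
        omega
      have key : ∀ i' j', Γ.IsTightFlag M X' i' j' → (Γ.localGraph X' i' j' (C (s + 1))).Adj (b 1)
          (b 0) → (Γ.localGraph X' i' j' (C (s + 1))).Adj (b 1) (b 2) →
          3 ≤ M (Γ.typ (a k)) i' → False := by
        intro i' j' hX' h1 h2 hadj
        rcases (localGraph_adj_typ h1).2.1 with e | e
        · rcases ha.mem_or_of_mem_flag hX' hk hx hadj h1.1 e with h | h
          · exact hz (hXW' h.1)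
          · rcases h.1 with h | h <;> rw [h] at hz
            · exact hz (haW _ (by omega))
            · exact hz (haW _ (by omega))
        · exact hz (hXW' (ha.mem_flag_of_mem_flag hM hD hX' hk hx hadj h1 h2 hne e))
      have h1 := (hbn.adj 0 (by omega)).symm
      have h2 := hbn.adj 1 (by omega)
      rcases hX'.typ_adj _ hx with c | c
      · exact key i' j' hX' h1 h2 c
      · exact key j' i' hX'.symm (localGraph_comm X' i' j' _ ▸ h1)
          (localGraph_comm X' i' j' _ ▸ h2) c
  have hXs : X' ⊆ C s := by
    intro x hx
    refine (ha.mem_right_iff.1 (hXS hx)).resolve_right ?_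
    rintro ⟨k, hk, rfl⟩
    exact hfree k hk (hXW hx)
  have hnotnew : ∀ v ∈ W, v ∈ C (s + 1) → v ∈ C s := by
    intro v hv hvs
    refine (ha.mem_right_iff.1 hvs).resolve_right ?_
    rintro ⟨k, hk, rfl⟩
    exact hfree k hk hv
  have hex' : ∃ r, r ≤ l ∧ b r ∉ C s := by
    by_contra! hcon
    exact hnew (union_subset hXs (by rintro _ ⟨r, hr, rfl⟩; exact hcon r hr))
  obtain ⟨r, ⟨hrl, hrs⟩, hrmin⟩ : ∃ r, (r ≤ l ∧ b r ∉ C s) ∧ ∀ r' < r, ¬ (r' ≤ l ∧ b r' ∉ C s) :=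
    ⟨Nat.find hex', Nat.find_spec hex', fun n' => Nat.find_min hex'⟩
  have hbC : ∀ k ≤ l, b k ∈ C (s + 1) := fun k hk => hn (Or.inr ⟨k, hk, rfl⟩)
  have hr0 : 0 < r := by
    rcases Nat.eq_zero_or_pos r with rfl | h
    · exact absurd (hnotnew _ hb0 (hbC 0 (by omega))) hrs
    · exact h
  have hrl' : r < l := by
    refine hrl.lt_of_ne ?_
    rintro rfl
    exact hrs (hnotnew _ hbl (hbC r le_rfl))
  obtain ⟨k, hk, hkr⟩ := (ha.mem_right_iff.1 (hbC r hrl)).resolve_left hrs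
  have hnb : ∀ r k (a : ℕ → V) X i j, Γ.FreeStep M (C s) (C (s + 1)) X i j a → 0 < r → r < l →
      k ∈ Ioo 0 (M i j - 1) → a k = b r → X' = X ∧ (i' = i ∧ j' = j ∨ i' = j ∧ j' = i) ∧
      (b (r - 1) = a (k - 1) ∧ b (r + 1) = a (k + 1) ∨
        b (r - 1) = a (k + 1) ∧ b (r + 1) = a (k - 1)) := by
    intro r k a X i j ha h0 h1 hk e
    refine ha.eq_of_adj_of_adj hM hD hX' hXS hk (e ▸ ?_) (e ▸ hbn.adj r h1) fun e => ?_
    · have := hbn.adj (r - 1) (by omega)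
      rw [show r - 1 + 1 = r by omega] at this
      exact this.symm
    · have := hb.inj (show r - 1 ∈ Iic l by simp; omega) (show r + 1 ∈ Iic l by simp; omega) e
      omega
  -- normalize the description of the step
  obtain ⟨a', ha', hfree', hk'⟩ : ∃ a', Γ.FreeStep M (C s) (C (s + 1)) X' i' j' a' ∧
      (∀ k ∈ Ioo 0 (M i' j' - 1), a' k ∉ W) ∧ ∃ k ∈ Ioo 0 (M i' j' - 1), a' k = b r := by
    obtain ⟨rfl, ⟨rfl, rfl⟩ | ⟨rfl, rfl⟩, -⟩ := hnb r k a X i j ha hr0 hrl' hk hkr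
    · exact ⟨a, ha, hfree, k, hk, hkr⟩
    · have e := M.symmetric i' j'
      exact ⟨a, ha.symm, e ▸ hfree, k, e ▸ hk, hkr⟩
  clear hfree hk hkr ha
  obtain ⟨k, hk, hkr⟩ := hk'
  -- As `b r` is the first new vertex, `b (r - 1)` is an end of the added path; after reversal it is
  -- `a 0`.
  obtain ⟨a, ha, hfree, hr1, hr2⟩ : ∃ a, Γ.FreeStep M (C s) (C (s + 1)) X' i' j' a ∧
      (∀ k ∈ Ioo 0 (M i' j' - 1), a k ∉ W) ∧ b (r - 1) = a 0 ∧ b r = a 1 := by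
    have hold : b (r - 1) ∈ C s := by
      by_contra hc
      exact hrmin (r - 1) (by omega) ⟨by omega, hc⟩
    simp only [mem_Ioo] at hk
    have h3 := ha'.three_le
    rcases (hnb r k a' X' i' j' ha' hr0 hrl' hk hkr).2.2 with ⟨e, -⟩ | ⟨e, -⟩
    · have : k - 1 = 0 := by
        by_contra hc
        exact ha'.notMem (k - 1) (by simp only [mem_Ioo]; omega) (e ▸ hold)
      rw [this] at e
      obtain rfl : k = 1 := by omega
      exact ⟨a', ha', hfree', e, hkr.symm⟩
    · have : k + 1 = M i' j' - 1 := by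
        by_contra hc
        exact ha'.notMem (k + 1) (by simp only [mem_Ioo]; omega) (e ▸ hold)
      refine ⟨_, ha'.reverse, fun k hk => hfree' _ (by simp only [mem_Ioo] at hk ⊢; omega), ?_, ?_⟩
      · rw [e, this]; rfl
      · rw [← hkr]; congr 1; omega
  have h3 := ha.three_le
  -- From there `b` cannot turn back, and it cannot stop at an inner vertex, which is not in `W`; so
  -- it reaches the last vertex of the added path. Since `l < M i' j'`, there is no room for
  -- anything else.
  have hprop : ∀ t, t + 1 ≤ M i' j' - 1 → r + t ≤ l ∧ b (r + t) = a (t + 1) ∧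
      b (r + t - 1) = a t := by
    intro t
    induction t with
    | zero => exact fun _ => ⟨by omega, hr2, hr1⟩
    | succ t ih =>
      intro ht
      obtain ⟨h1, h2, h3'⟩ := ih (by omega)
      have hlt : r + t < l := by
        refine h1.lt_of_ne fun e => ?_
        rw [e] at h2
        exact hfree (t + 1) (by simp only [mem_Ioo]; omega) (h2 ▸ hbl)
      refine ⟨hlt, ?_, by simpa [← Nat.add_assoc] using h2⟩
      rcases (hnb (r + t) (t + 1) a X' i' j' ha (by omega) hlt
        (by simp only [mem_Ioo]; omega) h2.symm).2.2 with e | e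
      · exact e.2
      · have := ha.inj (show t ∈ Iic (M i' j' - 1) by simp; omega)
          (show t + 1 + 1 ∈ Iic (M i' j' - 1) by simp; omega) (h3'.symm.trans e.1)
        omega
  have hfin := (hprop (M i' j' - 2) (by omega)).1
  obtain rfl : r = 1 := by omega
  refine ⟨s, a, ha, hfree, by omega, fun k hk => ?_⟩
  rcases Nat.eq_zero_or_pos k with rfl | h0
  · exact hr1
  · obtain ⟨t, rfl⟩ : ∃ t, k = t + 1 := ⟨k - 1, by omega⟩
    rw [Nat.add_comm t 1, (hprop t (by omega)).2.1, Nat.add_comm]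

/-- A short path with endpoints in the free set `W` that leaves `W` is the path of a step. -/
theorem exists_step [Finite I] (hM : M.IsGood) (hint : Γ.IsIntermediateOn M univ)
    (hC : ⋃ n, C n = univ) (hW : Γ.IsFreeIn M W C) {X' : Set V} {i' j' : I}
    (hX' : Γ.IsTightFlag M X' i' j') (hXW : X' ⊆ W) {l : ℕ} {b : ℕ → V}
    (hl : l < M i' j') (hb : (Γ.localGraph X' i' j' univ).IsPathSeq l b) (hb0 : b 0 ∈ W)
    (hbl : b l ∈ W) {k₀ : ℕ} (hk₀ : k₀ ≤ l) (hbk : b k₀ ∉ W) :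
    ∃ n a, Γ.FreeStep M (C n) (C (n + 1)) X' i' j' a ∧ (∀ k ∈ Ioo 0 (M i' j' - 1), a k ∉ W) ∧
      l = M i' j' - 1 ∧ ∀ k ≤ l, b k = a k := by
  classical
  have h0 : 0 < k₀ := Nat.pos_of_ne_zero (by rintro rfl; exact hbk hb0)
  have h1 : k₀ < l := hk₀.lt_of_ne (by rintro rfl; exact hbk hbl)
  obtain ⟨q, ⟨hq0, hqW⟩, hqmin⟩ : ∃ q, (k₀ < q ∧ b q ∈ W) ∧ ∀ q' < q, ¬ (k₀ < q' ∧ b q' ∈ W) :=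
    have hex : ∃ q, k₀ < q ∧ b q ∈ W := ⟨l, h1, hbl⟩
    ⟨Nat.find hex, Nat.find_spec hex, fun n' => Nat.find_min hex⟩
  obtain ⟨p, ⟨hp0, hpW⟩, hpmin⟩ : ∃ p, (p < k₀ ∧ b (k₀ - 1 - p) ∈ W) ∧
      ∀ p' < p, ¬ (p' < k₀ ∧ b (k₀ - 1 - p') ∈ W) :=
    have hex : ∃ p, p < k₀ ∧ b (k₀ - 1 - p) ∈ W :=
      ⟨k₀ - 1, by omega, by simpa [Nat.sub_self] using hb0⟩
    ⟨Nat.find hex, Nat.find_spec hex, fun n' => Nat.find_min hex⟩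
  have hql : q ≤ l := by
    by_contra! hc
    exact hqmin l hc ⟨h1, hbl⟩
  set r := k₀ - 1 - p with hr
  obtain ⟨n, a, ha, hfree, he, hba⟩ := exists_step_of_notMem hM hint hC hW hX' hXW (l := q - r)
    (b := fun k => b (r + k)) (by omega) (by omega) (hb.segment (by omega)) hpW
    (by simpa [show r + (q - r) = q by omega] using hqW) (by
      intro k hk0 hkq hkW
      rcases lt_trichotomy (r + k) k₀ with h | h | h
      · refine hpmin (k₀ - 1 - (r + k)) (by omega) ⟨by omega, ?_⟩
        rwa [show k₀ - 1 - (k₀ - 1 - (r + k)) = r + k by omega]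
      · rw [h] at hkW; exact hbk hkW
      · exact hqmin (r + k) (by omega) ⟨h, hkW⟩)
  -- The segment outside `W` around `k₀` has length `M i' j' - 1 ≥ l`, so it is all of `b`.
  have hr0 : r = 0 := by omega
  refine ⟨n, a, ha, hfree, by omega, fun k hk => ?_⟩
  rw [← hba k (by omega), hr0, Nat.zero_add]

/-- Free sets contain the vertices determined by property (D). -/
theorem mem_of_inc_of_inc (hC : ⋃ n, C n = univ) (hW : Γ.IsFreeIn M W C) {x x' z : V} (hx : x ∈ W)
    (hx' : x' ∈ W) (hne : x ≠ x') (ht : Γ.typ x = Γ.typ x') (h4 : 4 ≤ M (Γ.typ x) (Γ.typ z))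
    (h1 : Γ.inc x z) (h2 : Γ.inc x' z) : z ∈ W := by
  classical
  have hex : ∃ n, {x, x', z} ⊆ C n := (toFinite _).exists_subset_of_monotone
    hW.isFreeChain.monotone (hC ▸ subset_univ _)
  obtain ⟨n, hn, hmin⟩ : ∃ n, {x, x', z} ⊆ C n ∧ ∀ n' < n, ¬ {x, x', z} ⊆ C n' :=
    ⟨Nat.find hex, Nat.find_spec hex, fun n' => Nat.find_min hex⟩
  simp only [insert_subset_iff, singleton_subset_iff] at hn hmin
  rcases n with _ | s
  · exact (hW.1.meet x ⟨hx, hn.1⟩ x' ⟨hx', hn.2.1⟩ z hn.2.2 hne ht h4 h1 h2).1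
  rcases hW.2 s with e | ⟨X, i, j, a, ha, hfree⟩
  · exact absurd (e ▸ hn) (hmin s (by omega))
  rcases hfree with hfree | ⟨hXW, haW⟩
  · have hnotnew : ∀ v ∈ W, v ∈ C (s + 1) → v ∈ C s := by
      intro v hv hvs
      refine (ha.mem_right_iff.1 hvs).resolve_right ?_
      rintro ⟨k, hk, rfl⟩
      exact hfree k hk hv
    have hxs := hnotnew x hx hn.1
    have hxs' := hnotnew x' hx' hn.2.1
    have hzs : z ∉ C s := fun hz => hmin s (by omega) ⟨hxs, hxs', hz⟩
    obtain ⟨k, hk, rfl⟩ := (ha.mem_right_iff.1 hn.2.2).resolve_left hzs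
    exfalso
    rw [M.symmetric] at h4
    have hk' := hk
    simp only [mem_Ioo] at hk'
    -- If `x` and `x'` lie on the path, they are old, so they are its ends and `M i j = 3`, contrary
    -- to `h4`. Otherwise they are two vertices of the flag with the same type.
    by_cases c : Γ.typ x = i ∨ Γ.typ x = j
    · have e1 := ha.eq_of_inc hk hn.1 c (by rintro rfl; exact hzs hxs) (Γ.symm h1)
      have e2 := ha.eq_of_inc hk hn.2.1 (ht ▸ c) (by rintro rfl; exact hzs hxs') (Γ.symm h2)
      have hold : ∀ r, a r ∈ C s → r ≤ M i j - 1 → r = 0 ∨ r = M i j - 1 := by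
        intro r hr hrm
        by_contra! hc
        exact ha.notMem r (by simp only [mem_Ioo]; omega) hr
      have hpair : a (k - 1) ∈ C s ∧ a (k + 1) ∈ C s := by
        rcases e1 with rfl | rfl <;> rcases e2 with rfl | rfl <;>
          first | exact absurd rfl hne | exact ⟨hxs, hxs'⟩ | exact ⟨hxs', hxs⟩
      have f1 := hold _ hpair.1 (by omega)
      have f2 := hold _ hpair.2 (by omega)
      have h3 : M i j = 3 := by omega
      have hk3 := ha.typ_mem k (by omega)
      have hne' : Γ.typ (a k) ≠ Γ.typ x := M.ne_of_three_le (by omega)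
      have h3' : M j i = 3 := M.symmetric i j ▸ h3
      rcases hk3 with e | e <;> rcases c with e' | e' <;> rw [e, e'] at h4 hne' <;>
        first | exact hne' rfl | omega
    · push Not at c
      have e1 := ha.mem_flag_of_inc hk hn.1 c.1 c.2 (by omega) (Γ.symm h1)
      have e2 := ha.mem_flag_of_inc hk hn.2.1 (ht ▸ c.1) (ht ▸ c.2) (by rw [← ht]; omega)
        (Γ.symm h2)
      exact hne (ha.tight.isFlag.eq_of_typ_eq e1 e2 ht)
  · have hnew : x ∉ C s ∨ x' ∉ C s ∨ z ∉ C s := by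
      have := hmin s (by omega)
      tauto
    rcases hnew with h | h | h
    · obtain ⟨k, hk, rfl⟩ := (ha.mem_right_iff.1 hn.1).resolve_left h
      exact ha.mem_of_inc hXW haW hk hn.2.2 (by omega) h1
    · obtain ⟨k, hk, rfl⟩ := (ha.mem_right_iff.1 hn.2.1).resolve_left h
      exact ha.mem_of_inc hXW haW hk hn.2.2 (by rw [← ht]; omega) h2
    · obtain ⟨k, hk, rfl⟩ := (ha.mem_right_iff.1 hn.2.2).resolve_left h
      exact haW k (by simp only [mem_Ioo] at hk; omega)

end IsFreeIn

theorem FreeStep.mem_image_of_mem_sdiff {S S' X : Set V} {i j : I} {a : ℕ → V}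
    (h : Γ.FreeStep M S S' X i j a) {v : V} : v ∈ S' \ S ↔ ∃ k ∈ Ioo 0 (M i j - 1), a k = v := by
  rw [mem_sdiff, h.mem_right_iff]
  constructor
  · rintro ⟨h1 | h1, h2⟩
    · exact absurd h1 h2
    · exact h1
  · rintro ⟨k, hk, rfl⟩
    exact ⟨Or.inr ⟨k, hk, rfl⟩, h.notMem k hk⟩

/-- A closed set that is generated by a finite set is free with respect to a tail of the chain. -/
theorem IsClosedIn.exists_isFreeIn [Finite I] (hM : M.IsGood) {C : ℕ → Set V}
    (hint : Γ.IsIntermediateOn M univ) (hC : ⋃ n, C n = univ) (hchain : Γ.IsFreeChain M C)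
    {A E : Set V} (hA : Γ.IsClosedIn M A univ) (hE : E.Finite) (hEA : E ⊆ A)
    (hgen : ∀ B, Γ.IsClosedIn M B univ → E ⊆ B → A ⊆ B) :
    ∃ N, Γ.IsFreeIn M A (fun n => C (N + n)) := by
  classical
  have hmono := hchain.monotone
  -- The tail starts at a stage that contains the generators.
  obtain ⟨N, hN⟩ := hE.exists_subset_of_monotone hmono (hC ▸ subset_univ _)
  refine ⟨N, ?_⟩
  set D : ℕ → Set V := fun n => C (N + n) with hDdef
  have hDchain : Γ.IsFreeChain M D := fun n => hchain (N + n)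
  have hDmono := hDchain.monotone
  have hDuniv : ⋃ n, D n = univ := by
    refine eq_univ_of_forall fun v => ?_
    obtain ⟨n, hn⟩ := mem_iUnion.1 (hC ▸ mem_univ v : v ∈ ⋃ n, C n)
    exact mem_iUnion.2 ⟨n, hmono (by omega) hn⟩
  -- Starting from `A ∩ D 0`, collect the new vertices of those steps whose flag and ends have
  -- already been collected. The union `W` is free by construction. It is contained in `A` since `A`
  -- is closed, and it will turn out to be closed, so that it contains everything generated by `E`.
  let good : ℕ → Set V → Prop := fun n T => ∃ X i j a, Γ.FreeStep M (D n) (D (n + 1)) X i j a ∧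
    X ⊆ T ∧ a 0 ∈ T ∧ a (M i j - 1) ∈ T
  let T : ℕ → Set V := fun n => Nat.rec (motive := fun _ => Set V) (A ∩ D 0)
    (fun n T => T ∪ {v | v ∈ D (n + 1) \ D n ∧ good n T}) n
  have hT0 : T 0 = A ∩ D 0 := rfl
  have hTs : ∀ n : ℕ, T (n + 1) = T n ∪ {v | v ∈ D (n + 1) \ D n ∧ good n (T n)} := fun _ => rfl
  have hTD : ∀ n, T n ⊆ D n := by
    intro n
    induction n with
    | zero => exact inter_subset_right
    | succ n ih =>
      rw [hTs]
      exact union_subset (ih.trans (hDmono (Nat.le_succ n))) fun v hv => hv.1.1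
  have hTmono : Monotone T := by
    refine monotone_nat_of_le_succ fun n => ?_
    rw [hTs]
    exact subset_union_left
  have hTinter : ∀ n m, T m ∩ D n ⊆ T n := by
    intro n m
    rcases le_total m n with h | h
    · exact inter_subset_left.trans (hTmono h)
    · induction m, h using Nat.le_induction with
      | base => exact inter_subset_left
      | succ m hm ih =>
        rintro v ⟨hv, hvn⟩
        refine ih ⟨?_, hvn⟩
        rw [hTs] at hv
        rcases hv with hv | hv
        · exact hv
        · exact absurd (hDmono hm hvn) hv.1.2
  set W := ⋃ n, T n with hW
  have hWD : ∀ n, W ∩ D n = T n := by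
    intro n
    refine Subset.antisymm ?_ (subset_inter (subset_iUnion T n) (hTD n))
    rintro v ⟨hv, hvn⟩
    obtain ⟨m, hm⟩ := mem_iUnion.1 hv
    exact hTinter n m ⟨hm, hvn⟩
  have hfull : ∀ n X i j a, Γ.FreeStep M (D n) (D (n + 1)) X i j a → X ⊆ W → a 0 ∈ W →
      a (M i j - 1) ∈ W → ∀ k ≤ M i j - 1, a k ∈ W := by
    intro n X i j a ha hX h0 h1 k hk
    have hgood : good n (T n) := ⟨X, i, j, a, ha, by
      rw [← hWD n]; exact subset_inter hX ha.subset, by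
      rw [← hWD n]; exact ⟨h0, ha.first_mem.2⟩, by rw [← hWD n]; exact ⟨h1, ha.last_mem.2⟩⟩
    rcases Nat.eq_zero_or_pos k with rfl | hk0
    · exact h0
    · rcases hk.eq_or_lt with rfl | hk1
      · exact h1
      · refine mem_iUnion.2 ⟨n + 1, ?_⟩
        rw [hTs]
        exact Or.inr ⟨ha.mem_image_of_mem_sdiff.2 ⟨k, ⟨hk0, hk1⟩, rfl⟩, hgood⟩
  have hfree : Γ.IsFreeIn M W D := by
    refine ⟨?_, fun n => ?_⟩
    · rw [hWD, hT0]
      exact hA.inter (subset_univ _)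
    · rcases hDchain n with e | ⟨X, i, j, a, ha⟩
      · exact Or.inl e
      · right
        rcases Classical.em (good n (T n)) with hg | hg
        · obtain ⟨X, i, j, a, ha, hX, h0, h1⟩ := hg
          have hTW := subset_iUnion T n
          exact ⟨X, i, j, a, ha, Or.inr ⟨hX.trans hTW,
            hfull n X i j a ha (hX.trans hTW) (hTW h0) (hTW h1)⟩⟩
        · refine ⟨X, i, j, a, ha, Or.inl fun k hk hkW => ?_⟩
          have : a k ∈ W ∩ D (n + 1) :=
            ⟨hkW, ha.mem_right (by simp only [mem_Ioo] at hk; omega)⟩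
          rw [hWD, hTs] at this
          rcases this with h | h
          · exact ha.notMem k hk (hTD n h)
          · exact hg h.2
  have hWA : W ⊆ A := by
    refine iUnion_subset fun n => ?_
    induction n with
    | zero => exact inter_subset_left
    | succ n ih =>
      rw [hTs]
      refine union_subset ih fun v hv => ?_
      obtain ⟨hv, X, i, j, a, ha, hX, h0, h1⟩ := hv
      obtain ⟨k, hk, rfl⟩ := ha.mem_image_of_mem_sdiff.1 hv
      have h3 := ha.three_le
      refine hA.path X i j (hX.trans ih) ha.tight (M i j - 1) a (by omega)
        (ha.isPathSeq.mono fun k hk => localGraph_mono (subset_univ _) (ha.isPathSeq.adj k hk))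
        (ih h0) (ih h1) k ?_
      simp only [mem_Ioo] at hk
      omega
  have hclosed : Γ.IsClosedIn M W univ := by
    refine ⟨subset_univ _, fun X i j hX hXt l b hl hb h0 h1 k hk => ?_,
      fun x hx x' hx' z _ hne ht h4 h1 h2 =>
        hfree.mem_of_inc_of_inc hDuniv hx hx' hne ht h4 h1 h2⟩
    -- A short path that leaves `W` is the path of a step that avoids `W`. But the flag and the ends
    -- of this step are in `W`, so its vertices have been collected.
    by_contra hkW
    obtain ⟨n, a, ha, hnew, rfl, hba⟩ :=
      hfree.exists_step hM hint hDuniv hXt hX hl hb h0 h1 hk hkW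
    rw [hba k hk] at hkW
    exact hkW (hfull n X i j a ha hX (hba 0 (by omega) ▸ h0) (hba _ le_rfl ▸ h1) k hk)
  have hAW : A ⊆ W := hgen W hclosed fun e he => by
    have : e ∈ T 0 := ⟨hEA he, hN he⟩
    exact mem_iUnion.2 ⟨0, this⟩
  rwa [hAW.antisymm hWA]

end IncGeometry

/-! ### The free amalgam of two intermediate geometries -/

/-- An index outside a set lies in a gap between two indices inside it. -/
theorem Nat.exists_gap {p : ℕ → Prop} {q l : ℕ} (h0 : p 0) (hl : p l) (hq : ¬ p q) (hql : q ≤ l) :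
    ∃ r s, r < q ∧ q < s ∧ s ≤ l ∧ p r ∧ p s ∧ ∀ k, r < k → k < s → ¬ p k := by
  classical
  have hex : ∃ s, q < s ∧ p s := ⟨l, hql.lt_of_ne (by rintro rfl; exact hq hl), hl⟩
  have hr : ∃ r < q, p r ∧ ∀ k, r < k → k ≤ q → ¬ p k := by
    clear hex hql
    induction q with
    | zero => exact absurd h0 hq
    | succ q ih =>
      by_cases c : p q
      · exact ⟨q, q.lt_succ_self, c, fun k h1 h2 => by
          obtain rfl : k = q + 1 := by omega
          exact hq⟩
      · obtain ⟨r, h1, h2, h3⟩ := ih c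
        refine ⟨r, h1.trans q.lt_succ_self, h2, fun k h4 h5 => ?_⟩
        rcases h5.eq_or_lt with rfl | h5
        · exact hq
        · exact h3 k h4 (by omega)
  obtain ⟨r, h1, h2, h3⟩ := hr
  refine ⟨r, Nat.find hex, h1, (Nat.find_spec hex).1, ?_, h2, (Nat.find_spec hex).2,
    fun k h4 h5 hk => ?_⟩
  · exact Nat.find_min' hex ⟨hql.lt_of_ne (by rintro rfl; exact hq hl), hl⟩
  · rcases le_or_gt k q with h6 | h6
    · exact h3 k h4 h6 hk
    · exact Nat.find_min hex h5 ⟨h6, hk⟩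

namespace IncGeometry

variable {I V V' : Type} {Γ : IncGeometry I V} {Γ' : IncGeometry I V'} {M : CoxeterMatrix I}

/-- `Γ` is the free amalgam of two intermediate geometries over a common closed part. -/
structure IsAmalgam (Γ : IncGeometry I V) (M : CoxeterMatrix I) (B₁ B₂ : Set V) : Prop where
  union : B₁ ∪ B₂ = univ
  inc_iff : ∀ u ∉ B₂, ∀ v ∉ B₁, (Γ.inc u v ↔ M (Γ.typ u) (Γ.typ v) = 2)
  int₁ : Γ.IsIntermediateOn M B₁
  int₂ : Γ.IsIntermediateOn M B₂
  closed₁ : Γ.IsClosedIn M (B₁ ∩ B₂) B₁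
  closed₂ : Γ.IsClosedIn M (B₁ ∩ B₂) B₂

namespace IsAmalgam

variable {B₁ B₂ : Set V}

protected theorem symm (h : Γ.IsAmalgam M B₁ B₂) : Γ.IsAmalgam M B₂ B₁ where
  union := union_comm B₁ B₂ ▸ h.union
  inc_iff u hu v hv := by
    rw [M.symmetric, ← h.inc_iff v hv u hu]
    exact ⟨Γ.symm, Γ.symm⟩
  int₁ := h.int₂
  int₂ := h.int₁
  closed₁ := inter_comm B₁ B₂ ▸ h.closed₂
  closed₂ := inter_comm B₁ B₂ ▸ h.closed₁

theorem mem_or (h : Γ.IsAmalgam M B₁ B₂) (v : V) : v ∈ B₁ ∨ v ∈ B₂ := by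
  have := mem_univ v
  rwa [← h.union] at this

theorem mem_of_inc (h : Γ.IsAmalgam M B₁ B₂) {u v : V} (huv : Γ.inc u v)
    (h3 : 3 ≤ M (Γ.typ u) (Γ.typ v)) (hv : v ∉ B₁) : u ∈ B₂ := by
  by_contra hu
  have := (h.inc_iff u hu v hv).1 huv
  omega

theorem propF (h : Γ.IsAmalgam M B₁ B₂) : Γ.PropFOn M univ := by
  intro u _ v _ huv
  by_cases h1 : u ∈ B₁ ∧ v ∈ B₁
  · exact h.int₁.propF u h1.1 v h1.2 huv
  by_cases h2 : u ∈ B₂ ∧ v ∈ B₂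
  · exact h.int₂.propF u h2.1 v h2.2 huv
  have hu := h.mem_or u
  have hv := h.mem_or v
  by_cases hu1 : u ∈ B₁
  · exact (h.inc_iff u (by tauto) v (by tauto)).2 huv
  · exact (h.symm.inc_iff u (by tauto) v (by tauto)).2 huv

theorem meet (h : Γ.IsAmalgam M B₁ B₂) {x x' z : V} (hx : x ∈ B₁) (hx' : x' ∈ B₁) (hne : x ≠ x')
    (ht : Γ.typ x = Γ.typ x') (h4 : 4 ≤ M (Γ.typ x) (Γ.typ z)) (h1 : Γ.inc x z)
    (h2 : Γ.inc x' z) : z ∈ B₁ := by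
  by_contra hz
  have hx2 := h.mem_of_inc h1 (by omega) hz
  have hx2' := h.mem_of_inc h2 (by rw [← ht]; omega) hz
  exact hz (h.closed₂.meet x ⟨hx, hx2⟩ x' ⟨hx', hx2'⟩ z ((h.mem_or z).resolve_left hz) hne ht h4
    h1 h2).1

/-- If `x` and `x'` lie in the same part, then `meet` puts `z` and `z'` there as well. If they lie
on different sides, `z` and `z'` are in the part of `x'`, and `meet` applied to `z` and `z'` puts
`x` there too. -/
theorem propD (h : Γ.IsAmalgam M B₁ B₂) : Γ.PropDOn M univ := by
  intro x _ x' _ z _ z' _ ht ht' h4 h1 h2 h3 h5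
  by_contra! hcon
  obtain ⟨hne, hne'⟩ := hcon
  have h4' : 4 ≤ M (Γ.typ z) (Γ.typ x) := M.symmetric (Γ.typ x) (Γ.typ z) ▸ h4
  have key : ∀ {B₁ B₂ : Set V}, Γ.IsAmalgam M B₁ B₂ → x ∈ B₁ → x' ∈ B₁ → False := by
    intro B₁ B₂ h hx hx'
    rcases h.int₁.propD x hx x' hx' z (h.meet hx hx' hne ht h4 h1 h3) z'
      (h.meet hx hx' hne ht (ht' ▸ h4) h2 h5) ht ht' h4 h1 h2 h3 h5 with e | e
    · exact hne e
    · exact hne' e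
  have key' : ∀ {B₁ B₂ : Set V}, Γ.IsAmalgam M B₁ B₂ → x ∉ B₂ → x' ∉ B₁ → False := by
    intro B₁ B₂ h hx hx'
    have hz : z ∈ B₂ := h.mem_of_inc (Γ.symm h3) (by rw [← ht]; omega) hx'
    have hz' : z' ∈ B₂ := h.mem_of_inc (Γ.symm h5) (by rw [← ht, ← ht']; omega) hx'
    exact hx (h.symm.meet hz hz' hne' ht' h4' (Γ.symm h1) (Γ.symm h2))
  by_cases hx : x ∈ B₁ <;> by_cases hx' : x' ∈ B₁
  · exact key h hx hx'
  · by_cases hx2 : x ∈ B₂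
    · exact key h.symm hx2 ((h.mem_or x').resolve_left hx')
    · exact key' h hx2 hx'
  · by_cases hx2 : x' ∈ B₂
    · exact key h.symm ((h.mem_or x).resolve_left hx) hx2
    · exact key' h.symm hx hx2
  · exact key h.symm ((h.mem_or x).resolve_left hx) ((h.mem_or x').resolve_left hx')

/-- Let the type of `x` be adjacent to `i`. As `x` and `v` lie on different sides, `v` has type `j`,
and `u`, `u'` have type `i` and are in both parts. One of the bonds from `i` to `j` and to the type
of `x` has label at least 4. In the first case closedness puts `v` in `B₁`, in the second case it
puts `x` in `B₂`. -/
theorem false_of_adj (h : Γ.IsAmalgam M B₁ B₂) (hM : M.IsGood) {X : Set V} {i j : I}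
    (hX : Γ.IsTightFlag M X i j) {x v u u' : V} (hx : x ∈ X) (hx2 : x ∉ B₂) (hv : v ∉ B₁)
    (hu : (Γ.localGraph X i j univ).Adj v u) (hu' : (Γ.localGraph X i j univ).Adj v u')
    (hne : u ≠ u') : False := by
  wlog hxi : 3 ≤ M (Γ.typ x) i generalizing i j
  · refine this hX.symm (localGraph_comm X i j _ ▸ hu) (localGraph_comm X i j _ ▸ hu') ?_
    exact (hX.typ_adj x hx).resolve_left hxi
  have h3 := hX.adj
  have hvj : Γ.typ v = j := by
    refine hu.1.1.2.resolve_left fun e => hx2 ?_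
    exact h.mem_of_inc (hu.1.1.1.2 x hx) (e ▸ hxi) hv
  have hui : Γ.typ u = i := by
    have := localGraph_adj_typ hu
    grind
  have hui' : Γ.typ u' = i := by
    have := localGraph_adj_typ hu'
    grind
  have hmem : ∀ w, Γ.typ w = i → (Γ.localGraph X i j univ).Adj v w → w ∈ B₂ := fun w hw hvw =>
    h.mem_of_inc (Γ.symm hvw.2.2.2) (by rw [hw, hvj]; exact h3) hv
  have hmem' : ∀ w, Γ.typ w = i → (Γ.localGraph X i j univ).Adj v w → w ∈ B₁ := fun w hw hvw =>
    h.symm.mem_of_inc (Γ.symm (hvw.2.1.1.1.2 x hx)) (by rw [hw, M.symmetric]; exact hxi) hx2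
  by_cases h4 : 4 ≤ M i (Γ.typ x)
  · exact hx2 (h.symm.meet (hmem u hui hu) (hmem u' hui' hu') hne (hui.trans hui'.symm) (hui ▸ h4)
      (Γ.symm (hu.2.1.1.1.2 x hx)) (Γ.symm (hu'.2.1.1.1.2 x hx)))
  · have h4' := hM.four_le (Γ.typ x) i j (by rw [M.symmetric] at h4; omega) h3
      (hX.typ_ne x hx).2
    exact hv (h.meet (hmem' u hui hu) (hmem' u' hui' hu') hne (hui.trans hui'.symm)
      (by rw [hui, hvj]; exact h4') (Γ.symm hu.2.2.2) (Γ.symm hu'.2.2.2))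

/-- A path whose inner vertices are all outside `B₁` lies entirely in `B₂`, where the common part is
closed; so there are no inner vertices. -/
theorem path_mem (h : Γ.IsAmalgam M B₁ B₂) {X : Set V} {i j : I} (hX : Γ.IsTightFlag M X i j)
    (hX1 : X ⊆ B₁) (hX2 : X ⊆ B₂) {l : ℕ} {b : ℕ → V} (hl : l < M i j)
    (hb : (Γ.localGraph X i j univ).IsPathSeq l b) (h0 : b 0 ∈ B₁) (hl' : b l ∈ B₁)
    (hk : ∀ k, 0 < k → k < l → b k ∉ B₁) : ∀ k, 0 < k → ¬ k < l := by
  intro k h1 h2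
  have hmem : ∀ k ≤ l, b k ∈ B₂ := by
    intro k hkl
    rcases Nat.eq_zero_or_pos k with rfl | h0'
    · exact h.mem_of_inc (hb.adj 0 (by omega)).2.2.2 (hX.adj_typ (hb.adj 0 (by omega)))
        (hk 1 (by omega) (by omega))
    · rcases hkl.eq_or_lt with rfl | hkl
      · have := hb.adj (k - 1) (by omega)
        rw [show k - 1 + 1 = k by omega] at this
        exact h.mem_of_inc (Γ.symm this.2.2.2) (hX.adj_typ this.symm) (hk (k - 1) (by omega) (by omega))
      · exact (h.mem_or _).resolve_left (hk k h0' hkl)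
  refine hk k h1 h2 (h.closed₂.path X i j (subset_inter hX1 hX2) hX l b hl ?_ ⟨h0, hmem 0 (by omega)⟩
    ⟨hl', hmem l le_rfl⟩ k h2.le).1
  exact hb.mono fun k hk => ⟨⟨(hb.adj k hk).1.1, hmem k hk.le⟩,
    ⟨(hb.adj k hk).2.1.1, hmem (k + 1) hk⟩, (hb.adj k hk).2.2⟩

/-- A short path that leaves `B₁` is handled by `path_mem` if its flag is in the common part, and by
`false_of_adj` otherwise. -/
theorem isClosedIn (h : Γ.IsAmalgam M B₁ B₂) (hM : M.IsGood) : Γ.IsClosedIn M B₁ univ where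
  subset := subset_univ _
  path X i j hX hXt l b hl hb h0 h1 k hk := by
    by_contra hkB
    obtain ⟨r, s, hr, hs, hsl, hrB, hsB, hgap⟩ := Nat.exists_gap (p := (b · ∈ B₁)) h0 h1 hkB hk
    by_cases hX2 : X ⊆ B₂
    · refine h.path_mem hXt hX hX2 (l := s - r) (b := fun k => b (r + k)) (by omega)
        (hb.segment (by omega)) hrB (by simpa [show r + (s - r) = s by omega] using hsB)
        (fun k h1 h2 => hgap _ (by omega) (by omega)) (k - r) (by omega) (by omega)
    · obtain ⟨x, hx, hx2⟩ := not_subset.1 hX2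
      have h1 := hb.adj (k - 1) (by omega)
      rw [show k - 1 + 1 = k by omega] at h1
      refine h.false_of_adj hM hXt hx hx2 hkB h1.symm (hb.adj k (by omega)) fun e => ?_
      have := hb.inj (show k - 1 ∈ Iic l by simp; omega) (show k + 1 ∈ Iic l by simp; omega) e
      omega
  meet x hx x' hx' z _ := h.meet hx hx'

/-- If the flag is not contained in one of the parts, `false_of_adj` keeps the cycle inside the
other. So either flag and cycle lie in one part, or the flag meets both sides while the cycle is in
the common part, or the flag is in the common part. The second case contradicts closedness. In the
third case, a cycle that leaves both parts contains two disjoint arcs, each too long for `path_mem`.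
-/
theorem propP (h : Γ.IsAmalgam M B₁ B₂) (hM : M.IsGood) : Γ.PropPOn M univ := by
  intro i j X _ hX n v hv
  have hn := hv.three_le
  have hstay : ∀ {B : Set V}, Γ.IsIntermediateOn M B → X ⊆ B → (∀ k, v k ∈ B) → 2 * M i j ≤ n := by
    intro B hB hXB hvB
    exact hB.propP i j X hXB hX n v (hv.mono fun k => ⟨⟨(hv.adj k).1.1, hvB k⟩,
      ⟨(hv.adj k).2.1.1, hvB (k + 1)⟩, (hv.adj k).2.2⟩)
  have hne : ∀ k, v k ≠ v (k + 2) := fun k => (hv.add_two_ne k).symm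
  have hleft : ∀ {B₁ B₂ : Set V}, Γ.IsAmalgam M B₁ B₂ → ¬ X ⊆ B₂ → ∀ k, v (k + 1) ∈ B₁ := by
    intro B₁ B₂ h hX2 k
    obtain ⟨x, hx, hx2⟩ := not_subset.1 hX2
    by_contra hk
    exact h.false_of_adj hM hX hx hx2 hk (hv.adj k).symm (hv.adj (k + 1)) (hne k)
  have hleft' : ∀ {B₁ B₂ : Set V}, Γ.IsAmalgam M B₁ B₂ → ¬ X ⊆ B₂ → ∀ k, v k ∈ B₁ := by
    intro B₁ B₂ h hX2 k
    have := hleft h hX2 (k + n - 1)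
    rwa [show k + n - 1 + 1 = k + n by omega, hv.periodic] at this
  by_cases hX2 : X ⊆ B₂
  swap
  · by_cases hX1 : X ⊆ B₁
    · exact hstay h.int₁ hX1 (hleft' h hX2)
    exfalso
    have hm1 := hleft' h hX2
    have hm2 := hleft' h.symm hX1
    obtain ⟨x, hx, hx2⟩ := not_subset.1 hX2
    have key : ∀ i j, Γ.IsTightFlag M X i j → (∀ k, (Γ.localGraph X i j univ).Adj (v k) (v (k + 1)))
        → 3 ≤ M (Γ.typ x) i → False := by
      intro i j hX hadj hxi
      obtain ⟨k, hk⟩ : ∃ k, Γ.typ (v k) = i := by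
        by_cases e : Γ.typ (v 0) = i
        · exact ⟨0, e⟩
        · refine ⟨1, ?_⟩
          have := localGraph_adj_typ (hadj 0)
          simp only [Nat.zero_add] at this
          grind
      have hk1 : Γ.typ (v (k + 1)) = j := by
        have := localGraph_adj_typ (hadj k)
        grind
      have hk2 : Γ.typ (v (k + 2)) = i := by
        have := localGraph_adj_typ (hadj (k + 1))
        grind
      have hinc : ∀ k, Γ.inc x (v k) := fun k => (hadj k).1.1.1.2 x hx
      by_cases h4 : 4 ≤ M i (Γ.typ x)
      · exact hx2 (h.symm.meet (hm2 k) (hm2 (k + 2)) (hne k) (hk.trans hk2.symm) (hk ▸ h4)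
          (Γ.symm (hinc k)) (Γ.symm (hinc (k + 2))))
      -- With label 3, the vertex `x` is the middle of a path of length 2 from `v k` to `v (k + 2)`
      -- in the local graph of `v (k + 1)`. The latter is a tight flag because `j` is the only
      -- further type adjacent to `i` or the type of `x`. Closedness of the common part then puts
      -- `x` in `B₂`.
      have hx3 : M (Γ.typ x) i = 3 := by rw [M.symmetric] at h4; omega
      have hxj := (hX.typ_ne x hx).2
      have hxi' := (hX.typ_ne x hx).1
      have hji : j ≠ i := (M.ne_of_three_le hX.adj).symm
      have htight : Γ.IsTightFlag M {v (k + 1)} (Γ.typ x) i := by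
        refine ⟨?_, hxi, ?_, ?_, fun t h1 h2 h3 => ⟨_, rfl, ?_⟩⟩
        · rintro _ rfl _ rfl
          exact Γ.inc_self _
        · rintro _ rfl
          rw [hk1]
          exact ⟨hxj.symm, hji⟩
        · rintro _ rfl
          rw [hk1, M.symmetric j i]
          exact Or.inr hX.adj
        · rw [hk1]
          exact (hM.eq_of_adj _ i j hx3 hX.adj hxj t h1 h2 h3).symm
      have hxl : x ∈ Γ.localSet {v (k + 1)} (Γ.typ x) i := by
        rw [htight.mem_localSet]
        refine ⟨Or.inl rfl, ?_⟩
        rintro _ rfl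
        exact Γ.symm (hinc _)
      have hvl : ∀ r, Γ.typ (v r) = i → Γ.inc (v (k + 1)) (v r) →
          v r ∈ Γ.localSet {v (k + 1)} (Γ.typ x) i := by
        intro r hr hr'
        rw [htight.mem_localSet]
        refine ⟨Or.inr hr, ?_⟩
        rintro _ rfl
        exact hr'
      have hx1 := (h.mem_or x).resolve_right hx2
      have hxv : ∀ r, Γ.typ (v r) = i → x ≠ v r := fun r hr e => hxi' (by rw [e, hr])
      let b : ℕ → V := fun r => if r = 0 then v k else if r = 1 then x else v (k + 2)
      have hb : (Γ.localGraph {v (k + 1)} (Γ.typ x) i B₁).IsPathSeq 2 b := by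
        refine ⟨fun r hr => ?_, fun r hr s hs e => ?_⟩
        · have l0 := hvl k hk (Γ.symm (hadj k).2.2.2)
          have l2 := hvl (k + 2) hk2 (hadj (k + 1)).2.2.2
          interval_cases r
          · exact ⟨⟨l0, hm1 k⟩, ⟨hxl, hx1⟩, (hxv k hk).symm, Γ.symm (hinc k)⟩
          · exact ⟨⟨hxl, hx1⟩, ⟨l2, hm1 (k + 2)⟩, hxv _ hk2, hinc _⟩
        · simp only [mem_Iic] at hr hs
          have e1 := hne k
          have e2 := hxv k hk
          have e3 := hxv _ hk2
          interval_cases r <;> interval_cases s <;> simp [b] at e <;>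
            first | rfl | exact absurd e e1 | exact absurd e e1.symm | exact absurd e e2 |
              exact absurd e e2.symm | exact absurd e e3 | exact absurd e e3.symm
      exact hx2 (h.closed₁.path {v (k + 1)} (Γ.typ x) i
        (by rintro _ rfl; exact ⟨hm1 _, hm2 _⟩) htight 2 b (by omega) hb ⟨hm1 k, hm2 k⟩
        ⟨hm1 (k + 2), hm2 (k + 2)⟩ 1 (by omega)).2
    rcases hX.typ_adj x hx with c | c
    · exact key i j hX hv.adj c
    · exact key j i hX.symm (fun k => localGraph_comm X i j _ ▸ hv.adj k) c
  by_cases hX1 : X ⊆ B₁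
  swap
  · exact hstay h.int₂ hX2 (hleft' h.symm hX1)
  by_contra! hlt
  have hout : ∀ {B : Set V}, Γ.IsIntermediateOn M B → X ⊆ B → ∃ p, v p ∉ B := by
    intro B hB hXB
    by_contra! hall
    exact absurd (hstay hB hXB hall) (by omega)
  obtain ⟨p, hp⟩ := hout h.int₂ hX2
  wlog hp0 : p = 0 generalizing v p
  -- Rotation by `p * n - p` undoes rotation by `p`.
  · have hvp : ∀ k, v (k + (p * n - p) + p) = v k := fun k => by
      rw [Nat.add_assoc, Nat.sub_add_cancel (Nat.le_mul_of_pos_right p (by omega)), Nat.mul_comm,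
        hv.apply_add_mul]
    refine this (v := fun k => v (k + p)) (hv.rotate p) ?_ ?_ ?_ ?_ ?_ 0 (by simpa using hp) rfl
    · exact fun hB hXB hvB => hstay hB hXB fun k => hvp k ▸ hvB (k + (p * n - p))
    · exact fun k => by
        have := hne (k + p)
        rwa [Nat.add_right_comm] at this
    · exact fun h hX2 k => hleft' h hX2 _
    · exact fun h hX2 k => hleft' h hX2 _
    · intro B hB hXB
      by_contra! hall
      exact absurd (hstay hB hXB fun k => hvp k ▸ hall (k + (p * n - p)))
        (show ¬ 2 * M i j ≤ n by omega)
  subst hp0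
  obtain ⟨q, hq⟩ := hout h.int₁ hX1
  rw [← hv.apply_mod] at hq
  have hqn : q % n < n := Nat.mod_lt _ (by omega)
  generalize q % n = q at hq hqn
  have hvn : v n = v 0 := by simpa using hv.periodic 0
  have h01 := (h.mem_or (v 0)).resolve_right hp
  have hq2 := (h.mem_or (v q)).resolve_left hq
  -- Around `q` there is a maximal arc outside `B₁`, and around `n`, which is the same place as 0,
  -- one outside `B₂`.
  obtain ⟨t, t', ht, ht', htn, htB, htB', hgap⟩ := Nat.exists_gap (p := (v · ∈ B₁)) h01
    (hvn ▸ h01) hq hqn.le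
  obtain ⟨s, s', hs, hs', hsn, hsB, hsB', hgap'⟩ := Nat.exists_gap (p := fun k => v (q + k) ∈ B₂)
    (q := n - q) (l := n) hq2 (by simpa only [hv.periodic] using hq2)
    (by rwa [show q + (n - q) = n by omega, hvn]) (by omega)
  have hpath : ∀ r l, l < n → (Γ.localGraph X i j univ).IsPathSeq l (fun k => v (r + k)) := by
    intro r l hl
    refine ⟨fun k hk => hv.adj _, fun k hk k' hk' e => ?_⟩
    simp only [mem_Iic] at hk hk'
    exact (Nat.ModEq.add_left_cancel' r (hv.eq_iff.1 e)).eq_of_lt_of_lt (by omega) (by omega)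
  have hsB1 : v (q + s) ∈ B₁ := h.symm.mem_of_inc (hv.adj (q + s)).2.2.2
    (hX.adj_typ (hv.adj (q + s))) (hgap' (s + 1) (by omega) (by omega))
  have hsB1' : v (q + s') ∈ B₁ := by
    have := hv.adj (q + (s' - 1))
    have h2 := hgap' (s' - 1) (by omega) (by omega)
    have h3 := h.symm.mem_of_inc (Γ.symm this.2.2.2) (hX.adj_typ this.symm) h2
    rwa [show q + (s' - 1) + 1 = q + s' by omega] at h3
  have hst : t' ≤ q + s := by
    by_contra! hc
    exact hgap (q + s) (by omega) (by omega) hsB1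
  have hst' : q + s' ≤ n + t := by
    by_contra! hc
    refine hgap (q + s' - n) (by omega) (by omega) ?_
    rwa [← hv.periodic, show q + s' - n + n = q + s' by omega]
  -- By `path_mem` each arc has length at least `M i j`. The arcs do not overlap, so the cycle has
  -- length at least `2 * M i j`.
  have hL : M i j ≤ t' - t := by
    by_contra! hc
    exact h.path_mem hX hX1 hX2 hc (hpath t _ (by omega)) htB
      (by simpa [show t + (t' - t) = t' by omega] using htB')
      (fun k h1 h2 => hgap _ (by omega) (by omega)) (q - t) (by omega) (by omega)
  have hL' : M i j ≤ s' - s := by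
    by_contra! hc
    exact h.symm.path_mem hX hX2 hX1 hc (hpath (q + s) _ (by omega)) hsB
      (by simpa [show q + s + (s' - s) = q + s' by omega] using hsB')
      (fun k h1 h2 => by rw [Nat.add_assoc]; exact hgap' _ (by omega) (by omega))
      (n - q - s) (by omega) (by omega)
  omega

theorem isIntermediateOn (h : Γ.IsAmalgam M B₁ B₂) (hM : M.IsGood) : Γ.IsIntermediateOn M univ :=
  ⟨h.propF, h.propP hM, h.propD⟩

end IsAmalgam

end IncGeometry

/-! ### Transport of chains, and a chain for the amalgam -/

theorem SimpleGraph.IsPathSeq.congr {V : Type*} {G : SimpleGraph V} {l : ℕ} {b b' : ℕ → V}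
    (h : G.IsPathSeq l b) (e : ∀ k ≤ l, b k = b' k) : G.IsPathSeq l b' where
  adj k hk := e k hk.le ▸ e (k + 1) hk ▸ h.adj k hk
  inj k hk r hr hkr := h.inj hk hr (by rw [e k hk, e r hr, hkr])

namespace IncGeometry

variable {I V V' : Type} {Γ : IncGeometry I V} {Γ' : IncGeometry I V'} {M : CoxeterMatrix I}

namespace IsoOn

variable {φ : V → V'} {S : Set V}

theorem exists_lift {T : Set V} {l : ℕ} {b : ℕ → V'} (hb : ∀ k ≤ l, b k ∈ φ '' T) :
    ∃ u : ℕ → V, (∀ k ≤ l, u k ∈ T) ∧ ∀ k ≤ l, φ (u k) = b k := by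
  obtain ⟨v, -⟩ := hb 0 (Nat.zero_le _)
  have : Nonempty V := ⟨v⟩
  choose! u hu using hb
  exact ⟨u, fun k hk => (hu k hk).1, fun k hk => (hu k hk).2⟩

theorem isClosedIn_image (h : IsoOn Γ Γ' φ S) {A T : Set V} (hT : T ⊆ S)
    (hA : Γ.IsClosedIn M A T) : Γ'.IsClosedIn M (φ '' A) (φ '' T) where
  subset := image_mono hA.subset
  path X i j hX hXt l b hl hb h0 h1 k hk := by
    obtain ⟨Y, hY, rfl⟩ := subset_image_iff.1 hX
    have hAS := hA.subset.trans hT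
    have hbT : ∀ k ≤ l, b k ∈ φ '' T := by
      intro k hk
      rcases hk.lt_or_eq with hk | rfl
      · exact (hb.adj k hk).1.2
      · exact image_mono hA.subset h1
    obtain ⟨u, hu, hub⟩ := exists_lift hbT
    have hu' := (h.isPathSeq_image (hY.trans hAS) hT fun k hk => hT (hu k hk)).1
      (hb.congr fun k hk => (hub k hk).symm)
    rw [← hub 0 (Nat.zero_le _), h.inj.mem_image_iff hAS (hT (hu 0 (Nat.zero_le _)))] at h0
    rw [← hub l le_rfl, h.inj.mem_image_iff hAS (hT (hu l le_rfl))] at h1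
    exact hub k hk ▸ mem_image_of_mem φ
      (hA.path Y i j hY ((h.isTightFlag_image (hY.trans hAS)).1 hXt) l u hl hu' h0 h1 k hk)
  meet := by
    rintro _ ⟨x, hx, rfl⟩ _ ⟨x', hx', rfl⟩ _ ⟨z, hz, rfl⟩ hne
    have hxS := hT (hA.subset hx)
    have hxS' := hT (hA.subset hx')
    rw [h.typ x hxS, h.typ x' hxS', h.typ z (hT hz), h.inc x hxS z (hT hz),
      h.inc x' hxS' z (hT hz)]
    exact fun e h4 h1 h2 => mem_image_of_mem φ
      (hA.meet x hx x' hx' z hz (fun e => hne (congrArg φ e)) e h4 h1 h2)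

theorem freeStep_image (h : IsoOn Γ Γ' φ S) {T T' X : Set V} {i j : I} {a : ℕ → V} (hT : T' ⊆ S)
    (hs : Γ.FreeStep M T T' X i j a) : Γ'.FreeStep M (φ '' T) (φ '' T') (φ '' X) i j (φ ∘ a) := by
  have hTS := hs.subset_right.trans hT
  have hXS := hs.subset.trans hTS
  have ha : ∀ k ≤ M i j - 1, a k ∈ S := fun k hk => hT (hs.mem_right hk)
  have h3 := hs.three_le
  refine ⟨(h.isTightFlag_image hXS).2 hs.tight, image_mono hs.subset,
    ⟨(h.mem_localSet_image hXS (ha _ (by omega))).2 hs.first_mem.1,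
      mem_image_of_mem φ hs.first_mem.2⟩,
    ⟨(h.mem_localSet_image hXS (ha _ le_rfl)).2 hs.last_mem.1, mem_image_of_mem φ hs.last_mem.2⟩,
    ?_, fun k hk hk' => ?_, fun k hk l hl e => hs.inj hk hl (h.inj (ha k hk) (ha l hl) e),
    fun k hk => ?_, fun k hk => ?_, ?_⟩
  · rw [hs.eq_union, image_union, image_comp]
  · have hk2 := hk
    simp only [mem_Ioo] at hk2
    exact hs.notMem k hk ((h.inj.mem_image_iff hTS (ha k (by omega))).1 hk')
  · rw [Function.comp, h.typ _ (ha k (by omega))]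
    exact hs.typ_mem k hk
  · rw [Function.comp, Function.comp, h.typ _ (ha k (by omega)), h.typ _ (ha (k + 1) (by omega))]
    exact hs.typ_ne k hk
  · rintro k hk _ ⟨w, hw, rfl⟩ hne
    have hk2 := hk
    simp only [mem_Ioo] at hk2
    have h1 := ha (k - 1) (by omega)
    have h2 := ha (k + 1) (by omega)
    have h4 := ha k (by omega)
    simp only [Function.comp, h.inc _ h4 w (hT hw), h.typ _ h4, h.typ w (hT hw),
      h.inj.eq_iff (hT hw) h1, h.inj.eq_iff (hT hw) h2, h.inj.mem_image_iff hXS (hT hw)]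
    exact hs.inc_iff k hk w hw fun e => hne (congrArg φ e)

theorem isFreeIn_image (h : IsoOn Γ Γ' φ univ) {W : Set V} {C : ℕ → Set V}
    (hW : Γ.IsFreeIn M W C) : Γ'.IsFreeIn M (φ '' W) (fun n => φ '' C n) := by
  have hinj : Function.Injective φ := injOn_univ.1 h.inj
  refine ⟨image_inter hinj ▸ h.isClosedIn_image (subset_univ _) hW.1, fun n => ?_⟩
  refine (hW.2 n).imp (congrArg (φ '' ·)) fun ⟨X, i, j, a, ha, hfree⟩ =>
    ⟨_, i, j, _, h.freeStep_image (subset_univ _) ha, hfree.imp (fun hn k hk hk' => ?_)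
      fun ⟨hX, hk⟩ => ⟨image_mono hX, fun k hk' => mem_image_of_mem φ (hk k hk')⟩⟩
  exact hn k hk (hinj.mem_set_image.1 hk')

theorem isFreeChain_image (h : IsoOn Γ Γ' φ univ) {C : ℕ → Set V} (hC : Γ.IsFreeChain M C) :
    Γ'.IsFreeChain M (fun n => φ '' C n) := fun n =>
  (hC n).imp (congrArg (φ '' ·)) fun ⟨_, i, j, _, ha⟩ =>
    ⟨_, i, j, _, h.freeStep_image (subset_univ _) ha⟩

end IsoOn

theorem IsFreeChain.finite {C : ℕ → Set V} (hC : Γ.IsFreeChain M C) (h0 : (C 0).Finite) (n : ℕ) :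
    (C n).Finite := by
  induction n with
  | zero => exact h0
  | succ n ih =>
    rcases hC n with e | ⟨X, i, j, a, ha⟩
    · exact e ▸ ih
    · rw [ha.eq_union]
      exact ih.union ((finite_Ioo _ _).image a)

/-- A vertex of a free set `W` that is born after `w ∉ W` is not incident to `w`, unless this is
prescribed by (F). -/
theorem IsFreeIn.not_adj {W : Set V} {C : ℕ → Set V} (hW : Γ.IsFreeIn M W C) {n : ℕ} {v w : V}
    (hv : v ∈ W) (hvC : v ∈ ⋃ n, C n) (hvn : v ∉ C n) (hw : w ∈ C n) (hwW : w ∉ W)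
    (hinc : Γ.inc v w) : ¬ 3 ≤ M (Γ.typ v) (Γ.typ w) := by
  classical
  intro h3
  have hex := mem_iUnion.1 hvC
  obtain ⟨r, hr, hmin⟩ : ∃ r, v ∈ C r ∧ ∀ r' < r, v ∉ C r' :=
    ⟨Nat.find hex, Nat.find_spec hex, fun n' => Nat.find_min hex⟩
  have hnr : n < r := by
    by_contra! hc
    exact hvn (hW.isFreeChain.monotone hc hr)
  obtain ⟨s, rfl⟩ : ∃ s, r = s + 1 := ⟨r - 1, by omega⟩
  rcases hW.2 s with e | ⟨X, i, j, a, ha, hfree⟩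
  · exact hmin s (by omega) (e ▸ hr)
  obtain ⟨k, hk, rfl⟩ := (ha.mem_right_iff.1 hr).resolve_left (hmin s (by omega))
  rcases hfree with hfree | ⟨hX, haW⟩
  · exact hfree k hk hv
  · exact hwW (ha.mem_of_inc hX haW hk (hW.isFreeChain.monotone hnr.le hw) h3 hinc)

/-- This permits a change in the order of steps: vertices added elsewhere do not disturb a free
step, as long as their incidences with the new path are those prescribed by (F). -/
theorem FreeStep.union (hM : M.IsGood) {S S' T X : Set V} {i j : I} {a : ℕ → V}
    (h : Γ.FreeStep M S S' X i j a) (hF : Γ.PropFOn M univ)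
    (hT : ∀ k ∈ Ioo 0 (M i j - 1), a k ∉ T)
    (hinc : ∀ k ∈ Ioo 0 (M i j - 1), ∀ w ∈ T, w ∉ S' → Γ.inc (a k) w →
      ¬ 3 ≤ M (Γ.typ (a k)) (Γ.typ w)) : Γ.FreeStep M (S ∪ T) (S' ∪ T) X i j a where
  tight := h.tight
  subset := h.subset.trans subset_union_left
  first_mem := ⟨h.first_mem.1, Or.inl h.first_mem.2⟩
  last_mem := ⟨h.last_mem.1, Or.inl h.last_mem.2⟩
  eq_union := by rw [h.eq_union, union_right_comm]
  notMem k hk := not_or.2 ⟨h.notMem k hk, hT k hk⟩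
  inj := h.inj
  typ_mem := h.typ_mem
  typ_ne := h.typ_ne
  inc_iff k hk w hw hne := by
    by_cases hwS : w ∈ S'
    · exact h.inc_iff k hk w hwS hne
    have hwT := hw.resolve_left hwS
    have hk' := hk
    simp only [mem_Ioo] at hk'
    constructor
    · intro hi
      have h2 := hinc k hk w hwT hwS hi
      have h1 : Γ.typ (a k) ≠ Γ.typ w := fun e => hne ((Γ.inc_iff_eq e).1 hi).symm
      exact Or.inr (Or.inr (Or.inr ((hM.eq_two_or h1).resolve_right h2)))
    · rintro (rfl | rfl | e | e)
      · exact absurd (h.mem_right (by omega)) hwS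
      · exact absurd (h.mem_right (by omega)) hwS
      · exact absurd (h.subset_right (h.subset e)) hwS
      · exact hF _ (mem_univ _) _ (mem_univ _) e

/-- The chains are run alternately, with `S` held back until `T` contains the common vertices of the
next stage of `S`. As the common part is free for `S`, the path of a step of `S` is either common,
and then already present, or it avoids the common part and can be added freely to the union. The
steps of `T` remain free because a common vertex that `S` has not reached yet is not incident,
except by (F), with the part of `S` outside `B₂`. -/
theorem IsAmalgam.exists_isFreeChain (hM : M.IsGood) {B₁ B₂ : Set V} (h : Γ.IsAmalgam M B₁ B₂)
    {S T : ℕ → Set V} (hS : Γ.IsFreeIn M (B₁ ∩ B₂) S) (hT : Γ.IsFreeChain M T)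
    (hS1 : ⋃ n, S n = B₁) (hT2 : ⋃ n, T n = B₂) (hS0 : (S 0).Finite) (hT0 : (T 0).Finite) :
    ∃ U, (U 0).Finite ∧ Γ.IsFreeChain M U ∧ ⋃ n, U n = univ := by
  classical
  have hSmono := hS.isFreeChain.monotone
  have hTmono := hT.monotone
  have hfin : ∀ n, (S n).Finite := hS.isFreeChain.finite hS0
  have hex : ∀ n, ∃ t, B₁ ∩ B₂ ∩ S n ⊆ T t := fun n =>
    ((hfin n).subset inter_subset_right).exists_subset_of_monotone hTmono
      (hT2 ▸ inter_subset_left.trans inter_subset_right)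
  obtain ⟨t₀, ht₀⟩ := hex 0
  -- After `n` rounds the chain `S` has reached stage `s n`; it advances in round `n` only if `T (t₀
  -- + n)` contains the common vertices of its next stage.
  let s : ℕ → ℕ := fun n => Nat.rec (motive := fun _ => ℕ) 0
    (fun n r => if B₁ ∩ B₂ ∩ S (r + 1) ⊆ T (t₀ + n) then r + 1 else r) n
  have hs : ∀ n : ℕ, s (n + 1) = if B₁ ∩ B₂ ∩ S (s n + 1) ⊆ T (t₀ + n) then s n + 1 else s n :=
    fun _ => rfl
  have hinv : ∀ n, B₁ ∩ B₂ ∩ S (s n) ⊆ T (t₀ + n) := by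
    intro n
    induction n with
    | zero => exact ht₀
    | succ n ih =>
      rw [hs]
      split_ifs with hc
      · exact hc.trans (hTmono (by omega))
      · exact ih.trans (hTmono (by omega))
  have hsmono : Monotone s := by
    refine monotone_nat_of_le_succ fun n => ?_
    rw [hs]
    split_ifs <;> omega
  have hsunb : ∀ m, ∃ n, m ≤ s n := by
    intro m
    induction m with
    | zero => exact ⟨0, Nat.zero_le _⟩
    | succ m ih =>
      obtain ⟨n, hn⟩ := ih
      by_contra! hc
      have heq : ∀ r, s (n + r) = m := fun r => by
        have := hc (n + r)
        have := hsmono (show n ≤ n + r by omega)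
        omega
      obtain ⟨t, ht⟩ := hex (m + 1)
      -- If `s` were constant from some round on, `T` would in the meantime catch up with the next
      -- stage of `S`.
      have := hs (n + t)
      rw [heq, if_pos (ht.trans (hTmono (by omega))), Nat.add_assoc, heq] at this
      omega
  have hS1' : ∀ n, S n ⊆ B₁ := fun n => hS1 ▸ subset_iUnion S n
  have hT2' : ∀ n, T n ⊆ B₂ := fun n => hT2 ▸ subset_iUnion T n
  have hSstep : ∀ n, (S (s (n + 1)) ∪ T (t₀ + n) = S (s n) ∪ T (t₀ + n)) ∨ ∃ X i j a,
      Γ.FreeStep M (S (s n) ∪ T (t₀ + n)) (S (s (n + 1)) ∪ T (t₀ + n)) X i j a := by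
    intro n
    rw [hs]
    split_ifs with hc
    swap
    · exact Or.inl rfl
    rcases hS.2 (s n) with e | ⟨X, i, j, a, ha, hfree | ⟨-, hW⟩⟩
    · exact Or.inl (by rw [e])
    · right
      refine ⟨X, i, j, a, ha.union hM h.propF (fun k hk hkT => ?_) fun k hk w hw hwS hi => ?_⟩
      · have hk' := hk
        simp only [mem_Ioo] at hk'
        exact hfree k hk ⟨hS1' _ (ha.mem_right (by omega)), hT2' _ hkT⟩
      · have hk' := hk
        simp only [mem_Ioo] at hk'
        have hkS : a k ∈ S (s n + 1) := ha.mem_right (by omega)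
        by_cases hw1 : w ∈ B₁
        · rw [M.symmetric]
          exact hS.not_adj ⟨hw1, hT2' _ hw⟩ (hS1 ▸ hw1) hwS hkS (hfree k hk) (Γ.symm hi)
        · intro h3
          exact hfree k hk ⟨hS1' _ hkS, h.mem_of_inc hi h3 hw1⟩
    · left
      rw [ha.eq_union, union_right_comm]
      refine union_eq_self_of_subset_right ?_
      rintro _ ⟨k, hk, rfl⟩
      simp only [mem_Ioo] at hk
      exact Or.inr (hc ⟨hW k (by omega), ha.mem_right (by omega)⟩)
  have hTstep : ∀ n, (S (s (n + 1)) ∪ T (t₀ + (n + 1)) = S (s (n + 1)) ∪ T (t₀ + n)) ∨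
      ∃ X i j a, Γ.FreeStep M (S (s (n + 1)) ∪ T (t₀ + n)) (S (s (n + 1)) ∪ T (t₀ + (n + 1)))
        X i j a := by
    intro n
    have hinv' : B₁ ∩ B₂ ∩ S (s (n + 1)) ⊆ T (t₀ + n) := by
      rw [hs]
      split_ifs with hc
      · exact hc
      · exact hinv n
    rcases hT (t₀ + n) with e | ⟨X, i, j, a, ha⟩
    · exact Or.inl (by rw [← Nat.add_assoc, e])
    · right
      refine ⟨X, i, j, a, ?_⟩
      rw [union_comm, union_comm (S (s (n + 1)))]
      have hkB : ∀ k ∈ Ioo 0 (M i j - 1), a k ∈ B₂ := fun k hk =>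
        hT2' _ (ha.mem_right (by simp only [mem_Ioo] at hk; omega))
      have hkS : ∀ k ∈ Ioo 0 (M i j - 1), a k ∉ S (s (n + 1)) := fun k hk hkS =>
        ha.notMem k hk (hinv' ⟨⟨hS1' _ hkS, hkB k hk⟩, hkS⟩)
      refine ha.union hM h.propF hkS fun k hk w hw hwT hi => ?_
      have hw2 : w ∉ B₂ := fun hw2 => hwT (hTmono (by omega) (hinv' ⟨⟨hS1' _ hw, hw2⟩, hw⟩))
      by_cases hk1 : a k ∈ B₁
      · exact hS.not_adj ⟨hk1, hkB k hk⟩ (hS1 ▸ hk1) (hkS k hk) hw (fun hw' => hw2 hw'.2) hi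
      · intro h3
        exact hk1 (h.symm.mem_of_inc hi h3 hw2)
  let U : ℕ → Set V := fun n => S (s ((n + 1) / 2)) ∪ T (t₀ + n / 2)
  refine ⟨U, ?_, fun n => ?_, ?_⟩
  · exact (hfin _).union (hT.finite hT0 _)
  · obtain ⟨r, rfl | rfl⟩ := Nat.even_or_odd' n
    · have := hSstep r
      simpa only [U, show (2 * r + 1 + 1) / 2 = r + 1 by omega, show (2 * r + 1) / 2 = r by omega,
        show 2 * r / 2 = r by omega] using this
    · have := hTstep r
      simpa only [U, show (2 * r + 1 + 1 + 1) / 2 = r + 1 by omega,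
        show (2 * r + 1 + 1) / 2 = r + 1 by omega, show (2 * r + 1) / 2 = r by omega] using this
  · refine eq_univ_of_forall fun v => mem_iUnion.2 ?_
    rcases h.mem_or v with hv | hv
    · rw [← hS1] at hv
      obtain ⟨m, hm⟩ := mem_iUnion.1 hv
      obtain ⟨n, hn⟩ := hsunb m
      exact ⟨2 * n, Or.inl (hSmono (by rwa [show (2 * n + 1) / 2 = n by omega]) hm)⟩
    · rw [← hT2] at hv
      obtain ⟨m, hm⟩ := mem_iUnion.1 hv
      exact ⟨2 * m, Or.inr (hTmono (by omega) hm)⟩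

/-! ### The amalgam of two geometries -/

section amalgam

variable {N V₁ V₂ : Type} (Γ₁ : IncGeometry I V₁) (Γ₂ : IncGeometry I V₂) (M : CoxeterMatrix I)
  (f : N → V₁) (g : N → V₂)

/-- The incidence relation of the amalgam between the first geometry and the new vertices of the
second one. -/
def crossInc (u : V₁) (v : V₂) : Prop :=
  (∃ a, f a = u ∧ Γ₂.inc (g a) v) ∨ (u ∉ range f ∧ M (Γ₁.typ u) (Γ₂.typ v) = 2)

variable {Γ₁ Γ₂ f g}

theorem typ_ne_of_crossInc (ht : ∀ a, Γ₁.typ (f a) = Γ₂.typ (g a)) {u : V₁} {v : V₂}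
    (hv : v ∉ range g) (h : crossInc Γ₁ Γ₂ M f g u v) : Γ₁.typ u ≠ Γ₂.typ v := by
  intro e
  rcases h with ⟨a, rfl, ha⟩ | ⟨-, h2⟩
  · rw [ht] at e
    exact hv ⟨a, (Γ₂.inc_iff_eq e).1 ha⟩
  · rw [e] at h2
    simp at h2

variable (Γ₁ Γ₂ f g)

/-- The free amalgam of two geometries over a common part. -/
def amalgam (ht : ∀ a, Γ₁.typ (f a) = Γ₂.typ (g a)) :
    IncGeometry I (V₁ ⊕ {v : V₂ // v ∉ range g}) where
  typ := Sum.elim Γ₁.typ fun v => Γ₂.typ v.1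
  inc
    | .inl u, .inl v => Γ₁.inc u v
    | .inl u, .inr v => crossInc Γ₁ Γ₂ M f g u v.1
    | .inr v, .inl u => crossInc Γ₁ Γ₂ M f g u v.1
    | .inr u, .inr v => Γ₂.inc u.1 v.1
  symm := by
    rintro (u | u) (v | v) h
    · exact Γ₁.symm h
    · exact h
    · exact h
    · exact Γ₂.symm h
  inc_iff_eq := by
    rintro (u | u) (v | v) h
    · exact (Γ₁.inc_iff_eq h).trans Sum.inl_injective.eq_iff.symm
    · exact ⟨fun hi => absurd h (typ_ne_of_crossInc M ht v.2 hi), fun e => by cases e⟩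
    · exact ⟨fun hi => absurd h.symm (typ_ne_of_crossInc M ht u.2 hi), fun e => by cases e⟩
    · exact (Γ₂.inc_iff_eq h).trans (Subtype.ext_iff.symm.trans Sum.inr_injective.eq_iff.symm)

open Classical in
/-- The embedding of the second geometry in the amalgam. -/
noncomputable def amalgamRight (f : N → V₁) (g : N → V₂) (v : V₂) :
    V₁ ⊕ {v : V₂ // v ∉ range g} :=
  if h : ∃ a, g a = v then Sum.inl (f h.choose) else Sum.inr ⟨v, h⟩

variable {Γ₁ Γ₂ M f g}

theorem amalgamRight_apply (hg : Function.Injective g) (a : N) :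
    amalgamRight f g (g a) = Sum.inl (f a) := by
  have h : ∃ b, g b = g a := ⟨a, rfl⟩
  rw [amalgamRight, dif_pos h, hg h.choose_spec]

theorem amalgamRight_of_notMem {v : V₂} (hv : v ∉ range g) :
    amalgamRight f g v = Sum.inr ⟨v, hv⟩ := dif_neg hv

theorem isoOn_inl (ht : ∀ a, Γ₁.typ (f a) = Γ₂.typ (g a)) :
    IsoOn Γ₁ (amalgam Γ₁ Γ₂ M f g ht) Sum.inl univ :=
  ⟨Sum.inl_injective.injOn, fun _ _ => rfl, fun _ _ _ _ => Iff.rfl⟩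

theorem isoOn_amalgamRight (ht : ∀ a, Γ₁.typ (f a) = Γ₂.typ (g a)) (hf : Function.Injective f)
    (hg : Function.Injective g) (hi : ∀ a b, Γ₁.inc (f a) (f b) ↔ Γ₂.inc (g a) (g b)) :
    IsoOn Γ₂ (amalgam Γ₁ Γ₂ M f g ht) (amalgamRight f g) univ := by
  have hcross : ∀ a v, crossInc Γ₁ Γ₂ M f g (f a) v ↔ Γ₂.inc (g a) v := fun a v =>
    ⟨fun h => by
      rcases h with ⟨b, hb, h⟩ | h
      · exact hf hb ▸ h
      · exact absurd ⟨a, rfl⟩ h.1, fun h => Or.inl ⟨a, rfl, h⟩⟩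
  refine ⟨fun u _ v _ e => ?_, fun v _ => ?_, fun u _ v _ => ?_⟩
  · by_cases hu : u ∈ range g <;> by_cases hv : v ∈ range g
    · obtain ⟨a, rfl⟩ := hu
      obtain ⟨b, rfl⟩ := hv
      rw [amalgamRight_apply hg, amalgamRight_apply hg] at e
      rw [hf (Sum.inl_injective e)]
    · obtain ⟨a, rfl⟩ := hu
      rw [amalgamRight_apply hg, amalgamRight_of_notMem hv] at e
      cases e
    · obtain ⟨a, rfl⟩ := hv
      rw [amalgamRight_apply hg, amalgamRight_of_notMem hu] at e
      cases e
    · rw [amalgamRight_of_notMem hu, amalgamRight_of_notMem hv] at e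
      exact congrArg Subtype.val (Sum.inr_injective e)
  · by_cases hv : v ∈ range g
    · obtain ⟨b, rfl⟩ := hv
      rw [amalgamRight_apply hg]
      exact ht b
    · rw [amalgamRight_of_notMem hv]
      rfl
  · by_cases hu : u ∈ range g <;> by_cases hv : v ∈ range g
    · obtain ⟨a, rfl⟩ := hu
      obtain ⟨b, rfl⟩ := hv
      rw [amalgamRight_apply hg, amalgamRight_apply hg]
      exact hi a b
    · obtain ⟨a, rfl⟩ := hu
      rw [amalgamRight_apply hg, amalgamRight_of_notMem hv]
      exact hcross a v
    · obtain ⟨b, rfl⟩ := hv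
      rw [amalgamRight_apply hg, amalgamRight_of_notMem hu]
      exact (hcross b u).trans ⟨Γ₂.symm, Γ₂.symm⟩
    · rw [amalgamRight_of_notMem hu, amalgamRight_of_notMem hv]
      exact Iff.rfl

theorem image_inl_range (hg : Function.Injective g) :
    Sum.inl '' range f = amalgamRight f g '' range g := by
  rw [← range_comp, ← range_comp]
  congr 1
  exact funext fun a => (amalgamRight_apply hg a).symm

theorem inter_amalgam (hg : Function.Injective g) :
    Sum.inl '' univ ∩ amalgamRight f g '' univ = Sum.inl '' range f := by
  refine Subset.antisymm ?_ (subset_inter (image_mono (subset_univ _))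
    (image_inl_range hg ▸ image_mono (subset_univ _)))
  rintro _ ⟨⟨u, -, rfl⟩, v, -, e⟩
  by_cases hv : v ∈ range g
  · exact image_inl_range (f := f) hg ▸ e ▸ mem_image_of_mem _ hv
  · rw [amalgamRight_of_notMem hv] at e
    cases e

theorem isAmalgam_amalgam (ht : ∀ a, Γ₁.typ (f a) = Γ₂.typ (g a)) (hf : Function.Injective f)
    (hg : Function.Injective g) (hi : ∀ a b, Γ₁.inc (f a) (f b) ↔ Γ₂.inc (g a) (g b))
    (h₁ : Γ₁.IsIntermediateOn M univ) (h₂ : Γ₂.IsIntermediateOn M univ)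
    (hc₁ : Γ₁.IsClosedIn M (range f) univ) (hc₂ : Γ₂.IsClosedIn M (range g) univ) :
    (amalgam Γ₁ Γ₂ M f g ht).IsAmalgam M (Sum.inl '' univ) (amalgamRight f g '' univ) where
  union := by
    refine eq_univ_of_forall ?_
    rintro (u | v)
    · exact Or.inl ⟨u, mem_univ _, rfl⟩
    · exact Or.inr ⟨v, mem_univ _, amalgamRight_of_notMem v.2⟩
  inc_iff := by
    rintro (u | u) hu (v | v) hv
    · exact absurd ⟨v, mem_univ _, rfl⟩ hv
    · constructor
      · rintro (⟨a, rfl, -⟩ | h)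
        · exact absurd ⟨g a, mem_univ _, amalgamRight_apply hg a⟩ hu
        · exact h.2
      · refine fun h => Or.inr ⟨?_, h⟩
        rintro ⟨a, rfl⟩
        exact hu ⟨g a, mem_univ _, amalgamRight_apply hg a⟩
    · exact absurd ⟨v, mem_univ _, rfl⟩ hv
    · exact absurd ⟨u, mem_univ _, amalgamRight_of_notMem u.2⟩ hu
  int₁ := (isoOn_inl ht).isIntermediateOn_image.2 h₁
  int₂ := (isoOn_amalgamRight ht hf hg hi).isIntermediateOn_image.2 h₂
  closed₁ := inter_amalgam hg ▸ (isoOn_inl ht).isClosedIn_image subset_rfl hc₁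
  closed₂ := by
    rw [inter_amalgam hg, image_inl_range hg]
    exact (isoOn_amalgamRight ht hf hg hi).isClosedIn_image subset_rfl hc₂

end amalgam

/-- Two geometries that arise from finite geometries by free chains can be amalgamated over a
finitely generated closed part. -/
theorem exists_amalgam [Finite I] (hM : M.IsGood) {N V₁ V₂ : Type} {Γ₁ : IncGeometry I V₁}
    {Γ₂ : IncGeometry I V₂} {f : N → V₁} {g : N → V₂} (ht : ∀ a, Γ₁.typ (f a) = Γ₂.typ (g a))
    (hf : Function.Injective f) (hg : Function.Injective g)
    (hi : ∀ a b, Γ₁.inc (f a) (f b) ↔ Γ₂.inc (g a) (g b))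
    (h₁ : Γ₁.IsIntermediateOn M univ) (h₂ : Γ₂.IsIntermediateOn M univ)
    (hc₁ : Γ₁.IsClosedIn M (range f) univ) (hc₂ : Γ₂.IsClosedIn M (range g) univ)
    {E : Set V₁} (hE : E.Finite) (hEf : E ⊆ range f)
    (hgen : ∀ B, Γ₁.IsClosedIn M B univ → E ⊆ B → range f ⊆ B)
    {C₁ : ℕ → Set V₁} (hC₁ : Γ₁.IsFreeChain M C₁) (hfin₁ : (C₁ 0).Finite)
    (huniv₁ : ⋃ n, C₁ n = univ)
    {C₂ : ℕ → Set V₂} (hC₂ : Γ₂.IsFreeChain M C₂) (hfin₂ : (C₂ 0).Finite)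
    (huniv₂ : ⋃ n, C₂ n = univ) :
    ∃ (W : Type) (Δ : IncGeometry I W) (e₁ : V₁ → W) (e₂ : V₂ → W) (U : ℕ → Set W),
      IsoOn Γ₁ Δ e₁ univ ∧ IsoOn Γ₂ Δ e₂ univ ∧ (∀ a, e₁ (f a) = e₂ (g a)) ∧
      Δ.IsIntermediateOn M univ ∧ Δ.IsClosedIn M (range e₁) univ ∧
      Δ.IsClosedIn M (range e₂) univ ∧ Δ.IsFreeChain M U ∧ (U 0).Finite ∧ ⋃ n, U n = univ := by
  have hA := isAmalgam_amalgam ht hf hg hi h₁ h₂ hc₁ hc₂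
  have i₁ := isoOn_inl (M := M) ht
  have i₂ := isoOn_amalgamRight (M := M) ht hf hg hi
  obtain ⟨n, hn⟩ := hc₁.exists_isFreeIn hM h₁ huniv₁ hC₁ hE hEf hgen
  have hn' : ⋃ k, C₁ (n + k) = univ := by
    refine eq_univ_of_forall fun v => ?_
    obtain ⟨m, hm⟩ := mem_iUnion.1 (huniv₁ ▸ mem_univ v : v ∈ ⋃ n, C₁ n)
    exact mem_iUnion.2 ⟨m, hC₁.monotone (by omega) hm⟩
  have hfree := i₁.isFreeIn_image hn
  rw [← inter_amalgam hg] at hfree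
  obtain ⟨U, hU0, hU, hUu⟩ := hA.exists_isFreeChain hM hfree (i₂.isFreeChain_image hC₂)
    (by rw [← image_iUnion, hn']) (by rw [← image_iUnion, huniv₂]) ((hC₁.finite hfin₁ _).image _)
    (hfin₂.image _)
  have hc1 := hA.isClosedIn hM
  have hc2 := hA.symm.isClosedIn hM
  rw [image_univ] at hc1 hc2
  exact ⟨_, _, _, _, U, i₁, i₂, fun a => (amalgamRight_apply hg a).symm, hA.isIntermediateOn hM,
    hc1, hc2, hU, hU0, hUu⟩

end IncGeometry

/-! ### Free embeddings in saturated geometries -/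

theorem exists_nat_seq {α : Type*} {P : ℕ → α → Prop} {R : ℕ → α → α → Prop} {x : α} (h0 : P 0 x)
    (h : ∀ n x, P n x → ∃ y, P (n + 1) y ∧ R n x y) :
    ∃ f : ℕ → α, f 0 = x ∧ ∀ n, P n (f n) ∧ R n (f n) (f (n + 1)) := by
  choose g hg using h
  let F : ∀ n, {y // P n y} := fun n => Nat.rec (motive := fun n => {y // P n y}) ⟨x, h0⟩
    (fun n y => ⟨g n y.1 y.2, (hg n y.1 y.2).1⟩) n
  exact ⟨fun n => (F n).1, rfl, fun n => ⟨(F n).2, (hg n (F n).1 (F n).2).2⟩⟩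

namespace IncGeometry

variable {I V V' : Type} {Γ : IncGeometry I V} {Γ' : IncGeometry I V'} {M : CoxeterMatrix I}

/-- The same path can be added to another set that contains the flag and the endpoints. -/
theorem FreeStep.replace (hM : M.IsGood) {S S' T X : Set V} {i j : I} {a : ℕ → V}
    (h : Γ.FreeStep M S S' X i j a) (hF : Γ.PropFOn M univ) (hX : X ⊆ T) (h0 : a 0 ∈ T)
    (h1 : a (M i j - 1) ∈ T) (hT : ∀ k ∈ Ioo 0 (M i j - 1), a k ∉ T)
    (hinc : ∀ k ∈ Ioo 0 (M i j - 1), ∀ w ∈ T, w ∉ S' → Γ.inc (a k) w →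
      ¬ 3 ≤ M (Γ.typ (a k)) (Γ.typ w)) :
    Γ.FreeStep M T (T ∪ a '' Ioo 0 (M i j - 1)) X i j a where
  tight := h.tight
  subset := hX
  first_mem := ⟨h.first_mem.1, h0⟩
  last_mem := ⟨h.last_mem.1, h1⟩
  eq_union := rfl
  notMem := hT
  inj := h.inj
  typ_mem := h.typ_mem
  typ_ne := h.typ_ne
  inc_iff k hk w hw hne := by
    by_cases hwS : w ∈ S'
    · exact h.inc_iff k hk w hwS hne
    have hk' := hk
    simp only [mem_Ioo] at hk'
    have hwT : w ∈ T := hw.resolve_right (by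
      rintro ⟨r, hr, rfl⟩
      exact hwS (h.mem_right (by simp only [mem_Ioo] at hr; omega)))
    constructor
    · intro hi
      have h2 := hinc k hk w hwT hwS hi
      have h1 : Γ.typ (a k) ≠ Γ.typ w := fun e => hne ((Γ.inc_iff_eq e).1 hi).symm
      exact Or.inr (Or.inr (Or.inr ((hM.eq_two_or h1).resolve_right h2)))
    · rintro (rfl | rfl | e | e)
      · exact absurd (h.mem_right (by omega)) hwS
      · exact absurd (h.mem_right (by omega)) hwS
      · exact absurd (h.subset_right (h.subset e)) hwS
      · exact hF _ (mem_univ _) _ (mem_univ _) e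

theorem FreeStep.typ_eq {Γ : IncGeometry I V} {Γ' : IncGeometry I V'} {S S' X : Set V}
    {T T' X' : Set V'} {i j : I} {a : ℕ → V} {a' : ℕ → V'} (h : Γ.FreeStep M S S' X i j a)
    (h' : Γ'.FreeStep M T T' X' i j a') (h0 : Γ'.typ (a' 0) = Γ.typ (a 0)) :
    ∀ k ≤ M i j - 1, Γ'.typ (a' k) = Γ.typ (a k) := by
  have h3 := h.three_le
  intro k hk
  induction k with
  | zero => exact h0
  | succ k ih =>
    have e := ih (by omega)
    have h1 := h.typ_mem k (by omega)
    have h2 := h.typ_mem (k + 1) (by omega)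
    have h4 := h'.typ_mem (k + 1) (by omega)
    have h5 := h.typ_ne k (by omega)
    have h6 := h'.typ_ne k (by omega)
    grind

/-- An isomorphism extends over parallel free steps. -/
theorem IsoOn.exists_extend {φ : V → V'} {S S' X : Set V} {T' : Set V'} {i j : I} {a : ℕ → V}
    {a' : ℕ → V'} (h : IsoOn Γ Γ' φ S) (hs : Γ.FreeStep M S S' X i j a)
    (hs' : Γ'.FreeStep M (φ '' S) T' (φ '' X) i j a') (h0 : a' 0 = φ (a 0))
    (h1 : a' (M i j - 1) = φ (a (M i j - 1))) :
    ∃ φ', IsoOn Γ Γ' φ' S' ∧ EqOn φ φ' S ∧ φ' '' S' = T' := by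
  classical
  let φ' : V → V' := fun w => if h : ∃ k ∈ Ioo 0 (M i j - 1), a k = w then a' h.choose else φ w
  have hnew : ∀ k ∈ Ioo 0 (M i j - 1), φ' (a k) = a' k := by
    intro k hk
    have hex : ∃ r ∈ Ioo 0 (M i j - 1), a r = a k := ⟨k, hk, rfl⟩
    simp only [φ', dif_pos hex]
    congr 1
    exact hs.inj (show _ ∈ Iic _ from hex.choose_spec.1.2.le) (show _ ∈ Iic _ from hk.2.le)
      hex.choose_spec.2
  have hold : ∀ w ∈ S, φ' w = φ w := fun w hw => dif_neg fun ⟨k, hk, e⟩ => hs.notMem k hk (e ▸ hw)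
  have hall : ∀ k ≤ M i j - 1, φ' (a k) = a' k := by
    intro k hk
    rcases Nat.eq_zero_or_pos k with rfl | hk0
    · rw [h0, hold _ hs.first_mem.2]
    · rcases hk.eq_or_lt with rfl | hk1
      · rw [h1, hold _ hs.last_mem.2]
      · exact hnew k ⟨hk0, hk1⟩
  have hXS : X ⊆ S := hs.subset
  have ht0 : Γ'.typ (a' 0) = Γ.typ (a 0) := by rw [h0, h.typ _ hs.first_mem.2]
  have htyp := hs.typ_eq hs' ht0
  have hmem : ∀ w ∈ S, φ w ∈ φ '' S := fun w hw => mem_image_of_mem φ hw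
  have hinj : InjOn φ' S' := by
    intro u hu v hv e
    rcases hs.mem_right_iff.1 hu with hu | ⟨k, hk, rfl⟩ <;>
      rcases hs.mem_right_iff.1 hv with hv | ⟨r, hr, rfl⟩
    · rw [hold u hu, hold v hv] at e
      exact h.inj hu hv e
    · rw [hold u hu, hnew r hr] at e
      exact absurd (e ▸ hmem u hu) (hs'.notMem r hr)
    · rw [hold v hv, hnew k hk] at e
      exact absurd (e ▸ hmem v hv) (hs'.notMem k hk)
    · rw [hnew k hk, hnew r hr] at e
      rw [hs'.inj (show _ ∈ Iic _ from hk.2.le) (show _ ∈ Iic _ from hr.2.le) e]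
  have htyp' : ∀ v ∈ S', Γ'.typ (φ' v) = Γ.typ v := by
    intro v hv
    rcases hs.mem_right_iff.1 hv with hv | ⟨k, hk, rfl⟩
    · rw [hold v hv, h.typ v hv]
    · rw [hnew k hk, htyp k hk.2.le]
  have himg : φ' '' S' = T' := by
    rw [hs.eq_union, hs'.eq_union, image_union, image_image, image_congr hold, image_congr hnew]
  have key : ∀ k ∈ Ioo 0 (M i j - 1), ∀ w ∈ S', Γ'.inc (φ' (a k)) (φ' w) ↔ Γ.inc (a k) w := by
    intro k hk w hw
    have hk' := hk
    simp only [mem_Ioo] at hk'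
    have hkS : a k ∈ S' := hs.mem_right (by omega)
    by_cases e : w = a k
    · rw [e]
      exact iff_of_true (Γ'.inc_self _) (Γ.inc_self _)
    have hXw : φ' w ∈ φ '' X ↔ w ∈ X := by
      rw [← image_congr fun x hx => hold x (hXS hx)]
      exact hinj.mem_image_iff (hXS.trans hs.subset_right) hw
    rw [hs.inc_iff k hk w hw e, hnew k hk, hs'.inc_iff k hk (φ' w) (himg ▸ mem_image_of_mem _ hw)
      fun e' => e (hinj hw hkS (e'.trans (hnew k hk).symm)), htyp k (by omega), htyp' w hw, hXw,
      ← hall (k - 1) (by omega), ← hall (k + 1) (by omega),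
      hinj.eq_iff hw (hs.mem_right (by omega)), hinj.eq_iff hw (hs.mem_right (by omega))]
  refine ⟨φ', ⟨hinj, htyp', fun u hu v hv => ?_⟩, fun w hw => (hold w hw).symm, himg⟩
  rcases hs.mem_right_iff.1 hu with hu' | ⟨k, hk, rfl⟩
  · rcases hs.mem_right_iff.1 hv with hv' | ⟨k, hk, rfl⟩
    · rw [hold u hu', hold v hv']
      exact h.inc u hu' v hv'
    · exact ⟨fun e => Γ.symm ((key k hk u hu).1 (Γ'.symm e)),
        fun e => Γ'.symm ((key k hk u hu).2 (Γ.symm e))⟩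
  · exact key k hk v hv

/-- A step that meets the union meets one of the `W n`, and its path and flag are then contained in
that `W n`. -/
theorem IsFreeIn.iUnion {W : ℕ → Set V} {C : ℕ → Set V}
    (h : ∀ n, Γ.IsFreeIn M (W n) C) (h0 : ∀ n, W n ∩ C 0 ⊆ W 0) :
    Γ.IsFreeIn M (⋃ n, W n) C := by
  refine ⟨?_, fun s => ?_⟩
  · have : (⋃ n, W n) ∩ C 0 = W 0 ∩ C 0 := by
      refine Subset.antisymm ?_ (inter_subset_inter_left _ (subset_iUnion W 0))
      rintro v ⟨hv, hvC⟩
      obtain ⟨n, hn⟩ := mem_iUnion.1 hv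
      exact ⟨h0 n ⟨hn, hvC⟩, hvC⟩
    exact this ▸ (h 0).1
  · by_cases hex : ∃ v n, v ∈ W n ∧ v ∈ C (s + 1) ∧ v ∉ C s
    · obtain ⟨v, n, hvW, hv, hvs⟩ := hex
      refine ((h n).2 s).imp_right fun ⟨X, i, j, a, ha, hfree⟩ => ⟨X, i, j, a, ha, Or.inr ?_⟩
      obtain ⟨k, hk, rfl⟩ := (ha.mem_right_iff.1 hv).resolve_left hvs
      obtain ⟨hX, hW⟩ := hfree.resolve_left fun hf => hf k hk hvW
      exact ⟨hX.trans (subset_iUnion W n), fun k hk => mem_iUnion.2 ⟨n, hW k hk⟩⟩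
    · push Not at hex
      refine ((h 0).2 s).imp_right fun ⟨X, i, j, a, ha, _⟩ =>
        ⟨X, i, j, a, ha, Or.inl fun k hk hkW => ?_⟩
      obtain ⟨n, hn⟩ := mem_iUnion.1 hkW
      exact ha.notMem k hk
        (hex _ n hn (ha.mem_right (by simp only [mem_Ioo] at hk; omega)))

/-- The other steps are not affected, because the inner vertices of paths added at different stages
are different. -/
theorem IsFreeIn.union_of_step {W : Set V} {C : ℕ → Set V} (hW : Γ.IsFreeIn M W C) {s : ℕ}
    {X : Set V} {i j : I} {a : ℕ → V} (ha : Γ.FreeStep M (C s) (C (s + 1)) X i j a) (hX : X ⊆ W)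
    (h0 : a 0 ∈ W) (h1 : a (M i j - 1) ∈ W) : Γ.IsFreeIn M (W ∪ a '' Ioo 0 (M i j - 1)) C := by
  have hmono := hW.isFreeChain.monotone
  refine ⟨?_, fun t => ?_⟩
  · have : (W ∪ a '' Ioo 0 (M i j - 1)) ∩ C 0 = W ∩ C 0 := by
      rw [union_inter_distrib_right, union_eq_left]
      rintro _ ⟨⟨k, hk, rfl⟩, hk0⟩
      exact absurd (hmono (Nat.zero_le s) hk0) (ha.notMem k hk)
    exact this ▸ hW.1
  · rcases eq_or_ne t s with rfl | hts
    · refine Or.inr ⟨X, i, j, a, ha, Or.inr ⟨hX.trans subset_union_left, fun k hk => ?_⟩⟩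
      rcases Nat.eq_zero_or_pos k with rfl | hk0
      · exact Or.inl h0
      · rcases hk.eq_or_lt with rfl | hk1
        · exact Or.inl h1
        · exact Or.inr ⟨k, ⟨hk0, hk1⟩, rfl⟩
    · refine (hW.2 t).imp_right fun ⟨Y, p, q, c, hc, hfree⟩ => ⟨Y, p, q, c, hc, ?_⟩
      refine hfree.imp (fun hf k hk => ?_)
        fun ⟨hY, hf⟩ => ⟨hY.trans subset_union_left, fun k hk => Or.inl (hf k hk)⟩
      rintro (hkW | ⟨r, hr, e⟩)
      · exact hf k hk hkW
      · have e1 : c k ∈ C (t + 1) := hc.mem_right (by simp only [mem_Ioo] at hk; omega)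
        have e2 : a r ∈ C (s + 1) := ha.mem_right (by simp only [mem_Ioo] at hr; omega)
        rcases lt_or_gt_of_ne hts with hlt | hlt
        · exact ha.notMem r hr (hmono hlt (e ▸ e1))
        · exact hc.notMem k hk (hmono hlt (e ▸ e2))

theorem FreeStep.typ_last_iff {S S' X : Set V} {i j : I} {a : ℕ → V}
    (h : Γ.FreeStep M S S' X i j a) : Γ.typ (a (M i j - 1)) = Γ.typ (a 0) ↔ Odd (M i j) := by
  have h3 := h.three_le
  rw [SimpleGraph.apply_eq_iff_even (fun _ _ => localGraph_adj_typ) h.isPathSeq.adj]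
  obtain ⟨t, ht⟩ : ∃ t, M i j = t + 1 := ⟨M i j - 1, by omega⟩
  rw [ht, Nat.add_sub_cancel, Nat.odd_add_one, Nat.not_odd_iff_even]

/-- A geometry that arises by free steps embeds in every saturated geometry over a closed part of
the first stage. -/
theorem exists_isFreeIn_embedding [Finite I] (hM : M.IsGood) {U : ℕ → Set V} {C : ℕ → Set V'}
    (hU : Γ.IsFreeChain M U) (hUu : ⋃ n, U n = univ) (hΓ : Γ.IsIntermediateOn M univ)
    (hC : Γ'.IsFreeChain M C) (hCu : ⋃ n, C n = univ) (hΓ' : Γ'.IsIntermediateOn M univ)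
    (hsat : Γ'.IsSaturatedOn M univ) {φ₀ : V → V'} (h₀ : IsoOn Γ Γ' φ₀ (U 0))
    (hcl : Γ'.IsClosedIn M (φ₀ '' U 0) (C 0)) :
    ∃ φ, IsoOn Γ Γ' φ univ ∧ EqOn φ₀ φ (U 0) ∧ Γ'.IsFreeIn M (range φ) C := by
  classical
  have hUmono := hU.monotone
  have hstep : ∀ n φ, IsoOn Γ Γ' φ (U n) ∧ Γ'.IsFreeIn M (φ '' U n) C →
      ∃ φ', (IsoOn Γ Γ' φ' (U (n + 1)) ∧ Γ'.IsFreeIn M (φ' '' U (n + 1)) C) ∧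
        (EqOn φ φ' (U n) ∧ φ' '' U (n + 1) ∩ C 0 ⊆ φ '' U n) := by
    rintro n φ ⟨hφ, hfree⟩
    rcases hU n with e | ⟨X, i, j, a, ha⟩
    · exact ⟨φ, e ▸ ⟨hφ, hfree⟩, fun _ _ => rfl, e ▸ inter_subset_left⟩
    have h3 := ha.three_le
    have hXU := ha.subset
    have hXi := (hφ.isTightFlag_image (M := M) hXU).2 ha.tight
    have hlast := ha.typ_last_iff
    rw [← hφ.typ _ ha.first_mem.2, ← hφ.typ _ ha.last_mem.2] at hlast
    -- Saturation supplies a short path between the images of the ends of the step; this will be the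
    -- image of the new path.
    obtain ⟨l, b, hl, hb, hb0, hbl⟩ := hsat (φ '' X) i j (subset_univ _) hXi (φ (a 0))
      ⟨(hφ.mem_localSet_image hXU ha.first_mem.2).2 ha.first_mem.1, mem_univ _⟩
      (φ (a (M i j - 1))) ⟨(hφ.mem_localSet_image hXU ha.last_mem.2).2 ha.last_mem.1, mem_univ _⟩
      hlast
    have hb0' : b 0 ∈ φ '' U n := hb0 ▸ mem_image_of_mem φ ha.first_mem.2
    have hbl' : b l ∈ φ '' U n := hbl ▸ mem_image_of_mem φ ha.last_mem.2
    -- If the short path stayed in the image of `U n`, its preimage would be the path of the step by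
    -- uniqueness of short paths in `Γ`; but the vertex `a 1` is not in `U n`.
    obtain ⟨k₀, hk₀, hk₀W⟩ : ∃ k ≤ l, b k ∉ φ '' U n := by
      by_contra! hcon
      obtain ⟨u, hu, hub⟩ := IsoOn.exists_lift hcon
      have hpath : (Γ'.localGraph (φ '' X) i j (φ '' U n)).IsPathSeq l (φ ∘ u) :=
        (hb.mono fun k hk => ⟨⟨(hb.adj k hk).1.1, hcon k hk.le⟩,
          ⟨(hb.adj k hk).2.1.1, hcon (k + 1) hk⟩, (hb.adj k hk).2.2⟩ :
          (Γ'.localGraph (φ '' X) i j (φ '' U n)).IsPathSeq l b).congr fun k hk => (hub k hk).symm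
      rw [hφ.isPathSeq_image hXU subset_rfl hu] at hpath
      have hP := hΓ.propP i j X (subset_univ _) ha.tight
      obtain ⟨rfl, heq⟩ := hP.path_unique
        (hpath.mono fun k hk => localGraph_mono (subset_univ _) (hpath.adj k hk))
        (ha.isPathSeq.mono fun k hk => localGraph_mono (subset_univ _) (ha.isPathSeq.adj k hk))
        (hφ.inj (hu 0 (Nat.zero_le _)) ha.first_mem.2 (by rw [hub 0 (Nat.zero_le _), hb0]))
        (hφ.inj (hu l le_rfl) ha.last_mem.2 (by rw [hub l le_rfl, hbl])) (by omega)
      exact ha.notMem 1 (by simp only [mem_Ioo]; omega) (heq 1 (by omega) ▸ hu 1 (by omega))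
    -- Since the image so far is free, the path is that of a step of `C` which avoids the image. So
    -- it has the same incidences as the path to be mapped.
    obtain ⟨s, a', ha', hnew, rfl, hba⟩ := hfree.exists_step hM hΓ' hCu hXi (image_mono hXU) hl hb
      hb0' hbl' hk₀ hk₀W
    rw [hba 0 (Nat.zero_le _)] at hb0 hb0'
    rw [hba _ le_rfl] at hbl hbl'
    have hrep := ha'.replace hM hΓ'.propF (image_mono hXU) hb0' hbl' hnew fun k hk w hw hws hi => by
      rw [M.symmetric]
      exact hfree.not_adj hw (hCu ▸ mem_univ _) hws
        (ha'.mem_right (by simp only [mem_Ioo] at hk; omega)) (hnew k hk) (Γ'.symm hi)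
    obtain ⟨φ', hφ', heq, himg⟩ := hφ.exists_extend ha hrep hb0 hbl
    refine ⟨φ', ⟨hφ', himg ▸ hfree.union_of_step ha' (image_mono hXU) hb0' hbl'⟩, heq, ?_⟩
    rw [himg]
    rintro v ⟨hv | ⟨k, hk, rfl⟩, hv0⟩
    · exact hv
    · exact absurd (hC.monotone (Nat.zero_le s) hv0) (ha'.notMem k hk)
  -- The image of `U 0` is contained in `C 0`, so all steps of `C` avoid it.
  have hstart : Γ'.IsFreeIn M (φ₀ '' U 0) C := by
    refine ⟨by rwa [inter_eq_left.2 hcl.subset], fun s => ?_⟩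
    refine (hC s).imp_right fun ⟨X, i, j, a, ha⟩ => ⟨X, i, j, a, ha, Or.inl fun k hk hkW => ?_⟩
    exact ha.notMem k hk (hC.monotone (Nat.zero_le s) (hcl.subset hkW))
  obtain ⟨Φ, hΦ0, hΦ⟩ := exists_nat_seq ⟨h₀, hstart⟩ hstep
  have heq : ∀ n m, n ≤ m → EqOn (Φ n) (Φ m) (U n) := by
    intro n m hnm
    induction m, hnm using Nat.le_induction with
    | base => exact fun _ _ => rfl
    | succ m hm ih => exact fun v hv => (ih hv).trans ((hΦ m).2.1 (hUmono hm hv))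
  have hmem : ∀ v, ∃ n, v ∈ U n := fun v => mem_iUnion.1 (hUu ▸ mem_univ v)
  choose N hN using hmem
  have hφ : ∀ n, EqOn (fun v => Φ (N v) v) (Φ n) (U n) := by
    intro n v hv
    rcases le_total n (N v) with h | h
    · exact (heq _ _ h hv).symm
    · exact heq _ _ h (hN v)
  refine ⟨fun v => Φ (N v) v, ⟨fun u _ v _ e => ?_, fun v _ => (hΦ _).1.1.typ v (hN v),
    fun u _ v _ => ?_⟩, fun v hv => ?_, ?_⟩
  · have hu := hUmono (le_max_left (N u) (N v)) (hN u)
    have hv := hUmono (le_max_right (N u) (N v)) (hN v)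
    exact (hΦ _).1.1.inj hu hv ((hφ _ hu).symm.trans (e.trans (hφ _ hv)))
  · have hu := hUmono (le_max_left (N u) (N v)) (hN u)
    have hv := hUmono (le_max_right (N u) (N v)) (hN v)
    have := (hΦ _).1.1.inc u hu v hv
    rwa [← hφ _ hu, ← hφ _ hv] at this
  · rw [← hΦ0]
    exact (hφ 0 hv).symm
  · have : range (fun v => Φ (N v) v) = ⋃ n, Φ n '' U n := by
      refine Subset.antisymm ?_ (iUnion_subset fun n => ?_)
      · rintro _ ⟨v, rfl⟩
        exact mem_iUnion.2 ⟨N v, v, hN v, rfl⟩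
      · rintro _ ⟨v, hv, rfl⟩
        exact ⟨v, hφ n hv⟩
    rw [this]
    refine IsFreeIn.iUnion (fun n => (hΦ n).1.2) fun n => ?_
    induction n with
    | zero => exact inter_subset_left
    | succ n ih => exact fun v hv => ih ⟨(hΦ n).2.2 hv, hv.2⟩

/-- Saturated closed parts are mapped to closed sets by free embeddings. -/
theorem IsFreeIn.isClosedIn_image [Finite I] (hM : M.IsGood) {C : ℕ → Set V'}
    (hCu : ⋃ n, C n = univ) (hΓ' : Γ'.IsIntermediateOn M univ) {φ : V → V'}
    (hφ : IsoOn Γ Γ' φ univ) (hfree : Γ'.IsFreeIn M (range φ) C) {B : Set V}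
    (hB : Γ.IsClosedIn M B univ) (hsat : Γ.IsSaturatedOn M B) :
    Γ'.IsClosedIn M (φ '' B) univ where
  subset := subset_univ _
  path X i j hX hXt l b hl hb h0 h1 k hk := by
    have hBr : φ '' B ⊆ range φ := image_subset_range φ B
    have hinj : Function.Injective φ := injOn_univ.1 hφ.inj
    by_cases hin : ∀ k ≤ l, b k ∈ φ '' univ
    · rw [← inter_eq_left.2 (hBr)] at h0 h1 ⊢
      have := (hφ.isClosedIn_image (subset_univ _) hB).path X i j hX hXt l b hl
        (hb.mono fun k hk => ⟨⟨(hb.adj k hk).1.1, hin k hk.le⟩,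
          ⟨(hb.adj k hk).2.1.1, hin (k + 1) hk⟩, (hb.adj k hk).2.2⟩) h0.1 h1.1 k hk
      exact ⟨this, hBr this⟩
    · push Not at hin
      obtain ⟨k₀, hk₀, hk₀W⟩ := hin
      rw [image_univ] at hk₀W
      exfalso
      obtain ⟨n, a, ha, hnew, rfl, hba⟩ := hfree.exists_step hM hΓ' hCu hXt (hX.trans hBr) hl hb
        (hBr h0) (hBr h1) hk₀ hk₀W
      obtain ⟨Y, hY, rfl⟩ := subset_image_iff.1 hX
      obtain ⟨x, hx, hx'⟩ := h0
      obtain ⟨y, hy, hy'⟩ := h1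
      have hYt := (hφ.isTightFlag_image (subset_univ _)).1 hXt
      have hlast := ha.typ_last_iff
      have hax := hba 0 (Nat.zero_le _)
      have hay := hba _ le_rfl
      rw [← hax, ← hay, ← hx', ← hy', hφ.typ x (mem_univ _), hφ.typ y (mem_univ _)] at hlast
      have hxl := ha.first_mem.1
      have hyl := ha.last_mem.1
      rw [← hax, ← hx', hφ.mem_localSet_image (subset_univ _) (mem_univ _)] at hxl
      rw [← hay, ← hy', hφ.mem_localSet_image (subset_univ _) (mem_univ _)] at hyl
      -- The ends of the step have the types for which saturation of `B` gives a short path inside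
      -- the image; by uniqueness it coincides with `b`, which leaves the image.
      obtain ⟨l', c, hl', hc, rfl, rfl⟩ := hsat Y i j hY hYt x ⟨hxl, hx⟩ y ⟨hyl, hy⟩ hlast
      have hc' := (hφ.isPathSeq_image (subset_univ _) (subset_univ _) fun _ _ => mem_univ _).2 hc
      obtain ⟨rfl, heq⟩ := (hΓ'.propP i j _ (subset_univ _) hXt).path_unique hb
        (hc'.mono fun k hk => localGraph_mono (subset_univ _) (hc'.adj k hk))
        hx'.symm hy'.symm (by omega)
      exact hk₀W (heq k₀ hk₀ ▸ mem_range_self _)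
  meet := by
    rintro _ ⟨x, hx, rfl⟩ _ ⟨x', hx', rfl⟩ z - hne ht h4 h1 h2
    obtain ⟨w, rfl⟩ := hfree.mem_of_inc_of_inc hCu (mem_range_self x) (mem_range_self x') hne ht h4
      h1 h2
    rw [hφ.typ x (mem_univ _), hφ.typ w (mem_univ _)] at h4
    rw [hφ.typ x (mem_univ _), hφ.typ x' (mem_univ _)] at ht
    exact mem_image_of_mem φ (hB.meet x hx x' hx' w (mem_univ _) (fun e => hne (congrArg φ e)) ht h4
      ((hφ.inc _ (mem_univ _) _ (mem_univ _)).1 h1) ((hφ.inc _ (mem_univ _) _ (mem_univ _)).1 h2))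

theorem IsoOn.isSaturatedOn_image {φ : V → V'} {S A : Set V} (h : IsoOn Γ Γ' φ S) (hAS : A ⊆ S)
    (hA : Γ.IsSaturatedOn M A) : Γ'.IsSaturatedOn M (φ '' A) := by
  rintro X i j hX hXt _ ⟨hx, x, hxA, rfl⟩ _ ⟨hy, y, hyA, rfl⟩ hxy
  obtain ⟨Y, hY, rfl⟩ := subset_image_iff.1 hX
  have hYS := hY.trans hAS
  rw [h.typ x (hAS hxA), h.typ y (hAS hyA)] at hxy
  obtain ⟨l, b, hl, hb, rfl, rfl⟩ := hA Y i j hY ((h.isTightFlag_image hYS).1 hXt) x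
    ⟨(h.mem_localSet_image hYS (hAS hxA)).1 hx, hxA⟩ y
    ⟨(h.mem_localSet_image hYS (hAS hyA)).1 hy, hyA⟩ hxy
  refine ⟨l, φ ∘ b, hl, (h.isPathSeq_image hYS hAS fun k hk => ?_).2 hb, rfl, rfl⟩
  rcases hk.lt_or_eq with hk | rfl
  · exact hAS (hb.adj k hk).1.2
  · exact hAS hyA

end IncGeometry

/-! ### Exhaustive application of Procedure B -/

namespace IncGeometry

variable {I V V' : Type} {Γ : IncGeometry I V} {Γ' : IncGeometry I V'} {M : CoxeterMatrix I}

/-- The geometry with given types in which vertices of adjacent types are incident as prescribed by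
a relation, and vertices of distinct non-adjacent types are always incident. -/
def ofRel (M : CoxeterMatrix I) (t : V → I) (R : V → V → Prop) : IncGeometry I V where
  typ := t
  inc u v := u = v ∨ M (t u) (t v) = 2 ∨ (3 ≤ M (t u) (t v) ∧ (R u v ∨ R v u))
  symm {u v} h := by
    rw [M.symmetric (t v) (t u), or_comm (a := R v u), eq_comm]
    exact h
  inc_iff_eq {u v} h := by
    refine ⟨?_, Or.inl⟩
    rintro (e | e | e)
    · exact e
    · rw [h] at e; simp at e
    · rw [h] at e; simp at e

theorem ofRel_propFOn (t : V → I) (R : V → V → Prop) (S : Set V) : (ofRel M t R).PropFOn M S :=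
  fun _ _ _ _ h => Or.inr (Or.inl h)

theorem IsoOn.localGraph_eq {Γ' : IncGeometry I V} {S X : Set V} (h : IsoOn Γ Γ' id S)
    (hX : X ⊆ S) (i j : I) : Γ'.localGraph X i j S = Γ.localGraph X i j S := by
  have := fun {u v : V} => h.adj_image (u := u) (v := v) (i := i) (j := j) hX subset_rfl
  rw [image_id, image_id] at this
  ext u v
  exact ⟨fun huv => (this huv.1.2 huv.2.1.2).1 huv, fun huv => (this huv.1.2 huv.2.1.2).2 huv⟩

theorem exists_short_path {S X : Set V} {i j : I} {x y : V}
    (hxy : Γ.typ y = Γ.typ x ↔ Odd (M i j))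
    (hlt : ¬ (M i j : ℕ∞) + 1 ≤ (Γ.localGraph X i j S).edist x y) :
    ∃ l b, l < M i j ∧ (Γ.localGraph X i j S).IsPathSeq l b ∧ b 0 = x ∧ b l = y := by
  rw [not_le] at hlt
  obtain ⟨l, b, hl, hb, rfl, rfl⟩ :=
    SimpleGraph.exists_isPathSeq_of_edist_lt (m := M i j + 1) (by exact_mod_cast hlt)
  refine ⟨l, b, ?_, hb, rfl, rfl⟩
  have e1 := SimpleGraph.apply_eq_iff_even (fun _ _ => localGraph_adj_typ) hb.adj
  rw [hxy] at e1
  have : l ≠ M i j := by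
    rintro rfl
    rw [← Nat.not_even_iff_odd] at e1
    tauto
  omega

/-- A path can be added freely on unused vertices. -/
theorem exists_freeStep [Infinite V] (hM : M.IsGood) {S X : Set V} {i j : I} {x y : V}
    (hS : S.Finite) (hF : Γ.PropFOn M S) (hXS : X ⊆ S) (hX : Γ.IsTightFlag M X i j)
    (hx : x ∈ Γ.localSet X i j ∩ S) (hy : y ∈ Γ.localSet X i j ∩ S) (hne : x ≠ y)
    (hxy : Γ.typ y = Γ.typ x ↔ Odd (M i j)) :
    ∃ (Γ' : IncGeometry I V) (S' : Set V) (a : ℕ → V), Γ'.FreeStep M S S' X i j a ∧ a 0 = x ∧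
      a (M i j - 1) = y ∧ IsoOn Γ Γ' id S := by
  classical
  have h3 := hX.adj
  have h3' : 3 ≤ M j i := M.symmetric i j ▸ h3
  -- All geometries live on the same set `V`. The vertices outside `S` are a supply of new ones,
  -- whose previous incidences are discarded and whose types can be reassigned.
  let ν : ℕ ↪ ↥Sᶜ := hS.infinite_compl.natEmbedding
  have hν : ∀ k, (ν k : V) ∉ S := fun k => (ν k).2
  have hνinj : ∀ k l, (ν k : V) = ν l → k = l := fun k l e => ν.injective (Subtype.ext e)
  obtain ⟨o, hoj, hox, hij⟩ : ∃ o, (o = i ∨ o = j) ∧ o ≠ Γ.typ x ∧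
      ∀ t, t = i ∨ t = j ↔ t = Γ.typ x ∨ t = o := by
    have hne := M.ne_of_three_le h3
    rcases hx.1.2 with e | e
    · exact ⟨j, Or.inr rfl, by rw [e]; exact hne.symm, fun t => by rw [e]⟩
    · exact ⟨i, Or.inl rfl, by rw [e]; exact hne, fun t => by rw [e, or_comm]⟩
  have h3o : 3 ≤ M (Γ.typ x) o ∧ 3 ≤ M o (Γ.typ x) := by
    rcases hoj with rfl | rfl <;> rcases hx.1.2 with e | e <;> rw [e] at hox ⊢ <;>
      first | exact absurd rfl hox | exact ⟨h3, h3'⟩ | exact ⟨h3', h3⟩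
  let a : ℕ → V := fun k => if k = 0 then x else if k = M i j - 1 then y else ν k
  have ha0 : a 0 = x := rfl
  have ha1 : a (M i j - 1) = y := by
    simp only [a, if_neg (show M i j - 1 ≠ 0 by omega), if_true]
  have hak : ∀ k ∈ Ioo 0 (M i j - 1), a k = ν k := fun k hk => by
    simp only [mem_Ioo] at hk
    simp only [a, if_neg (show k ≠ 0 by omega), if_neg (show k ≠ M i j - 1 by omega)]
  -- The types alternate, beginning with that of `x`; by `hxy` this agrees with the type of `y` at
  -- the other end.
  let t : ℕ → I := fun k => if Even k then Γ.typ x else o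
  let t' : V → I := fun v => if h : ∃ k, (ν k : V) = v then t h.choose else Γ.typ v
  have ht'S : ∀ v ∈ S, t' v = Γ.typ v := fun v hv => dif_neg fun ⟨k, hk⟩ => hν k (hk ▸ hv)
  have ht'ν : ∀ k, t' (ν k) = t k := fun k => by
    have hex : ∃ l, (ν l : V) = ν k := ⟨k, rfl⟩
    simp only [t', dif_pos hex]
    rw [hνinj _ _ hex.choose_spec]
  have ht'a : ∀ k ≤ M i j - 1, t' (a k) = t k := by
    intro k hk
    rcases Nat.eq_zero_or_pos k with rfl | hk0
    · rw [ha0, ht'S x hx.2]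
      simp [t]
    · rcases hk.eq_or_lt with rfl | hk1
      · rw [ha1, ht'S y hy.2]
        have he : Even (M i j - 1) ↔ Odd (M i j) := by
          obtain ⟨t, ht⟩ : ∃ t, M i j = t + 1 := ⟨M i j - 1, by omega⟩
          rw [ht, Nat.add_sub_cancel, Nat.odd_add_one, Nat.not_odd_iff_even]
        have := (hij (Γ.typ y)).1 hy.1.2
        simp only [t]
        split_ifs with hc
        · exact hxy.2 (he.1 hc)
        · exact this.resolve_left fun e => hc (he.2 (hxy.1 e))
      · rw [hak k ⟨hk0, hk1⟩, ht'ν]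
  have htij : ∀ k, t k = i ∨ t k = j := fun k => by
    rw [hij]
    simp only [t]
    split_ifs <;> simp
  have htadj : ∀ k, 3 ≤ M (t k) (t (k + 1)) ∧ 3 ≤ M (t (k + 1)) (t k) := fun k => by
    simp only [t, Nat.even_add_one]
    by_cases hk : Even k <;> simp [hk, h3o]
  have hainj : InjOn a (Iic (M i j - 1)) := by
    intro k hk l hl e
    simp only [mem_Iic] at hk hl
    simp only [a] at e
    split_ifs at e <;>
      first | omega | exact absurd e hne | exact absurd e.symm hne |
        exact absurd (e ▸ hx.2) (hν _) | exact absurd (e ▸ hy.2) (hν _) | exact hνinj _ _ e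
  have haS : ∀ k ∈ Ioo 0 (M i j - 1), a k ∉ S := fun k hk => hak k hk ▸ hν k
  let R : V → V → Prop := fun u v => (u ∈ S ∧ v ∈ S ∧ Γ.inc u v) ∨
    ∃ k ∈ Ioo 0 (M i j - 1), u = a k ∧ (v = a (k - 1) ∨ v = a (k + 1) ∨ v ∈ X)
  have hiso : IsoOn Γ (ofRel M t' R) id S := by
    refine ⟨injOn_id S, ht'S, fun u hu v hv => ?_⟩
    change (u = v ∨ M (t' u) (t' v) = 2 ∨ (3 ≤ M (t' u) (t' v) ∧ (R u v ∨ R v u))) ↔ _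
    rw [ht'S u hu, ht'S v hv]
    constructor
    · rintro (rfl | e | ⟨-, (e | ⟨k, hk, rfl, -⟩) | (e | ⟨k, hk, rfl, -⟩)⟩)
      · exact Γ.inc_self _
      · exact hF u hu v hv e
      · exact e.2.2
      · exact absurd hu (haS k hk)
      · exact Γ.symm e.2.2
      · exact absurd hv (haS k hk)
    · intro e
      by_cases ht : Γ.typ u = Γ.typ v
      · exact Or.inl ((Γ.inc_iff_eq ht).1 e)
      · rcases hM.eq_two_or ht with h2 | h2
        · exact Or.inr (Or.inl h2)
        · exact Or.inr (Or.inr ⟨h2, Or.inl (Or.inl ⟨hu, hv, e⟩)⟩)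
  have hXt : (ofRel M t' R).IsTightFlag M X i j := by
    have := (hiso.isTightFlag_image (M := M) (i := i) (j := j) hXS).2 hX
    rwa [image_id] at this
  have hloc : ∀ v ∈ S, v ∈ Γ.localSet X i j → v ∈ (ofRel M t' R).localSet X i j := by
    intro v hv hv'
    have := (hiso.mem_localSet_image hXS hv).2 hv'
    rwa [image_id] at this
  refine ⟨ofRel M t' R, S ∪ a '' Ioo 0 (M i j - 1), a, ⟨hXt, hXS, ?_, ?_, rfl, haS, hainj,
    fun k hk => ?_, fun k hk => ?_, fun k hk w hw hwne => ?_⟩, ha0, ha1, hiso⟩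
  · exact ⟨hloc x hx.2 hx.1, hx.2⟩
  · rw [ha1]
    exact ⟨hloc y hy.2 hy.1, hy.2⟩
  · change t' (a k) = i ∨ t' (a k) = j
    rw [ht'a k (by omega)]
    exact htij k
  · change t' (a k) ≠ t' (a (k + 1))
    rw [ht'a k (by omega), ht'a (k + 1) (by omega)]
    exact M.ne_of_three_le (htadj k).1
  · have hk' := hk
    simp only [mem_Ioo] at hk'
    change (a k = w ∨ M (t' (a k)) (t' w) = 2 ∨
      (3 ≤ M (t' (a k)) (t' w) ∧ (R (a k) w ∨ R w (a k)))) ↔ _ ∨ _ ∨ _ ∨ M (t' (a k)) (t' w) = 2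
    constructor
    · rintro (e | e | ⟨-, (e | ⟨l, hl, e, h⟩) | (e | ⟨l, hl, rfl, h⟩)⟩)
      · exact absurd e.symm hwne
      · exact Or.inr (Or.inr (Or.inr e))
      · exact absurd e.1 (haS k hk)
      · obtain rfl := hainj (show k ∈ Iic _ from hk.2.le) (show l ∈ Iic _ from hl.2.le) e
        tauto
      · exact absurd e.2.1 (haS k hk)
      · simp only [mem_Ioo] at hl
        rcases h with e | e | e
        · have := hainj (show k ∈ Iic _ from hk.2.le)
            (show l - 1 ∈ Iic _ by simp only [mem_Iic]; omega) e
          exact Or.inr (Or.inl (congrArg a (by omega)))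
        · have := hainj (show k ∈ Iic _ from hk.2.le)
            (show l + 1 ∈ Iic _ by simp only [mem_Iic]; omega) e
          exact Or.inl (congrArg a (by omega))
        · exact absurd (hXS e) (haS k hk)
    · rintro (rfl | rfl | e | e)
      · refine Or.inr (Or.inr ⟨?_, Or.inl (Or.inr ⟨k, hk, rfl, Or.inl rfl⟩)⟩)
        rw [ht'a k (by omega), ht'a (k - 1) (by omega)]
        have := (htadj (k - 1)).2
        rwa [show k - 1 + 1 = k by omega] at this
      · refine Or.inr (Or.inr ⟨?_, Or.inl (Or.inr ⟨k, hk, rfl, Or.inr (Or.inl rfl)⟩)⟩)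
        rw [ht'a k (by omega), ht'a (k + 1) (by omega)]
        exact (htadj k).1
      · have hne' : t' (a k) ≠ t' w := by
          rw [ht'a k (by omega), ht'S w (hXS e)]
          have := hX.typ_ne w e
          rcases htij k with h | h <;> rw [h]
          · exact this.1.symm
          · exact this.2.symm
        rcases hM.eq_two_or hne' with h2 | h2
        · exact Or.inr (Or.inl h2)
        · exact Or.inr (Or.inr ⟨h2, Or.inl (Or.inr ⟨k, hk, rfl, Or.inr (Or.inr e)⟩)⟩)
      · exact Or.inr (Or.inl e)

theorem IsoOn.trans {V'' : Type} {Γ'' : IncGeometry I V''} {φ : V → V'} {ψ : V' → V''} {S : Set V}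
    (h : IsoOn Γ Γ' φ S) (h' : IsoOn Γ' Γ'' ψ (φ '' S)) : IsoOn Γ Γ'' (ψ ∘ φ) S where
  inj := h'.inj.comp h.inj (mapsTo_image φ S)
  typ v hv := (h'.typ _ (mem_image_of_mem φ hv)).trans (h.typ v hv)
  inc u hu v hv := (h'.inc _ (mem_image_of_mem φ hu) _ (mem_image_of_mem φ hv)).trans
    (h.inc u hu v hv)

theorem isoOn_id (S : Set V) : IsoOn Γ Γ id S := ⟨injOn_id S, fun _ _ => rfl, fun _ _ _ _ => Iff.rfl⟩

/-- The limit of a chain of geometries, each of which extends the previous one. -/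
theorem exists_limit (G : ℕ → IncGeometry I V) {S : ℕ → Set V} (hS : Monotone S)
    (h : ∀ n, IsoOn (G n) (G (n + 1)) id (S n)) :
    ∃ Γ : IncGeometry I V, ∀ n, IsoOn (G n) Γ id (S n) := by
  classical
  have hmn : ∀ n m, n ≤ m → IsoOn (G n) (G m) id (S n) := by
    intro n m hnm
    induction m, hnm using Nat.le_induction with
    | base => exact isoOn_id _
    | succ m hm ih => exact ih.trans (by rw [image_id]; exact (h m).mono (hS hm))
  have htyp : ∀ n m v, v ∈ S n → v ∈ S m → (G n).typ v = (G m).typ v := by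
    intro n m v hn hm
    rcases le_total n m with hnm | hnm
    · exact ((hmn n m hnm).typ v hn).symm
    · exact (hmn m n hnm).typ v hm
  have hinc : ∀ n m u v, u ∈ S n → v ∈ S n → u ∈ S m → v ∈ S m →
      ((G n).inc u v ↔ (G m).inc u v) := by
    intro n m u v hn hn' hm hm'
    rcases le_total n m with hnm | hnm
    · exact ((hmn n m hnm).inc u hn v hn').symm
    · exact (hmn m n hnm).inc u hm v hm'
  let t : V → I := fun v => if h : ∃ n, v ∈ S n then (G h.choose).typ v else (G 0).typ v
  have ht : ∀ n v, v ∈ S n → t v = (G n).typ v := by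
    intro n v hv
    have hex : ∃ n, v ∈ S n := ⟨n, hv⟩
    simp only [t, dif_pos hex]
    exact htyp _ _ _ hex.choose_spec hv
  refine ⟨⟨t, fun u v => u = v ∨ ∃ n, u ∈ S n ∧ v ∈ S n ∧ (G n).inc u v, ?_, ?_⟩,
    fun n => ⟨injOn_id _, fun v hv => ht n v hv, fun u hu v hv => ?_⟩⟩
  · rintro u v (e | ⟨n, hu, hv, e⟩)
    · exact Or.inl e.symm
    · exact Or.inr ⟨n, hv, hu, (G n).symm e⟩
  · intro u v e
    refine ⟨?_, Or.inl⟩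
    rintro (e' | ⟨n, hu, hv, e'⟩)
    · exact e'
    · rw [ht n u hu, ht n v hv] at e
      exact ((G n).inc_iff_eq e).1 e'
  · change (u = v ∨ _) ↔ _
    constructor
    · rintro (rfl | ⟨m, hu', hv', e⟩)
      · exact (G n).inc_self _
      · exact (hinc m n u v hu' hv' hu hv).1 e
    · exact fun e => Or.inr ⟨n, hu, hv, e⟩

/-- Procedure B can be applied exhaustively. -/
theorem exists_saturated_chain [Finite I] [Infinite V] [Countable V] (hM : M.IsGood) {S : Set V}
    (hS : S.Finite) (hΓ : Γ.IsIntermediateOn M S) :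
    ∃ (Γ' : IncGeometry I V) (C : ℕ → Set V), C 0 = S ∧ IsoOn Γ Γ' id S ∧ Γ'.IsFreeChain M C ∧
      Γ'.IsIntermediateOn M (⋃ n, C n) ∧ Γ'.IsSaturatedOn M (⋃ n, C n) := by
  classical
  have : Nonempty (Finset V × I × I × V × V) := by
    obtain ⟨v⟩ : Nonempty V := inferInstance
    exact ⟨(∅, Γ.typ v, Γ.typ v, v, v)⟩
  -- Task `t` is treated at all stages `Nat.pair t n`, and for large `n` such a stage contains the
  -- data of the task.
  obtain ⟨task, htask⟩ := exists_surjective_nat (Finset V × I × I × V × V)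
  let P : ℕ → IncGeometry I V × Set V → Prop := fun _ p => p.2.Finite ∧ p.1.IsIntermediateOn M p.2
  let R : ℕ → IncGeometry I V × Set V → IncGeometry I V × Set V → Prop := fun n p q =>
    IsoOn p.1 q.1 id p.2 ∧ p.2 ⊆ q.2 ∧ (q.2 = p.2 ∨ ∃ X i j a, q.1.FreeStep M p.2 q.2 X i j a) ∧
      ∀ (X : Finset V) (i j : I) (x y : V), task n.unpair.1 = (X, i, j, x, y) → (X : Set V) ⊆ p.2 →
        p.1.IsTightFlag M X i j → x ∈ p.1.localSet X i j ∩ p.2 → y ∈ p.1.localSet X i j ∩ p.2 →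
        (p.1.typ y = p.1.typ x ↔ Odd (M i j)) →
        ∃ l b, l < M i j ∧ (q.1.localGraph X i j q.2).IsPathSeq l b ∧ b 0 = x ∧ b l = y
  have hstep : ∀ n p, P n p → ∃ q, P (n + 1) q ∧ R n p q := by
    rintro n ⟨G, T⟩ ⟨hT, hG⟩
    rcases ht : task n.unpair.1 with ⟨X, i, j, x, y⟩
    by_cases hv : (X : Set V) ⊆ T ∧ G.IsTightFlag M X i j ∧ x ∈ G.localSet X i j ∩ T ∧
      y ∈ G.localSet X i j ∩ T ∧ (G.typ y = G.typ x ↔ Odd (M i j)) ∧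
      (M i j : ℕ∞) + 1 ≤ (G.localGraph X i j T).edist x y
    · obtain ⟨hXT, hX, hx, hy, hxy, hd⟩ := hv
      have hne : x ≠ y := by
        rintro rfl
        rw [SimpleGraph.edist_self] at hd
        simp at hd
      obtain ⟨G', T', a, ha, rfl, rfl, hiso⟩ :=
        exists_freeStep hM hT hG.propF hXT hX hx hy hne hxy
      have h3 := ha.three_le
      have hG' : G'.IsIntermediateOn M T := by
        have := hiso.isIntermediateOn_image.2 hG
        rwa [image_id] at this
      refine ⟨(G', T'), ⟨?_, ha.isIntermediateOn hM ?_ hG'⟩, hiso, ha.subset_right,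
        Or.inr ⟨X, i, j, a, ha⟩, fun X' i' j' x' y' e _ _ _ _ _ => ?_⟩
      · change T'.Finite
        rw [ha.eq_union]
        exact hT.union ((finite_Ioo _ _).image a)
      · rw [hiso.localGraph_eq hXT]
        exact hd
      · simp only [ht, Prod.mk.injEq] at e
        obtain ⟨rfl, rfl, rfl, rfl, rfl⟩ := e
        exact ⟨M i j - 1, a, by omega, ha.isPathSeq, rfl, rfl⟩
    · refine ⟨(G, T), ⟨hT, hG⟩, isoOn_id _, subset_rfl, Or.inl rfl,
        fun X' i' j' x' y' e hXT hX hx hy hxy => ?_⟩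
      simp only [ht, Prod.mk.injEq] at e
      obtain ⟨rfl, rfl, rfl, rfl, rfl⟩ := e
      exact exists_short_path hxy fun hd => hv ⟨hXT, hX, hx, hy, hxy, hd⟩
  obtain ⟨F, hF0, hF⟩ := exists_nat_seq (x := (Γ, S)) ⟨hS, hΓ⟩ hstep
  have hmono : Monotone fun n => (F n).2 := monotone_nat_of_le_succ fun n => (hF n).2.2.1
  obtain ⟨Γ', hΓ'⟩ := exists_limit (fun n => (F n).1) hmono fun n => (hF n).2.1
  refine ⟨Γ', fun n => (F n).2, by simp only [hF0], by simpa only [hF0] using hΓ' 0, fun n => ?_,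
    isIntermediateOn_iUnion hmono fun n => ?_, fun X i j hX hXt x hx y hy hxy => ?_⟩
  · refine (hF n).2.2.2.1.imp_right fun ⟨X, i, j, a, ha⟩ => ⟨X, i, j, a, ?_⟩
    have := (hΓ' (n + 1)).freeStep_image subset_rfl ha
    simpa only [image_id, Function.id_comp] using this
  · have := (hΓ' n).isIntermediateOn_image.2 (hF n).1.2
    rwa [image_id] at this
  · have hXfin := hXt.isFlag.finite
    -- The stage `Nat.pair t n` is at least `n`, so it contains the flag and both vertices, and its
    -- task is to join them.
    obtain ⟨n, hn⟩ := (hXfin.union (toFinite {x, y})).exists_subset_of_monotone hmono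
      (union_subset hX (by rintro _ (rfl | rfl); exacts [hx.2, hy.2]))
    obtain ⟨t, ht⟩ := htask (hXfin.toFinset, i, j, x, y)
    have hr : n ≤ Nat.pair t n := Nat.right_le_pair t n
    obtain ⟨hXr, hxr⟩ := union_subset_iff.1 (hn.trans (hmono hr))
    have hxr' : x ∈ (F (Nat.pair t n)).2 := hxr (by simp)
    have hyr' : y ∈ (F (Nat.pair t n)).2 := hxr (by simp)
    have hiso := hΓ' (Nat.pair t n)
    have hloc : ∀ v ∈ (F (Nat.pair t n)).2, v ∈ Γ'.localSet X i j →
        v ∈ (F (Nat.pair t n)).1.localSet X i j := by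
      intro v hv hv'
      refine (hiso.mem_localSet_image (i := i) (j := j) hXr hv).1 ?_
      rwa [image_id]
    obtain ⟨l, b, hl, hb, h0, h1⟩ := (hF (Nat.pair t n)).2.2.2.2 hXfin.toFinset i j x y
      (by rw [Nat.unpair_pair]; exact ht) (by rwa [hXfin.coe_toFinset])
      (by
        rw [hXfin.coe_toFinset]
        refine (hiso.isTightFlag_image hXr).1 ?_
        rwa [image_id])
      (by rw [hXfin.coe_toFinset]; exact ⟨hloc x hxr' hx.1, hxr'⟩)
      (by rw [hXfin.coe_toFinset]; exact ⟨hloc y hyr' hy.1, hyr'⟩)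
      (by rw [← hxy, ← hiso.typ x hxr', ← hiso.typ y hyr']; rfl)
    rw [hXfin.coe_toFinset] at hb
    have hXr' := hXr.trans (hmono (Nat.le_succ _))
    refine ⟨l, b, hl, ?_, h0, h1⟩
    have hbS : ∀ k ≤ l, b k ∈ (F (Nat.pair t n + 1)).2 := by
      intro k hk
      rcases hk.lt_or_eq with hk | rfl
      · exact (hb.adj k hk).1.2
      · exact hmono (Nat.le_succ _) (h1 ▸ hyr')
    have := ((hΓ' (Nat.pair t n + 1)).isPathSeq_image hXr' subset_rfl hbS).2 hb
    simp only [image_id, Function.id_comp] at this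
    exact this.mono fun k hk => localGraph_mono (subset_iUnion (fun n => (F n).2) _) (this.adj k hk)

end IncGeometry

/-! ### Ample finite geometries -/

namespace IncGeometry

variable {I V V' : Type} {Γ : IncGeometry I V} {Γ' : IncGeometry I V'} {M : CoxeterMatrix I}

/-- Vertices with at most one neighbour that is not prescribed by (F) can be added freely. -/
theorem IsIntermediateOn.extend_pendant {S : Set V} (hF : Γ.PropFOn M univ)
    (hS : Γ.IsIntermediateOn M S) (hp : ∀ v ∉ S, ∀ u u', Γ.inc v u → Γ.inc v u' →
      3 ≤ M (Γ.typ v) (Γ.typ u) → 3 ≤ M (Γ.typ v) (Γ.typ u') → u = u') :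
    Γ.IsIntermediateOn M univ ∧ Γ.IsClosedIn M S univ := by
  have hp' : ∀ v u u', Γ.inc u v → Γ.inc u' v → 3 ≤ M (Γ.typ u) (Γ.typ v) →
      3 ≤ M (Γ.typ u') (Γ.typ v) → u ≠ u' → v ∈ S := by
    intro v u u' h1 h2 h3 h4 hne
    rw [M.symmetric] at h3 h4
    by_contra hv
    exact hne (hp v hv u u' (Γ.symm h1) (Γ.symm h2) h3 h4)
  have hadj : ∀ {X : Set V} {i j : I}, Γ.IsTightFlag M X i j → ∀ v u u',
      (Γ.localGraph X i j univ).Adj u v → (Γ.localGraph X i j univ).Adj u' v → u ≠ u' → v ∈ S :=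
    fun hX v u u' h1 h2 => hp' v u u' h1.2.2.2 h2.2.2.2 (hX.adj_typ h1) (hX.adj_typ h2)
  refine ⟨⟨hF, fun i j X _ hX n v hv => ?_, fun x _ x' _ z _ z' _ ht ht' h4 h1 h2 h3 h5 => ?_⟩,
    ⟨subset_univ _, fun X i j _ hX l b _ hb h0 h1 k hk => ?_,
      fun x hx x' hx' z _ hne ht h4 h1 h2 =>
        hp' z x x' h1 h2 (by omega) (by rw [← ht]; omega) hne⟩⟩
  · have hvS : ∀ k, v k ∈ S := by
      intro k
      have h3 := hv.three_le
      rw [← hv.periodic, show k + n = k + n - 1 + 1 by omega]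
      exact hadj hX _ _ _ (hv.adj (k + n - 1)) (hv.adj (k + n - 1 + 1)).symm
        (hv.add_two_ne (k + n - 1)).symm
    have hXS : X ⊆ S := by
      intro x hx
      have hinc : ∀ k, Γ.inc (v k) x := fun k => Γ.symm ((hv.adj k).1.1.1.2 x hx)
      have key : ∀ i j, Γ.IsTightFlag M X i j →
          (∀ k, (Γ.localGraph X i j univ).Adj (v k) (v (k + 1))) → 3 ≤ M (Γ.typ x) i → x ∈ S := by
        intro i j hX hadj hxi
        obtain ⟨k, hk⟩ : ∃ k, Γ.typ (v k) = i := by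
          by_cases e : Γ.typ (v 0) = i
          · exact ⟨0, e⟩
          · refine ⟨1, ?_⟩
            have := localGraph_adj_typ (hadj 0)
            simp only [Nat.zero_add] at this
            grind
        have hk2 : Γ.typ (v (k + 2)) = i := by
          have h1 := localGraph_adj_typ (hadj k)
          have := localGraph_adj_typ (hadj (k + 1))
          grind
        rw [M.symmetric] at hxi
        exact hp' x _ _ (hinc k) (hinc (k + 2)) (hk ▸ hxi) (hk2 ▸ hxi) (hv.add_two_ne k).symm
      rcases hX.typ_adj x hx with c | c
      · exact key i j hX hv.adj c
      · exact key j i hX.symm (fun k => localGraph_comm X i j _ ▸ hv.adj k) c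
    exact hS.propP i j X hXS hX n v (hv.mono fun k => ⟨⟨(hv.adj k).1.1, hvS k⟩,
      ⟨(hv.adj k).2.1.1, hvS (k + 1)⟩, (hv.adj k).2.2⟩)
  · by_contra! hcon
    obtain ⟨hne, hne'⟩ := hcon
    have h4' := M.symmetric (Γ.typ x) (Γ.typ z) ▸ h4
    exact (hS.propD x (hp' x z z' (Γ.symm h1) (Γ.symm h2) (by omega) (by rw [← ht']; omega) hne')
      x' (hp' x' z z' (Γ.symm h3) (Γ.symm h5) (by rw [← ht]; omega)
        (by rw [← ht, ← ht']; omega) hne')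
      z (hp' z x x' h1 h3 (by omega) (by rw [← ht]; omega) hne)
      z' (hp' z' x x' h2 h5 (by rw [← ht']; omega) (by rw [← ht, ← ht']; omega) hne)
      ht ht' h4 h1 h2 h3 h5).elim hne hne'
  · rcases Nat.eq_zero_or_pos k with rfl | hk0
    · exact h0
    · rcases hk.eq_or_lt with rfl | hk1
      · exact h1
      · have e := hb.adj (k - 1) (by omega)
        rw [show k - 1 + 1 = k by omega] at e
        refine hadj hX _ _ _ e (hb.adj k hk1).symm fun e => ?_
        have := hb.inj (show k - 1 ∈ Iic l by simp; omega) (show k + 1 ∈ Iic l by simp; omega) e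
        omega

/-- Conditions on a finite intermediate geometry which guarantee that Procedure B leads to a
geometry of type `M`: there are many vertices of each type, isolated if `p t` is not adjacent to
`t`, and otherwise every vertex of type `t` is incident with a vertex of type `p t`. -/
structure IsAmpleOn (Γ : IncGeometry I V) (M : CoxeterMatrix I) (p : I → I) (R : I → Set V)
    (S : Set V) : Prop where
  subset : ∀ t, R t ⊆ S
  typ : ∀ t, ∀ r ∈ R t, Γ.typ r = t
  card : ∀ t, 12 ≤ (R t).encard
  isolated : ∀ t, ¬ 3 ≤ M t (p t) → ∀ r ∈ R t, ∀ u ∈ S, 3 ≤ M t (Γ.typ u) → ¬ Γ.inc r u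
  exists_inc : ∀ v ∈ S, 3 ≤ M (Γ.typ v) (p (Γ.typ v)) →
    ∃ w ∈ S, Γ.typ w = p (Γ.typ v) ∧ Γ.inc v w

theorem IsAmpleOn.image {p : I → I} {R : I → Set V} {S : Set V} {φ : V → V'}
    (hφ : IsoOn Γ Γ' φ S) (h : Γ.IsAmpleOn M p R S) :
    Γ'.IsAmpleOn M p (fun t => φ '' R t) (φ '' S) where
  subset t := image_mono (h.subset t)
  typ t := by
    rintro _ ⟨r, hr, rfl⟩
    rw [hφ.typ r (h.subset t hr), h.typ t r hr]
  card t := by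
    rw [(hφ.inj.mono (h.subset t)).encard_image]
    exact h.card t
  isolated t ht := by
    rintro _ ⟨r, hr, rfl⟩ _ ⟨u, hu, rfl⟩
    rw [hφ.typ u hu, hφ.inc r (h.subset t hr) u hu]
    exact h.isolated t ht r hr u hu
  exists_inc := by
    rintro _ ⟨v, hv, rfl⟩
    rw [hφ.typ v hv]
    intro h3
    obtain ⟨w, hw, ht, hi⟩ := h.exists_inc v hv h3
    exact ⟨_, mem_image_of_mem φ hw, (hφ.typ w hw).trans ht, (hφ.inc v hv w hw).2 hi⟩

/-- Add twelve vertices of each type, and then for every vertex `a` a partner in the right copy, of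
type `p` of the type of `a`, which is incident with `a` if the types are adjacent. A vertex outside
`D` has at most one neighbour not prescribed by (F), so `extend_pendant` applies. By `hp`, a partner
that needs a neighbour of its own has it in `a`. -/
theorem exists_ample {D : Type} (hM : M.IsGood) {Γ₀ : IncGeometry I D}
    (h₀ : Γ₀.IsIntermediateOn M univ) {p : I → I}
    (hp : ∀ t, 3 ≤ M (p t) (p (p t)) → p (p t) = t) :
    ∃ (Γ : IncGeometry I ((D ⊕ I × Fin 12) ⊕ (D ⊕ I × Fin 12)))
      (e : D → (D ⊕ I × Fin 12) ⊕ (D ⊕ I × Fin 12)) (R : I → Set _),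
      IsoOn Γ₀ Γ e univ ∧ Γ.IsIntermediateOn M univ ∧ Γ.IsClosedIn M (range e) univ ∧
        Γ.IsAmpleOn M p R univ := by
  let tA : D ⊕ I × Fin 12 → I := Sum.elim Γ₀.typ Prod.fst
  let t : (D ⊕ I × Fin 12) ⊕ (D ⊕ I × Fin 12) → I := Sum.elim tA (p ∘ tA)
  let rel : (D ⊕ I × Fin 12) ⊕ (D ⊕ I × Fin 12) → (D ⊕ I × Fin 12) ⊕ (D ⊕ I × Fin 12) → Prop
    | .inl (.inl u), .inl (.inl v) => Γ₀.inc u v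
    | .inl u, .inr v => u = v
    | _, _ => False
  have hnb : ∀ v u, (∀ d, v ≠ .inl (.inl d)) → 3 ≤ M (t v) (t u) → (ofRel M t rel).inc v u →
      (∃ a, v = .inl a ∧ u = .inr a) ∨ ∃ a, v = .inr a ∧ u = .inl a := by
    rintro v u hv h3 (rfl | h | ⟨-, h⟩)
    · simp at h3
    · omega
    · rcases v with (v | v) | (v | v)
      · exact absurd rfl (hv v)
      all_goals rcases u with (u | u) | (u | u) <;> simp [rel] at h; simp [h]
  have hiso : IsoOn Γ₀ (ofRel M t rel) (Sum.inl ∘ Sum.inl) univ := by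
    refine ⟨(Sum.inl_injective.comp Sum.inl_injective).injOn, fun _ _ => rfl, fun u _ v _ => ?_⟩
    constructor
    · rintro (e | e | ⟨-, e | e⟩)
      · rw [Sum.inl_injective (Sum.inl_injective e)]
        exact Γ₀.inc_self _
      · exact h₀.propF u (mem_univ _) v (mem_univ _) e
      · exact e
      · exact Γ₀.symm e
    · intro e
      by_cases ht : Γ₀.typ u = Γ₀.typ v
      · rw [(Γ₀.inc_iff_eq ht).1 e]
        exact inc_self _
      · rcases hM.eq_two_or ht with h2 | h2
        · exact Or.inr (Or.inl h2)
        · exact Or.inr (Or.inr ⟨h2, Or.inl e⟩)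
  have hpend := IsIntermediateOn.extend_pendant (ofRel_propFOn t rel univ)
    (hiso.isIntermediateOn_image.2 h₀) fun v hv u u' h1 h2 h3 h4 => by
      have hv' : ∀ d, v ≠ .inl (.inl d) := fun d e => hv ⟨d, mem_univ _, e.symm⟩
      rcases hnb v u hv' h3 h1 with ⟨a, rfl, rfl⟩ | ⟨a, rfl, rfl⟩ <;>
        rcases hnb _ u' hv' h4 h2 with ⟨b, e, rfl⟩ | ⟨b, e, rfl⟩ <;> cases e <;> rfl
  rw [image_univ] at hpend
  refine ⟨ofRel M t rel, _, fun i => range fun k => .inl (.inr (i, k)), hiso, hpend.1, hpend.2,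
    fun _ => subset_univ _, ?_, fun i => ?_, ?_, ?_⟩
  · rintro i _ ⟨k, rfl⟩
    rfl
  · rw [← image_univ, Function.Injective.encard_image]
    · simp
    · intro k l e
      simpa using e
  · rintro i hi _ ⟨k, rfl⟩ u - h3 hinc
    rcases hnb (.inl (.inr (i, k))) u (fun d e => by simp at e) h3 hinc with
      ⟨a, e, rfl⟩ | ⟨a, e, rfl⟩
    · cases e
      exact hi h3
    · cases e
  · rintro (a | a) - h3
    · exact ⟨.inr a, mem_univ _, rfl, Or.inr (Or.inr ⟨h3, Or.inl (by
        rcases a with a | a <;> rfl)⟩)⟩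
    · have e : p (p (tA a)) = tA a := hp _ h3
      refine ⟨.inl a, mem_univ _, e.symm, Or.inr (Or.inr ⟨?_, Or.inr (by
        rcases a with a | a <;> rfl)⟩)⟩
      have h3' : 3 ≤ M (p (tA a)) (p (p (tA a))) := h3
      rwa [e] at h3'

/-- Procedure B leads from a finite intermediate geometry to a saturated geometry. -/
theorem exists_saturated_completion [Finite I] {V₁ : Type} [Finite V₁] [Nonempty V₁]
    (hM : M.IsGood) {Γ₁ : IncGeometry I V₁} (h₁ : Γ₁.IsIntermediateOn M univ) :
    ∃ (V : Type) (_ : Countable V) (Γ : IncGeometry I V) (C : ℕ → Set V) (e : V₁ → V),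
      C 0 = range e ∧ Γ.IsFreeChain M C ∧ ⋃ n, C n = univ ∧ Γ.IsIntermediateOn M univ ∧
      Γ.IsSaturatedOn M univ ∧ IsoOn Γ₁ Γ e univ := by
  classical
  obtain ⟨v₀⟩ : Nonempty V₁ := inferInstance
  have hV₁ : Countable V₁ := Finite.to_countable
  -- The natural numbers are spare vertices for Procedure B; those that remain unused are discarded
  -- at the end.
  let Γ₂ : IncGeometry I (V₁ ⊕ ℕ) := ofRel M (Sum.elim Γ₁.typ fun _ => Γ₁.typ v₀) fun u v =>
    ∃ u' v', u = .inl u' ∧ v = .inl v' ∧ Γ₁.inc u' v'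
  have hiso : IsoOn Γ₁ Γ₂ Sum.inl univ := by
    refine ⟨Sum.inl_injective.injOn, fun _ _ => rfl, fun u _ v _ => ?_⟩
    constructor
    · rintro (e | e | ⟨-, ⟨u', v', h1, h2, h⟩ | ⟨u', v', h1, h2, h⟩⟩)
      · rw [Sum.inl_injective e]
        exact Γ₁.inc_self _
      · exact h₁.propF u (mem_univ _) v (mem_univ _) e
      · rwa [Sum.inl_injective h1, Sum.inl_injective h2]
      · rw [Sum.inl_injective h1, Sum.inl_injective h2]
        exact Γ₁.symm h
    · intro e
      by_cases ht : Γ₁.typ u = Γ₁.typ v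
      · rw [(Γ₁.inc_iff_eq ht).1 e]
        exact inc_self _
      · rcases hM.eq_two_or ht with h2 | h2
        · exact Or.inr (Or.inl h2)
        · exact Or.inr (Or.inr ⟨h2, Or.inl ⟨u, v, rfl, rfl, e⟩⟩)
  obtain ⟨Γ₃, C, hC0, hid, hchain, hint, hsat⟩ := exists_saturated_chain (V := V₁ ⊕ ℕ) hM
    (finite_univ.image Sum.inl) (hiso.isIntermediateOn_image.2 h₁)
  set T := ⋃ n, C n with hT
  have hCT : ∀ n, C n ⊆ T := subset_iUnion C
  have hne : Nonempty T := ⟨⟨.inl v₀, hCT 0 (hC0 ▸ ⟨_, mem_univ _, rfl⟩)⟩⟩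
  let ψ : V₁ ⊕ ℕ → T := fun v => if h : v ∈ T then ⟨v, h⟩ else hne.some
  have hψv : ∀ v (h : v ∈ T), ψ v = ⟨v, h⟩ := fun v h => dif_pos h
  have hψ : IsoOn Γ₃ (Γ₃.induce T) ψ T := by
    refine ⟨fun u hu v hv e => ?_, fun v hv => ?_, fun u hu v hv => ?_⟩
    · rw [hψv u hu, hψv v hv] at e
      exact congrArg Subtype.val e
    · rw [hψv v hv]
      rfl
    · rw [hψv u hu, hψv v hv]
      rfl
  have hψT : ψ '' T = univ := eq_univ_of_forall fun v => ⟨v, v.2, hψv v v.2⟩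
  have h12 := hiso.trans (hid : IsoOn Γ₂ Γ₃ id _)
  have h13 : IsoOn Γ₁ (Γ₃.induce T) (ψ ∘ id ∘ Sum.inl) univ :=
    h12.trans (hψ.mono (by rw [Function.id_comp, ← hC0]; exact hCT 0))
  have himg : (ψ ∘ id ∘ Sum.inl) '' univ = ψ '' C 0 := by
    rw [hC0, ← image_comp]
    rfl
  refine ⟨T, inferInstance, Γ₃.induce T, fun n => ψ '' C n, _, by rw [← image_univ, himg],
    fun n => ?_, ?_, ?_, ?_, h13⟩
  · exact (hchain n).imp (congrArg (ψ '' ·)) fun ⟨X, i, j, a, ha⟩ =>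
      ⟨_, i, j, _, hψ.freeStep_image (hCT _) ha⟩
  · rw [← image_iUnion, ← hT, hψT]
  · rw [← hψT]
    exact hψ.isIntermediateOn_image.2 hint
  · rw [← hψT]
    exact hψ.isSaturatedOn_image subset_rfl hsat

/-- Every finite intermediate geometry is a closed part of an ample finite intermediate geometry,
from which Procedure B leads to a saturated geometry. -/
theorem exists_ample_completion [Finite I] [Nonempty I] {D : Type} [Finite D] (hM : M.IsGood)
    {Γ₀ : IncGeometry I D} (h₀ : Γ₀.IsIntermediateOn M univ) {p : I → I}
    (hp : ∀ t, 3 ≤ M (p t) (p (p t)) → p (p t) = t) :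
    ∃ (V : Type) (_ : Countable V) (Γ : IncGeometry I V) (C : ℕ → Set V) (e : D → V)
      (R : I → Set V), (C 0).Finite ∧ Γ.IsFreeChain M C ∧ ⋃ n, C n = univ ∧
      Γ.IsIntermediateOn M univ ∧ Γ.IsSaturatedOn M univ ∧ IsoOn Γ₀ Γ e univ ∧
      Γ.IsClosedIn M (range e) (C 0) ∧ Γ.IsAmpleOn M p R (C 0) := by
  obtain ⟨Γ₁, e, R, he, h₁, hcl, hample⟩ := exists_ample hM h₀ hp
  obtain ⟨V, hV, Γ, C, f, hC0, hchain, huniv, hint, hsat, hf⟩ := exists_saturated_completion hM h₁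
  refine ⟨V, hV, Γ, C, f ∘ e, fun t => f '' R t, hC0 ▸ finite_range f, hchain, huniv, hint, hsat,
    he.trans (hf.mono (subset_univ _)), ?_, ?_⟩
  · rw [hC0, range_comp, ← image_univ (f := f)]
    exact hf.isClosedIn_image subset_rfl hcl
  · rw [hC0, ← image_univ]
    exact hample.image hf

end IncGeometry

/-! ### Counting neighbours: thickness of completions -/

theorem Set.exists_subset_pair {α : Type*} [Nonempty α] {L : Set α} (h : ¬ 3 ≤ L.encard) :
    ∃ a b, L ⊆ {a, b} := by
  obtain ⟨x⟩ : Nonempty α := inferInstance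
  have hfin : L.Finite := by
    by_contra hc
    rw [(infinite_coe_iff.1 (infinite_coe_iff.2 hc)).encard_eq] at h
    simp at h
  have hn := hfin.cast_ncard_eq
  rw [← hn] at h
  have h3 : L.ncard < 3 := by
    by_contra hc
    exact h (by exact_mod_cast not_lt.1 hc)
  have : L.ncard = 0 ∨ L.ncard = 1 ∨ L.ncard = 2 := by omega
  rcases this with h0 | h1 | h2
  · rw [ncard_eq_zero hfin] at h0
    exact ⟨x, x, h0 ▸ empty_subset _⟩
  · obtain ⟨a, rfl⟩ := ncard_eq_one.1 h1
    exact ⟨a, a, by simp⟩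
  · obtain ⟨a, b, -, rfl⟩ := ncard_eq_two.1 h2
    exact ⟨a, b, subset_rfl⟩

theorem Set.encard_pair_le_two {α : Type*} (a b : α) : ({a, b} : Set α).encard ≤ 2 := by
  refine (encard_insert_le _ _).trans ?_
  rw [encard_singleton]
  norm_num

/-- `c` is a leaf of the diagram, attached to `d`. -/
structure CoxeterMatrix.IsLeaf {I : Type} (M : CoxeterMatrix I) (c d : I) : Prop where
  adj : 3 ≤ M c d
  eq : ∀ k, 3 ≤ M k c → k = d

/-- `c` and `e` are the two neighbours of `d` in the diagram. -/
structure CoxeterMatrix.IsMiddle {I : Type} (M : CoxeterMatrix I) (d c e : I) : Prop where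
  left : 3 ≤ M c d
  right : 3 ≤ M e d
  ne : c ≠ e
  eq : ∀ k, 3 ≤ M k d → k = c ∨ k = e

namespace IncGeometry

variable {I V V' : Type} {Γ : IncGeometry I V} {M : CoxeterMatrix I}

theorem IsFreeChain.mem_zero_or {C : ℕ → Set V} (hC : Γ.IsFreeChain M C) (hCu : ⋃ n, C n = univ)
    (v : V) : v ∈ C 0 ∨ ∃ s X i j a, Γ.FreeStep M (C s) (C (s + 1)) X i j a ∧
      ∃ k ∈ Ioo 0 (M i j - 1), a k = v := by
  obtain ⟨n, hn⟩ := mem_iUnion.1 (hCu ▸ mem_univ v : v ∈ ⋃ n, C n)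
  induction n with
  | zero => exact Or.inl hn
  | succ n ih =>
    rcases hC n with e | ⟨X, i, j, a, ha⟩
    · exact ih (e ▸ hn)
    · rcases ha.mem_right_iff.1 hn with h | h
      · exact ih h
      · exact Or.inr ⟨n, X, i, j, a, ha, h⟩

/-- The old neighbours of a new vertex. -/
theorem FreeStep.encard_inc_le {S S' X : Set V} {i j : I} {a : ℕ → V}
    (h : Γ.FreeStep M S S' X i j a) {k : ℕ} (hk : k ∈ Ioo 0 (M i j - 1)) {c : I}
    (hc : 3 ≤ M c (Γ.typ (a k))) :
    {r | r ∈ S ∧ Γ.typ r = c ∧ Γ.inc r (a k)}.encard ≤ 2 ∧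
      (4 ≤ M c (Γ.typ (a k)) → {r | r ∈ S ∧ Γ.typ r = c ∧ Γ.inc r (a k)}.Subsingleton) := by
  have hk' := hk
  simp only [mem_Ioo] at hk'
  by_cases hcij : c = i ∨ c = j
  · have hsub : ∀ r, r ∈ S ∧ Γ.typ r = c ∧ Γ.inc r (a k) → r = a (k - 1) ∨ r = a (k + 1) := by
      rintro r ⟨hr, rfl, hi⟩
      refine h.eq_of_inc hk (h.subset_right hr) hcij ?_ (Γ.symm hi)
      rintro rfl
      exact h.notMem k hk hr
    refine ⟨(encard_le_encard (t := {a (k - 1), a (k + 1)}) hsub).trans (Set.encard_pair_le_two _ _), ?_⟩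
    intro h4 r hr r' hr'
    have hold : ∀ n, a n ∈ S → n ≤ M i j - 1 → n = 0 ∨ n = M i j - 1 := by
      intro n hn hnm
      by_contra! hcon
      exact h.notMem n (by simp only [mem_Ioo]; omega) hn
    have hm : 4 ≤ M i j := by
      have h1 := h.typ_mem k (by omega)
      have h2 : c ≠ Γ.typ (a k) := M.ne_of_three_le hc
      rcases hcij with e1 | e1 <;> rcases h1 with e2 | e2 <;> rw [e1, e2] at h4 h2 <;>
        first | exact absurd rfl h2 | exact h4 | exact M.symmetric j i ▸ h4
    -- Since `4 ≤ M i j`, there are at least two new vertices, so at most one neighbour of `a k` on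
    -- the path is old.
    have hno : ¬ (a (k - 1) ∈ S ∧ a (k + 1) ∈ S) := by
      rintro ⟨h1, h2⟩
      have := hold _ h1 (by omega)
      have := hold _ h2 (by omega)
      omega
    rcases hsub r hr with e | e <;> rcases hsub r' hr' with e' | e'
    · rw [e, e']
    · exact absurd ⟨e ▸ hr.1, e' ▸ hr'.1⟩ hno
    · exact absurd ⟨e' ▸ hr'.1, e ▸ hr.1⟩ hno
    · rw [e, e']
  · push Not at hcij
    have hsub : {r | r ∈ S ∧ Γ.typ r = c ∧ Γ.inc r (a k)}.Subsingleton := by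
      have hX : ∀ r, r ∈ S ∧ Γ.typ r = c ∧ Γ.inc r (a k) → r ∈ X := by
        rintro r ⟨hr, rfl, hi⟩
        exact h.mem_flag_of_inc hk (h.subset_right hr) hcij.1 hcij.2 (by rwa [M.symmetric])
          (Γ.symm hi)
      exact fun r hr r' hr' => h.tight.isFlag.eq_of_typ_eq (hX r hr) (hX r' hr')
        (hr.2.1.trans hr'.2.1.symm)
    exact ⟨(encard_le_one_iff_subsingleton.2 hsub).trans (by norm_num), fun _ => hsub⟩

/-- A new vertex of type `i` has neighbours of type `j` on the path, and neighbours of every other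
type adjacent to `i` in the flag. -/
theorem exists_inc_of_chain {C : ℕ → Set V} (hC : Γ.IsFreeChain M C) (hCu : ⋃ n, C n = univ)
    {p : I → I} (h0 : ∀ v ∈ C 0, 3 ≤ M (Γ.typ v) (p (Γ.typ v)) →
      ∃ w ∈ C 0, Γ.typ w = p (Γ.typ v) ∧ Γ.inc v w) (v : V)
    (hv : 3 ≤ M (Γ.typ v) (p (Γ.typ v))) : ∃ w, Γ.typ w = p (Γ.typ v) ∧ Γ.inc v w := by
  rcases hC.mem_zero_or hCu v with hv0 | ⟨s, X, i, j, a, ha, k, hk, rfl⟩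
  · obtain ⟨w, -, hw⟩ := h0 v hv0 hv
    exact ⟨w, hw⟩
  · have hk' := hk
    simp only [mem_Ioo] at hk'
    wlog hi : Γ.typ (a k) = i generalizing i j
    · rw [M.symmetric] at hk hk'
      exact this j i ha.symm hk hk' ((ha.typ_mem k (by rw [M.symmetric]; omega)).resolve_left hi)
    by_cases hj : p (Γ.typ (a k)) = j
    · have := ha.isPathSeq.adj k (by omega)
      exact ⟨a (k + 1), (ha.typ_eq_of_add_one (by omega) hi).trans hj.symm, this.2.2.2⟩
    · rw [hi] at hv hj ⊢
      obtain ⟨x, hx, ht⟩ := ha.tight.exists_typ (p i) (M.ne_of_three_le hv).symm hj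
        (Or.inl (by rwa [M.symmetric]))
      exact ⟨x, ht, Γ.symm ((ha.mem_localSet (by omega)).1.2 x hx)⟩

section edge

variable {c d e : I}

theorem isTightFlag_singleton (hcd : M.IsLeaf c d) (hd : M.IsMiddle d c e) {y : V}
    (hy : Γ.typ y = e) : Γ.IsTightFlag M {y} c d := by
  refine ⟨?_, hcd.adj, ?_, ?_, fun t h1 h2 h3 => ⟨y, rfl, ?_⟩⟩
  · rintro _ rfl _ rfl
    exact Γ.inc_self _
  · rintro _ rfl
    rw [hy]
    exact ⟨hd.ne.symm, M.ne_of_three_le hd.right⟩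
  · rintro _ rfl
    rw [hy]
    exact Or.inr hd.right
  · rw [hy]
    rcases h3 with h | h
    · exact absurd (hcd.eq t h) h2
    · exact ((hd.eq t h).resolve_left h1).symm

theorem adj_of_inc (hcd : M.IsLeaf c d) (hd : M.IsMiddle d c e) (hF : Γ.PropFOn M univ)
    (hce : M c e = 2) {x l y : V} (hx : Γ.typ x = c) (hl : Γ.typ l = d) (hy : Γ.typ y = e)
    (hxl : Γ.inc x l) (hly : Γ.inc l y) : (Γ.localGraph {y} c d univ).Adj x l := by
  have ht := isTightFlag_singleton hcd hd hy
  refine ⟨⟨ht.mem_localSet.2 ⟨Or.inl hx, ?_⟩, mem_univ _⟩,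
    ⟨ht.mem_localSet.2 ⟨Or.inr hl, ?_⟩, mem_univ _⟩, ?_, hxl⟩
  · rintro _ rfl
    exact Γ.symm (hF x (mem_univ _) _ (mem_univ _) (by rw [hx, hy, hce]))
  · rintro _ rfl
    exact Γ.symm hly
  · rintro rfl
    exact M.ne_of_three_le hcd.adj (hx.symm.trans hl)

/-- A local graph of adjacent types has no cycle of length 4, because the label is at least 3. -/
theorem eq_of_adj_of_adj (hint : Γ.IsIntermediateOn M univ) {X : Set V} {i j : I}
    (hX : Γ.IsTightFlag M X i j) {u u' w w' : V} (h1 : (Γ.localGraph X i j univ).Adj u w)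
    (h2 : (Γ.localGraph X i j univ).Adj w u') (h3 : (Γ.localGraph X i j univ).Adj u' w')
    (h4 : (Γ.localGraph X i j univ).Adj w' u) (hu : u ≠ u') : w = w' := by
  by_contra hw
  have := hint.propP i j X (subset_univ _) hX 4 _ (isCycleSeq_four h1 h2 h3 h4 hu hw)
  have := hX.adj
  omega

theorem exists_adj_adj (hsat : Γ.IsSaturatedOn M univ) {X : Set V} {i j : I}
    (hX : Γ.IsTightFlag M X i j) (h3 : M i j = 3) {u u' : V} (hu : u ∈ Γ.localSet X i j)
    (hu' : u' ∈ Γ.localSet X i j) (ht : Γ.typ u' = Γ.typ u) (hne : u ≠ u') :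
    ∃ w, (Γ.localGraph X i j univ).Adj u w ∧ (Γ.localGraph X i j univ).Adj w u' := by
  obtain ⟨l, b, hl, hb, rfl, rfl⟩ := hsat X i j (subset_univ _) hX u ⟨hu, mem_univ _⟩ u'
    ⟨hu', mem_univ _⟩ (by simp only [ht, h3, true_iff]; decide)
  have he := (SimpleGraph.apply_eq_iff_even (fun _ _ => localGraph_adj_typ) hb.adj).1 ht
  have hl' : l = 0 ∨ l = 1 ∨ l = 2 := by omega
  rcases hl' with rfl | rfl | rfl
  · exact absurd rfl hne
  · exact absurd he (by decide)
  · exact ⟨b 1, hb.adj 0 (by omega), hb.adj 1 (by omega)⟩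

/-- An edge of label 3 at a leaf: two vertices of the types surrounding `d` have at least three
common neighbours. -/
theorem three_le_encard_common (hcd : M.IsLeaf c d) (hd : M.IsMiddle d c e) (h3 : M c d = 3)
    (hce : M c e = 2) (hint : Γ.IsIntermediateOn M univ) (hsat : Γ.IsSaturatedOn M univ)
    {R : Set V} (hR : ∀ r ∈ R, Γ.typ r = c) (hcard : 12 ≤ R.encard)
    (hQ : ∀ l, Γ.typ l = d → {r ∈ R | Γ.inc r l}.encard ≤ 2) {x y : V} (hx : Γ.typ x = c)
    (hy : Γ.typ y = e) : 3 ≤ {l | Γ.typ l = d ∧ Γ.inc x l ∧ Γ.inc y l}.encard := by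
  by_contra hlt
  have : Nonempty V := ⟨x⟩
  obtain ⟨l₁, l₂, hL⟩ := exists_subset_pair hlt
  have ht := isTightFlag_singleton hcd hd hy
  have hloc : ∀ x, Γ.typ x = c → x ∈ Γ.localSet {y} c d := by
    intro x hx
    rw [ht.mem_localSet]
    refine ⟨Or.inl hx, ?_⟩
    rintro _ rfl
    exact Γ.symm (hint.propF x (mem_univ _) _ (mem_univ _) (by rw [hx, hy, hce]))
  -- In the residue of `y`, every element of `R` other than `x` is joined to `x` by a path of length
  -- 2, which must pass through `l₁` or `l₂`. Each of these has at most two neighbours in `R`, so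
  -- `R` would have at most five elements.
  have hsub : R ⊆ {x} ∪ ({r ∈ R | Γ.typ l₁ = d ∧ Γ.inc r l₁} ∪
      {r ∈ R | Γ.typ l₂ = d ∧ Γ.inc r l₂}) := by
    intro r hr
    by_cases hrx : r = x
    · exact Or.inl hrx
    right
    obtain ⟨l, h1, h2⟩ := exists_adj_adj hsat ht h3 (hloc x hx) (hloc r (hR r hr))
      ((hR r hr).trans hx.symm) (Ne.symm hrx)
    have hl : Γ.typ l = d := by
      have := localGraph_adj_typ h1
      grind
    rcases hL ⟨hl, h1.2.2.2, h1.2.1.1.1.2 y rfl⟩ with rfl | rfl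
    · exact Or.inl ⟨hr, hl, Γ.symm h2.2.2.2⟩
    · exact Or.inr ⟨hr, hl, Γ.symm h2.2.2.2⟩
  have hQ' : ∀ l, {r ∈ R | Γ.typ l = d ∧ Γ.inc r l}.encard ≤ 2 := by
    intro l
    by_cases hl : Γ.typ l = d
    · simpa only [hl, true_and] using hQ l hl
    · simp [hl]
  have h1 := (hcard.trans (encard_le_encard hsub)).trans ((encard_union_le _ _).trans
    (add_le_add_right ((encard_union_le _ _).trans (add_le_add (hQ' l₁) (hQ' l₂))) _))
  rw [encard_singleton] at h1
  exact absurd h1 (by norm_num)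

/-- Choose `r ∈ R` not incident with `l`. Since the label is 3, each of the at least three common
neighbours of `r` and `y` is joined to `l`, in the residue of `y`, by a vertex of type `c`. These
vertices are different, as a coincidence would produce a cycle of length 4. -/
theorem three_le_encard_leaf (hcd : M.IsLeaf c d) (hd : M.IsMiddle d c e) (h3 : M c d = 3)
    (hce : M c e = 2) (hint : Γ.IsIntermediateOn M univ) (hsat : Γ.IsSaturatedOn M univ)
    {R : Set V} (hR : ∀ r ∈ R, Γ.typ r = c) (hcard : 12 ≤ R.encard)
    (hQ : ∀ l, Γ.typ l = d → {r ∈ R | Γ.inc r l}.encard ≤ 2) {l y : V} (hl : Γ.typ l = d)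
    (hy : Γ.typ y = e) (hly : Γ.inc l y) : 3 ≤ {x | Γ.typ x = c ∧ Γ.inc x l}.encard := by
  obtain ⟨r, hr, hrl⟩ : ∃ r ∈ R, ¬ Γ.inc r l := by
    by_contra! hcon
    have : R ⊆ {r ∈ R | Γ.inc r l} := fun r hr => ⟨hr, hcon r hr⟩
    exact absurd ((hcard.trans (encard_le_encard this)).trans (hQ l hl)) (by norm_num)
  have hcom := three_le_encard_common hcd hd h3 hce hint hsat hR hcard hQ (hR r hr) hy
  have ht := isTightFlag_singleton hcd hd hy
  have hloc : ∀ l, Γ.typ l = d → Γ.inc l y → l ∈ Γ.localSet {y} c d := by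
    intro l hl hi
    rw [ht.mem_localSet]
    refine ⟨Or.inr hl, ?_⟩
    rintro _ rfl
    exact Γ.symm hi
  have hex : ∀ l' ∈ {l | Γ.typ l = d ∧ Γ.inc r l ∧ Γ.inc y l}, ∃ x,
      (Γ.localGraph {y} c d univ).Adj l x ∧ (Γ.localGraph {y} c d univ).Adj x l' := by
    rintro l' ⟨h1, h2, h4⟩
    refine exists_adj_adj hsat ht h3 (hloc l hl hly) (hloc l' h1 (Γ.symm h4)) (h1.trans hl.symm) ?_
    rintro rfl
    exact hrl h2
  choose! g hg1 hg2 using hex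
  refine hcom.trans (encard_le_encard_of_injOn (f := g) (fun l' hl' => ?_) fun l' hl' l'' hl'' e => ?_)
  · have := localGraph_adj_typ (hg1 l' hl')
    refine ⟨?_, Γ.symm (hg1 l' hl').2.2.2⟩
    grind
  · have hadj : ∀ l' ∈ {l | Γ.typ l = d ∧ Γ.inc r l ∧ Γ.inc y l},
        (Γ.localGraph {y} c d univ).Adj r l' := fun l' hl' =>
      adj_of_inc hcd hd hint.propF hce (hR r hr) hl'.1 hy hl'.2.1 (Γ.symm hl'.2.2)
    refine eq_of_adj_of_adj hint ht (hadj l' hl') (hg2 l' hl').symm (e ▸ hg2 l'' hl'')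
      (hadj l'' hl'').symm fun e => hrl ?_
    rw [e]
    exact Γ.symm (hg1 l' hl').2.2.2

/-- The vertices of `R` at distance at most two from `π`. -/
def nearSet (Γ : IncGeometry I V) (d : I) (R : Set V) (π : V) : Set V :=
  {r ∈ R | r = π ∨ ∃ b, Γ.typ b = d ∧ Γ.inc b r ∧ Γ.inc b π}

/-- If `π ∈ R`, only `π` itself is near. Otherwise a near vertex is reached through some `b`, and
different near vertices need different `b`, since each `b` is incident with at most one element of
`R`. -/
theorem encard_nearSet_le {R : Set V} (hQ : ∀ l, Γ.typ l = d → {r ∈ R | Γ.inc l r}.Subsingleton)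
    {π : V} (hQ' : π ∉ R → {b | Γ.typ b = d ∧ Γ.inc b π ∧ ∃ r ∈ R, Γ.inc b r}.encard ≤ 2) :
    (Γ.nearSet d R π).encard ≤ 2 := by
  by_cases hπ : π ∈ R
  · refine (encard_le_one_iff_subsingleton.2 ?_).trans (by norm_num)
    have : ∀ r ∈ Γ.nearSet d R π, r = π := by
      rintro r ⟨hr, rfl | ⟨b, hb, h1, h2⟩⟩
      · rfl
      · exact hQ b hb ⟨hr, h1⟩ ⟨hπ, h2⟩
    exact fun r hr r' hr' => (this r hr).trans (this r' hr').symm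
  · have hex : ∀ r ∈ Γ.nearSet d R π, ∃ b, Γ.typ b = d ∧ Γ.inc b r ∧ Γ.inc b π := by
      rintro r ⟨hr, rfl | h⟩
      · exact absurd hr hπ
      · exact h
    choose! g hg1 hg2 hg3 using hex
    refine le_trans (encard_le_encard_of_injOn (f := g) (fun r hr => ?_) fun r hr r' hr' e => ?_)
      (hQ' hπ)
    · exact ⟨hg1 r hr, hg3 r hr, r, hr.1, hg2 r hr⟩
    · exact hQ _ (hg1 r hr) ⟨hr.1, hg2 r hr⟩ ⟨hr'.1, e ▸ hg2 r' hr'⟩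

/-- With fewer than three neighbours of type `c` at `l`, some `s ∈ R` is far from all of them. Short
paths from `s`, or from the common neighbours of `s` and `z`, to `l` then either do not exist or
provide at least three neighbours of `l` after all. -/
theorem three_le_encard_leaf_of_four_le (hcd : M.IsLeaf c d) (hd : M.IsMiddle d c e)
    (h45 : M c d = 4 ∨ M c d = 5) (hce : M c e = 2) (hint : Γ.IsIntermediateOn M univ)
    (hsat : Γ.IsSaturatedOn M univ) {R : Set V} (hR : ∀ r ∈ R, Γ.typ r = c)
    (hcard : 12 ≤ R.encard) (hnear : ∀ π, Γ.typ π = c → (Γ.nearSet d R π).encard ≤ 2)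
    (hcom : ∀ x y, Γ.typ x = c → Γ.typ y = e →
      3 ≤ {l | Γ.typ l = d ∧ Γ.inc x l ∧ Γ.inc y l}.encard) {l z : V} (hl : Γ.typ l = d)
    (hz : Γ.typ z = e) (hlz : Γ.inc l z) : 3 ≤ {x | Γ.typ x = c ∧ Γ.inc x l}.encard := by
  by_contra hlt
  have : Nonempty V := ⟨l⟩
  obtain ⟨π₁, π₂, hL⟩ := exists_subset_pair hlt
  have ht := isTightFlag_singleton hcd hd hz
  have hlocc : ∀ x, Γ.typ x = c → x ∈ Γ.localSet {z} c d := by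
    intro x hx
    rw [ht.mem_localSet]
    refine ⟨Or.inl hx, ?_⟩
    rintro _ rfl
    exact Γ.symm (hint.propF x (mem_univ _) _ (mem_univ _) (by rw [hx, hz, hce]))
  have hlocd : ∀ l, Γ.typ l = d → Γ.inc l z → l ∈ Γ.localSet {z} c d := by
    intro l hl hi
    rw [ht.mem_localSet]
    refine ⟨Or.inr hl, ?_⟩
    rintro _ rfl
    exact Γ.symm hi
  -- At most four elements of `R` are near `π₁` or `π₂`.
  obtain ⟨s, hs, hfar⟩ : ∃ s ∈ R, ∀ π, Γ.typ π = c → Γ.inc π l → s ∉ Γ.nearSet d R π := by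
    by_contra! hcon
    have hsub : R ⊆ {r ∈ Γ.nearSet d R π₁ | Γ.typ π₁ = c} ∪
        {r ∈ Γ.nearSet d R π₂ | Γ.typ π₂ = c} := by
      intro r hr
      obtain ⟨π, hπ, hπl, hrπ⟩ := hcon r hr
      rcases hL ⟨hπ, hπl⟩ with rfl | rfl
      · exact Or.inl ⟨hrπ, hπ⟩
      · exact Or.inr ⟨hrπ, hπ⟩
    have h2 : ∀ π, {r ∈ Γ.nearSet d R π | Γ.typ π = c}.encard ≤ 2 := by
      intro π
      by_cases hπ : Γ.typ π = c
      · exact (encard_le_encard (sep_subset _ _)).trans (hnear π hπ)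
      · simp [hπ]
    have h1 := (hcard.trans (encard_le_encard hsub)).trans
      ((encard_union_le _ _).trans (add_le_add (h2 π₁) (h2 π₂)))
    exact absurd h1 (by norm_num)
  have hsl : ¬ Γ.inc s l := fun h => hfar s (hR s hs) h ⟨hs, Or.inl rfl⟩
  have hstep : ∀ {u v}, (Γ.localGraph {z} c d univ).Adj u v → Γ.typ u = c → Γ.typ v = d := by
    intro u v huv hu
    have := localGraph_adj_typ huv
    grind
  have hstep' : ∀ {u v}, (Γ.localGraph {z} c d univ).Adj u v → Γ.typ u = d → Γ.typ v = c := by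
    intro u v huv hu
    have := localGraph_adj_typ huv
    grind
  have hpar := fun {l : ℕ} {b : ℕ → V} (hb : (Γ.localGraph {z} c d univ).IsPathSeq l b) =>
    SimpleGraph.apply_eq_iff_even (fun _ _ => localGraph_adj_typ) hb.adj
  have hne : c ≠ d := M.ne_of_three_le hcd.adj
  rcases h45 with h4 | h5
  -- Label 4: saturation joins `s` and `l` by a path of length 1 or 3, and then `s` is near a
  -- neighbour of `l`.
  · obtain ⟨n, b, hn, hb, hb0, hbn⟩ := hsat {z} c d (subset_univ _) ht s
      ⟨hlocc s (hR s hs), mem_univ _⟩ l ⟨hlocd l hl hlz, mem_univ _⟩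
      (by rw [hR s hs, hl, h4]; exact iff_of_false hne.symm (by decide))
    have hp := hpar hb
    rw [hb0, hbn, hR s hs, hl, iff_false_left hne.symm] at hp
    have hn' : n = 0 ∨ n = 1 ∨ n = 2 ∨ n = 3 := by omega
    rcases hn' with rfl | rfl | rfl | rfl
    · exact hp (by decide)
    · have := (hb.adj 0 (by omega)).2.2.2
      rw [hb0, show 0 + 1 = 1 from rfl, hbn] at this
      exact hsl this
    · exact hp (by decide)
    · have e0 := hb.adj 0 (by omega)
      have e1 := hb.adj 1 (by omega)
      have e2 := hb.adj 2 (by omega)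
      have t1 := hstep e0 (hb0 ▸ hR s hs)
      have t2 := hstep' e1 t1
      refine hfar (b 2) t2 (by simpa only [hbn] using e2.2.2.2) ⟨hs, Or.inr ⟨b 1, t1, ?_, ?_⟩⟩
      · exact hb0 ▸ Γ.symm e0.2.2.2
      · exact e1.2.2.2
  -- Label 5: each common neighbour `l'` of `s` and `z` is joined to `l` by a path of even length at
  -- most 4. As `s` is far from the neighbours of `l`, the length is 4; replacing the last edge by
  -- an edge from `s` at the beginning gives a path of length 4 from `s` to a neighbour of `l`.
  · have hex : ∀ l' ∈ {l | Γ.typ l = d ∧ Γ.inc s l ∧ Γ.inc z l}, ∃ b : ℕ → V,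
        (Γ.localGraph {z} c d univ).IsPathSeq 4 b ∧ b 0 = s ∧ b 1 = l' ∧ Γ.typ (b 4) = c ∧
          Γ.inc (b 4) l := by
      rintro l' ⟨hl', hsl', hzl'⟩
      obtain ⟨n, b, hn, hb, hb0, hbn⟩ := hsat {z} c d (subset_univ _) ht l'
        ⟨hlocd l' hl' (Γ.symm hzl'), mem_univ _⟩ l ⟨hlocd l hl hlz, mem_univ _⟩
        (by rw [hl', hl, h5]; exact iff_of_true rfl (by decide))
      have hp := hpar hb
      rw [hb0, hbn, hl', hl, iff_true_left rfl] at hp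
      have hn' : n = 0 ∨ n = 1 ∨ n = 2 ∨ n = 3 ∨ n = 4 := by omega
      rcases hn' with rfl | rfl | rfl | rfl | rfl
      · rw [hb0] at hbn
        exact absurd (hbn ▸ hsl') hsl
      · exact absurd hp (by decide)
      · have e0 := hb.adj 0 (by omega)
        have e1 := hb.adj 1 (by omega)
        have t1 := hstep' e0 (hb0 ▸ hl')
        exact absurd ⟨hs, Or.inr ⟨l', hl', Γ.symm hsl', hb0 ▸ e0.2.2.2⟩⟩
          (hfar (b 1) t1 (by simpa only [hbn] using e1.2.2.2))
      · exact absurd hp (by decide)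
      · have e0 := hb.adj 0 (by omega)
        have e1 := hb.adj 1 (by omega)
        have e2 := hb.adj 2 (by omega)
        have e3 := hb.adj 3 (by omega)
        have t1 := hstep' e0 (hb0 ▸ hl')
        have t2 := hstep e1 t1
        have t3 := hstep' e2 t2
        have e3' : Γ.inc (b 3) l := by simpa only [hbn] using e3.2.2.2
        have hf := hfar (b 3) t3 e3'
        have hsadj : (Γ.localGraph {z} c d univ).Adj s (b 0) := by
          rw [hb0]
          exact adj_of_inc hcd hd hint.propF hce (hR s hs) hl' hz hsl' (Γ.symm hzl')
        have hs0 : s ≠ b 0 := hsadj.2.2.1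
        have hs1 : s ≠ b 1 := fun e => hf ⟨hs, Or.inr ⟨b 2, t2, e ▸ Γ.symm e1.2.2.2, e2.2.2.2⟩⟩
        have hs2 : s ≠ b 2 := fun e => hne ((hR s hs).symm.trans (e ▸ t2))
        have hs3 : s ≠ b 3 := fun e => hf ⟨hs, Or.inl e⟩
        refine ⟨fun k => if k = 0 then s else b (k - 1), ⟨fun k hk => ?_, fun k hk r hr e => ?_⟩,
          rfl, hb0, t3, e3'⟩
        · interval_cases k
          · exact hsadj
          · exact e0
          · exact e1
          · exact e2
        · simp only [mem_Iic] at hk hr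
          have hinj := hb.inj
          by_cases hk0 : k = 0 <;> by_cases hr0 : r = 0
          · omega
          · simp only [hk0, if_true, if_neg hr0] at e
            exfalso
            have : r = 1 ∨ r = 2 ∨ r = 3 ∨ r = 4 := by omega
            rcases this with rfl | rfl | rfl | rfl
            · exact hs0 e
            · exact hs1 e
            · exact hs2 e
            · exact hs3 e
          · simp only [hr0, if_true, if_neg hk0] at e
            exfalso
            have : k = 1 ∨ k = 2 ∨ k = 3 ∨ k = 4 := by omega
            rcases this with rfl | rfl | rfl | rfl
            · exact hs0 e.symm
            · exact hs1 e.symm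
            · exact hs2 e.symm
            · exact hs3 e.symm
          · simp only [if_neg hk0, if_neg hr0] at e
            have := hinj (show k - 1 ∈ Iic 4 by simp only [mem_Iic]; omega)
              (show r - 1 ∈ Iic 4 by simp only [mem_Iic]; omega) e
            omega
    choose! b hb hb0 hb1 hb4 hbl using hex
    -- Two such paths with the same end coincide, because `4 + 4 < 2 * 5`; so different `l'` lead to
    -- different neighbours of `l`.
    refine hlt ((hcom s z (hR s hs) hz).trans (encard_le_encard_of_injOn (f := fun l' => b l' 4)
      (fun l' hl' => ⟨hb4 l' hl', hbl l' hl'⟩) fun l' hl' l'' hl'' e => ?_))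
    have := (hint.propP c d {z} (subset_univ _) ht).path_unique (hb l' hl') (hb l'' hl'')
      ((hb0 l' hl').trans (hb0 l'' hl'').symm) e (by omega)
    rw [← hb1 l' hl', ← hb1 l'' hl'', this.2 1 (by omega)]

end edge

/-- The neighbours in `R` of a vertex of type `d`, where `R` consists of vertices of type `c` that
are isolated in the first stage. -/
theorem encard_inc_le_of_chain {C : ℕ → Set V} (hC : Γ.IsFreeChain M C) (hCu : ⋃ n, C n = univ)
    {c d : I} (hcd : 3 ≤ M c d) {R : Set V} (hR : ∀ r ∈ R, Γ.typ r = c) (hRC : R ⊆ C 0)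
    (hiso : ∀ r ∈ R, ∀ u ∈ C 0, 3 ≤ M c (Γ.typ u) → ¬ Γ.inc r u) {l : V} (hl : Γ.typ l = d) :
    {r ∈ R | Γ.inc r l}.encard ≤ 2 ∧ (4 ≤ M c d → {r ∈ R | Γ.inc l r}.Subsingleton) := by
  rcases hC.mem_zero_or hCu l with hl0 | ⟨s, X, i, j, a, ha, k, hk, rfl⟩
  · have hno : ∀ r ∈ R, ¬ Γ.inc r l := fun r hr => hiso r hr l hl0 (hl ▸ hcd)
    refine ⟨?_, fun _ r hr => absurd (Γ.symm hr.2) (hno r hr.1)⟩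
    rw [show {r ∈ R | Γ.inc r l} = ∅ from eq_empty_of_forall_notMem fun r hr => hno r hr.1 hr.2]
    simp
  · rw [← hl] at hcd ⊢
    have h := ha.encard_inc_le hk hcd
    have hsub : ∀ r ∈ R, r ∈ C s ∧ Γ.typ r = c :=
      fun r hr => ⟨hC.monotone (Nat.zero_le s) (hRC hr), hR r hr⟩
    refine ⟨(encard_le_encard ?_).trans h.1,
      fun h4 r hr r' hr' => h.2 h4 ⟨(hsub r hr.1).1, (hsub r hr.1).2, Γ.symm hr.2⟩
        ⟨(hsub r' hr'.1).1, (hsub r' hr'.1).2, Γ.symm hr'.2⟩⟩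
    exact fun r hr => ⟨(hsub r hr.1).1, (hsub r hr.1).2, hr.2⟩

/-- As the label is at least 4, a new vertex of type `d` has at most one old neighbour of type `c`.
If it were younger than `π ∉ R`, it could not be incident with both `π` and an element of `R`. So
the relevant neighbours of `π` are among its two neighbours on the path with which it was added. -/
theorem encard_nearSet_le_of_chain {C : ℕ → Set V} (hC : Γ.IsFreeChain M C)
    (hCu : ⋃ n, C n = univ) {c d : I} (hcd : M.IsLeaf c d) (h4 : 4 ≤ M c d) {R : Set V}
    (hR : ∀ r ∈ R, Γ.typ r = c) (hRC : R ⊆ C 0)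
    (hiso : ∀ r ∈ R, ∀ u ∈ C 0, 3 ≤ M c (Γ.typ u) → ¬ Γ.inc r u) {π : V} (hπ : Γ.typ π = c) :
    (Γ.nearSet d R π).encard ≤ 2 := by
  refine encard_nearSet_le
    (fun l hl => (encard_inc_le_of_chain hC hCu hcd.adj hR hRC hiso hl).2 h4) fun hπR => ?_
  -- a neighbour of `π` that meets `R` is not younger than `π`
  have hold : ∀ s, π ∈ C s → ∀ b, Γ.typ b = d → Γ.inc b π → (∃ r ∈ R, Γ.inc b r) → b ∈ C s := by
    rintro s hπs b hb hbπ ⟨r, hr, hbr⟩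
    rcases hC.mem_zero_or hCu b with h0 | ⟨s', X, i, j, a, ha, k, hk, rfl⟩
    · exact hC.monotone (Nat.zero_le s) h0
    by_contra hbs
    have hss : s ≤ s' := by
      by_contra! hlt
      exact hbs (hC.monotone (show s' + 1 ≤ s by omega)
        (ha.mem_right (by simp only [mem_Ioo] at hk; omega)))
    have h := (ha.encard_inc_le hk (hb.symm ▸ hcd.adj)).2 (hb.symm ▸ h4)
      ⟨hC.monotone hss hπs, hπ, Γ.symm hbπ⟩
      ⟨hC.monotone (Nat.zero_le s') (hRC hr), hR r hr, Γ.symm hbr⟩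
    exact hπR (h ▸ hr)
  rcases hC.mem_zero_or hCu π with h0 | ⟨s, X, i, j, a, ha, k, hk, rfl⟩
  · rw [show {b | Γ.typ b = d ∧ Γ.inc b π ∧ ∃ r ∈ R, Γ.inc b r} = ∅ from
      eq_empty_of_forall_notMem fun b hb => ?_]
    · simp
    obtain ⟨hb, hbπ, r, hr, hbr⟩ := hb
    exact hiso r hr b (hold 0 h0 b hb hbπ ⟨r, hr, hbr⟩) (hb.symm ▸ hcd.adj) (Γ.symm hbr)
  · have hk' := hk
    simp only [mem_Ioo] at hk'
    refine (encard_le_encard (t := {a (k - 1), a (k + 1)}) ?_).trans (Set.encard_pair_le_two _ _)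
    rintro b ⟨hb, hbπ, hbR⟩
    refine ha.eq_of_inc hk (hold (s + 1) (ha.mem_right (by omega)) b hb hbπ hbR) ?_ ?_
      (Γ.symm hbπ)
    · rw [hb]
      rcases ha.typ_mem k (by omega) with e | e
      · right
        exact (hcd.eq j (by rw [← hπ, e, M.symmetric]; exact ha.three_le)).symm
      · left
        exact (hcd.eq i (by rw [← hπ, e]; exact ha.three_le)).symm
    · rintro rfl
      exact M.ne_of_three_le hcd.adj (hπ.symm.trans hb)

end IncGeometry

/-! ### Thick saturated completions for the three diagrams -/

/-- Every set of two types has a neighbour in the diagram. -/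
def CoxeterMatrix.IsLinked {I : Type} (M : CoxeterMatrix I) : Prop :=
  ∀ i j, i ≠ j → ∃ h, h ≠ i ∧ h ≠ j ∧ (3 ≤ M h i ∨ 3 ≤ M h j)

theorem CoxeterMatrix.isGood_of_equiv {I J : Type} {M : CoxeterMatrix I} {N : J → J → ℕ}
    (e : I ≃ J) (h : ∀ i j, M i j = N (e i) (e j)) (h1 : ∀ i j, i ≠ j → 2 ≤ N i j)
    (h3 : ∀ i j h, N i j = 3 → 3 ≤ N j h → i ≠ h → 4 ≤ N j h)
    (h4 : ∀ i j h, N i j = 3 → 3 ≤ N j h → i ≠ h →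
      ∀ k, k ≠ i → k ≠ j → (3 ≤ N k i ∨ 3 ≤ N k j) → k = h) : M.IsGood where
  two_le i j hij := by
    rw [h]; exact h1 _ _ (e.injective.ne hij)
  four_le i j k := by
    simp only [h]; exact fun a b c => h3 _ _ _ a b (e.injective.ne c)
  eq_of_adj i j k := by
    simp only [h]
    exact fun a b c l hl hl' hll =>
      e.injective (h4 _ _ _ a b (e.injective.ne c) _ (e.injective.ne hl) (e.injective.ne hl') hll)

theorem CoxeterMatrix.isLeaf_of_equiv {I J : Type} {M : CoxeterMatrix I} {N : J → J → ℕ}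
    (e : I ≃ J) (h : ∀ i j, M i j = N (e i) (e j)) {a b : J} (h1 : 3 ≤ N a b)
    (h2 : ∀ k, 3 ≤ N k a → k = b) : M.IsLeaf (e.symm a) (e.symm b) where
  adj := by simpa [h] using h1
  eq k hk := by
    rw [Equiv.eq_symm_apply]
    exact h2 _ (by simpa [h] using hk)

theorem CoxeterMatrix.isMiddle_of_equiv {I J : Type} {M : CoxeterMatrix I} {N : J → J → ℕ}
    (e : I ≃ J) (h : ∀ i j, M i j = N (e i) (e j)) {a b c : J} (h1 : 3 ≤ N b a) (h2 : 3 ≤ N c a)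
    (h3 : b ≠ c) (h4 : ∀ k, 3 ≤ N k a → k = b ∨ k = c) :
    M.IsMiddle (e.symm a) (e.symm b) (e.symm c) where
  left := by simpa [h] using h1
  right := by simpa [h] using h2
  ne := e.symm.injective.ne h3
  eq k hk := by
    rw [Equiv.eq_symm_apply, Equiv.eq_symm_apply]
    exact h4 _ (by simpa [h] using hk)

theorem CoxeterMatrix.IsMiddle.symm {I : Type} {M : CoxeterMatrix I} {d c e : I}
    (h : M.IsMiddle d c e) : M.IsMiddle d e c :=
  ⟨h.right, h.left, h.ne.symm, fun k hk => (h.eq k hk).symm⟩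

namespace IncGeometry

variable {I V V' : Type} {Γ : IncGeometry I V} {Γ' : IncGeometry I V'} {M : CoxeterMatrix I}

/-- Every flag can be extended by any missing type in at least three ways. -/
def IsRich (Γ : IncGeometry I V) : Prop :=
  ∀ X, Γ.IsFlag X → ∀ i ∉ Γ.typ '' X, 3 ≤ {v | Γ.typ v = i ∧ ∀ x ∈ X, Γ.inc x v}.encard

/-- By (F), only the vertices of the flag whose type is adjacent to `t` restrict the extension. If
such a type is missing at a middle node, any vertex of that type can be used in its place. -/
theorem isRich_of_leaf_or_middle (hM : M.IsGood) (hF : Γ.PropFOn M univ)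
    (h0 : ∀ t, 3 ≤ {x | Γ.typ x = t}.encard)
    (h : ∀ t, (∃ d, M.IsLeaf t d ∧
        ∀ l, Γ.typ l = d → 3 ≤ {x | Γ.typ x = t ∧ Γ.inc x l}.encard) ∨
      ∃ c e, M.IsMiddle t c e ∧ ∀ x y, Γ.typ x = c → Γ.typ y = e →
        3 ≤ {l | Γ.typ l = t ∧ Γ.inc x l ∧ Γ.inc y l}.encard) : Γ.IsRich := by
  intro X hX t ht
  have hne : ∀ x ∈ X, Γ.typ x ≠ t := fun x hx e => ht ⟨x, hx, e⟩
  have hfar : ∀ x ∈ X, ∀ v, Γ.typ v = t → ¬ 3 ≤ M (Γ.typ x) t → Γ.inc x v := by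
    rintro x hx v rfl hn
    exact hF x (mem_univ _) v (mem_univ _) ((hM.eq_two_or (hne x hx)).resolve_right hn)
  have hnon : ∀ t, ∃ x, Γ.typ x = t := by
    intro t
    by_contra! hcon
    have := h0 t
    rw [show {x | Γ.typ x = t} = ∅ from eq_empty_of_forall_notMem hcon] at this
    simp at this
  rcases h t with ⟨d, hd, hl⟩ | ⟨c, e, hce, hcom⟩
  · by_cases hX' : ∃ l ∈ X, Γ.typ l = d
    · obtain ⟨l, hlX, hld⟩ := hX'
      refine (hl l hld).trans (encard_le_encard ?_)
      rintro v ⟨hv, hvl⟩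
      refine ⟨hv, fun x hx => ?_⟩
      by_cases hxt : 3 ≤ M (Γ.typ x) t
      · rw [hX.eq_of_typ_eq hx hlX ((hd.eq _ hxt).trans hld.symm)]
        exact Γ.symm hvl
      · exact hfar x hx v hv hxt
    · refine (h0 t).trans (encard_le_encard fun v hv => ⟨hv, fun x hx => ?_⟩)
      exact hfar x hx v hv fun h => hX' ⟨x, hx, hd.eq _ h⟩
  · have hex : ∀ c, ∃ x, Γ.typ x = c ∧ ∀ x' ∈ X, Γ.typ x' = c → x' = x := by
      intro c
      by_cases hc : ∃ x ∈ X, Γ.typ x = c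
      · obtain ⟨x, hx, hxc⟩ := hc
        exact ⟨x, hxc, fun x' hx' h => hX.eq_of_typ_eq hx' hx (h.trans hxc.symm)⟩
      · obtain ⟨x, hx⟩ := hnon c
        exact ⟨x, hx, fun x' hx' h => absurd ⟨x', hx', h⟩ hc⟩
    obtain ⟨x, hx, hxX⟩ := hex c
    obtain ⟨y, hy, hyX⟩ := hex e
    refine (hcom x y hx hy).trans (encard_le_encard ?_)
    rintro v ⟨hv, hxv, hyv⟩
    refine ⟨hv, fun x' hx' => ?_⟩
    by_cases hxt : 3 ≤ M (Γ.typ x') t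
    · rcases hce.eq _ hxt with h | h
      · rwa [hxX x' hx' h]
      · rwa [hyX x' hx' h]
    · exact hfar x' hx' v hv hxt

/-- The geometry `Γ` is obtained by free steps from a finite part that contains the image of `Γ₀`
as a closed subset, and it is saturated and rich. -/
structure IsCompletion {D : Type} (Γ₀ : IncGeometry I D) (Γ : IncGeometry I V)
    (M : CoxeterMatrix I) (C : ℕ → Set V) (e : D → V) : Prop where
  finite : (C 0).Finite
  chain : Γ.IsFreeChain M C
  iUnion : ⋃ n, C n = univ
  int : Γ.IsIntermediateOn M univ
  sat : Γ.IsSaturatedOn M univ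
  iso : IsoOn Γ₀ Γ e univ
  closed : Γ.IsClosedIn M (range e) (C 0)
  rich : Γ.IsRich

/-- Finite intermediate geometries have countable completions. -/
def HasCompletions (M : CoxeterMatrix I) : Prop :=
  ∀ (D : Type) [Finite D] (Γ₀ : IncGeometry I D), Γ₀.IsIntermediateOn M univ →
    ∃ (V : Type) (_ : Countable V) (Γ : IncGeometry I V) (C : ℕ → Set V) (e : D → V),
      Γ₀.IsCompletion Γ M C e

/-- The choice of `p` leaves the added vertices of types `c` and `e` isolated and gives every vertex
of type `d` a neighbour of type `e`. The count at the simple bond yields common neighbours for `c`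
and `e`, then three neighbours of type `c` at each vertex of type `d`, and with these the count at
the bond with label 4 or 5 can be carried out. -/
theorem hasCompletions_of_three [Finite I] (hM : M.IsGood) {c d e : I} (hc : M.IsLeaf c d)
    (hd : M.IsMiddle d c e) (he : M.IsLeaf e d) (h3 : M c d = 3) (h45 : M e d = 4 ∨ M e d = 5)
    (hce : M c e = 2) (hall : ∀ t, t = c ∨ t = d ∨ t = e) : HasCompletions M := by
  classical
  intro D _ Γ₀ h₀
  have : Nonempty I := ⟨c⟩
  have hdc := M.ne_of_three_le hc.adj
  have hde := M.ne_of_three_le he.adj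
  obtain ⟨V, hV, Γ, C, f, R, hC0, hC, hCu, hint, hsat, hf, hcl, hR⟩ :=
    exists_ample_completion hM h₀ (p := fun t => if t = d then e else t) (by
      intro t
      by_cases ht : t = d
      · simp [ht, hde]
      · simp [ht])
  refine ⟨V, hV, Γ, C, f, hC0, hC, hCu, hint, hsat, hf, hcl, ?_⟩
  have hQ : ∀ l, Γ.typ l = d → {r ∈ R c | Γ.inc r l}.encard ≤ 2 := fun l hl =>
    (encard_inc_le_of_chain hC hCu hc.adj (hR.typ c) (hR.subset c)
      (hR.isolated c (by simp [hdc])) hl).1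
  have hcom := fun x y => three_le_encard_common (x := x) (y := y) hc hd h3 hce hint hsat
    (hR.typ c) (hR.card c) hQ
  have hleaf : ∀ l, Γ.typ l = d → 3 ≤ {x | Γ.typ x = c ∧ Γ.inc x l}.encard := by
    intro l hl
    obtain ⟨y, hy, hly⟩ := exists_inc_of_chain hC hCu (p := fun t => if t = d then e else t)
      hR.exists_inc l (by simpa [hl, M.symmetric d e] using he.adj)
    exact three_le_encard_leaf hc hd h3 hce hint hsat (hR.typ c) (hR.card c) hQ hl
      (by simpa [hl] using hy) hly
  have hleaf' : ∀ l, Γ.typ l = d → 3 ≤ {x | Γ.typ x = e ∧ Γ.inc x l}.encard := by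
    intro l hl
    obtain ⟨z, hz, hzl⟩ : {x | Γ.typ x = c ∧ Γ.inc x l}.Nonempty := by
      rw [nonempty_iff_ne_empty]
      intro h
      have := hleaf l hl
      simp [h] at this
    have hecard := hR.card e
    refine three_le_encard_leaf_of_four_le he hd.symm h45 (M.symmetric c e ▸ hce) hint hsat
      (hR.typ e) (hR.card e) (fun π hπ => ?_) (fun x y hx hy => ?_) hl hz (Γ.symm hzl)
    · exact encard_nearSet_le_of_chain hC hCu he (by omega) (hR.typ e) (hR.subset e)
        (hR.isolated e (by simp [hde])) hπ
    · simpa only [and_comm (a := Γ.inc y _)] using hcom y x hy hx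
  refine isRich_of_leaf_or_middle hM hint.propF (fun t => ?_) fun t => ?_
  · exact (le_trans (by norm_num) (hR.card t)).trans (encard_le_encard fun r hr => hR.typ t r hr)
  · rcases hall t with rfl | rfl | rfl
    · exact Or.inl ⟨d, hc, hleaf⟩
    · exact Or.inr ⟨c, e, hd, hcom⟩
    · exact Or.inl ⟨d, he, hleaf'⟩

/-- Here `p` interchanges the two middle types, so every vertex of a middle type has a neighbour of
the other one, while the added vertices of the two end types are isolated. Both halves of the
diagram are then treated by the count at a simple bond. -/
theorem hasCompletions_of_four [Finite I] (hM : M.IsGood) {c d e f : I} (hc : M.IsLeaf c d)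
    (hd : M.IsMiddle d c e) (he : M.IsMiddle e d f) (hf : M.IsLeaf f e) (h3 : M c d = 3)
    (h3' : M f e = 3) (hce : M c e = 2) (hdf : M f d = 2)
    (hall : ∀ t, t = c ∨ t = d ∨ t = e ∨ t = f) : HasCompletions M := by
  classical
  intro D _ Γ₀ h₀
  have : Nonempty I := ⟨c⟩
  have hcd := M.ne_of_three_le hc.adj
  have hfe := M.ne_of_three_le hf.adj
  obtain ⟨V, hV, Γ, C, g, R, hC0, hC, hCu, hint, hsat, hg, hcl, hR⟩ :=
    exists_ample_completion hM h₀ (p := Equiv.swap d e) fun t _ => Equiv.swap_apply_self d e t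
  refine ⟨V, hV, Γ, C, g, hC0, hC, hCu, hint, hsat, hg, hcl, ?_⟩
  have hinc := exists_inc_of_chain hC hCu hR.exists_inc
  have key : ∀ {c d' e' : I}, M.IsLeaf c d' → M.IsMiddle d' c e' → M c d' = 3 → M c e' = 2 →
      Equiv.swap d e c = c → Equiv.swap d e d' = e' →
      (∀ x y, Γ.typ x = c → Γ.typ y = e' →
        3 ≤ {l | Γ.typ l = d' ∧ Γ.inc x l ∧ Γ.inc y l}.encard) ∧
      ∀ l, Γ.typ l = d' → 3 ≤ {x | Γ.typ x = c ∧ Γ.inc x l}.encard := by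
    intro c d' e' hc hd h3 hce hpc hpd
    have hQ : ∀ l, Γ.typ l = d' → {r ∈ R c | Γ.inc r l}.encard ≤ 2 := fun l hl =>
      (encard_inc_le_of_chain hC hCu hc.adj (hR.typ c) (hR.subset c)
        (hR.isolated c (by simp [hpc])) hl).1
    refine ⟨fun x y => three_le_encard_common hc hd h3 hce hint hsat (hR.typ c) (hR.card c) hQ,
      fun l hl => ?_⟩
    obtain ⟨y, hy, hly⟩ := hinc l (by rw [hl, hpd, M.symmetric]; exact hd.right)
    exact three_le_encard_leaf hc hd h3 hce hint hsat (hR.typ c) (hR.card c) hQ hl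
      (by rw [hy, hl, hpd]) hly
  have h1 := key hc hd h3 hce (Equiv.swap_apply_of_ne_of_ne hcd hd.ne) (Equiv.swap_apply_left d e)
  have h2 := key hf he.symm h3' hdf (Equiv.swap_apply_of_ne_of_ne he.ne.symm hfe)
    (Equiv.swap_apply_right d e)
  refine isRich_of_leaf_or_middle hM hint.propF (fun t => ?_) fun t => ?_
  · exact (le_trans (by norm_num) (hR.card t)).trans (encard_le_encard fun r hr => hR.typ t r hr)
  · rcases hall t with rfl | rfl | rfl | rfl
    · exact Or.inl ⟨d, hc, h1.2⟩
    · exact Or.inr ⟨c, e, hd, h1.1⟩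
    · exact Or.inr ⟨f, d, he.symm, h2.1⟩
    · exact Or.inl ⟨e, hf, h2.2⟩

end IncGeometry

/-- The combinatorial content of the diagrams `C₃`, `H₃`, `F₄` that is used below. -/
structure CoxeterMatrix.IsAdmissible {I : Type} (M : CoxeterMatrix I) : Prop where
  nonempty : Nonempty I
  good : M.IsGood
  linked : M.IsLinked
  rank_le : Nat.card I ≤ 4
  completions : IncGeometry.HasCompletions M

/-- The labels are given by a literal matrix `N`, so that all conditions on the diagram can be
decided. -/
theorem CoxeterMatrix.isAdmissible_of_three {I : Type} [Finite I] {M : CoxeterMatrix I}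
    {N : Fin 3 → Fin 3 → ℕ} (hN : N = ![![1, 3, 2], ![3, 1, 4], ![2, 4, 1] ] ∨
      N = ![![1, 3, 2], ![3, 1, 5], ![2, 5, 1] ]) (e : I ≃ Fin 3)
    (h : ∀ i j, M i j = N (e i) (e j)) : M.IsAdmissible := by
  have hg : M.IsGood := by
    rcases hN with rfl | rfl <;>
      exact CoxeterMatrix.isGood_of_equiv e h (by decide) (by decide) (by decide)
  refine ⟨⟨e.symm 0⟩, hg, ?_, by simp [Nat.card_congr e], ?_⟩
  · have : ∀ i j : Fin 3, i ≠ j → ∃ h, h ≠ i ∧ h ≠ j ∧ (3 ≤ N h i ∨ 3 ≤ N h j) := by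
      rcases hN with rfl | rfl <;> decide
    intro i j hij
    obtain ⟨k, h1, h2, h3⟩ := this (e i) (e j) (e.injective.ne hij)
    exact ⟨e.symm k, by rwa [Ne, Equiv.symm_apply_eq], by rwa [Ne, Equiv.symm_apply_eq],
      by simpa [h] using h3⟩
  · rcases hN with rfl | rfl <;>
      exact IncGeometry.hasCompletions_of_three hg (c := e.symm 0) (d := e.symm 1) (e := e.symm 2)
        (CoxeterMatrix.isLeaf_of_equiv e h (by decide) (by decide))
        (CoxeterMatrix.isMiddle_of_equiv e h (by decide) (by decide) (by decide) (by decide))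
        (CoxeterMatrix.isLeaf_of_equiv e h (by decide) (by decide)) (by simp [h]) (by simp [h])
        (by simp [h]) (by
          intro t
          simp only [Equiv.eq_symm_apply]
          generalize e t = s
          revert s; decide)

theorem CoxeterMatrix.isAdmissible_of_four {I : Type} [Finite I] {M : CoxeterMatrix I}
    {N : Fin 4 → Fin 4 → ℕ}
    (hN : N = ![![1, 3, 2, 2], ![3, 1, 4, 2], ![2, 4, 1, 3], ![2, 2, 3, 1] ]) (e : I ≃ Fin 4)
    (h : ∀ i j, M i j = N (e i) (e j)) : M.IsAdmissible := by
  subst hN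
  have hg : M.IsGood :=
    CoxeterMatrix.isGood_of_equiv e h (by decide) (by decide) (by decide)
  refine ⟨⟨e.symm 0⟩, hg, ?_, by simp [Nat.card_congr e], ?_⟩
  · intro i j hij
    have : ∀ i j : Fin 4, i ≠ j → ∃ h, h ≠ i ∧ h ≠ j ∧
        (3 ≤ (![![1, 3, 2, 2], ![3, 1, 4, 2], ![2, 4, 1, 3], ![2, 2, 3, 1] ] : Fin 4 → Fin 4 → ℕ)
          h i ∨ 3 ≤ (![![1, 3, 2, 2], ![3, 1, 4, 2], ![2, 4, 1, 3], ![2, 2, 3, 1] ] :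
            Fin 4 → Fin 4 → ℕ) h j) := by decide
    obtain ⟨k, h1, h2, h3⟩ := this (e i) (e j) (e.injective.ne hij)
    exact ⟨e.symm k, by rwa [Ne, Equiv.symm_apply_eq], by rwa [Ne, Equiv.symm_apply_eq],
      by simpa only [h, Equiv.apply_symm_apply] using h3⟩
  · exact IncGeometry.hasCompletions_of_four hg (c := e.symm 0) (d := e.symm 1) (e := e.symm 2)
      (f := e.symm 3)
      (CoxeterMatrix.isLeaf_of_equiv e h (by decide) (by decide))
      (CoxeterMatrix.isMiddle_of_equiv e h (by decide) (by decide) (by decide) (by decide))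
      (CoxeterMatrix.isMiddle_of_equiv e h (by decide) (by decide) (by decide) (by decide))
      (CoxeterMatrix.isLeaf_of_equiv e h (by decide) (by decide)) (by simp [h]) (by simp [h])
      (by simp [h]) (by simp [h]) (by
        intro t
        simp only [Equiv.eq_symm_apply]
        generalize e t = s
        revert s; decide)

theorem CoxeterMatrix.isAdmissible_of_hasDiagram {I : Type} [Finite I] {M : CoxeterMatrix I}
    (hM : M.HasDiagram (CoxeterMatrix.B 3) ∨ M.HasDiagram CoxeterMatrix.H₃ ∨
      M.HasDiagram CoxeterMatrix.F₄) : M.IsAdmissible := by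
  have h0 : ∀ {J : Type} {N : CoxeterMatrix J} (e : I ≃ J), M.reindex e = N →
      ∀ i j, M i j = N (e i) (e j) := by
    rintro J _ e rfl i j
    simp [CoxeterMatrix.reindex_apply]
  rcases hM with ⟨e, h⟩ | ⟨e, h⟩ | ⟨e, h⟩
  · refine isAdmissible_of_three (Or.inl rfl) e fun i j => (h0 e h i j).trans ?_
    generalize e i = a
    generalize e j = b
    fin_cases a <;> fin_cases b <;> rfl
  · refine isAdmissible_of_three (Or.inr rfl) e fun i j => (h0 e h i j).trans ?_
    generalize e i = a
    generalize e j = b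
    fin_cases a <;> fin_cases b <;> rfl
  · refine isAdmissible_of_four rfl e fun i j => (h0 e h i j).trans ?_
    generalize e i = a
    generalize e j = b
    fin_cases a <;> fin_cases b <;> rfl

/-! ### Incidence graphs of generalized polygons -/

namespace SimpleGraph

variable {V α : Type*} {G : SimpleGraph V}

/-- The graph `G` has the vertices in `W`, is 2-coloured by `t`, and is like the incidence graph of
a generalized `m`-gon. -/
structure IsPolygonOn (G : SimpleGraph V) (m : ℕ) (W : Set V) (t : V → α) (x y : α) : Prop where
  two_le : 2 ≤ m
  nonempty : W.Nonempty
  mem : ∀ u v, G.Adj u v → u ∈ W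
  typ_mem : ∀ u ∈ W, t u = x ∨ t u = y
  typ_ne : ∀ u v, G.Adj u v → t u ≠ t v
  short : G.NoShortCycle m
  join : ∀ u ∈ W, ∀ v ∈ W, (t v = t u ↔ Odd m) → ∃ l b, l < m ∧ G.IsPathSeq l b ∧ b 0 = u ∧ b l = v
  degree : ∀ u ∈ W, ∀ v, ∃ w, w ≠ v ∧ G.Adj u w

namespace IsPathSeq

theorem snoc {l : ℕ} {b : ℕ → V} (hb : G.IsPathSeq l b) {w : V} (hw : G.Adj (b l) w)
    (hn : ∀ k ≤ l, b k ≠ w) : G.IsPathSeq (l + 1) (fun k => if k ≤ l then b k else w) where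
  adj k hk := by
    rcases (Nat.lt_succ_iff.1 hk).lt_or_eq with h | rfl
    · simp only [h.le, if_true, Nat.succ_le_of_lt h]
      exact hb.adj k h
    · simpa using hw
  inj k hk r hr e := by
    simp only [mem_Iic] at hk hr
    by_cases h1 : k ≤ l <;> by_cases h2 : r ≤ l <;> simp only [h1, h2, if_true, if_false] at e
    · exact hb.inj h1 h2 e
    · exact absurd e (hn k h1)
    · exact absurd e.symm (hn r h2)
    · omega

end IsPathSeq

/-- If `w` were the vertex `b k`, then the edge and the segment of `b` from `b k` to `b l` would be
two short paths with the same ends, which forces `k = l - 1`. -/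
theorem NoShortCycle.notMem_of_ne {m : ℕ} (hG : G.NoShortCycle m) {l : ℕ} {b : ℕ → V}
    (hb : G.IsPathSeq l b) (hl : l + 1 < 2 * m) {w : V} (hw : G.Adj (b l) w) (hne : w ≠ b (l - 1)) :
    ∀ k ≤ l, b k ≠ w := by
  rintro k hk rfl
  rcases hk.lt_or_eq with hk | rfl
  · have h1 := hb.segment (r := k) (s := l - k) (by omega)
    have h2 : G.IsPathSeq 1 (fun n => if n = 0 then b k else b l) := by
      refine ⟨fun n hn => ?_, fun n hn r hr e => ?_⟩
      · obtain rfl : n = 0 := by omega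
        simpa using hw.symm
      · have hn' : n = 0 ∨ n = 1 := by simp only [mem_Iic] at hn; omega
        have hr' : r = 0 ∨ r = 1 := by simp only [mem_Iic] at hr; omega
        rcases hn' with rfl | rfl <;> rcases hr' with rfl | rfl
        · rfl
        · exact absurd e hw.ne'
        · exact absurd e hw.ne
        · rfl
    have := (hG.path_unique h1 h2 (by simp) (by simp [show k + (l - k) = l by omega]) (by omega)).1
    exact hne (by rw [show k = l - 1 by omega])
  · exact G.loopless.irrefl _ hw

namespace IsPolygonOn

variable {m : ℕ} {W : Set V} {t : V → α} {x y : α}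

theorem adj_typ (h : G.IsPolygonOn m W t x y) (u v : V) (huv : G.Adj u v) :
    t u ≠ t v ∧ (t u = x ∨ t u = y) ∧ (t v = x ∨ t v = y) :=
  ⟨h.typ_ne u v huv, h.typ_mem u (h.mem u v huv), h.typ_mem v (h.mem v u huv.symm)⟩

/-- If the parity is wrong for `join`, it is right for a neighbour of `v`, and one edge is appended.
-/
theorem exists_path (h : G.IsPolygonOn m W t x y) {u v : V} (hu : u ∈ W) (hv : v ∈ W) :
    ∃ l b, l ≤ m ∧ G.IsPathSeq l b ∧ b 0 = u ∧ b l = v := by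
  by_cases hp : t v = t u ↔ Odd m
  · obtain ⟨l, b, hl, hb⟩ := h.join u hu v hv hp
    exact ⟨l, b, hl.le, hb⟩
  · obtain ⟨w, -, hw⟩ := h.degree v hv v
    have hww := h.mem w v hw.symm
    obtain ⟨l, b, hl, hb, rfl, rfl⟩ := h.join u hu w hww (by
      have h1 := h.typ_ne v w hw
      have h2 := h.typ_mem u hu
      have h3 := h.typ_mem v hv
      have h4 := h.typ_mem w hww
      have : t w = t u ↔ ¬ t v = t u := by grind
      tauto)
    obtain ⟨p, -, hp, -⟩ := hb.exists_walk
    obtain ⟨l', b', hl', hb', h0, h1⟩ := (p.concat hw.symm).exists_isPathSeq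
    rw [Walk.length_concat, hp] at hl'
    exact ⟨l', b', by omega, hb', h0, h1⟩

theorem exists_long_path (h : G.IsPolygonOn m W t x y) {u : V} (hu : u ∈ W) {l : ℕ} (hl : l ≤ m) :
    ∃ b, G.IsPathSeq l b ∧ b 0 = u := by
  induction l with
  | zero => exact ⟨fun _ => u, ⟨fun k hk => absurd hk (Nat.not_lt_zero k),
      fun k hk r hr _ => (Nat.le_zero.1 hk).trans (Nat.le_zero.1 hr).symm⟩, rfl⟩
  | succ l ih =>
    obtain ⟨b, hb, rfl⟩ := ih (by omega)
    have hbl : b l ∈ W := by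
      rcases l with - | l
      · exact hu
      · exact h.mem _ _ (hb.adj l (by omega)).symm
    obtain ⟨w, hw, hbw⟩ := h.degree _ hbl (b (l - 1))
    have := h.two_le
    exact ⟨_, hb.snoc hbw (h.short.notMem_of_ne hb (by omega) hbw hw),
      if_pos (Nat.zero_le l)⟩

/-- Join `b 0` to another neighbour of `b m` by a short path, and append the edge to `b m`. The
result has length `m`, since anything shorter would coincide with `b`. -/
theorem exists_second_path (h : G.IsPolygonOn m W t x y) {b : ℕ → V} (hb : G.IsPathSeq m b) :
    ∃ b', G.IsPathSeq m b' ∧ b' 0 = b 0 ∧ b' m = b m ∧ b' (m - 1) ≠ b (m - 1) := by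
  have h2 := h.two_le
  have h0 : b 0 ∈ W := h.mem _ _ (hb.adj 0 (by omega))
  have hm : b m ∈ W := by
    have := hb.adj (m - 1) (by omega)
    rw [show m - 1 + 1 = m by omega] at this
    exact h.mem _ _ this.symm
  obtain ⟨w, hw, hbw⟩ := h.degree _ hm (b (m - 1))
  have hsn := hb.snoc hbw (h.short.notMem_of_ne hb (by omega) hbw hw)
  have hpar := apply_eq_iff_even h.adj_typ hsn.adj
  simp only [Nat.zero_le, if_true, show ¬ m + 1 ≤ m by omega, if_false,
    Nat.even_add_one, Nat.not_even_iff_odd] at hpar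
  obtain ⟨l, c, hl, hc, hc0, rfl⟩ := h.join _ h0 w (h.mem _ _ hbw.symm) hpar
  have hne : b m ≠ c (l - 1) := by
    intro e
    have := (h.short.path_unique (hc.segment (r := 0) (s := l - 1) (by omega)) hb
      (by simpa using hc0) (by simpa using e.symm) (by omega)).1
    omega
  have hc' := hc.snoc hbw.symm (h.short.notMem_of_ne hc (by omega) hbw.symm hne)
  have hlm : l + 1 = m := by
    by_contra hcon
    have := (h.short.path_unique hc' hb (by simpa using hc0) (by simp) (by omega)).1
    omega
  subst hlm
  exact ⟨_, hc', by simpa using hc0, by simp, by simpa using hw⟩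

theorem ediam_eq (h : G.IsPolygonOn m W t x y) (hW : W = univ) : G.ediam = m := by
  subst hW
  refine le_antisymm (ediam_le_of_edist_le fun u v => ?_) ?_
  · obtain ⟨l, b, hl, hb, rfl, rfl⟩ := h.exists_path (mem_univ u) (mem_univ v)
    exact hb.edist_le.trans (by exact_mod_cast hl)
  · obtain ⟨u, hu⟩ := h.nonempty
    obtain ⟨b, hb, rfl⟩ := h.exists_long_path hu le_rfl
    refine le_trans ?_ (edist_le_ediam (u := b 0) (v := b m))
    by_contra! hlt
    obtain ⟨l, c, hl, hc, h0, h1⟩ := exists_isPathSeq_of_edist_lt hlt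
    have := (h.short.path_unique hc hb h0 h1 (by omega)).1
    omega

theorem egirth_eq (h : G.IsPolygonOn m W t x y) : G.egirth = 2 * m := by
  refine le_antisymm ?_ (le_egirth.2 fun u c hc => ?_)
  · obtain ⟨u, hu⟩ := h.nonempty
    obtain ⟨b, hb, rfl⟩ := h.exists_long_path hu le_rfl
    obtain ⟨b', hb', h0, h1, hne⟩ := h.exists_second_path hb
    obtain ⟨p, hp, hpl, hpb⟩ := hb.exists_walk
    obtain ⟨q, hq, hql, hqb⟩ := hb'.exists_walk
    obtain ⟨q', hq', hql', hqb'⟩ : ∃ q' : G.Walk (b 0) (b m), q'.IsPath ∧ q'.length = m ∧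
        ∀ k ≤ m, q'.getVert k = b' k :=
      ⟨q.copy h0 h1, by simpa using hq, by simpa using hql, fun k hk => by simpa using hqb k hk⟩
    have hpq : p ≠ q' := by
      rintro rfl
      exact hne ((hqb' _ (by omega)).symm.trans (hpb _ (by omega)))
    obtain ⟨w, -, -, c, hc, hcl⟩ := hp.exists_isCycle_length_le_add_of_ne hq' hpq
    refine (egirth_le_length hc).trans ?_
    rw [hpl, hql'] at hcl
    exact_mod_cast (show c.length ≤ 2 * m by omega)
  · exact_mod_cast hc.two_mul_le_length h.short

/-- The unique shortest paths are those of length less than `m`. -/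
theorem exists_unique_shortest_iff (h : G.IsPolygonOn m W t x y) {u v z : V} (hu : u ∈ W)
    (hv : v ∈ W) {k : ℕ} :
    (∃ p : G.Walk u v, (∀ q : G.Walk u v, q ≠ p → p.length < q.length) ∧ k ≤ p.length ∧
      z = p.getVert k) ↔
    ∃ l b, l < m ∧ G.IsPathSeq l b ∧ b 0 = u ∧ b l = v ∧ k ≤ l ∧ z = b k := by
  constructor
  · rintro ⟨p, hp, hk, rfl⟩
    have hpath : p.IsPath := by
      classical
      by_contra hcon
      have hne : p.bypass ≠ p := fun e => hcon (e ▸ p.bypass_isPath)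
      exact absurd (hp _ hne) (not_lt.2 p.length_bypass_le_length)
    refine ⟨p.length, p.getVert, ?_, hpath.isPathSeq, by simp, by simp, hk, rfl⟩
    by_contra hlt
    obtain ⟨l, b, hl, hb, rfl, rfl⟩ := h.exists_path hu hv
    obtain ⟨q, hq, hql, hqb⟩ := hb.exists_walk
    have hqp : q = p := by
      by_contra hne
      have := hp q hne
      omega
    subst hqp
    obtain rfl : l = m := by omega
    -- A path of length `m` is not a unique shortest path, because there is a second one.
    obtain ⟨b', hb', h0, h1, hne⟩ := h.exists_second_path hb
    obtain ⟨r, hr, hrl, hrb⟩ := hb'.exists_walk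
    have h3 : ∀ {u v : V} (e0 : b' 0 = u) (e1 : b' l = v), ∃ r' : G.Walk u v, r'.length = l ∧
        r'.getVert (l - 1) = b' (l - 1) := by
      rintro _ _ rfl rfl
      exact ⟨r, hrl, hrb _ (by omega)⟩
    obtain ⟨r', hr'l, hr'b⟩ := h3 h0 h1
    have := hp r' (by
      rintro rfl
      exact hne (hr'b.symm.trans (hqb _ (by omega))))
    omega
  · rintro ⟨l, b, hl, hb, rfl, rfl, hk, rfl⟩
    obtain ⟨p, hp, hpl, hpb⟩ := hb.exists_walk
    refine ⟨p, fun q hq => ?_, by omega, (hpb k hk).symm⟩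
    by_contra! hle
    have hqpath : q.IsPath := by
      classical
      by_contra hcon
      obtain ⟨l', b', hl', hb', h0, h1⟩ := q.exists_isPathSeq
      have h1 := (h.short.path_unique hb hb' h0.symm h1.symm (by omega)).1
      have h2 : q.bypass.length = l := by
        have := (h.short.path_unique hb q.bypass_isPath.isPathSeq (by simp) (by simp) (by
          have := q.length_bypass_le_length
          omega)).1
        exact this.symm
      have h3 : q.bypass.length = q.length := by omega
      exact hcon ((Walk.bypass_eq_self_of_length_le_length_bypass q h3.ge) ▸ q.bypass_isPath)
    have h1 := h.short.path_unique hb hqpath.isPathSeq (by simp) (by simp) (by omega)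
    refine hq (Walk.ext_getVert fun n => ?_)
    rcases le_total n l with hn | hn
    · rw [← h1.2 n hn, hpb n hn]
    · rw [Walk.getVert_of_length_le _ (by omega), Walk.getVert_of_length_le _ (by omega)]

end IsPolygonOn

end SimpleGraph

theorem SimpleGraph.IsPolygonOn.comap_val {V α : Type*} {G : SimpleGraph V} {m : ℕ} {W : Set V}
    {t : V → α} {x y : α} (h : G.IsPolygonOn m W t x y) :
    (G.comap ((↑) : W → V)).IsPolygonOn m univ (fun v => t v) x y where
  two_le := h.two_le
  nonempty := by
    obtain ⟨u, hu⟩ := h.nonempty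
    exact ⟨⟨u, hu⟩, mem_univ _⟩
  mem _ _ _ := mem_univ _
  typ_mem u _ := h.typ_mem u u.2
  typ_ne u v huv := h.typ_ne u v huv
  short n v hv := h.short n (fun k => v k) ⟨hv.three_le, fun k => by rw [hv.periodic], hv.adj,
    fun k hk r hr e => hv.inj hk hr (Subtype.ext e)⟩
  join u _ v _ huv := by
    obtain ⟨l, b, hl, hb, h0, h1⟩ := h.join u u.2 v v.2 huv
    have hbW : ∀ k ≤ l, b k ∈ W := by
      intro k hk
      rcases hk.lt_or_eq with hk | rfl
      · exact h.mem _ _ (hb.adj k hk)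
      · exact h1 ▸ v.2
    classical
    have hv : ∀ k (hk : k ≤ l), ((if h : k ≤ l then ⟨b k, hbW k h⟩ else u : W) : V) = b k :=
      fun k hk => by rw [dif_pos hk]
    refine ⟨l, fun k => if h : k ≤ l then ⟨b k, hbW k h⟩ else u, hl,
      ⟨fun k hk => ?_, fun k hk r hr e => ?_⟩, ?_, ?_⟩
    · rw [SimpleGraph.comap_adj, hv k hk.le, hv (k + 1) hk]
      exact hb.adj k hk
    · have := congrArg Subtype.val e
      simp only [hv k hk, hv r hr] at this
      exact hb.inj hk hr this
    · exact Subtype.ext ((hv 0 (Nat.zero_le l)).trans h0)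
    · exact Subtype.ext ((hv l le_rfl).trans h1)
  degree u _ v := by
    obtain ⟨w, hw, huw⟩ := h.degree u u.2 v
    exact ⟨⟨w, h.mem _ _ huw.symm⟩, fun e => hw (congrArg Subtype.val e), huw⟩

/-! ### Rich saturated intermediate geometries and geometries of type `M` -/

namespace IncGeometry

variable {I V V' : Type} {Γ : IncGeometry I V} {Γ' : IncGeometry I V'} {M : CoxeterMatrix I}

theorem IsFlag.insert {X : Set V} (hX : Γ.IsFlag X) {v : V} (hv : ∀ x ∈ X, Γ.inc x v) :
    Γ.IsFlag (insert v X) := by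
  rintro x (rfl | hx) y (rfl | hy)
  · exact inc_self _
  · exact Γ.symm (hv y hy)
  · exact hv x hx
  · exact hX x hx y hy

theorem graphOn_adj_typ {X : Set V} {i j : I} (u v : V)
    (h : (Γ.graphOn (Γ.localSet X i j)).Adj u v) :
    Γ.typ u ≠ Γ.typ v ∧ (Γ.typ u = i ∨ Γ.typ u = j) ∧ (Γ.typ v = i ∨ Γ.typ v = j) :=
  ⟨fun e => h.2.2.1 ((Γ.inc_iff_eq e).1 h.2.2.2), h.1.2, h.2.1.2⟩

theorem IsLocalFlag.symm {X : Set V} {i j : I} (h : Γ.IsLocalFlag M X i j) :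
    Γ.IsLocalFlag M X j i :=
  ⟨h.1, h.2.1.symm, h.2.2.2.1, h.2.2.1, fun k hk hk' hkk => h.2.2.2.2 k hk' hk hkk.symm⟩

theorem localGraph_univ (X : Set V) (i j : I) :
    Γ.localGraph X i j univ = Γ.graphOn (Γ.localSet X i j) := by
  rw [localGraph, inter_univ]

theorem IsLocalFlag.exists_tight_univ (hM : M.IsGood) {X : Set V} {i j : I}
    (hF : Γ.PropFOn M univ) (h : Γ.IsLocalFlag M X i j) (hij : M i j ≠ 2) :
    ∃ Y ⊆ X, Γ.IsTightFlag M Y i j ∧ Γ.localSet Y i j = Γ.localSet X i j := by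
  obtain ⟨Y, h1, h2, h3, -⟩ := h.exists_tight hM hF hij (subset_univ X)
  rw [inter_univ, inter_univ] at h3
  exact ⟨Y, h1, h2, h3⟩

/-- Intermediate, saturated and rich geometries. -/
structure IsFull (Γ : IncGeometry I V) (M : CoxeterMatrix I) : Prop where
  int : Γ.IsIntermediateOn M univ
  sat : Γ.IsSaturatedOn M univ
  rich : Γ.IsRich

/-- A weakening of `IsFull`, in which only flags with two vertices need have extensions. -/
structure IsNearFull (Γ : IncGeometry I V) (M : CoxeterMatrix I) : Prop where
  int : Γ.IsIntermediateOn M univ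
  sat : Γ.IsSaturatedOn M univ
  rich : ∀ X, Γ.IsFlag X → X.Nontrivial → ∀ i ∉ Γ.typ '' X,
    3 ≤ {v | Γ.typ v = i ∧ ∀ x ∈ X, Γ.inc x v}.encard

theorem IsFull.isNearFull (h : Γ.IsFull M) : Γ.IsNearFull M :=
  ⟨h.int, h.sat, fun X hX _ => h.rich X hX⟩

theorem IsLocalFlag.nonempty (hL : M.IsLinked) {X : Set V} {i j : I} (hX : Γ.IsLocalFlag M X i j) :
    X.Nonempty := by
  obtain ⟨h, hi, hj, hh⟩ := hL i j hX.2.1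
  obtain ⟨x, hx, -⟩ := hX.2.2.2.2 h hi hj (by omega)
  exact ⟨x, hx⟩

/-- For adjacent types, (P) gives the girth and saturation gives the short paths; for non-adjacent
types, (F) does both. The degrees come from extending `insert u X`, which has at least two vertices
because a local flag of a linked diagram is not empty. -/
theorem IsNearFull.isPolygonOn (hM : M.IsGood) (hL : M.IsLinked) (h : Γ.IsNearFull M) {X : Set V}
    {i j : I} (hX : Γ.IsLocalFlag M X i j) (hne : (Γ.localSet X i j).Nonempty) :
    (Γ.graphOn (Γ.localSet X i j)).IsPolygonOn (M i j) (Γ.localSet X i j) Γ.typ i j where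
  two_le := hM.two_le i j hX.2.1
  nonempty := hne
  mem u v huv := huv.1
  typ_mem u hu := hu.2
  typ_ne u v huv := (graphOn_adj_typ u v huv).1
  short := by
    rcases hM.eq_two_or hX.2.1 with h2 | h3
    · rw [h2]
      refine SimpleGraph.noShortCycle_of_bipartite graphOn_adj_typ fun k hk n v hv => ?_
      have := hv.three_le
      omega
    · obtain ⟨Y, -, hY, e⟩ := hX.exists_tight_univ hM h.int.propF (by omega)
      have := h.int.propP i j Y (subset_univ _) hY
      rwa [localGraph_univ, e] at this
  join u hu v hv huv := by
    rcases hM.eq_two_or hX.2.1 with h2 | h3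
    · have hne : Γ.typ v ≠ Γ.typ u := fun e => absurd (huv.1 e) (by rw [h2]; decide)
      have hinc : Γ.inc u v := by
        refine h.int.propF u (mem_univ _) v (mem_univ _) ?_
        rcases hu.2 with e | e <;> rcases hv.2 with e' | e' <;> rw [e, e'] at hne ⊢
        · exact absurd rfl hne
        · exact h2
        · rw [M.symmetric]; exact h2
        · exact absurd rfl hne
      have huv' : u ≠ v := fun e => hne (e ▸ rfl)
      refine ⟨1, fun k => if k = 0 then u else v, by omega, ⟨fun k hk => ?_, fun k hk r hr e => ?_⟩,
        by simp, by simp⟩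
      · obtain rfl : k = 0 := by omega
        exact ⟨hu, hv, huv', hinc⟩
      · simp only [mem_Iic] at hk hr
        by_cases h0 : k = 0 <;> by_cases h1 : r = 0 <;> simp only [h0, h1, if_true, if_false] at e
        · omega
        · exact absurd e huv'
        · exact absurd e.symm huv'
        · omega
    · obtain ⟨Y, -, hY, e⟩ := hX.exists_tight_univ hM h.int.propF (by omega)
      have := h.sat Y i j (subset_univ _) hY u ⟨e ▸ hu, mem_univ _⟩ v ⟨e ▸ hv, mem_univ _⟩ huv
      rwa [localGraph_univ, e] at this
  degree u hu v := by
    wlog hi : Γ.typ u = i generalizing i j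
    · rw [localSet_comm] at hne hu ⊢
      exact this hX.symm hne hu (hu.2.resolve_right hi)
    have hnj : j ∉ Γ.typ '' (insert u X) := by
      rintro ⟨x, rfl | hx, e⟩
      · exact hX.2.1 (hi.symm.trans e)
      · exact hX.2.2.2.1 ⟨x, hx, e⟩
    obtain ⟨x, hx⟩ := hX.nonempty hL
    have h3 := h.rich _ (hX.1.insert hu.1.2)
      ⟨u, Or.inl rfl, x, Or.inr hx, fun e => hu.1.1 (e ▸ hx)⟩ j hnj
    obtain ⟨w, ⟨hw, hwX⟩, hwv⟩ := exists_ne_of_one_lt_encard (lt_of_lt_of_le (by norm_num) h3) v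
    refine ⟨w, hwv, hu, ⟨⟨fun hX' => hnj ⟨w, Or.inr hX', hw⟩, fun x hx => hwX x (Or.inr hx)⟩,
      Or.inr hw⟩, ?_, hwX u (Or.inl rfl)⟩
    rintro rfl
    exact hX.2.1 (hi.symm.trans hw)

/-- Adding a vertex of the only missing type turns a flag of corank 1 into a maximal flag, and
different vertices give different flags. -/
theorem IsRich.isThick (h : Γ.IsRich) : Γ.IsThick := by
  intro X hX hc
  obtain ⟨i, hi⟩ := encard_eq_one.1 hc
  have hiX : i ∉ Γ.typ '' X := (hi.symm ▸ mem_singleton i : i ∈ (Γ.typ '' X)ᶜ)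
  refine (h X hX i hiX).trans (encard_le_encard_of_injOn (f := fun v => insert v X) ?_ ?_)
  · rintro v ⟨hv, hvX⟩
    refine ⟨⟨hX.insert hvX, fun Y hY hsub y hy => ?_⟩, subset_insert v X⟩
    obtain ⟨x, hx, hxy⟩ : ∃ x ∈ insert v X, Γ.typ x = Γ.typ y := by
      by_cases hyX : Γ.typ y ∈ Γ.typ '' X
      · obtain ⟨x, hx, e⟩ := hyX
        exact ⟨x, Or.inr hx, e⟩
      · have : Γ.typ y ∈ ({i} : Set I) := hi ▸ hyX
        exact ⟨v, Or.inl rfl, hv.trans this.symm⟩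
    exact hY.eq_of_typ_eq (hsub hx) hy hxy ▸ hx
  · rintro v ⟨hv, -⟩ w ⟨hw, -⟩ e
    have : v ∈ insert w X := (show insert v X = insert w X from e) ▸ mem_insert v X
    exact this.resolve_right fun hvX => hiX ⟨v, hvX, hv⟩

theorem IsRich.residue (h : Γ.IsRich) {X : Set V} (hX : Γ.IsFlag X) : (Γ.residue X).IsRich := by
  rintro Z hZ ⟨i, hiX⟩ hi
  have hfl : Γ.IsFlag (X ∪ Subtype.val '' Z) := by
    rintro x (hx | ⟨x, hx, rfl⟩) y (hy | ⟨y, hy, rfl⟩)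
    · exact hX x hx y hy
    · exact y.2.2 x hx
    · exact Γ.symm (x.2.2 y hy)
    · exact hZ x hx y hy
  have hni : i ∉ Γ.typ '' (X ∪ Subtype.val '' Z) := by
    rintro ⟨x, hx | ⟨x, hx, rfl⟩, e⟩
    · exact hiX ⟨x, hx, e⟩
    · exact hi ⟨x, hx, Subtype.ext e⟩
  refine (h _ hfl i hni).trans ?_
  rw [← Function.Injective.encard_image Subtype.val_injective]
  refine encard_le_encard ?_
  rintro v ⟨rfl, hvX⟩
  exact ⟨⟨v, fun hv => hiX ⟨v, hv, rfl⟩, fun x hx => hvX x (Or.inl hx)⟩, ⟨rfl, fun x hx =>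
    hvX x (Or.inr ⟨x, hx, rfl⟩)⟩, rfl⟩

namespace IsFull

theorem isPolygonOn_residue (hM : M.IsGood) (hL : M.IsLinked) (h : Γ.IsFull M) {X : Set V} (hX : Γ.IsFlag X)
    {i j : I} (hij : i ≠ j) (ht : (Γ.typ '' X)ᶜ = {i, j}) :
    (Γ.residue X).graph.IsPolygonOn (M i j) univ (fun v => Γ.typ v) i j := by
  have hmem : ∀ k, k ∉ Γ.typ '' X ↔ k = i ∨ k = j := fun k => by
    rw [← mem_compl_iff, ht]; rfl
  have hloc : Γ.IsLocalFlag M X i j := by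
    refine ⟨hX, hij, (hmem i).2 (Or.inl rfl), (hmem j).2 (Or.inr rfl), fun k hk hk' _ => ?_⟩
    by_contra hcon
    rcases (hmem k).1 hcon with e | e
    · exact hk e
    · exact hk' e
  have hW : Γ.localSet X i j = Γ.residueSet X := by
    ext v
    exact ⟨fun hv => hv.1, fun hv => ⟨hv, (hmem _).1 (Γ.typ_notMem_of_mem_residueSet hv)⟩⟩
  have hne : (Γ.localSet X i j).Nonempty := by
    have h3 := h.rich X hX i hloc.2.2.1
    obtain ⟨v, hv, hvX⟩ : {v | Γ.typ v = i ∧ ∀ x ∈ X, Γ.inc x v}.Nonempty := by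
      rw [nonempty_iff_ne_empty]
      intro e
      simp [e] at h3
    exact ⟨v, ⟨fun hX' => hloc.2.2.1 ⟨v, hX', hv⟩, hvX⟩, Or.inl hv⟩
  have := h.isNearFull.isPolygonOn hM hL hloc hne
  rw [hW] at this
  convert this.comap_val using 1
  ext u v
  simp [graph, graphOn, residue, Subtype.ext_iff]

theorem isOfType (hM : M.IsGood) (hL : M.IsLinked) (h : Γ.IsFull M) : Γ.IsOfType M := by
  refine ⟨h.rich.isThick, fun X hX hc => ?_, fun i j hij X hX ht => ⟨?_, ?_, ?_, ?_⟩⟩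
  · obtain ⟨i, j, hij, e⟩ := encard_eq_two.1 hc
    have hp := h.isPolygonOn_residue hM hL hX hij e
    obtain ⟨v, -⟩ := hp.nonempty
    have : Nonempty (Γ.residueSet X) := ⟨v⟩
    refine SimpleGraph.connected_of_ediam_ne_top ?_
    rw [hp.ediam_eq rfl]
    exact ENat.natCast_ne_top _
  · rw [show {k // k ∉ Γ.typ '' X} = ((Γ.typ '' X)ᶜ : Set I) from rfl, ht, compl_compl,
      Nat.card_coe_set_eq, ncard_pair hij]
  · exact (h.rich.residue hX).isThick
  · exact (h.isPolygonOn_residue hM hL hX hij (by rw [ht, compl_compl])).egirth_eq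
  · exact (h.isPolygonOn_residue hM hL hX hij (by rw [ht, compl_compl])).ediam_eq rfl

end IsFull

/-- A flag of corank 1 is not maximal itself, for otherwise it would be the only maximal flag above
it. So the maximal flags above it arise by adding one vertex. -/
theorem IsThick.three_le_encard (h : Γ.IsThick) {X : Set V} (hX : Γ.IsFlag X) {i : I}
    (hi : (Γ.typ '' X)ᶜ = {i}) : 3 ≤ {v | Γ.typ v = i ∧ ∀ x ∈ X, Γ.inc x v}.encard := by
  have h3 := h X hX (encard_eq_one.2 ⟨i, hi⟩)
  have hmem : ∀ k, k ∉ Γ.typ '' X ↔ k = i := fun k => by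
    rw [← mem_compl_iff, hi]; rfl
  have hmax : ¬ Maximal Γ.IsFlag X := by
    intro hmax
    have : {Y | Maximal Γ.IsFlag Y ∧ X ⊆ Y} ⊆ {X} := fun Y hY => hmax.eq_of_ge hY.1.1 hY.2
    have h1 := h3.trans (encard_le_encard this)
    rw [encard_singleton] at h1
    exact absurd h1 (by norm_num)
  have hex : ∀ Y ∈ {Y | Maximal Γ.IsFlag Y ∧ X ⊆ Y}, ∃ v, Γ.typ v = i ∧ (∀ x ∈ X, Γ.inc x v) ∧
      Y = insert v X := by
    rintro Y ⟨hY, hXY⟩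
    have hsub : ∀ y ∈ Y, y ∈ X ∨ Γ.typ y = i := by
      intro y hy
      by_cases hyX : Γ.typ y ∈ Γ.typ '' X
      · obtain ⟨x, hx, e⟩ := hyX
        exact Or.inl (hY.1.eq_of_typ_eq (hXY hx) hy e ▸ hx)
      · exact Or.inr ((hmem _).1 hyX)
    obtain ⟨v, hv, hvX⟩ : ∃ v ∈ Y, v ∉ X := by
      by_contra! hcon
      exact hmax (hXY.antisymm hcon ▸ hY)
    have hvi := (hsub v hv).resolve_left hvX
    refine ⟨v, hvi, fun x hx => hY.1 x (hXY hx) v hv, ?_⟩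
    refine subset_antisymm (fun y hy => ?_) (insert_subset hv hXY)
    rcases hsub y hy with h | h
    · exact Or.inr h
    · exact Or.inl (hY.1.eq_of_typ_eq hy hv (h.trans hvi.symm))
  obtain ⟨Y, hY⟩ : {Y | Maximal Γ.IsFlag Y ∧ X ⊆ Y}.Nonempty := by
    rw [nonempty_iff_ne_empty]
    intro e
    simp [e] at h3
  have : Nonempty V := ⟨(hex Y hY).choose⟩
  choose! g hg1 hg2 hg3 using hex
  refine h3.trans (encard_le_encard_of_injOn (f := g) (fun Y hY => ⟨hg1 Y hY, hg2 Y hY⟩) ?_)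
  intro Y hY Z hZ e
  rw [hg3 Y hY, hg3 Z hZ, e]

/-- In rank at most 4, a flag with two vertices has corank at most 2. Corank 1 is thickness. In
corank 2 the residue has finite girth, so it contains a cycle and hence a vertex of the second
missing type, and adding this vertex leads back to corank 1. -/
theorem IsOfType.isNearFull [Finite I] (hI : Nat.card I ≤ 4) (h : Γ.IsOfType M)
    (hint : Γ.IsIntermediateOn M univ) (hsat : Γ.IsSaturatedOn M univ) : Γ.IsNearFull M := by
  refine ⟨hint, hsat, fun X hX hX2 i hi => ?_⟩
  have hcard : ((Γ.typ '' X)ᶜ).ncard ≤ 2 := by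
    have h1 := ncard_add_ncard_compl (Γ.typ '' X)
    obtain ⟨x, hx, y, hy, hxy⟩ := hX2
    have h2 : 1 < (Γ.typ '' X).ncard := by
      rw [one_lt_ncard_iff (toFinite _)]
      exact ⟨_, _, mem_image_of_mem _ hx, mem_image_of_mem _ hy,
        fun e => hxy (hX.eq_of_typ_eq hx hy e)⟩
    omega
  by_cases hj : ∃ j ∉ Γ.typ '' X, j ≠ i
  · obtain ⟨j, hj, hji⟩ := hj
    have ht : (Γ.typ '' X)ᶜ = {i, j} := by
      symm
      refine eq_of_subset_of_ncard_le (insert_subset hi (singleton_subset_iff.2 hj)) ?_ (toFinite _)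
      rwa [ncard_pair hji.symm]
    have hmem : ∀ k, k ∉ Γ.typ '' X ↔ k = i ∨ k = j := fun k => by
      rw [← mem_compl_iff, ht]; rfl
    have hpol := h.2.2 i j hji.symm X hX (by rw [← ht, compl_compl])
    obtain ⟨u, hu, huX⟩ : ∃ u, Γ.typ u = j ∧ ∀ x ∈ X, Γ.inc x u := by
      have hcyc : ¬ (Γ.residue X).graph.IsAcyclic := by
        rw [← SimpleGraph.egirth_eq_top, hpol.2.2.1]
        exact_mod_cast ENat.natCast_ne_top (2 * M i j)
      unfold SimpleGraph.IsAcyclic at hcyc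
      push Not at hcyc
      obtain ⟨v, c, hc⟩ := hcyc
      have hadj := c.adj_getVert_succ (i := 0) (by have := hc.three_le_length; omega)
      have hne : Γ.typ (c.getVert 0).1 ≠ Γ.typ (c.getVert (0 + 1)).1 := fun e =>
        hadj.1 (((Γ.residue X).inc_iff_eq (Subtype.ext e)).1 hadj.2)
      have h1 := (hmem _).1 (Γ.typ_notMem_of_mem_residueSet (c.getVert 0).2)
      have h2 := (hmem _).1 (Γ.typ_notMem_of_mem_residueSet (c.getVert (0 + 1)).2)
      rcases h1 with h1 | h1
      · exact ⟨_, h2.resolve_left fun e => hne (h1.trans e.symm), (c.getVert (0 + 1)).2.2⟩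
      · exact ⟨_, h1, (c.getVert 0).2.2⟩
    refine (h.1.three_le_encard (hX.insert huX) (i := i) ?_).trans
      (encard_le_encard fun v hv => ⟨hv.1, fun x hx => hv.2 x (Or.inr hx)⟩)
    rw [image_insert_eq, hu]
    ext k
    rw [mem_compl_iff, mem_insert_iff, not_or, hmem, mem_singleton_iff]
    grind
  · push Not at hj
    exact h.1.three_le_encard hX (subset_antisymm (fun k hk => hj k hk) (singleton_subset_iff.2 hi))

end IncGeometry

/-! ### Function symbols and closed sets -/

namespace IncGeometry

variable {I V V' : Type} {Γ : IncGeometry I V} {Γ' : IncGeometry I V'} {M : CoxeterMatrix I}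

/-- The vertex `v` is the `k`-th vertex on a path of length less than `M i j` from `y` to `z` in
the local graph of the `{i, j}`-local flag `X`, where `i` is the type of `y`. -/
def IsShortVertex (Γ : IncGeometry I V) (M : CoxeterMatrix I) (X : Set V) (k : ℕ) (y z v : V) :
    Prop :=
  ∃ j, Γ.IsLocalFlag M X (Γ.typ y) j ∧ y ∈ Γ.localSet X (Γ.typ y) j ∧
    z ∈ Γ.localSet X (Γ.typ y) j ∧ ∃ l b, l < M (Γ.typ y) j ∧
      (Γ.graphOn (Γ.localSet X (Γ.typ y) j)).IsPathSeq l b ∧ b 0 = y ∧ b l = z ∧ k ≤ l ∧ v = b k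

/-- In a generalized polygon the unique shortest paths are those of length less than `m`; the types
are interchanged if necessary to make `i` the type of `y`. -/
theorem IsNearFull.isPathVertex_iff (hM : M.IsAdmissible) (h : Γ.IsNearFull M) {X : Set V} {k : ℕ}
    {y z v : V} : Γ.IsPathVertex M X k y z v ↔ Γ.IsShortVertex M X k y z v := by
  constructor
  · rintro ⟨i, j, hX, hy, hz, hp⟩
    have hpol := h.isPolygonOn hM.good hM.linked hX ⟨y, hy⟩
    have := (hpol.exists_unique_shortest_iff hy hz).1 hp
    rcases hy.2 with e | e
    · subst e
      exact ⟨j, hX, hy, hz, this⟩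
    · subst e
      rw [localSet_comm] at hy hz this
      rw [M.symmetric] at this
      exact ⟨i, hX.symm, hy, hz, this⟩
  · rintro ⟨j, hX, hy, hz, hp⟩
    have hpol := h.isPolygonOn hM.good hM.linked hX ⟨y, hy⟩
    exact ⟨_, j, hX, hy, hz, (hpol.exists_unique_shortest_iff hy hz).2 hp⟩

/-- The second type `j` is the type of `z` if this differs from that of `y`. If both types agree and
`y ≠ z`, the path has length at least 2, so `j` is adjacent to `i`; another choice `j'` would
require a vertex of type `j` in `X`. For a fixed `j`, short paths are unique. -/
theorem IsShortVertex.unique (hM : M.IsAdmissible) (h : Γ.IsNearFull M) {X : Set V} {k : ℕ}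
    {y z v v' : V} (hv : Γ.IsShortVertex M X k y z v) (hv' : Γ.IsShortVertex M X k y z v') :
    v = v' := by
  obtain ⟨j, hX, hy, hz, l, b, hl, hb, hb0, hbl, hk, rfl⟩ := hv
  obtain ⟨j', hX', hy', hz', l', b', hl', hb', hb0', hbl', hk', rfl⟩ := hv'
  by_cases hyz : y = z
  · have h1 : l = 0 := hb.inj (mem_Iic.2 le_rfl) (mem_Iic.2 (Nat.zero_le _))
      (hbl.trans (hyz.symm.trans hb0.symm))
    have h2 : l' = 0 := hb'.inj (mem_Iic.2 le_rfl) (mem_Iic.2 (Nat.zero_le _))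
      (hbl'.trans (hyz.symm.trans hb0'.symm))
    obtain rfl : k = 0 := by omega
    rw [hb0, hb0']
  have hjj : j = j' := by
    by_cases ht : Γ.typ z = Γ.typ y
    · by_contra hne
      have key : ∀ {j l b}, l < M (Γ.typ y) j →
          (Γ.graphOn (Γ.localSet X (Γ.typ y) j)).IsPathSeq l b → b 0 = y → b l = z →
          3 ≤ M (Γ.typ y) j := by
        intro j l b hl hb hb0 hbl
        have he := SimpleGraph.apply_eq_iff_even (graphOn_adj_typ) hb.adj
        rw [hb0, hbl] at he
        have he := he.1 ht
        have : l ≠ 0 := by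
          rintro rfl
          exact hyz (hb0.symm.trans hbl)
        have : l ≠ 1 := by
          rintro rfl
          exact absurd he (by decide)
        omega
      have h1 := key hl hb hb0 hbl
      refine hX.2.2.2.1 (hX'.2.2.2.2 j hX.2.1.symm hne (Or.inl ?_))
      rw [M.symmetric]
      omega
    · exact (hz.2.resolve_left ht).symm.trans (hz'.2.resolve_left ht)
  subst hjj
  exact ((h.isPolygonOn hM.good hM.linked hX ⟨y, hy⟩).short.path_unique hb hb'
    (hb0.trans hb0'.symm) (hbl.trans hbl'.symm) (by omega)).2 k hk

theorem IsMeet.unique (hD : Γ.PropDOn M univ) {i j : I} (h4 : 4 ≤ M i j) {x y z z' : V}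
    (h : Γ.IsMeet i j x y z) (h' : Γ.IsMeet i j x y z') : z = z' := by
  obtain ⟨hne, hx, hy, hz, h1, h2⟩ := h
  obtain ⟨-, -, -, hz', h3, h5⟩ := h'
  exact (hD x (mem_univ _) y (mem_univ _) z (mem_univ _) z' (mem_univ _) (hx.trans hy.symm)
    (hz.trans hz'.symm) (by rwa [hx, hz]) h1 h3 h2 h5).resolve_left hne

theorem IsNearFull.funMap_path (hM : M.IsAdmissible) (h : Γ.IsNearFull M) {r k : ℕ}
    (hr : 1 ≤ r ∧ r + 2 ≤ Nat.card I) (v : Fin (r + 2) → V) {u : V}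
    (hu : Γ.IsShortVertex M (range fun a : Fin r => v (Fin.castAdd 2 a)) k (v (Fin.natAdd r 0))
      (v (Fin.natAdd r 1)) u) :
    letI := Γ.toStructure M
    Structure.funMap (L := geomLanguage M) (M := V) (GeomFun.path r k hr) v = u := by
  have hex : ∃ u, Γ.IsPathVertex M (range fun a : Fin r => v (Fin.castAdd 2 a)) k
      (v (Fin.natAdd r 0)) (v (Fin.natAdd r 1)) u := ⟨u, (h.isPathVertex_iff hM).2 hu⟩
  exact (dif_pos hex).trans
    (IsShortVertex.unique hM h ((h.isPathVertex_iff hM).1 hex.choose_spec) hu)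

theorem IsNearFull.funMap_path_of_not (hM : M.IsAdmissible) (h : Γ.IsNearFull M) {r k : ℕ}
    (hr : 1 ≤ r ∧ r + 2 ≤ Nat.card I) (v : Fin (r + 2) → V)
    (hu : ∀ u, ¬ Γ.IsShortVertex M (range fun a : Fin r => v (Fin.castAdd 2 a)) k
      (v (Fin.natAdd r 0)) (v (Fin.natAdd r 1)) u) :
    letI := Γ.toStructure M
    Structure.funMap (L := geomLanguage M) (M := V) (GeomFun.path r k hr) v = v 0 :=
  dif_neg fun ⟨u, hu'⟩ => hu u ((h.isPathVertex_iff hM).1 hu')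

theorem IsNearFull.funMap_meet (h : Γ.IsNearFull M) {i j : I} (h4 : 4 ≤ M i j) (v : Fin 2 → V)
    {u : V} (hu : Γ.IsMeet i j (v 0) (v 1) u) :
    letI := Γ.toStructure M
    Structure.funMap (L := geomLanguage M) (M := V) (GeomFun.meet i j h4) v = u := by
  have hex : ∃ u, Γ.IsMeet i j (v 0) (v 1) u := ⟨u, hu⟩
  exact (dif_pos hex).trans (IsMeet.unique h.int.propD h4 hex.choose_spec hu)

theorem funMap_meet_of_not {i j : I} (h4 : 4 ≤ M i j) (v : Fin 2 → V)
    (hu : ∀ u, ¬ Γ.IsMeet i j (v 0) (v 1) u) :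
    letI := Γ.toStructure M
    Structure.funMap (L := geomLanguage M) (M := V) (GeomFun.meet i j h4) v = v 0 :=
  dif_neg fun ⟨u, hu'⟩ => hu u hu'

/-- A closed set contains the short paths between its elements. -/
theorem IsClosedIn.short_path (hM : M.IsGood) (hF : Γ.PropFOn M univ) {A : Set V}
    (hA : Γ.IsClosedIn M A univ) {X : Set V} {i j : I} (hXA : X ⊆ A) (hX : Γ.IsLocalFlag M X i j)
    {l : ℕ} {b : ℕ → V} (hl : l < M i j) (hb : (Γ.graphOn (Γ.localSet X i j)).IsPathSeq l b)
    (h0 : b 0 ∈ A) (h1 : b l ∈ A) {k : ℕ} (hk : k ≤ l) : b k ∈ A := by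
  rcases hM.eq_two_or hX.2.1 with h2 | h3
  · rcases Nat.eq_zero_or_pos k with rfl | hk0
    · exact h0
    · rwa [show k = l by omega]
  · obtain ⟨Y, hYX, hY, e⟩ := hX.exists_tight_univ hM hF (by omega)
    exact hA.path Y i j (hYX.trans hXA) hY l b hl (by rwa [localGraph_univ, e]) h0 h1 k hk

theorem IsShortVertex.mem (hM : M.IsGood) (hF : Γ.PropFOn M univ) {A : Set V}
    (hA : Γ.IsClosedIn M A univ) {X : Set V} {k : ℕ} {y z u : V} (hXA : X ⊆ A) (hy : y ∈ A)
    (hz : z ∈ A) (h : Γ.IsShortVertex M X k y z u) : u ∈ A := by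
  obtain ⟨j, hX, -, -, l, b, hl, hb, rfl, rfl, hk, rfl⟩ := h
  exact hA.short_path hM hF hXA hX hl hb hy hz hk

theorem IsoOn.isLocalFlag_image {φ : V → V'} {A X : Set V} (h : IsoOn Γ Γ' φ A) (hXA : X ⊆ A)
    {i j : I} : Γ'.IsLocalFlag M (φ '' X) i j ↔ Γ.IsLocalFlag M X i j := by
  rw [IsLocalFlag, IsLocalFlag, h.isFlag_image hXA, h.image_typ_image hXA]

theorem IsoOn.isShortVertex_of_path {φ : V → V'} {A X : Set V} (h : IsoOn Γ Γ' φ A) (hXA : X ⊆ A)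
    {j : I} {l : ℕ} {b : ℕ → V} (hbA : ∀ k ≤ l, b k ∈ A) (hX : Γ.IsLocalFlag M X (Γ.typ (b 0)) j)
    (hyX : b 0 ∈ Γ.localSet X (Γ.typ (b 0)) j) (hzX : b l ∈ Γ.localSet X (Γ.typ (b 0)) j)
    (hl : l < M (Γ.typ (b 0)) j)
    (hb : (Γ.graphOn (Γ.localSet X (Γ.typ (b 0)) j)).IsPathSeq l b) {k : ℕ} (hk : k ≤ l) :
    Γ'.IsShortVertex M (φ '' X) k (φ (b 0)) (φ (b l)) (φ (b k)) := by
  have hy := hbA 0 (Nat.zero_le l)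
  refine ⟨j, ?_, ?_, ?_, l, φ ∘ b, ?_, ?_, rfl, rfl, hk, rfl⟩ <;> rw [h.typ _ hy]
  · exact (h.isLocalFlag_image hXA).2 hX
  · exact (h.mem_localSet_image hXA hy).2 hyX
  · exact (h.mem_localSet_image hXA (hbA l le_rfl)).2 hzX
  · exact hl
  · have := (h.isPathSeq_image hXA subset_rfl (T := A) hbA).2
      (hb.mono fun k hk => ⟨⟨(hb.adj k hk).1, hbA k hk.le⟩, ⟨(hb.adj k hk).2.1, hbA (k + 1) hk⟩,
        (hb.adj k hk).2.2⟩)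
    exact this.mono fun k hk => ⟨(this.adj k hk).1.1, (this.adj k hk).2.1.1, (this.adj k hk).2.2⟩

theorem IsoOn.isShortVertex {φ : V → V'} {A X : Set V} (h : IsoOn Γ Γ' φ A) (hM : M.IsGood)
    (hF : Γ.PropFOn M univ) (hA : Γ.IsClosedIn M A univ) {k : ℕ} {y z u : V} (hXA : X ⊆ A)
    (hy : y ∈ A) (hz : z ∈ A) (hu : Γ.IsShortVertex M X k y z u) :
    Γ'.IsShortVertex M (φ '' X) k (φ y) (φ z) (φ u) := by
  obtain ⟨j, hX, hyX, hzX, l, b, hl, hb, rfl, rfl, hk, rfl⟩ := hu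
  exact h.isShortVertex_of_path hXA (fun k hk => hA.short_path hM hF hXA hX hl hb hy hz hk) hX hyX
    hzX hl hb hk

theorem IsoOn.exists_inverse {φ : V → V'} {A : Set V} (h : IsoOn Γ Γ' φ A) (hne : A.Nonempty) :
    ∃ ψ : V' → V, IsoOn Γ' Γ ψ (φ '' A) ∧ ∀ a ∈ A, ψ (φ a) = a := by
  obtain ⟨a₀, -⟩ := hne
  have : Nonempty V := ⟨a₀⟩
  have hinv : ∀ a ∈ A, Function.invFunOn φ A (φ a) = a := fun a ha => h.inj.leftInvOn_invFunOn ha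
  refine ⟨Function.invFunOn φ A, ⟨?_, ?_, ?_⟩, hinv⟩
  · rintro _ ⟨a, ha, rfl⟩ _ ⟨b, hb, rfl⟩ e
    rw [hinv a ha, hinv b hb] at e
    rw [e]
  · rintro _ ⟨a, ha, rfl⟩
    rw [hinv a ha, h.typ a ha]
  · rintro _ ⟨a, ha, rfl⟩ _ ⟨b, hb, rfl⟩
    rw [hinv a ha, hinv b hb, h.inc a ha b hb]

/-- Isomorphisms of closed sets respect the function symbols. -/
theorem IsoOn.map_fun {φ : V → V'} {A : Set V} (h : IsoOn Γ Γ' φ A) (hM : M.IsAdmissible)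
    (hΓ : Γ.IsNearFull M) (hΓ' : Γ'.IsNearFull M) (hA : Γ.IsClosedIn M A univ)
    (hA' : Γ'.IsClosedIn M (φ '' A) univ) {n : ℕ} (f : (geomLanguage M).Functions n)
    (v : Fin n → V) (hv : ∀ i, v i ∈ A) :
    φ (@Structure.funMap (geomLanguage M) V (Γ.toStructure M) n f v) =
      @Structure.funMap (geomLanguage M) V' (Γ'.toStructure M) n f (φ ∘ v) := by
  cases f with
  | path r k hr =>
    have hXA : range (fun a : Fin r => v (Fin.castAdd 2 a)) ⊆ A := by
      rintro _ ⟨a, rfl⟩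
      exact hv _
    have hXr : φ '' range (fun a : Fin r => v (Fin.castAdd 2 a)) =
        range (fun a : Fin r => (φ ∘ v) (Fin.castAdd 2 a)) := by
      rw [← range_comp]; rfl
    by_cases hu : ∃ u, Γ.IsShortVertex M (range fun a : Fin r => v (Fin.castAdd 2 a)) k
      (v (Fin.natAdd r 0)) (v (Fin.natAdd r 1)) u
    · obtain ⟨u, hu⟩ := hu
      have hu' := h.isShortVertex hM.good hΓ.int.propF hA hXA (hv _) (hv _) hu
      rw [hXr] at hu'
      exact (congrArg φ (hΓ.funMap_path hM hr v hu)).trans (hΓ'.funMap_path hM hr (φ ∘ v) hu').symm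
    · push Not at hu
      refine (congrArg φ (hΓ.funMap_path_of_not hM hr v hu)).trans
        (hΓ'.funMap_path_of_not hM hr (φ ∘ v) fun u' hu' => ?_).symm
      -- A path vertex in `Γ'` lies in the closed set `φ '' A` together with its path, so it can be
      -- carried back.
      obtain ⟨ψ, hψ, hψφ⟩ := h.exists_inverse ⟨_, hv 0⟩
      have himg : ∀ {X}, X ⊆ A → ψ '' (φ '' X) = X := by
        intro X hX
        rw [image_image]
        exact (image_congr fun x hx => hψφ x (hX hx)).trans (image_id _)
      have := hψ.isShortVertex hM.good hΓ'.int.propF hA' (image_mono hXA)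
        (mem_image_of_mem φ (hv _)) (mem_image_of_mem φ (hv _)) (hXr ▸ hu')
      rw [himg hXA, hψφ _ (hv _), hψφ _ (hv _)] at this
      exact hu _ this
  | meet i j h4 =>
    by_cases hu : ∃ u, Γ.IsMeet i j (v 0) (v 1) u
    · obtain ⟨u, hu⟩ := hu
      have huA : u ∈ A := by
        obtain ⟨hne, hx, hy, hz, h1, h2⟩ := hu
        exact hA.meet _ (hv 0) _ (hv 1) u (mem_univ _) hne (hx.trans hy.symm) (by rwa [hx, hz]) h1 h2
      have hu' : Γ'.IsMeet i j ((φ ∘ v) 0) ((φ ∘ v) 1) (φ u) := by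
        obtain ⟨hne, hx, hy, hz, h1, h2⟩ := hu
        exact ⟨fun e => hne (h.inj (hv 0) (hv 1) e), (h.typ _ (hv 0)).trans hx,
          (h.typ _ (hv 1)).trans hy, (h.typ _ huA).trans hz, (h.inc _ (hv 0) _ huA).2 h1,
          (h.inc _ (hv 1) _ huA).2 h2⟩
      exact (congrArg φ (hΓ.funMap_meet h4 v hu)).trans (hΓ'.funMap_meet h4 (φ ∘ v) hu').symm
    · push Not at hu
      refine (congrArg φ (funMap_meet_of_not h4 v hu)).trans
        (funMap_meet_of_not h4 (φ ∘ v) fun u' hu' => ?_).symm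
      obtain ⟨hne, hx, hy, hz, h1, h2⟩ := hu'
      have huA : u' ∈ φ '' A := hA'.meet _ (mem_image_of_mem φ (hv 0)) _
        (mem_image_of_mem φ (hv 1)) u' (mem_univ _) hne (hx.trans hy.symm)
        (by rw [← hz, ← hx] at h4; exact h4) h1 h2
      obtain ⟨u, hu', rfl⟩ := huA
      exact hu u ⟨fun e => hne (congrArg φ e), (h.typ _ (hv 0)).symm.trans hx,
        (h.typ _ (hv 1)).symm.trans hy, (h.typ _ hu').symm.trans hz, (h.inc _ (hv 0) _ hu').1 h1,
        (h.inc _ (hv 1) _ hu').1 h2⟩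

theorem IsoOn.map_rel {φ : V → V'} {A : Set V} (h : IsoOn Γ Γ' φ A) {n : ℕ}
    (r : (geomLanguage M).Relations n) (v : Fin n → V) (hv : ∀ i, v i ∈ A) :
    @Structure.RelMap (geomLanguage M) V' (Γ'.toStructure M) n r (φ ∘ v) ↔
      @Structure.RelMap (geomLanguage M) V (Γ.toStructure M) n r v := by
  cases r with
  | vertex i => exact Eq.congr_left (h.typ _ (hv 0))
  | incident => exact h.inc _ (hv 0) _ (hv 1)

/-- Closed sets are closed under the function symbols. -/
theorem IsClosedIn.funMap_mem (hM : M.IsAdmissible) (hΓ : Γ.IsNearFull M) {A : Set V}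
    (hA : Γ.IsClosedIn M A univ) {n : ℕ} (f : (geomLanguage M).Functions n)
    (v : Fin n → V) (hv : ∀ i, v i ∈ A) :
    @Structure.funMap (geomLanguage M) V (Γ.toStructure M) n f v ∈ A := by
  cases f with
  | path r k hr =>
    have hXA : range (fun a : Fin r => v (Fin.castAdd 2 a)) ⊆ A := by
      rintro _ ⟨a, rfl⟩
      exact hv _
    by_cases hu : ∃ u, Γ.IsShortVertex M (range fun a : Fin r => v (Fin.castAdd 2 a)) k
      (v (Fin.natAdd r 0)) (v (Fin.natAdd r 1)) u
    · obtain ⟨u, hu⟩ := hu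
      have := hΓ.funMap_path hM hr v hu
      exact this.symm ▸ hu.mem hM.good hΓ.int.propF hA hXA (hv _) (hv _)
    · push Not at hu
      have := hΓ.funMap_path_of_not hM hr v hu
      exact this.symm ▸ hv 0
  | meet i j h4 =>
    by_cases hu : ∃ u, Γ.IsMeet i j (v 0) (v 1) u
    · obtain ⟨u, hu⟩ := hu
      have := hΓ.funMap_meet h4 v hu
      obtain ⟨hne, hx, hy, hz, h1, h2⟩ := hu
      exact this.symm ▸ hA.meet _ (hv 0) _ (hv 1) u (mem_univ _) hne (hx.trans hy.symm)
        (by rwa [hx, hz]) h1 h2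
    · push Not at hu
      have := funMap_meet_of_not h4 v hu
      exact this.symm ▸ hv 0

theorem IsFlag.ncard_add_two_le [Finite I] {X : Set V} (hX : Γ.IsFlag X) {i j : I} (hij : i ≠ j)
    (hi : i ∉ Γ.typ '' X) (hj : j ∉ Γ.typ '' X) : X.ncard + 2 ≤ Nat.card I := by
  rw [← InjOn.ncard_image fun x hx y hy e => hX.eq_of_typ_eq hx hy e, ← ncard_pair hij,
    ← ncard_union_eq (by
      rw [disjoint_right]
      rintro _ (rfl | rfl)
      · exact hi
      · exact hj) (toFinite _) (toFinite _)]
  exact ncard_le_card _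

/-- Sets that are closed under the function symbols are closed. -/
theorem isClosedIn_of_funMap_mem [Finite I] (hM : M.IsAdmissible) (hΓ : Γ.IsNearFull M) {A : Set V}
    (hA : ∀ {n : ℕ} (f : (geomLanguage M).Functions n) (v : Fin n → V), (∀ i, v i ∈ A) →
      @Structure.funMap (geomLanguage M) V (Γ.toStructure M) n f v ∈ A) :
    Γ.IsClosedIn M A univ where
  subset := subset_univ _
  path X i j hXA hX l b hl hb h0 h1 k hk := by
    rcases Nat.eq_zero_or_pos k with rfl | hk0
    · exact h0
    have hloc := hX.isLocalFlag hM.good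
    have hfin : X.Finite := hX.isFlag.finite
    have : Finite X := hfin
    have hne := hloc.nonempty hM.linked
    -- A tight flag is not empty, as the diagram is linked, and it misses the types `i` and `j`; so
    -- there is a function symbol for its size.
    have hr : 1 ≤ Nat.card X ∧ Nat.card X + 2 ≤ Nat.card I := by
      rw [Nat.card_coe_set_eq]
      exact ⟨(ncard_pos hfin).2 hne, hX.isFlag.ncard_add_two_le hloc.2.1 hloc.2.2.1 hloc.2.2.2.1⟩
    rw [localGraph_univ] at hb
    have hy : b 0 ∈ Γ.localSet X i j := (hb.adj 0 (by omega)).1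
    have hz : b l ∈ Γ.localSet X i j := by
      have := hb.adj (l - 1) (by omega)
      rw [show l - 1 + 1 = l by omega] at this
      exact this.2.1
    set v : Fin (Nat.card X + 2) → V :=
      Fin.append (fun a => ((Finite.equivFin X).symm a : V)) ![b 0, b l] with hvdef
    have hv1 : range (fun a : Fin (Nat.card X) => v (Fin.castAdd 2 a)) = X := by
      simp only [hvdef, Fin.append_left]
      rw [range_comp' Subtype.val (Finite.equivFin X).symm, (Finite.equivFin X).symm.range_eq_univ,
        image_univ, Subtype.range_coe]
    have hv2 : v (Fin.natAdd (Nat.card X) 0) = b 0 := by simp [hvdef]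
    have hv3 : v (Fin.natAdd (Nat.card X) 1) = b l := by simp [hvdef]
    have hshort : Γ.IsShortVertex M X k (b 0) (b l) (b k) := by
      rcases hy.2 with e | e
      · exact ⟨j, e ▸ hloc, e ▸ hy, e ▸ hz, l, b, e ▸ hl, e ▸ hb, rfl, rfl, hk, rfl⟩
      · rw [localSet_comm] at hy hz hb
        rw [M.symmetric] at hl
        exact ⟨i, e ▸ hloc.symm, e ▸ hy, e ▸ hz, l, b, e ▸ hl, e ▸ hb, rfl, rfl, hk, rfl⟩
    rw [← hΓ.funMap_path hM hr v (u := b k) (by rwa [hv1, hv2, hv3])]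
    refine hA _ _ fun a => ?_
    refine Fin.addCases (fun a => ?_) (fun a => ?_) a
    · exact hXA (hv1.subset ⟨a, rfl⟩)
    · fin_cases a
      · exact hv2.symm ▸ h0
      · exact hv3.symm ▸ h1
  meet x hx x' hx' z _ hne ht h4 h1 h2 := by
    rw [← hΓ.funMap_meet h4 ![x, x'] (u := z) ⟨hne, rfl, ht.symm, rfl, h1, h2⟩]
    refine hA _ _ fun a => ?_
    fin_cases a
    · exact hx
    · exact hx'

end IncGeometry

/-! ### The amalgamation class -/

namespace IncGeometry

variable {I V V' : Type} {Γ : IncGeometry I V} {Γ' : IncGeometry I V'} {M : CoxeterMatrix I}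

theorem IsClosedIn.trans {A S T : Set V} (hA : Γ.IsClosedIn M A S) (hS : Γ.IsClosedIn M S T) :
    Γ.IsClosedIn M A T where
  subset := hA.subset.trans hS.subset
  path X i j hXA hX l b hl hb h0 h1 k hk := by
    have hbS := hS.path X i j (hXA.trans hA.subset) hX l b hl hb (hA.subset h0) (hA.subset h1)
    exact hA.path X i j hXA hX l b hl (hb.mono fun k hk => ⟨⟨(hb.adj k hk).1.1, hbS k hk.le⟩,
      ⟨(hb.adj k hk).2.1.1, hbS (k + 1) hk⟩, (hb.adj k hk).2.2⟩) h0 h1 k hk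
  meet x hx x' hx' z hz hne ht h4 h1 h2 :=
    hA.meet x hx x' hx' z (hS.meet x (hA.subset hx) x' (hA.subset hx') z hz hne ht h4 h1 h2)
      hne ht h4 h1 h2

/-- Embeddings of the structure `N` in the structure of the geometry `Γ`. -/
abbrev StrEmb (M : CoxeterMatrix I) (N : Type) [(geomLanguage M).Structure N]
    (Γ : IncGeometry I V) : Type :=
  @FirstOrder.Language.Embedding (geomLanguage M) N V _ (Γ.toStructure M)

variable {N : Type} [(geomLanguage M).Structure N]

theorem StrEmb.vertex_iff (ι : Γ.StrEmb M N) (a : N) (i : I) :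
    Γ.typ (ι a) = i ↔ Structure.RelMap (L := geomLanguage M) (GeomRel.vertex i : GeomRel I 1) ![a] :=
  let _ := Γ.toStructure M
  ι.map_rel (GeomRel.vertex i : (geomLanguage M).Relations 1) ![a]

theorem StrEmb.incident_iff (ι : Γ.StrEmb M N) (a b : N) : Γ.inc (ι a) (ι b) ↔
    Structure.RelMap (L := geomLanguage M) (GeomRel.incident : GeomRel I 2) ![a, b] :=
  let _ := Γ.toStructure M
  ι.map_rel (GeomRel.incident : (geomLanguage M).Relations 2) ![a, b]

theorem StrEmb.injective (ι : Γ.StrEmb M N) : Function.Injective ι :=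
  let _ := Γ.toStructure M
  Embedding.injective ι

theorem StrEmb.typ_eq (ι : Γ.StrEmb M N) (κ : Γ'.StrEmb M N) (a : N) :
    Γ.typ (ι a) = Γ'.typ (κ a) :=
  (ι.vertex_iff a _).2 ((κ.vertex_iff a _).1 rfl)

theorem StrEmb.inc_iff (ι : Γ.StrEmb M N) (κ : Γ'.StrEmb M N) (a b : N) :
    Γ.inc (ι a) (ι b) ↔ Γ'.inc (κ a) (κ b) :=
  (ι.incident_iff a b).trans (κ.incident_iff a b).symm

theorem isClosedIn_substructure [Finite I] (hM : M.IsAdmissible) (hΓ : Γ.IsNearFull M)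
    (S : @Substructure (geomLanguage M) V (Γ.toStructure M)) :
    Γ.IsClosedIn M (@SetLike.coe _ _ (@Substructure.instSetLike (geomLanguage M) V (Γ.toStructure M)) S)
      univ :=
  let _ := Γ.toStructure M
  isClosedIn_of_funMap_mem hM hΓ fun f v hv => S.fun_mem f v hv

theorem IsClosedIn.exists_substructure (hM : M.IsAdmissible) (hΓ : Γ.IsNearFull M) {A : Set V}
    (hA : Γ.IsClosedIn M A univ) :
    letI := Γ.toStructure M
    ∃ S : (geomLanguage M).Substructure V, (S : Set V) = A :=
  let _ := Γ.toStructure M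
  ⟨⟨A, fun f v hv => hA.funMap_mem hM hΓ f v hv⟩, rfl⟩

theorem StrEmb.isClosedIn_range [Finite I] (hM : M.IsAdmissible) (hΓ : Γ.IsNearFull M)
    (ι : Γ.StrEmb M N) : Γ.IsClosedIn M (range ι) univ := by
  let _ := Γ.toStructure M
  have := isClosedIn_substructure hM hΓ (Embedding.toHom ι).range
  rwa [Hom.range_coe] at this

/-- A finite generating set of `N` generates the image of `N`. -/
theorem StrEmb.exists_generators (hM : M.IsAdmissible) (hΓ : Γ.IsNearFull M) (ι : Γ.StrEmb M N)
    (hN : Structure.FG (geomLanguage M) N) : ∃ E : Set V, E.Finite ∧ E ⊆ range ι ∧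
      ∀ B, Γ.IsClosedIn M B univ → E ⊆ B → range ι ⊆ B := by
  let _ := Γ.toStructure M
  obtain ⟨s, hs, hcl⟩ := Structure.fg_iff.1 hN
  refine ⟨ι '' s, hs.image ι, image_subset_range ι s, fun B hB hsB => ?_⟩
  obtain ⟨S, rfl⟩ := hB.exists_substructure hM hΓ
  have : (⊤ : (geomLanguage M).Substructure N) ≤ S.comap (Embedding.toHom ι) := by
    rw [← hcl, Substructure.closure_le]
    intro a ha
    exact hsB (mem_image_of_mem ι ha)
  rintro _ ⟨a, rfl⟩
  exact this (Substructure.mem_top a)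

/-- Between near-full geometries, embeddings of structures are isomorphisms of incidence geometries
onto closed sets; all embeddings needed below are obtained in this way. -/
theorem IsoOn.exists_strEmb [Finite I] (hM : M.IsAdmissible) (hΓ : Γ.IsNearFull M)
    (hΓ' : Γ'.IsNearFull M) (ι : Γ.StrEmb M N) {φ : V → V'} (h : IsoOn Γ Γ' φ (range ι))
    (hcl : Γ'.IsClosedIn M (φ '' range ι) univ) : ∃ κ : Γ'.StrEmb M N, ∀ a, κ a = φ (ι a) := by
  let _ := Γ.toStructure M
  let _ := Γ'.toStructure M
  refine ⟨⟨⟨fun a => φ (ι a), fun a b e => ι.injective (h.inj ⟨a, rfl⟩ ⟨b, rfl⟩ e)⟩,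
    fun {n} f x => ?_, fun {n} r x => ?_⟩, fun a => rfl⟩
  · change φ (ι (Structure.funMap f x)) = Structure.funMap f (φ ∘ (ι ∘ x))
    rw [Embedding.map_fun]
    exact h.map_fun hM hΓ hΓ' (ι.isClosedIn_range hM hΓ) hcl f _ fun i => ⟨x i, rfl⟩
  · exact (h.map_rel r (ι ∘ x) fun i => ⟨x i, rfl⟩).trans (ι.map_rel r x)

theorem IsCompletion.isFull {D : Type} {Γ₀ : IncGeometry I D} {C : ℕ → Set V} {e : D → V}
    (h : Γ₀.IsCompletion Γ M C e) : Γ.IsFull M := ⟨h.int, h.sat, h.rich⟩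

theorem IsRich.nonempty [Nonempty I] (h : Γ.IsRich) : Nonempty V := by
  obtain ⟨i⟩ := ‹Nonempty I›
  by_contra hcon
  have := h ∅ (by simp [IsFlag]) i (by simp)
  rw [not_nonempty_iff] at hcon
  simp [eq_empty_of_isEmpty] at this

/-- A geometry obtained by free steps from a finite part embeds in every completion of that part. -/
theorem IsCompletion.exists_embedding [Finite I] (hM : M.IsAdmissible) {D : Type}
    {Γ₀ : IncGeometry I D} {C : ℕ → Set V'} {e : D → V'} (h : Γ₀.IsCompletion Γ' M C e)
    {U : ℕ → Set V} (hU : Γ.IsFreeChain M U) (huniv : ⋃ n, U n = univ)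
    (hint : Γ.IsIntermediateOn M univ) {ε : D → V} (hε : IsoOn Γ₀ Γ ε univ)
    (hε₀ : range ε = U 0) : ∃ φ, IsoOn Γ Γ' φ univ ∧
      ∀ B, Γ.IsClosedIn M B univ → Γ.IsSaturatedOn M B → Γ'.IsClosedIn M (φ '' B) univ := by
  have := hM.nonempty
  obtain ⟨v₀⟩ := h.rich.nonempty
  have hinj : Function.Injective ε := injOn_univ.1 hε.inj
  have hext : ∀ u, Function.extend ε e (fun _ => v₀) (ε u) = e u :=
    fun u => hinj.extend_apply _ _ _
  have himg : Function.extend ε e (fun _ => v₀) '' U 0 = range e := by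
    rw [← hε₀, ← range_comp]
    exact congrArg range (funext hext)
  have hφ₀ : IsoOn Γ Γ' (Function.extend ε e (fun _ => v₀)) (U 0) := by
    rw [← hε₀]
    refine ⟨?_, ?_, ?_⟩
    · rintro _ ⟨u, rfl⟩ _ ⟨v, rfl⟩ h'
      rw [hext, hext] at h'
      exact congrArg ε (h.iso.inj (mem_univ _) (mem_univ _) h')
    · rintro _ ⟨u, rfl⟩
      rw [hext, h.iso.typ _ (mem_univ _), hε.typ _ (mem_univ _)]
    · rintro _ ⟨u, rfl⟩ _ ⟨v, rfl⟩
      rw [hext, hext, h.iso.inc _ (mem_univ _) _ (mem_univ _),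
        hε.inc _ (mem_univ _) _ (mem_univ _)]
  obtain ⟨φ, hφ, -, hfree⟩ := exists_isFreeIn_embedding hM.good hU huniv hint h.chain h.iUnion h.int
    h.sat hφ₀ (himg.symm ▸ h.closed)
  exact ⟨φ, hφ, fun B hB hsat => hfree.isClosedIn_image hM.good h.iUnion h.int hφ hB hsat⟩

/-- The geometry on `D` induced by an injective map. -/
def comap {D : Type} (Γ : IncGeometry I V) (f : D → V) (hf : Function.Injective f) :
    IncGeometry I D where
  typ a := Γ.typ (f a)
  inc a b := Γ.inc (f a) (f b)
  symm h := Γ.symm h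
  inc_iff_eq h := (Γ.inc_iff_eq h).trans hf.eq_iff

theorem exists_comap {S : Set V} (hS : S.Finite) (hint : Γ.IsIntermediateOn M univ) :
    ∃ (n : ℕ) (Γ₀ : IncGeometry I (Fin n)) (ε : Fin n → V), Γ₀.IsIntermediateOn M univ ∧
      IsoOn Γ₀ Γ ε univ ∧ range ε = S := by
  have : Finite S := hS
  have hinj : Function.Injective fun a => ((Finite.equivFin S).symm a : V) :=
    Subtype.val_injective.comp (Finite.equivFin S).symm.injective
  have hiso : IsoOn (Γ.comap _ hinj) Γ (fun a => ((Finite.equivFin S).symm a : V)) univ :=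
    ⟨hinj.injOn, fun _ _ => rfl, fun _ _ _ _ => Iff.rfl⟩
  refine ⟨_, _, _, hiso.isIntermediateOn_image.1 (hint.mono (subset_univ _)), hiso, ?_⟩
  rw [range_comp' Subtype.val (Finite.equivFin S).symm, (Finite.equivFin S).symm.range_eq_univ,
    image_univ, Subtype.range_coe]

theorem isSaturatedOn_range {φ : V → V'} (h : IsoOn Γ Γ' φ univ) (hsat : Γ.IsSaturatedOn M univ) :
    Γ'.IsSaturatedOn M (range φ) := by
  rw [← image_univ]
  exact h.isSaturatedOn_image subset_rfl hsat

/-- The members of the class embed in the completions of finite geometries. -/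
theorem exists_code_of_mem_geomClass [Finite I] (hM : M.IsAdmissible)
    {A : Bundled (geomLanguage M).Structure} (hA : A ∈ geomClass M) :
    ∃ (n : ℕ) (Γ₀ : IncGeometry I (Fin n)), Γ₀.IsIntermediateOn M univ ∧
      ∀ {V : Type} {Γ : IncGeometry I V} {C : ℕ → Set V} {e : Fin n → V},
        Γ₀.IsCompletion Γ M C e → Nonempty (Γ.StrEmb M A) := by
  obtain ⟨-, V, Γ, hT, hB, hι⟩ := hA
  obtain ⟨ι⟩ : Nonempty (Γ.StrEmb M A) := hι
  obtain ⟨⟨U, hU0, hU, hUu⟩, hint, hsat⟩ := hB.exists_chain hM.good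
  have hnear := hT.isNearFull hM.rank_le hint hsat
  obtain ⟨n, Γ₀, ε, h₀, hε, hε₀⟩ := exists_comap hU0 hint
  refine ⟨n, Γ₀, h₀, fun {V' Γ' C e} hc => ?_⟩
  obtain ⟨φ, hφ, hcl⟩ := hc.exists_embedding hM hU hUu hint hε hε₀
  obtain ⟨κ, -⟩ := IsoOn.exists_strEmb hM hnear hc.isFull.isNearFull ι (hφ.mono (subset_univ _))
    ((hφ.isClosedIn_image subset_rfl (ι.isClosedIn_range hM hnear)).trans
      (hcl univ (isClosedIn_self _) hsat))
  exact ⟨κ⟩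

/-- The members of the class are the finitely generated structures that embed in the structure of
a countable full geometry obtained from a finite one. -/
theorem exists_full_of_mem_geomClass [Finite I] (hM : M.IsAdmissible)
    {A : Bundled (geomLanguage M).Structure} (hA : A ∈ geomClass M) :
    ∃ (V : Type) (_ : Countable V) (Γ : IncGeometry I V) (C : ℕ → Set V), Γ.IsFull M ∧
      (C 0).Finite ∧ Γ.IsFreeChain M C ∧ ⋃ n, C n = univ ∧ Nonempty (Γ.StrEmb M A) := by
  obtain ⟨n, Γ₀, h₀, h⟩ := exists_code_of_mem_geomClass hM hA
  obtain ⟨V, hV, Γ, C, e, hc⟩ := hM.completions _ Γ₀ h₀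
  exact ⟨V, hV, Γ, C, hc.isFull, hc.finite, hc.chain, hc.iUnion, h hc⟩

/-- There are countably many isomorphism types in the class. -/
theorem geomClass_countable [Finite I] (hM : M.IsAdmissible) :
    (Quotient.mk' '' geomClass M).Countable := by
  have : Countable (Σ n, IncGeometry I (Fin n)) := by
    have : ∀ n, Finite (IncGeometry I (Fin n)) := fun n =>
      Finite.of_injective (fun Γ => (Γ.typ, Γ.inc)) fun Γ Γ' h => by
        cases Γ
        cases Γ'
        simp_all
    infer_instance
  have hsub : Quotient.mk' '' geomClass M ⊆ ⋃ c : Σ n, IncGeometry I (Fin n),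
      {q | c.2.IsIntermediateOn M univ ∧ ∃ A ∈ geomClass M, Quotient.mk' A = q ∧
        ∀ {V : Type} {Γ : IncGeometry I V} {C : ℕ → Set V} {e : Fin c.1 → V},
        c.2.IsCompletion Γ M C e → Nonempty (Γ.StrEmb M A)} := by
    rintro _ ⟨A, hA, rfl⟩
    obtain ⟨n, Γ₀, h₀, h⟩ := exists_code_of_mem_geomClass hM hA
    exact mem_iUnion.2 ⟨⟨n, Γ₀⟩, h₀, A, hA, rfl, h⟩
  refine (countable_iUnion fun c => ?_).mono hsub
  by_cases hc : c.2.IsIntermediateOn M univ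
  -- All members with this code embed in one countable completion, whose age contains only countably
  -- many isomorphism types.
  · obtain ⟨V, hV, Γ, C, e, hce⟩ := hM.completions _ c.2 hc
    let _ := Γ.toStructure M
    refine (age.countable_quotient (L := geomLanguage M) V).mono ?_
    rintro _ ⟨-, A, hA, rfl, h⟩
    exact mem_image_of_mem _ ⟨hA.1, h hce⟩
  · exact (countable_empty).mono fun q hq => hc hq.1

theorem mem_geomClass_of_full (hM : M.IsAdmissible) (hΓ : Γ.IsFull M)
    {C : ℕ → Set V} (hC0 : (C 0).Finite) (hC : Γ.IsFreeChain M C) (hCu : ⋃ n, C n = univ)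
    (hN : Structure.FG (geomLanguage M) N) (ι : Γ.StrEmb M N) :
    (Bundled.of N : Bundled (geomLanguage M).Structure) ∈ geomClass M :=
  ⟨hN, V, Γ, hΓ.isOfType hM.good hM.linked, hC.isBuiltByB hM.good hC0 hCu hΓ.int hΓ.sat, ⟨ι⟩⟩

/-- The free amalgam `Δ` need not be saturated or rich, so it is mapped to a completion `Γ` of its
finite first stage. The two given geometries are closed and saturated in `Δ`; their images are
therefore closed in `Γ`, although the image of `Δ` need not be. The required structure is generated
by the images of `N` and `P`. -/
theorem exists_amalgam_embedding [Finite I] (hM : M.IsAdmissible) {N P : Type}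
    [(geomLanguage M).Structure N] [(geomLanguage M).Structure P]
    (hN : Structure.FG (geomLanguage M) N) (hP : Structure.FG (geomLanguage M) P)
    {V₁ V₂ K : Type} {Γ₁ : IncGeometry I V₁} {Γ₂ : IncGeometry I V₂} {f : K → V₁} {g : K → V₂}
    (ht : ∀ a, Γ₁.typ (f a) = Γ₂.typ (g a)) (hf : Function.Injective f)
    (hg : Function.Injective g) (hi : ∀ a b, Γ₁.inc (f a) (f b) ↔ Γ₂.inc (g a) (g b))
    (h₁ : Γ₁.IsFull M) (h₂ : Γ₂.IsFull M) (hc₁ : Γ₁.IsClosedIn M (range f) univ)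
    (hc₂ : Γ₂.IsClosedIn M (range g) univ) {E : Set V₁} (hE : E.Finite) (hEf : E ⊆ range f)
    (hgen : ∀ B, Γ₁.IsClosedIn M B univ → E ⊆ B → range f ⊆ B)
    {C₁ : ℕ → Set V₁} (hC₁ : Γ₁.IsFreeChain M C₁) (hfin₁ : (C₁ 0).Finite)
    (huniv₁ : ⋃ n, C₁ n = univ) {C₂ : ℕ → Set V₂} (hC₂ : Γ₂.IsFreeChain M C₂)
    (hfin₂ : (C₂ 0).Finite) (huniv₂ : ⋃ n, C₂ n = univ) (ι₁ : Γ₁.StrEmb M N)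
    (ι₂ : Γ₂.StrEmb M P) :
    ∃ Q : Bundled (geomLanguage M).Structure, Q ∈ geomClass M ∧ ∃ (u : N ↪[geomLanguage M] Q)
      (v : P ↪[geomLanguage M] Q), ∀ n p k, ι₁ n = f k → ι₂ p = g k → u n = v p := by
  obtain ⟨W, Δ, e₁, e₂, U, he₁, he₂, hcomm, hint, hcl₁, hcl₂, hU, hU0, hUu⟩ := exists_amalgam hM.good
    ht hf hg hi h₁.int h₂.int hc₁ hc₂ hE hEf hgen hC₁ hfin₁ huniv₁ hC₂ hfin₂ huniv₂
  obtain ⟨n, Γ₀, ε, h₀, hε, hε₀⟩ := exists_comap hU0 hint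
  obtain ⟨V, -, Γ, C, e, hc⟩ := hM.completions _ Γ₀ h₀
  obtain ⟨φ, hφ, hcl⟩ := hc.exists_embedding hM hU hUu hint hε hε₀
  have hfull := hc.isFull
  let _ := Γ.toStructure M
  have key : ∀ {N V₁ : Type} [(geomLanguage M).Structure N] {Γ₁ : IncGeometry I V₁}
      (ι₁ : Γ₁.StrEmb M N) {e₁ : V₁ → W}, Γ₁.IsFull M → IsoOn Γ₁ Δ e₁ univ →
      Δ.IsClosedIn M (range e₁) univ → ∃ κ : Γ.StrEmb M N, ∀ a, κ a = φ (e₁ (ι₁ a)) := by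
    intro N V₁ _ Γ₁ ι₁ e₁ h₁ he₁ hcl₁
    have hiso : IsoOn Γ₁ Γ (φ ∘ e₁) univ := he₁.trans (hφ.mono (subset_univ _))
    refine IsoOn.exists_strEmb hM h₁.isNearFull hfull.isNearFull ι₁ (hiso.mono (subset_univ _)) ?_
    refine (hiso.isClosedIn_image subset_rfl (ι₁.isClosedIn_range hM h₁.isNearFull)).trans ?_
    rw [image_univ, range_comp]
    exact hcl _ hcl₁ (isSaturatedOn_range he₁ h₁.sat)
  obtain ⟨κ₁, hκ₁⟩ := key ι₁ h₁ he₁ hcl₁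
  obtain ⟨κ₂, hκ₂⟩ := key ι₂ h₂ he₂ hcl₂
  refine ⟨Bundled.of ↥((Embedding.toHom κ₁).range ⊔ (Embedding.toHom κ₂).range),
    mem_geomClass_of_full hM hfull hc.finite hc.chain hc.iUnion ((Substructure.fg_iff_structure_fg _).1
      ((hN.range _).sup (hP.range _))) (Substructure.subtype _),
    (Substructure.inclusion le_sup_left).comp (Embedding.equivRange κ₁).toEmbedding,
    (Substructure.inclusion le_sup_right).comp (Embedding.equivRange κ₂).toEmbedding,
    fun n p k hn hp => Subtype.ext ?_⟩
  change κ₁ n = κ₂ p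
  rw [hκ₁, hκ₂, hn, hp, hcomm]

theorem geomClass_hereditary : Hereditary (geomClass M) := by
  rintro A ⟨-, V, Γ, hT, hB, ⟨ι⟩⟩ B ⟨hfg, ⟨κ⟩⟩
  let _ := Γ.toStructure M
  exact ⟨hfg, V, Γ, hT, hB, ⟨Embedding.comp ι κ⟩⟩

theorem geomClass_amalgamation [Finite I] (hM : M.IsAdmissible) : Amalgamation (geomClass M) := by
  rintro A N P f g hA hN hP
  obtain ⟨V₁, -, Γ₁, C₁, h₁, hfin₁, hC₁, huniv₁, ⟨ι₁⟩⟩ := exists_full_of_mem_geomClass hM hN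
  obtain ⟨V₂, -, Γ₂, C₂, h₂, hfin₂, hC₂, huniv₂, ⟨ι₂⟩⟩ := exists_full_of_mem_geomClass hM hP
  let κ₁ : Γ₁.StrEmb M A := letI := Γ₁.toStructure M; Embedding.comp ι₁ f
  let κ₂ : Γ₂.StrEmb M A := letI := Γ₂.toStructure M; Embedding.comp ι₂ g
  obtain ⟨E, hE, hEr, hgen⟩ := κ₁.exists_generators hM h₁.isNearFull hA.1
  obtain ⟨Q, hQ, u, v, huv⟩ := exists_amalgam_embedding hM hN.1 hP.1 (StrEmb.typ_eq κ₁ κ₂)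
    κ₁.injective κ₂.injective (StrEmb.inc_iff κ₁ κ₂) h₁ h₂ (κ₁.isClosedIn_range hM h₁.isNearFull)
    (κ₂.isClosedIn_range hM h₂.isNearFull) hE hEr hgen hC₁ hfin₁ huniv₁ hC₂ hfin₂ huniv₂ ι₁ ι₂
  exact ⟨Q, u, v, hQ, Embedding.ext fun a => huv (f a) (g a) a rfl rfl⟩

/-- Amalgamation over the empty set, which is closed and generated by nothing. -/
theorem geomClass_jointEmbedding [Finite I] (hM : M.IsAdmissible) :
    JointEmbedding (geomClass M) := by
  rintro N hN P hP
  obtain ⟨V₁, -, Γ₁, C₁, h₁, hfin₁, hC₁, huniv₁, ⟨ι₁⟩⟩ := exists_full_of_mem_geomClass hM hN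
  obtain ⟨V₂, -, Γ₂, C₂, h₂, hfin₂, hC₂, huniv₂, ⟨ι₂⟩⟩ := exists_full_of_mem_geomClass hM hP
  obtain ⟨Q, hQ, u, v, -⟩ := exists_amalgam_embedding hM hN.1 hP.1 (K := Empty) (f := Empty.elim)
    (g := Empty.elim) (fun a => a.elim) (fun a => a.elim) (fun a => a.elim) (fun a => a.elim) h₁ h₂
    (by rw [range_eq_empty]; exact isClosedIn_empty _) (by rw [range_eq_empty]; exact isClosedIn_empty _)
    finite_empty (empty_subset _) (fun B _ _ => by rw [range_eq_empty]; exact empty_subset _)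
    hC₁ hfin₁ huniv₁ hC₂ hfin₂ huniv₂ ι₁ ι₂
  exact ⟨Q, hQ, ⟨u⟩, ⟨v⟩⟩

end IncGeometry

/-! ### Existence of Fraïssé limits -/

namespace FirstOrder.Language

variable {L : FirstOrder.Language.{0, 0}} {K : Set (Bundled.{0} L.Structure)}

/-- An extension problem for the structure `G`: an embedding of the representative `R k` in `G`
that is to be extended along an embedding in `R l`. -/
abbrev ExtProblem (R : ℕ → Bundled.{0} L.Structure) (G : Type) [L.Structure G] : Type :=
  Σ k l : ℕ, (R k ↪[L] R l) × (R k ↪[L] G)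

/-- The extension problem induced in a larger structure. -/
def ExtProblem.map {R : ℕ → Bundled.{0} L.Structure} {G H : Type} [L.Structure G] [L.Structure H]
    (h : G ↪[L] H) (t : ExtProblem R G) : ExtProblem R H :=
  ⟨t.1, t.2.1, t.2.2.1, h.comp t.2.2.2⟩

/-- A stage in the construction of a Fraïssé limit: a structure, with the extension problems that
are to be solved at the later stages. -/
structure FraisseStage (K : Set (Bundled.{0} L.Structure)) (R : ℕ → Bundled.{0} L.Structure) where
  str : Bundled.{0} L.Structure
  mem : str ∈ K
  problem : ℕ → ℕ → ExtProblem R str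

/-- Every stage carries the extension problems of all earlier stages, transported along the chain.
Step `n` solves one of them by amalgamation: problem number `n.unpair.2` of stage `n.unpair.1`,
which is not later than `n`. The list numbered `n + 1` is filled in when stage `n + 1` is reached,
and what it contains before is irrelevant. -/
theorem exists_chain_of_isFraisse (hK : IsFraisse K) {R : ℕ → Bundled.{0} L.Structure}
    (hRK : ∀ n, R n ∈ K) (e : ∀ G : K, ℕ → ExtProblem R G.1) :
    ∃ (G : ℕ → Bundled.{0} L.Structure) (hG : ∀ n, G n ∈ K) (f : ∀ n, G n ↪[L] G (n + 1)),
      ∀ i j, ∃ n, ∃ hn : i ≤ n, ∃ u : R (e ⟨G i, hG i⟩ j).2.1 ↪[L] G n,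
        u.comp (e ⟨G i, hG i⟩ j).2.2.1 =
          (DirectedSystem.natLERec (G' := fun n => G n) f i n hn).comp
            (e ⟨G i, hG i⟩ j).2.2.2 := by
  classical
  have hstep : ∀ (n : ℕ) (s : FraisseStage K R), ∃ (t : FraisseStage K R) (h : s.str ↪[L] t.str),
      (∃ u : R (s.problem n.unpair.1 n.unpair.2).2.1 ↪[L] t.str,
        u.comp (s.problem n.unpair.1 n.unpair.2).2.2.1 =
          h.comp (s.problem n.unpair.1 n.unpair.2).2.2.2) ∧
      ∀ i, t.problem i = if i = n + 1 then e ⟨t.str, t.mem⟩ else fun j => (s.problem i j).map h := by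
    intro n s
    obtain ⟨Q, u, h, hQ, huh⟩ := hK.amalgamation _ _ _ (s.problem n.unpair.1 n.unpair.2).2.2.1
      (s.problem n.unpair.1 n.unpair.2).2.2.2 (hRK _) (hRK _) s.mem
    exact ⟨⟨Q, hQ, fun i => if i = n + 1 then e ⟨Q, hQ⟩ else fun j => (s.problem i j).map h⟩, h,
      ⟨u, huh⟩, fun i => rfl⟩
  choose next f hsol hprob using hstep
  let S : ℕ → FraisseStage K R :=
    fun n => Nat.rec ⟨R 0, hRK 0, fun _ => e ⟨R 0, hRK 0⟩⟩ (fun n s => next n s) n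
  refine ⟨fun n => (S n).str, fun n => (S n).mem, fun n => f n (S n), fun i j => ?_⟩
  have hself : ∀ n, (S n).problem n = e ⟨(S n).str, (S n).mem⟩ := by
    intro n
    cases n with
    | zero => rfl
    | succ n => exact (hprob n (S n) (n + 1)).trans (if_pos rfl)
  have hsucc : ∀ n (hn : i ≤ n), DirectedSystem.natLERec (G' := fun n => (S n).str)
      (fun n => f n (S n)) i (n + 1) (by omega) = (f n (S n)).comp
        (DirectedSystem.natLERec (G' := fun n => (S n).str) (fun n => f n (S n)) i n hn) := by
    intro n hn
    ext x
    simp only [DirectedSystem.coe_natLERec, Embedding.comp_apply]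
    exact Nat.leRecOn_succ (C := fun n => (S n).str) hn x
  have htr : ∀ n (hn : i ≤ n), (S n).problem i j = (e ⟨(S i).str, (S i).mem⟩ j).map
      (DirectedSystem.natLERec (G' := fun n => (S n).str) (fun n => f n (S n)) i n hn) := by
    intro n hn
    induction n, hn using Nat.le_induction with
    | base =>
      have : DirectedSystem.natLERec (G' := fun n => (S n).str) (fun n => f n (S n)) i i le_rfl =
          Embedding.refl L _ := by
        ext x
        simp [DirectedSystem.coe_natLERec, Nat.leRecOn_self]
      rw [hself, this]
      rfl
    | succ n hn ih =>
      have h1 : (S (n + 1)).problem i j = ((S n).problem i j).map (f n (S n)) := by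
        rw [show (S (n + 1)).problem i = _ from hprob n (S n) i, if_neg (by omega)]
      rw [h1, ih, hsucc n hn]
      rfl
  have hle := Nat.left_le_pair i j
  refine ⟨Nat.pair i j + 1, by omega, ?_⟩
  have := hsol (Nat.pair i j) (S (Nat.pair i j))
  rw [Nat.unpair_pair, htr _ hle] at this
  rw [hsucc _ hle]
  exact this

/-- A countable structure in the class, all of whose extension problems have a solution, is a
Fraïssé limit. -/
theorem isFraisseLimit_of_extension [Countable (Σ l, L.Functions l)] (hK : IsFraisse K) {F : Type}
    [L.Structure F] [Countable F] (hne : ∃ A ∈ K, Nonempty (A ↪[L] F)) (hage : L.age F ⊆ K)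
    (hext : ∀ A ∈ K, ∀ B ∈ K, ∀ (g : A ↪[L] B) (f : A ↪[L] F), ∃ u : B ↪[L] F, u.comp g = f) :
    IsFraisseLimit K F where
  age := by
    refine subset_antisymm hage fun N hN => ⟨hK.FG N hN, ?_⟩
    obtain ⟨A, hA, ⟨f⟩⟩ := hne
    obtain ⟨Q, hQ, ⟨a⟩, ⟨b⟩⟩ := hK.jointEmbedding A hA N hN
    obtain ⟨u, -⟩ := hext A hA Q hQ a f
    exact ⟨u.comp b⟩
  ultrahomogeneous := by
    rw [isUltrahomogeneous_iff_IsExtensionPair Structure.cg_of_countable,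
      isExtensionPair_iff_exists_embedding_closure_singleton_sup]
    intro S hS f m
    have h1 : Bundled.mk S ∈ K := hage (age.fg_substructure hS)
    have h2 : Bundled.mk ↥(Substructure.closure L {m} ⊔ S) ∈ K :=
      hage (age.fg_substructure ((Substructure.fg_closure_singleton m).sup hS))
    obtain ⟨u, hu⟩ := hext _ h1 _ h2 (Substructure.inclusion le_sup_right) f
    exact ⟨u, hu.symm⟩

/-- With representatives `R n` of the isomorphism types, a member of the class has only countably
many extension problems, because a finitely generated structure has only countably many embeddings
in a countable one. In the direct limit of a chain that solves them all, every embedding of a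
finitely generated structure factors through a stage, so it can be extended. -/
theorem exists_isFraisseLimit [Countable (Σ l, L.Functions l)] (hK : IsFraisse K) :
    ∃ (F : Type) (_ : L.Structure F) (_ : Countable F), IsFraisseLimit K F := by
  obtain ⟨c, hc⟩ := hK.is_essentially_countable.exists_eq_range (hK.is_nonempty.image _)
  have hrep : ∀ n, ∃ A ∈ K, (Quotient.mk' A : Quotient _) = c n := fun n => by
    have : c n ∈ Quotient.mk' '' K := hc ▸ mem_range_self n
    exact this
  choose R hRK hRc using hrep
  have hR : ∀ A ∈ K, ∃ n, Nonempty (A ≃[L] R n) := by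
    intro A hA
    obtain ⟨n, hn⟩ : (Quotient.mk' A : Quotient _) ∈ range c := hc ▸ mem_image_of_mem _ hA
    exact ⟨n, Quotient.exact (hn.symm.trans (hRc n).symm)⟩
  have hcount : ∀ A ∈ K, Countable A := fun A hA =>
    Structure.cg_iff_countable.1 (hK.FG A hA).cg
  have hprob : ∀ G : K, ∃ e : ℕ → ExtProblem R G.1, Function.Surjective e := by
    rintro ⟨G, hG⟩
    have := hcount G hG
    have := fun n => hcount _ (hRK n)
    have : Countable (ExtProblem R G) := by
      have := fun k l => (hK.FG _ (hRK k)).countable_embedding (R l)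
      have := fun k => (hK.FG _ (hRK k)).countable_embedding G
      infer_instance
    obtain ⟨k, ⟨i⟩⟩ := hR G hG
    have : Nonempty (ExtProblem R G) := ⟨⟨k, k, Embedding.refl L _, i.symm.toEmbedding⟩⟩
    exact exists_surjective_nat _
  choose e he using hprob
  obtain ⟨G, hG, f, hsol⟩ := exists_chain_of_isFraisse hK hRK e
  have hGc := fun n => hcount _ (hG n)
  let F := @DirectLimit L _ _ (fun n => (G n : Type)) _
    (DirectedSystem.natLERec (G' := fun n => (G n : Type)) f) _ _
  let of := fun n => @DirectLimit.of L ℕ _ (fun n => (G n : Type)) _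
    (DirectedSystem.natLERec (G' := fun n => (G n : Type)) f) _ _ _ n
  have hF : Countable F := by
    exact (Structure.cg_iff_countable (L := L)).1 (DirectLimit.cg _ fun n => (hK.FG _ (hG n)).cg)
  have hage : L.age F ⊆ K := by
    refine (age_directLimit (fun n => (G n : Type)) _).subset.trans ?_
    exact iUnion_subset fun n N hN => hK.hereditary (G n) (hG n) hN
  refine ⟨F, inferInstance, hF, isFraisseLimit_of_extension hK ⟨G 0, hG 0, ⟨of 0⟩⟩ hage ?_⟩
  intro A hA B hB g φ
  obtain ⟨i, T, hT⟩ := DirectLimit.exists_fg_substructure_in_Sigma φ.toHom.range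
    ((hK.FG A hA).range _)
  -- `φ` factors through a stage of the chain
  obtain ⟨ψ, hψ⟩ : ∃ ψ : A ↪[L] G i, ∀ a, of i (ψ a) = φ a := by
    have hle : φ.toHom.range ≤ (of i).toHom.range := by
      rw [← hT]
      rintro _ ⟨x, -, rfl⟩
      exact ⟨x, rfl⟩
    refine ⟨((of i).equivRange.symm.toEmbedding.comp (Substructure.inclusion hle)).comp
      φ.equivRange.toEmbedding, fun a => ?_⟩
    have := (of i).equivRange.apply_symm_apply (Substructure.inclusion hle (φ.equivRange a))
    exact congrArg Subtype.val this
  obtain ⟨k, ⟨ik⟩⟩ := hR A hA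
  obtain ⟨l, ⟨il⟩⟩ := hR B hB
  obtain ⟨j, hj⟩ := he ⟨G i, hG i⟩ ⟨k, l, (il.toEmbedding.comp g).comp ik.symm.toEmbedding,
    ψ.comp ik.symm.toEmbedding⟩
  have := hsol i j
  rw [hj] at this
  obtain ⟨n, hn, u, hu⟩ := this
  refine ⟨(of n).comp (u.comp il.toEmbedding), Embedding.ext fun a => ?_⟩
  have h1 := DFunLike.congr_fun hu (ik a)
  simp only [Embedding.comp_apply, Equiv.coe_toEmbedding, Equiv.symm_apply_apply] at h1
  rw [Embedding.comp_apply, Embedding.comp_apply, Embedding.comp_apply, Equiv.coe_toEmbedding, h1,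
    ← hψ]
  exact DirectLimit.of_f

end FirstOrder.Language

/-! ### The Fraïssé limit as a geometry -/

namespace IncGeometry

variable {I V V' : Type} {Γ : IncGeometry I V} {Γ' : IncGeometry I V'} {M : CoxeterMatrix I}

theorem geomClass_isFraisse [Finite I] (hM : M.IsAdmissible) : IsFraisse (geomClass M) where
  is_nonempty := by
    -- The empty geometry is intermediate, and the age of its completion contains members of the
    -- class.
    let Γ₀ : IncGeometry I Empty := ⟨Empty.elim, fun a => a.elim, fun {a} => a.elim, fun {a} => a.elim⟩
    obtain ⟨V, -, Γ, C, e, hc⟩ := hM.completions Empty Γ₀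
      ⟨fun a => a.elim, fun _ _ _ _ _ _ v _ => (v 0).elim, fun a => a.elim⟩
    let _ := Γ.toStructure M
    obtain ⟨A, hA, ⟨ι⟩⟩ := age.nonempty (L := geomLanguage M) V
    exact ⟨A, mem_geomClass_of_full hM hc.isFull hc.finite hc.chain hc.iUnion hA ι⟩
  FG _ h := h.1
  is_essentially_countable := geomClass_countable hM
  hereditary := geomClass_hereditary
  jointEmbedding := geomClass_jointEmbedding hM
  amalgamation := geomClass_amalgamation hM

section limit

variable {F : Type} [(geomLanguage M).Structure F] [Countable F]

/-- The image of `S` in the full geometry `Γ`, together with `t`, generates a member of the class.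
This member belongs to the age of `F`, and by ultrahomogeneity it can be embedded in `F` so that `S`
stays in place. -/
theorem exists_model [Finite I] (hM : M.IsAdmissible) (hF : IsFraisseLimit (geomClass M) F)
    {S : (geomLanguage M).Substructure F} (hS : S.FG) :
    ∃ (V : Type) (Γ : IncGeometry I V) (ι : Γ.StrEmb M S), Γ.IsFull M ∧ ∀ t : Set V, t.Finite →
      letI := Γ.toStructure M
      ∃ (T : (geomLanguage M).Substructure V) (κ : T ↪[geomLanguage M] F), t ⊆ T ∧
        ∀ x, ∃ hx : ι x ∈ T, κ ⟨ι x, hx⟩ = x := by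
  have hSm : Bundled.mk S ∈ geomClass M := hF.age ▸ age.fg_substructure hS
  obtain ⟨V, -, Γ, C, hΓ, hC0, hC, hCu, ⟨ι⟩⟩ := exists_full_of_mem_geomClass hM hSm
  refine ⟨V, Γ, ι, hΓ, fun t ht => ?_⟩
  let _ := Γ.toStructure M
  have hSfg := (Substructure.fg_iff_structure_fg S).1 hS
  let T : (geomLanguage M).Substructure V :=
    (Embedding.toHom ι).range ⊔ Substructure.closure (geomLanguage M) t
  have hT : T.FG := (hSfg.range _).sup (Substructure.fg_closure ht)
  have hTm : Bundled.mk T ∈ (geomLanguage M).age F := hF.age.symm ▸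
    mem_geomClass_of_full hM hΓ hC0 hC hCu ((Substructure.fg_iff_structure_fg T).1 hT)
      (Substructure.subtype T)
  have hle : (Embedding.toHom ι).range ≤ T := le_sup_left
  have := hTm.2
  obtain ⟨κ, hκ⟩ := hF.ultrahomogeneous.extend_embedding (T := T) hSfg S.subtype
    ((Substructure.inclusion hle).comp (Embedding.equivRange ι).toEmbedding)
  refine ⟨T, κ, Substructure.subset_closure.trans (le_sup_right : _ ≤ T), fun x => ⟨hle ⟨x, rfl⟩, ?_⟩⟩
  exact (DFunLike.congr_fun hκ x).symm

/-- The axioms of an incidence geometry involve two vertices at a time, so they can be read off in a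
model of the substructure generated by these two. -/
theorem exists_limitGeometry [Finite I] (hM : M.IsAdmissible)
    (hF : IsFraisseLimit (geomClass M) F) : ∃ Γ : IncGeometry I F,
    (∀ v i, Γ.typ v = i ↔
      Structure.RelMap (L := geomLanguage M) (GeomRel.vertex i : GeomRel I 1) ![v]) ∧
    ∀ u v, Γ.inc u v ↔
      Structure.RelMap (L := geomLanguage M) (GeomRel.incident : GeomRel I 2) ![u, v] := by
  have hmod : ∀ u v : F, ∃ (V : Type) (Γ : IncGeometry I V) (φ : F → V), (φ u = φ v → u = v) ∧
      (∀ w, w = u ∨ w = v → ∀ i, Γ.typ (φ w) = i ↔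
        Structure.RelMap (L := geomLanguage M) (GeomRel.vertex i : GeomRel I 1) ![w]) ∧
      ∀ w, w = u ∨ w = v → ∀ w', w' = u ∨ w' = v → (Γ.inc (φ w) (φ w') ↔
        Structure.RelMap (L := geomLanguage M) (GeomRel.incident : GeomRel I 2) ![w, w']) := by
    classical
    intro u v
    obtain ⟨V, Γ, ι, hΓ, -⟩ := exists_model hM hF
      (Substructure.fg_closure (L := geomLanguage M) (toFinite {u, v}))
    have hmem : ∀ w, w = u ∨ w = v → w ∈ Substructure.closure (geomLanguage M) {u, v} :=
      fun w hw => Substructure.subset_closure hw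
    have hφ : ∀ w (hw : w = u ∨ w = v),
        (if h : w ∈ Substructure.closure (geomLanguage M) {u, v} then ι ⟨w, h⟩
          else ι ⟨u, hmem u (Or.inl rfl)⟩) = ι ⟨w, hmem w hw⟩ := fun w hw => dif_pos (hmem w hw)
    refine ⟨V, Γ, fun w => if h : w ∈ Substructure.closure (geomLanguage M) {u, v} then ι ⟨w, h⟩
      else ι ⟨u, hmem u (Or.inl rfl)⟩, fun h => ?_, fun w hw i => ?_, fun w hw w' hw' => ?_⟩
    · simp only [hφ u (Or.inl rfl), hφ v (Or.inr rfl)] at h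
      exact congrArg Subtype.val (ι.injective h)
    · simp only [hφ w hw]
      refine (ι.vertex_iff _ i).trans ?_
      exact (Embedding.map_rel (Substructure.subtype _) _ _).symm.trans
        (iff_of_eq (congrArg _ (by ext a; fin_cases a; rfl)))
    · simp only [hφ w hw, hφ w' hw']
      refine (ι.incident_iff _ _).trans ?_
      exact (Embedding.map_rel (Substructure.subtype _) _ _).symm.trans
        (iff_of_eq (congrArg _ (by ext a; fin_cases a <;> rfl)))
  have htyp : ∀ v : F, ∃ i, ∀ j, i = j ↔
      Structure.RelMap (L := geomLanguage M) (GeomRel.vertex j : GeomRel I 1) ![v] := by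
    intro v
    obtain ⟨V, Γ, φ, -, h, -⟩ := hmod v v
    exact ⟨Γ.typ (φ v), h v (Or.inl rfl)⟩
  choose typ htyp using htyp
  refine ⟨⟨typ, fun u v => Structure.RelMap (L := geomLanguage M) (GeomRel.incident : GeomRel I 2)
    ![u, v], fun {u v} h => ?_, fun {u v} h => ?_⟩, htyp, fun u v => Iff.rfl⟩
  · obtain ⟨V, Γ, φ, -, -, hi⟩ := hmod u v
    exact (hi v (Or.inr rfl) u (Or.inl rfl)).1 (Γ.symm ((hi u (Or.inl rfl) v (Or.inr rfl)).2 h))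
  · obtain ⟨V, Γ, φ, hinj, ht, hi⟩ := hmod u v
    have h1 := (ht u (Or.inl rfl) _).2 ((htyp u _).1 rfl)
    have h2 := (ht v (Or.inr rfl) _).2 ((htyp v _).1 rfl)
    rw [← hi u (Or.inl rfl) v (Or.inr rfl), Γ.inc_iff_eq (h1.trans (h.trans h2.symm))]
    exact ⟨hinj, fun e => e ▸ rfl⟩

end limit

end IncGeometry

namespace IncGeometry

variable {I V V' : Type} {Γ : IncGeometry I V} {Γ' : IncGeometry I V'} {M : CoxeterMatrix I}

/-- The types and the incidence relation of `Γ` are those of the structure `F`. -/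
structure IsReduct {F : Type} [(geomLanguage M).Structure F] (Γ : IncGeometry I F) : Prop where
  typ : ∀ v i, Γ.typ v = i ↔
    Structure.RelMap (L := geomLanguage M) (GeomRel.vertex i : GeomRel I 1) ![v]
  inc : ∀ u v, Γ.inc u v ↔
    Structure.RelMap (L := geomLanguage M) (GeomRel.incident : GeomRel I 2) ![u, v]

/-- An embedding between parts of a geometry and of a structure, as a map of geometries. -/
theorem IsReduct.isoOn {F : Type} [(geomLanguage M).Structure F] {Δ : IncGeometry I F}
    (hΔ : Δ.IsReduct (M := M)) {S : (geomLanguage M).Substructure F} (ι : Γ.StrEmb M S) {φ : F → V}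
    (hφ : ∀ x : S, φ x = ι x) : IsoOn Δ Γ φ S := by
  have h1 : ∀ x (hx : x ∈ S), φ x = ι ⟨x, hx⟩ := fun x hx => hφ ⟨x, hx⟩
  refine ⟨fun x hx y hy e => ?_, fun x hx => ?_, fun x hx y hy => ?_⟩
  · rw [h1 x hx, h1 y hy] at e
    exact congrArg Subtype.val (ι.injective e)
  · rw [h1 x hx]
    refine (ι.vertex_iff _ _).2 ?_
    exact (Embedding.map_rel (Substructure.subtype _) _ _).symm.trans
      (iff_of_eq (congrArg _ (by ext a; fin_cases a; rfl))) |>.2 ((hΔ.typ x _).1 rfl)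
  · rw [h1 x hx, h1 y hy, hΔ.inc]
    refine (ι.incident_iff _ _).trans ?_
    exact (Embedding.map_rel (Substructure.subtype _) _ _).symm.trans
      (iff_of_eq (congrArg _ (by ext a; fin_cases a <;> rfl)))

theorem IsReduct.isoOn_symm {F : Type} [(geomLanguage M).Structure F] {Δ : IncGeometry I F}
    (hΔ : Δ.IsReduct (M := M)) {T : @Substructure (geomLanguage M) V (Γ.toStructure M)}
    (κ : letI := Γ.toStructure M; T ↪[geomLanguage M] F) {ψ : V → F} {A : Set V}
    (hψ : letI := Γ.toStructure M; ∀ x ∈ A, ∃ hx : x ∈ T, ψ x = κ ⟨x, hx⟩) : IsoOn Γ Δ ψ A := by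
  let _ := Γ.toStructure M
  refine ⟨fun x hx y hy e => ?_, fun x hx => ?_, fun x hx y hy => ?_⟩
  · obtain ⟨hx', e1⟩ := hψ x hx
    obtain ⟨hy', e2⟩ := hψ y hy
    rw [e1, e2] at e
    exact congrArg Subtype.val (κ.injective e)
  · obtain ⟨hx', e1⟩ := hψ x hx
    rw [e1, hΔ.typ]
    have := κ.map_rel (GeomRel.vertex (Γ.typ x) : (geomLanguage M).Relations 1) ![⟨x, hx'⟩]
    refine (iff_of_eq (congrArg _ (by ext a; fin_cases a; rfl))).trans this |>.2 rfl
  · obtain ⟨hx', e1⟩ := hψ x hx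
    obtain ⟨hy', e2⟩ := hψ y hy
    rw [e1, e2, hΔ.inc]
    have := κ.map_rel (GeomRel.incident : (geomLanguage M).Relations 2) ![⟨x, hx'⟩, ⟨y, hy'⟩]
    exact (iff_of_eq (congrArg _ (by ext a; fin_cases a <;> rfl))).trans this

section limit

variable {F : Type} [(geomLanguage M).Structure F] [Countable F] {Δ : IncGeometry I F}

/-- This is `exists_model` in terms of maps between vertex sets: finite configurations of `F` are
moved to a full geometry by `φ`, and what exists there is brought back by `ψ` without moving `S`. -/
theorem exists_local_model [Finite I] (hM : M.IsAdmissible) (hF : IsFraisseLimit (geomClass M) F)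
    (hΔ : Δ.IsReduct (M := M)) {s : Set F} (hs : s.Finite) :
    ∃ (V : Type) (Γ : IncGeometry I V) (φ : F → V) (S : (geomLanguage M).Substructure F),
      Γ.IsFull M ∧ s ⊆ S ∧ IsoOn Δ Γ φ S ∧ Γ.IsClosedIn M (φ '' S) univ ∧
      (∀ {n} (f : (geomLanguage M).Functions n) (v : Fin n → F), (∀ i, v i ∈ S) →
        φ (Structure.funMap f v) =
          @Structure.funMap (geomLanguage M) V (Γ.toStructure M) n f (φ ∘ v)) ∧
      ∀ t : Set V, t.Finite → ∃ ψ : V → F, IsoOn Γ Δ ψ (φ '' S ∪ t) ∧ ∀ x ∈ S, ψ (φ x) = x := by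
  classical
  obtain ⟨S, hS, hsS⟩ : ∃ S : (geomLanguage M).Substructure F, S.FG ∧ s ⊆ S :=
    ⟨_, Substructure.fg_closure hs, Substructure.subset_closure⟩
  obtain ⟨V, Γ, ι, hΓ, hext⟩ := exists_model hM hF hS
  let _ := Γ.toStructure M
  have := hM.nonempty
  obtain ⟨v₀⟩ := hΓ.rich.nonempty
  -- The image of `v₀` serves as default value of `ψ` outside `T`, as `v₀` does for `φ` outside `S`.
  obtain ⟨T₀, κ₀, hT₀, -⟩ := hext {v₀} (toFinite _)
  have hφ : ∀ x (hx : x ∈ S), (if h : x ∈ S then ι ⟨x, h⟩ else v₀) = ι ⟨x, hx⟩ :=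
    fun x hx => dif_pos hx
  have himg : (fun x => if h : x ∈ S then ι ⟨x, h⟩ else v₀) '' S = range ι := by
    ext v
    constructor
    · rintro ⟨x, hx, rfl⟩
      exact ⟨⟨x, hx⟩, (hφ x hx).symm⟩
    · rintro ⟨x, rfl⟩
      exact ⟨x, x.2, hφ x x.2⟩
  refine ⟨V, Γ, fun x => if h : x ∈ S then ι ⟨x, h⟩ else v₀, S, hΓ, hsS,
    hΔ.isoOn ι fun x => hφ x x.2, himg ▸ ι.isClosedIn_range hM hΓ.isNearFull, fun f v hv => ?_,
    fun t ht => ?_⟩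
  · simp only [hφ _ (S.fun_mem f v hv)]
    refine (Embedding.map_fun ι f fun i => ⟨v i, hv i⟩).trans (congrArg _ ?_)
    ext i
    exact (hφ (v i) (hv i)).symm
  · obtain ⟨T, κ, htT, hκ⟩ := hext t ht
    have hψ : ∀ x (hx : x ∈ T), (if h : x ∈ T then κ ⟨x, h⟩ else κ₀ ⟨v₀, hT₀ rfl⟩) = κ ⟨x, hx⟩ :=
      fun x hx => dif_pos hx
    refine ⟨fun x => if h : x ∈ T then κ ⟨x, h⟩ else κ₀ ⟨v₀, hT₀ rfl⟩, hΔ.isoOn_symm κ ?_, ?_⟩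
    · rw [himg]
      rintro _ (⟨x, rfl⟩ | hx)
      · exact ⟨(hκ x).1, hψ _ (hκ x).1⟩
      · exact ⟨htT hx, hψ _ (htT hx)⟩
    · intro x hx
      obtain ⟨h1, h2⟩ := hκ ⟨x, hx⟩
      simp only [hφ x hx]
      rw [hψ _ h1, h2]

/-- Finite subsets of `F` are intermediate because they embed in full geometries. The path needed
for saturation, and the three vertices needed for richness, exist in the local model and are copied
back to `F`. -/
theorem isFull_limitGeometry [Finite I] (hM : M.IsAdmissible)
    (hF : IsFraisseLimit (geomClass M) F) (hΔ : Δ.IsReduct (M := M)) : Δ.IsFull M where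
  int := by
    rcases isEmpty_or_nonempty F with h | h
    · exact ⟨fun u => (h.false u).elim, fun _ _ _ _ _ _ v _ => (h.false (v 0)).elim,
        fun x => (h.false x).elim⟩
    obtain ⟨g, hg⟩ := exists_surjective_nat F
    have huniv : ⋃ n, g '' Iic n = univ :=
      eq_univ_of_forall fun x => by
        obtain ⟨n, rfl⟩ := hg x
        exact mem_iUnion.2 ⟨n, n, mem_Iic.2 le_rfl, rfl⟩
    rw [← huniv]
    refine isIntermediateOn_iUnion (fun n m h => image_mono (Iic_subset_Iic.2 h)) fun n => ?_
    obtain ⟨V, Γ, φ, S, hΓ, hS, hφ, -⟩ := exists_local_model hM hF hΔ ((finite_Iic n).image g)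
    exact (hφ.isIntermediateOn_image.1 (hΓ.int.mono (subset_univ _))).mono hS
  sat X i j _ hX x hx y hy hxy := by
    obtain ⟨V, Γ, φ, S, hΓ, hS, hφ, -, -, hψ⟩ := exists_local_model hM hF hΔ
      (s := X ∪ {x, y}) (hX.isFlag.finite.union (toFinite _))
    have hXS : X ⊆ S := subset_union_left.trans hS
    have hxS : x ∈ (S : Set F) := hS (Or.inr (Or.inl rfl))
    have hyS : y ∈ (S : Set F) := hS (Or.inr (Or.inr rfl))
    obtain ⟨l, b, hl, hb, hb0, hbl⟩ := hΓ.sat (φ '' X) i j (subset_univ _)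
      ((hφ.isTightFlag_image hXS).2 hX) (φ x)
      ⟨(hφ.mem_localSet_image hXS hxS).2 hx.1, mem_univ _⟩ (φ y)
      ⟨(hφ.mem_localSet_image hXS hyS).2 hy.1, mem_univ _⟩ (by
        rw [hφ.typ x hxS, hφ.typ y hyS, hxy])
    obtain ⟨ψ, hψ, hψφ⟩ := hψ (b '' Iic l) ((finite_Iic l).image b)
    have hb' := (hψ.isPathSeq_image (i := i) (j := j) (X := φ '' X)
      ((image_mono hXS).trans subset_union_left) subset_rfl
      (fun k hk => Or.inr (mem_image_of_mem b hk))).2 (hb.mono fun k hk =>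
        ⟨⟨(hb.adj k hk).1.1, Or.inr (mem_image_of_mem b hk.le)⟩,
          ⟨(hb.adj k hk).2.1.1, Or.inr (mem_image_of_mem b (show k + 1 ≤ l from hk))⟩,
          (hb.adj k hk).2.2⟩)
    rw [image_image, image_congr fun x hx => hψφ x (hXS hx), image_id'] at hb'
    refine ⟨l, ψ ∘ b, hl, hb'.mono fun k hk => localGraph_mono (subset_univ _) (hb'.adj k hk), ?_, ?_⟩
    · exact (congrArg ψ hb0).trans (hψφ x hxS)
    · exact (congrArg ψ hbl).trans (hψφ y hyS)
  rich X hX i hi := by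
    obtain ⟨V, Γ, φ, S, hΓ, hS, hφ, -, -, hψ⟩ := exists_local_model hM hF hΔ hX.finite
    obtain ⟨t, ht, ht3⟩ := exists_subset_encard_eq (hΓ.rich (φ '' X) ((hφ.isFlag_image hS).2 hX) i
      (by rwa [hφ.image_typ_image hS]))
    have htfin : t.Finite := finite_of_encard_eq_coe ht3
    obtain ⟨ψ, hψ, hψφ⟩ := hψ t htfin
    rw [← ht3]
    refine encard_le_encard_of_injOn (f := ψ) (fun v hv => ⟨?_, fun x hx => ?_⟩)
      (hψ.inj.mono subset_union_right)
    · rw [hψ.typ v (Or.inr hv), (ht hv).1]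
    · have := (ht hv).2 (φ x) (mem_image_of_mem φ hx)
      rw [← hψ.inc _ (Or.inl (mem_image_of_mem φ (hS hx))) _ (Or.inr hv), hψφ x (hS hx)] at this
      exact this

end limit

/-- In a local model the functions of `F` are those of a full geometry. A path or a common neighbour
that exists in `F` is visible in a large enough model; conversely, what exists in the model lies in
the closed set `φ '' S` and so comes from `F`. -/
theorem toStructure_limitGeometry [Finite I] {F : Type} [instF : (geomLanguage M).Structure F]
    [Countable F] {Δ : IncGeometry I F} (hM : M.IsAdmissible) (hF : IsFraisseLimit (geomClass M) F) (hΔ : Δ.IsReduct (M := M)) :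
    Δ.toStructure M = instF := by
  have hfull := (isFull_limitGeometry hM hF hΔ).isNearFull
  refine Structure.ext ?_ ?_
  · funext n f v
    cases f with
    | path r k hr =>
      set X := range fun a : Fin r => v (Fin.castAdd 2 a) with hX
      have hXv : X ⊆ range v := by
        rintro _ ⟨a, rfl⟩
        exact ⟨_, rfl⟩
      have himg : ∀ {V : Type} (φ : F → V), φ '' X = range fun a : Fin r => (φ ∘ v) (Fin.castAdd 2 a) :=
        fun φ => by rw [hX, ← range_comp]; rfl
      by_cases hu : ∃ u, Δ.IsShortVertex M X k (v (Fin.natAdd r 0)) (v (Fin.natAdd r 1)) u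
      · obtain ⟨u, hu⟩ := hu
        refine (hfull.funMap_path hM hr v hu).trans ?_
        obtain ⟨j, h1, h2, h3, l, b, hl, hb, hb0, hbl, hk, rfl⟩ := hu
        obtain ⟨V, Γ, φ, S, hΓ, hS, hφ, -, hfun, -⟩ := exists_local_model hM hF hΔ
          (s := range v ∪ b '' Iic l) ((finite_range v).union ((finite_Iic l).image b))
        have hbS : ∀ k ≤ l, b k ∈ (S : Set F) := fun k hk => hS (Or.inr (mem_image_of_mem b hk))
        have hvS : ∀ i, v i ∈ S := fun i => hS (Or.inl ⟨i, rfl⟩)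
        rw [← hb0] at h1 h2 h3 hl hb
        rw [← hbl] at h3
        have := hφ.isShortVertex_of_path (hXv.trans (subset_union_left.trans hS)) hbS h1 h2 h3 hl hb
          hk
        rw [hb0, hbl, himg] at this
        have h4 := (hfun (GeomFun.path r k hr : (geomLanguage M).Functions _) v hvS).trans
          (hΓ.isNearFull.funMap_path hM hr (φ ∘ v) this)
        exact (hφ.inj (S.fun_mem _ v hvS) (hbS k hk) h4).symm
      · push Not at hu
        refine (hfull.funMap_path_of_not hM hr v hu).trans ?_
        obtain ⟨V, Γ, φ, S, hΓ, hS, hφ, hcl, hfun, hψ⟩ := exists_local_model hM hF hΔ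
          (finite_range v)
        have hvS : ∀ i, v i ∈ S := fun i => hS ⟨i, rfl⟩
        obtain ⟨ψ, hψ, hψφ⟩ := hψ ∅ finite_empty
        rw [union_empty] at hψ
        have h4 := (hfun (GeomFun.path r k hr : (geomLanguage M).Functions _) v hvS).trans
          (hΓ.isNearFull.funMap_path_of_not hM hr (φ ∘ v) fun u hu' => ?_)
        · exact (hφ.inj (S.fun_mem _ v hvS) (hvS 0) h4).symm
        rw [← himg] at hu'
        have := hψ.isShortVertex hM.good hΓ.int.propF hcl (image_mono (hXv.trans hS))
          (mem_image_of_mem φ (hvS _)) (mem_image_of_mem φ (hvS _)) hu'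
        rw [image_image, image_congr fun x hx => hψφ x (hS (hXv hx)), image_id', hψφ _ (hvS _),
          hψφ _ (hvS _)] at this
        exact hu _ this
    | meet i j h4 =>
      by_cases hu : ∃ u, Δ.IsMeet i j (v 0) (v 1) u
      · obtain ⟨u, hu⟩ := hu
        refine (hfull.funMap_meet h4 v hu).trans ?_
        obtain ⟨V, Γ, φ, S, hΓ, hS, hφ, -, hfun, -⟩ := exists_local_model hM hF hΔ
          (s := range v ∪ {u}) ((finite_range v).union (toFinite _))
        have huS : u ∈ (S : Set F) := hS (Or.inr rfl)
        have hvS : ∀ i, v i ∈ (S : Set F) := fun i => hS (Or.inl ⟨i, rfl⟩)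
        obtain ⟨hne, hx, hy, hz, h1, h2⟩ := hu
        have hu' : Γ.IsMeet i j ((φ ∘ v) 0) ((φ ∘ v) 1) (φ u) :=
          ⟨fun e => hne (hφ.inj (hvS 0) (hvS 1) e), (hφ.typ _ (hvS 0)).trans hx,
            (hφ.typ _ (hvS 1)).trans hy, (hφ.typ _ huS).trans hz, (hφ.inc _ (hvS 0) _ huS).2 h1,
            (hφ.inc _ (hvS 1) _ huS).2 h2⟩
        have h5 := (hfun (GeomFun.meet i j h4 : (geomLanguage M).Functions _) v hvS).trans
          (hΓ.isNearFull.funMap_meet h4 (φ ∘ v) hu')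
        exact (hφ.inj (S.fun_mem _ v hvS) huS h5).symm
      · push Not at hu
        refine (funMap_meet_of_not h4 v hu).trans ?_
        obtain ⟨V, Γ, φ, S, hΓ, hS, hφ, hcl, hfun, -⟩ := exists_local_model hM hF hΔ
          (finite_range v)
        have hvS : ∀ i, v i ∈ (S : Set F) := fun i => hS ⟨i, rfl⟩
        have h5 := (hfun (GeomFun.meet i j h4 : (geomLanguage M).Functions _) v hvS).trans
          (funMap_meet_of_not h4 (φ ∘ v) fun u' hu' => ?_)
        · exact (hφ.inj (S.fun_mem _ v hvS) (hvS 0) h5).symm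
        obtain ⟨hne, hx, hy, hz, h1, h2⟩ := hu'
        obtain ⟨u, huS, rfl⟩ := hcl.meet _ (mem_image_of_mem φ (hvS 0)) _
          (mem_image_of_mem φ (hvS 1)) u' (mem_univ _) hne (hx.trans hy.symm)
          (by rw [← hz, ← hx] at h4; exact h4) h1 h2
        exact hu u ⟨fun e => hne (congrArg φ e), (hφ.typ _ (hvS 0)).symm.trans hx,
          (hφ.typ _ (hvS 1)).symm.trans hy, (hφ.typ _ huS).symm.trans hz,
          (hφ.inc _ (hvS 0) _ huS).1 h1, (hφ.inc _ (hvS 1) _ huS).1 h2⟩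
  · funext n r v
    cases r with
    | vertex i =>
      exact propext ((hΔ.typ (v 0) i).trans
        (iff_of_eq (congrArg _ (by ext a; fin_cases a; rfl))))
    | incident =>
      exact propext ((hΔ.inc (v 0) (v 1)).trans
        (iff_of_eq (congrArg _ (by ext a; fin_cases a <;> rfl))))

end IncGeometry

/-! ### Homogeneity and flags -/

namespace IncGeometry

variable {I V V' : Type} {Γ : IncGeometry I V} {Γ' : IncGeometry I V'} {M : CoxeterMatrix I}

/-- In an ultrahomogeneous full geometry, isomorphisms of finite closed parts are induced by
automorphisms. -/
theorem IsoOn.exists_automorphism [Finite I] (hM : M.IsAdmissible) (hΓ : Γ.IsNearFull M)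
    (hu : letI := Γ.toStructure M; (geomLanguage M).IsUltrahomogeneous V) {φ : V → V} {A : Set V}
    (h : IsoOn Γ Γ φ A) (hA : A.Finite) (hcl : Γ.IsClosedIn M A univ)
    (hcl' : Γ.IsClosedIn M (φ '' A) univ) :
    letI := Γ.toStructure M
    ∃ g : V ≃[geomLanguage M] V, ∀ a ∈ A, g a = φ a := by
  let _ := Γ.toStructure M
  obtain ⟨S, rfl⟩ := hcl.exists_substructure hM hΓ
  have hr : range S.subtype = (S : Set V) := by simp
  obtain ⟨κ, hκ⟩ := IsoOn.exists_strEmb hM hΓ hΓ S.subtype (hr.symm ▸ h) (hr.symm ▸ hcl')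
  have : Finite S := hA
  obtain ⟨g, hg⟩ := hu S Substructure.FG.of_finite κ
  refine ⟨g, fun a ha => ?_⟩
  have := DFunLike.congr_fun hg ⟨a, ha⟩
  exact this.symm.trans (hκ ⟨a, ha⟩)

/-- Any two vertices of a flag are incident, so by uniqueness a short path between distinct ones is
just an edge; and distinct vertices of a flag have different types, so that `meet` is void. -/
theorem IsFlag.isClosedIn {X : Set V} (hX : Γ.IsFlag X) (hint : Γ.IsIntermediateOn M univ) :
    Γ.IsClosedIn M X univ where
  subset := subset_univ X
  path Y i j _ hY l b hl hb h0 hbl k hk := by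
    by_cases hl1 : l ≤ 1
    · obtain rfl | rfl : k = 0 ∨ k = l := by omega
      exacts [h0, hbl]
    · have h1 := (hb.adj 0 (by omega)).1
      have h2 := (hb.adj (l - 1) (by omega)).2.1
      rw [show l - 1 + 1 = l by omega] at h2
      have hne : b 0 ≠ b l := fun e => by
        have := hb.inj (mem_Iic.2 (Nat.zero_le l)) (mem_Iic.2 le_rfl) e
        omega
      have hb' : (Γ.localGraph Y i j univ).IsPathSeq 1 (fun k => if k = 0 then b 0 else b l) := by
        refine ⟨fun k hk => ?_, ?_⟩
        · obtain rfl : k = 0 := by omega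
          exact ⟨h1, h2, hne, hX _ h0 _ hbl⟩
        · intro k hk k' hk' e
          rw [mem_Iic] at hk hk'
          interval_cases k <;> interval_cases k' <;> simp_all
      have := (hint.propP i j Y (subset_univ Y) hY).path_unique hb hb' rfl rfl (by
        have := hY.adj
        omega)
      omega
  meet x hx x' hx' z _ hne ht _ _ _ := absurd ((Γ.inc_iff_eq ht).1 (hX x hx x' hx')) hne

theorem IsRich.exists_isFlag [Finite I] (h : Γ.IsRich) (J : Set I) :
    ∃ X, Γ.IsFlag X ∧ Γ.typ '' X = J := by
  induction J, J.toFinite using Set.Finite.induction_on with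
  | empty => exact ⟨∅, by simp [IsFlag], image_empty _⟩
  | @insert i J hi _ ih =>
    obtain ⟨X, hX, rfl⟩ := ih
    obtain ⟨v, hv, hvX⟩ : {v | Γ.typ v = i ∧ ∀ x ∈ X, Γ.inc x v}.Nonempty := by
      rw [nonempty_iff_ne_empty]
      intro e
      have := h X hX i hi
      simp [e] at this
    exact ⟨insert v X, hX.insert hvX, by rw [image_insert_eq, hv]⟩

/-- The bijection of flags that preserves types is an isomorphism between finite closed sets. -/
theorem IsFlag.exists_automorphism [Finite I] (hM : M.IsAdmissible) (hΓ : Γ.IsNearFull M)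
    (hu : letI := Γ.toStructure M; (geomLanguage M).IsUltrahomogeneous V) {X Y : Set V}
    (hX : Γ.IsFlag X) (hY : Γ.IsFlag Y) (hXY : Γ.typ '' X = Γ.typ '' Y) :
    letI := Γ.toStructure M
    ∃ g : V ≃[geomLanguage M] V, g '' X = Y := by
  let _ := Γ.toStructure M
  have hy : ∀ x, ∃ y, x ∈ X → y ∈ Y ∧ Γ.typ y = Γ.typ x := fun x => by
    by_cases hx : x ∈ X
    · obtain ⟨y, hy, e⟩ := hXY ▸ mem_image_of_mem Γ.typ hx
      exact ⟨y, fun _ => ⟨hy, e⟩⟩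
    · exact ⟨x, fun h => absurd h hx⟩
  choose φ hφ using hy
  have himg : φ '' X = Y := by
    ext y
    constructor
    · rintro ⟨x, hx, rfl⟩
      exact (hφ x hx).1
    · intro hy
      obtain ⟨x, hx, e⟩ := hXY ▸ mem_image_of_mem Γ.typ hy
      exact ⟨x, hx, hY.eq_of_typ_eq (hφ x hx).1 hy ((hφ x hx).2.trans e)⟩
  obtain ⟨g, hg⟩ := IsoOn.exists_automorphism (φ := φ) (A := X) hM hΓ hu
    ⟨fun x hx x' hx' e => hX.eq_of_typ_eq hx hx' (by rw [← (hφ x hx).2, ← (hφ x' hx').2, e]),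
      fun x hx => (hφ x hx).2,
      fun x hx x' hx' => iff_of_true (hY _ (hφ x hx).1 _ (hφ x' hx').1) (hX x hx x' hx')⟩
    hX.finite (hX.isClosedIn hΓ.int) (himg ▸ hY.isClosedIn hΓ.int)
  exact ⟨g, (image_congr hg).trans himg⟩

theorem exists_automorphism_of_equiv
    (hu : letI := Γ.toStructure M; (geomLanguage M).IsUltrahomogeneous V) :
    letI := Γ.toStructure M
    ∀ S T : (geomLanguage M).Substructure V, S.FG → ∀ e : S ≃[geomLanguage M] T,
      ∃ g : V ≃[geomLanguage M] V, ∀ s : S, g s = e s := by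
  let _ := Γ.toStructure M
  intro S T hS e
  obtain ⟨g, hg⟩ := hu S hS (T.subtype.comp e.toEmbedding)
  exact ⟨g, fun s => (DFunLike.congr_fun hg s).symm⟩

end IncGeometry

/-! ### Fano planes and the alternating group of degree 7 -/

/-- The third point on the line through `x` and `y` in the Fano plane. -/
def fanoThird (x y : Fin 7) : Fin 7 := x + (![0, 3, 6, 1, 5, 4, 2] : Fin 7 → Fin 7) (y - x)

/-- The map that sends `0, 1, 4` to `0, a, c` and preserves the lines of the Fano plane. -/
def fanoMap (a c : Fin 7) : Fin 7 → Fin 7 :=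
  ![0, a, fanoThird a c, fanoThird 0 a, c, fanoThird 0 c, fanoThird (fanoThird 0 a) c]

/-- The lines of the Fano plane. -/
def fanoLine (i : Fin 7) : Finset (Fin 7) := {i, i + 1, i + 3}

theorem mem_fanoPlane {l : Finset (Fin 7)} : l ∈ fanoPlane ↔ ∃ i, l = fanoLine i := by
  simp [fanoPlane, fanoLine, eq_comm]

set_option maxRecDepth 100000 in
theorem fanoMap_injective : ∀ a c : Fin 7, 0 ≠ a → c ≠ 0 → c ≠ a → c ≠ fanoThird 0 a →
    Function.Injective (fanoMap a c) := by
  decide +kernel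

set_option maxRecDepth 100000 in
theorem fanoMap_line : ∀ a c i : Fin 7, 0 ≠ a → c ≠ 0 → c ≠ a → c ≠ fanoThird 0 a →
    fanoMap a c (i + 3) = fanoThird (fanoMap a c i) (fanoMap a c (i + 1)) := by
  decide +kernel

set_option maxRecDepth 100000 in
-- This product is the sign: the collineations that fix `0` are even.
theorem prod_fanoMap : ∀ a c : Fin 7, 0 ≠ a → c ≠ 0 → c ≠ a → c ≠ fanoThird 0 a →
    ∏ j : Fin 7, ∏ i ∈ Finset.Iio j,
      (if fanoMap a c i < fanoMap a c j then (1 : ℤˣ) else -1) = 1 := by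
  decide +kernel

/-- Translations are even as well, so all collineations built from both lie in the alternating
group. -/
theorem prod_add_fin_seven : ∀ q : Fin 7, ∏ j : Fin 7, ∏ i ∈ Finset.Iio j,
    (if q + i < q + j then (1 : ℤˣ) else -1) = 1 := by
  decide +kernel

theorem fanoThird_sub (q x : Fin 7) : q + fanoThird 0 (x - q) = fanoThird q x := by
  simp [fanoThird]

theorem exists_line_fanoThird : ∀ x y : Fin 7, x ≠ y →
    ∃ i : Fin 7, {x, y, fanoThird x y} = fanoLine i := by
  decide +kernel

theorem eq_fanoThird : ∀ i x y z : Fin 7, x ≠ y → x ≠ z → y ≠ z →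
    {x, y, z} = fanoLine i → z = fanoThird x y := by
  decide +kernel

theorem card_fanoLine_inter : ∀ i j : Fin 7, i ≠ j →
    (fanoLine i ∩ fanoLine j).card = 1 := by
  decide +kernel

theorem card_fanoLine : ∀ i : Fin 7, (fanoLine i).card = 3 := by
  decide +kernel

theorem mem_image_fanoPlane {σ : Equiv.Perm (Fin 7)} {l : Finset (Fin 7)} :
    l ∈ (fanoPlane.image fun l => l.image σ) ↔ ∃ i, l = (fanoLine i).image σ := by
  simp only [Finset.mem_image, mem_fanoPlane]
  grind

/-- A permutation that maps lines to lines preserves the Fano plane. -/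
theorem image_fanoPlane_of_forall {g : Equiv.Perm (Fin 7)}
    (h : ∀ i, (fanoLine i).image g ∈ fanoPlane) : (fanoPlane.image fun l => l.image g) = fanoPlane := by
  refine Finset.eq_of_subset_of_card_le (fun l hl => ?_) (Finset.card_image_of_injective _
    (Finset.image_injective g.injective)).ge
  have hi := mem_image_fanoPlane.1 hl
  obtain ⟨i, rfl⟩ := hi
  exact h i

theorem image_mul_fanoPlane (σ τ : Equiv.Perm (Fin 7)) :
    (fanoPlane.image fun l => l.image (σ * τ)) =
      (fanoPlane.image fun l => l.image τ).image fun l => l.image σ := by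
  rw [Finset.image_image]
  refine Finset.image_congr fun l _ => ?_
  simp only [Function.comp_apply, Finset.image_image]
  rfl

/-- A collineation of the Fano plane in the alternating group that maps `0, 1, 4` to a given
triangle. -/
theorem exists_collineation {q a c : Fin 7} (h1 : q ≠ a) (h2 : c ≠ q) (h3 : c ≠ a)
    (h4 : c ≠ fanoThird q a) : ∃ g ∈ alternatingGroup (Fin 7),
      (fanoPlane.image fun l => l.image g) = fanoPlane ∧
        ∀ i, g i = q + fanoMap (a - q) (c - q) i := by
  replace h1 : 0 ≠ a - q := (sub_ne_zero.2 h1.symm).symm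
  replace h2 : c - q ≠ 0 := sub_ne_zero.2 h2
  replace h3 : c - q ≠ a - q := fun h => h3 (sub_left_injective h)
  replace h4 : c - q ≠ fanoThird 0 (a - q) := fun h => h4 (by rw [← fanoThird_sub, ← h]; simp)
  have hinj := fanoMap_injective _ _ h1 h2 h3 h4
  let g : Equiv.Perm (Fin 7) := Equiv.ofBijective _ (Finite.injective_iff_bijective.1 hinj)
  have hg : ∀ i, g i = fanoMap (a - q) (c - q) i := fun i => rfl
  refine ⟨Equiv.addLeft q * g, mul_mem ?_ ?_, ?_, fun i => rfl⟩
  · rw [Equiv.Perm.mem_alternatingGroup, Equiv.Perm.sign_eq_prod_prod_Iio]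
    simp only [Equiv.coe_addLeft]
    exact prod_add_fin_seven q
  · rw [Equiv.Perm.mem_alternatingGroup, Equiv.Perm.sign_eq_prod_prod_Iio]
    simp only [hg]
    exact prod_fanoMap _ _ h1 h2 h3 h4
  · rw [image_mul_fanoPlane, image_fanoPlane_of_forall (g := g) fun i => ?_,
      image_fanoPlane_of_forall fun i => mem_fanoPlane.2 ⟨q + i, ?_⟩]
    · simp [fanoLine, add_assoc]
    · obtain ⟨j, hj⟩ := exists_line_fanoThird _ _ (hinj.ne (show i ≠ i + 1 by simp))
      refine mem_fanoPlane.2 ⟨j, ?_⟩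
      rw [← hj, fanoLine, Finset.image_insert, Finset.image_insert, Finset.image_singleton, hg, hg,
        hg, fanoMap_line _ _ i h1 h2 h3 h4]

namespace IsNeumaierPlane

variable {P Q : Finset (Finset (Fin 7))} {l l' : Finset (Fin 7)}

theorem card_eq (hP : IsNeumaierPlane P) (hl : l ∈ P) : l.card = 3 := by
  obtain ⟨σ, -, rfl⟩ := hP
  have hi := mem_image_fanoPlane.1 hl
  obtain ⟨i, rfl⟩ := hi
  rw [Finset.card_image_of_injective _ σ.injective, card_fanoLine]

theorem card_inter (hP : IsNeumaierPlane P) (hl : l ∈ P) (hl' : l' ∈ P) (h : l ≠ l') :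
    (l ∩ l').card = 1 := by
  obtain ⟨σ, -, rfl⟩ := hP
  have hi := mem_image_fanoPlane.1 hl
  have hj := mem_image_fanoPlane.1 hl'
  obtain ⟨i, rfl⟩ := hi
  obtain ⟨j, rfl⟩ := hj
  rw [← Finset.image_inter _ _ σ.injective, Finset.card_image_of_injective _ σ.injective]
  refine card_fanoLine_inter i j ?_
  rintro rfl
  exact h rfl

theorem eq_of_mem (hP : IsNeumaierPlane P) (hl : l ∈ P) (hl' : l' ∈ P) {x y : Fin 7} (hxy : x ≠ y)
    (hx : x ∈ l) (hx' : x ∈ l') (hy : y ∈ l) (hy' : y ∈ l') : l = l' := by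
  by_contra h
  obtain ⟨z, hz⟩ := Finset.card_eq_one.1 (hP.card_inter hl hl' h)
  have h1 : x ∈ l ∩ l' := Finset.mem_inter.2 ⟨hx, hx'⟩
  have h2 : y ∈ l ∩ l' := Finset.mem_inter.2 ⟨hy, hy'⟩
  rw [hz, Finset.mem_singleton] at h1 h2
  exact hxy (h1.trans h2.symm)

theorem exists_mem (hP : IsNeumaierPlane P) {x y : Fin 7} (hxy : x ≠ y) :
    ∃ l ∈ P, x ∈ l ∧ y ∈ l := by
  obtain ⟨σ, -, rfl⟩ := hP
  obtain ⟨i, hi⟩ := exists_line_fanoThird _ _ (σ.symm.injective.ne hxy)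
  refine ⟨_, mem_image_fanoPlane.2 ⟨i, rfl⟩, ?_, ?_⟩ <;> rw [← hi]
  · exact Finset.mem_image.2 ⟨σ.symm x, by simp, by simp⟩
  · exact Finset.mem_image.2 ⟨σ.symm y, by simp, by simp⟩

theorem exists_eq_insert (hP : IsNeumaierPlane P) (hl : l ∈ P) {p : Fin 7} (hp : p ∈ l) :
    ∃ a b, p ≠ a ∧ p ≠ b ∧ a ≠ b ∧ l = {p, a, b} := by
  obtain ⟨a, b, hab, h⟩ := Finset.card_eq_two.1
    ((Finset.card_erase_of_mem hp).trans (by rw [hP.card_eq hl]))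
  have ha : a ∈ l.erase p := by simp [h]
  have hb : b ∈ l.erase p := by simp [h]
  exact ⟨a, b, (Finset.ne_of_mem_erase ha).symm, (Finset.ne_of_mem_erase hb).symm, hab, by
    rw [← h, Finset.insert_erase hp]⟩

/-- The presentation of `P` by an even permutation `ρ` can be changed by an even collineation of the
standard plane. The collineation is chosen to take the triangle `0, 1, 4` to the preimages of `p, a,
c`; the images of `3` and `5`, the third points on the two lines, are then correct automatically. -/
theorem exists_perm (hP : IsNeumaierPlane P) {p a b c d : Fin 7} (hpa : p ≠ a) (hpb : p ≠ b)
    (hab : a ≠ b) (hpc : p ≠ c) (hpd : p ≠ d) (hcd : c ≠ d) (hl : {p, a, b} ∈ P)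
    (hl' : {p, c, d} ∈ P) (hca : c ≠ a) (hcb : c ≠ b) : ∃ σ ∈ alternatingGroup (Fin 7),
      P = (fanoPlane.image fun l => l.image σ) ∧ σ 0 = p ∧ σ 1 = a ∧ σ 3 = b ∧ σ 4 = c ∧ σ 5 = d := by
  obtain ⟨ρ, hρ, rfl⟩ := hP
  have key : ∀ {x y : Fin 7}, p ≠ x → p ≠ y → x ≠ y →
      {p, x, y} ∈ (fanoPlane.image fun l => l.image ρ) →
      ρ.symm y = fanoThird (ρ.symm p) (ρ.symm x) := by
    intro x y hpx hpy hxy h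
    have hi := mem_image_fanoPlane.1 h
    obtain ⟨i, e⟩ := hi
    refine eq_fanoThird i _ _ _ (ρ.symm.injective.ne hpx) (ρ.symm.injective.ne hpy)
      (ρ.symm.injective.ne hxy) (Finset.image_injective ρ.injective (Eq.trans ?_ e))
    simp
  have hb := key hpa hpb hab hl
  have hd := key hpc hpd hcd hl'
  obtain ⟨g, hg, hgf, hgm⟩ := exists_collineation (ρ.symm.injective.ne hpa)
    (ρ.symm.injective.ne hpc.symm) (ρ.symm.injective.ne hca) (hb ▸ ρ.symm.injective.ne hcb)
  refine ⟨ρ * g, mul_mem hρ hg, ?_, ?_, ?_, ?_, ?_, ?_⟩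
  · rw [image_mul_fanoPlane, hgf]
  all_goals rw [Equiv.Perm.mul_apply, hgm]
  · simp [fanoMap]
  · simp [fanoMap]
  · change ρ (_ + fanoThird 0 _) = b
    rw [fanoThird_sub, ← hb, Equiv.apply_symm_apply]
  · simp [fanoMap]
  · change ρ (_ + fanoThird 0 _) = d
    rw [fanoThird_sub, ← hd, Equiv.apply_symm_apply]

/-- Two planes have at most one line in common. -/
theorem eq_of_two_lines (hP : IsNeumaierPlane P) (hQ : IsNeumaierPlane Q) (hl : l ∈ P) (hl' : l' ∈ P)
    (h : l ≠ l') (hlQ : l ∈ Q) (hlQ' : l' ∈ Q) : P = Q := by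
  obtain ⟨p, hp⟩ := Finset.card_eq_one.1 (hP.card_inter hl hl' h)
  have hpl : p ∈ l ∩ l' := by simp [hp]
  rw [Finset.mem_inter] at hpl
  obtain ⟨a, b, hpa, hpb, hab, rfl⟩ := hP.exists_eq_insert hl hpl.1
  obtain ⟨c, d, hpc, hpd, hcd, rfl⟩ := hP.exists_eq_insert hl' hpl.2
  have hne : ∀ x, p ≠ x → x ∈ ({p, a, b} : Finset (Fin 7)) → x ∉ ({p, c, d} : Finset (Fin 7)) :=
    fun x hx h1 h2 => hx.symm (by simpa [hp] using Finset.mem_inter.2 ⟨h1, h2⟩)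
  have hca : c ≠ a := by rintro rfl; exact hne c hpc (by simp) (by simp)
  have hcb : c ≠ b := by rintro rfl; exact hne c hpc (by simp) (by simp)
  obtain ⟨σ, hσ, rfl, s0, s1, s3, s4, s5⟩ :=
    hP.exists_perm hpa hpb hab hpc hpd hcd hl hl' hca hcb
  obtain ⟨τ, hτ, rfl, t0, t1, t3, t4, t5⟩ :=
    hQ.exists_perm hpa hpb hab hpc hpd hcd hlQ hlQ' hca hcb
  suffices h : σ = τ by rw [h]
  -- The permutations agree on the five points of the two lines, so `σ⁻¹ * τ` moves at most `2` and
  -- `6`; being even, it is the identity.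
  have hfix : ∀ i, i ≠ 2 → i ≠ 6 → (σ⁻¹ * τ) i = i := by
    intro i h2 h6
    rw [Equiv.Perm.mul_apply, Equiv.Perm.inv_eq_iff_eq]
    have : i = 0 ∨ i = 1 ∨ i = 3 ∨ i = 4 ∨ i = 5 := by omega
    rcases this with rfl | rfl | rfl | rfl | rfl
    exacts [t0.trans s0.symm, t1.trans s1.symm, t3.trans s3.symm, t4.trans s4.symm,
      t5.trans s5.symm]
  by_contra hst
  have hsw : (σ⁻¹ * τ).IsSwap := by
    rw [← Equiv.Perm.card_support_eq_two]
    have hsub : (σ⁻¹ * τ).support ⊆ {2, 6} := fun i hi => by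
      by_contra hi'
      simp only [Finset.mem_insert, Finset.mem_singleton, not_or] at hi'
      exact Equiv.Perm.mem_support.1 hi (hfix i hi'.1 hi'.2)
    have h1 := Finset.card_le_card hsub
    have h2 := (Equiv.Perm.two_le_card_support_of_ne_one (f := σ⁻¹ * τ) fun e =>
      hst (inv_mul_eq_one.1 e))
    exact le_antisymm h1 h2
  have h1 := hsw.sign_eq
  rw [Equiv.Perm.mem_alternatingGroup] at hσ hτ
  rw [Equiv.Perm.sign_mul, Equiv.Perm.sign_inv, hσ, hτ] at h1
  exact absurd h1 (by decide)

/-- Three lines on a point that are pairwise coplanar lie in one plane. -/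
theorem mem_of_triangle {R : Finset (Finset (Fin 7))} (hP : IsNeumaierPlane P)
    (hQ : IsNeumaierPlane Q) (hR : IsNeumaierPlane R) {l'' : Finset (Fin 7)} {p : Fin 7}
    (hp : p ∈ l) (hp' : p ∈ l') (hp'' : p ∈ l'') (h1 : l ≠ l') (h2 : l ≠ l'') (h3 : l' ≠ l'')
    (hP1 : l ∈ P) (hP2 : l' ∈ P) (hQ1 : l ∈ Q) (hQ2 : l'' ∈ Q) (hR1 : l' ∈ R) (hR2 : l'' ∈ R) :
    l'' ∈ P := by
  obtain ⟨x, y, hpx, hpy, hxy, e⟩ := hQ.exists_eq_insert hQ2 hp''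
  have hx : x ∈ l'' := by simp [e]
  obtain ⟨m, hm, hpm, hxm⟩ := hP.exists_mem hpx
  have hml : m ≠ l := by rintro rfl; exact h2 (hQ.eq_of_mem hQ1 hQ2 hpx hp hp'' hxm hx)
  have hml' : m ≠ l' := by rintro rfl; exact h3 (hR.eq_of_mem hR1 hR2 hpx hp' hp'' hxm hx)
  -- A line on `p` that meets `l` and `l'` only in `p` is contained in this set, which has three
  -- points. This applies to `l''` and to the third line `m` of `P` on `p`, so they are equal.
  have hsub : ∀ {k}, p ∈ k → (k ∩ l).card = 1 → (k ∩ l').card = 1 → k ⊆ insert p (l ∪ l')ᶜ := by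
    intro k hk c1 c2 z hz
    by_cases hzp : z = p
    · simp [hzp]
    obtain ⟨u, hu⟩ := Finset.card_eq_one.1 c1
    obtain ⟨v, hv⟩ := Finset.card_eq_one.1 c2
    have g1 : p = u := Finset.mem_singleton.1 (hu ▸ Finset.mem_inter.2 ⟨hk, hp⟩)
    have g2 : p = v := Finset.mem_singleton.1 (hv ▸ Finset.mem_inter.2 ⟨hk, hp'⟩)
    refine Finset.mem_insert_of_mem (Finset.mem_compl.2 fun h => ?_)
    rcases Finset.mem_union.1 h with h | h
    · exact hzp ((Finset.mem_singleton.1 (hu ▸ Finset.mem_inter.2 ⟨hz, h⟩)).trans g1.symm)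
    · exact hzp ((Finset.mem_singleton.1 (hv ▸ Finset.mem_inter.2 ⟨hz, h⟩)).trans g2.symm)
  have hcard : (insert p (l ∪ l')ᶜ).card = 3 := by
    rw [Finset.card_insert_of_notMem (by simp [hp]), Finset.card_compl, Fintype.card_fin]
    have := Finset.card_union_add_card_inter l l'
    rw [hP.card_inter hP1 hP2 h1, hP.card_eq hP1, hP.card_eq hP2] at this
    omega
  rw [Finset.eq_of_subset_of_card_le (hsub hp'' (hQ.card_inter hQ2 hQ1 h2.symm)
      (hR.card_inter hR2 hR1 h3.symm)) (by rw [hcard, hQ.card_eq hQ2]),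
    ← Finset.eq_of_subset_of_card_le (hsub hpm (hP.card_inter hm hP1 hml)
      (hP.card_inter hm hP2 hml')) (by rw [hcard, hP.card_eq hm])]
  exact hm

end IsNeumaierPlane

/-- Two lines that meet in a point are coplanar. -/
theorem exists_isNeumaierPlane {p a b c d : Fin 7} (h : [p, a, b, c, d].Nodup) :
    ∃ P, IsNeumaierPlane P ∧ {p, a, b} ∈ P ∧ {p, c, d} ∈ P := by
  -- The alternating group of degree 7 is 5-transitive, so two lines of the standard plane that meet
  -- in a point can be moved to the given ones.
  have := alternatingGroup.isMultiplyPretransitive (Fin 7)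
  rw [Nat.card_eq_fintype_card, Fintype.card_fin] at this
  have hinj : Function.Injective ![p, a, b, c, d] := by
    rw [← List.nodup_ofFn]
    simpa using h
  obtain ⟨σ, hσ⟩ := MulAction.exists_smul_eq (alternatingGroup (Fin 7))
    (⟨![0, 1, 3, 4, 5], by decide⟩ : Fin 5 ↪ Fin 7) ⟨![p, a, b, c, d], hinj⟩
  have key : ∀ i : Fin 5, σ.1 ((![0, 1, 3, 4, 5] : Fin 5 → Fin 7) i) = ![p, a, b, c, d] i :=
    fun i => DFunLike.congr_fun hσ i
  have h0 : σ.1 0 = p := key 0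
  have h1 : σ.1 1 = a := key 1
  have h3 : σ.1 3 = b := key 2
  have h4 : σ.1 4 = c := key 3
  have h5 : σ.1 5 = d := key 4
  refine ⟨_, ⟨σ, σ.2, rfl⟩, mem_image_fanoPlane.2 ⟨0, ?_⟩,
    mem_image_fanoPlane.2 ⟨4, ?_⟩⟩
  · rw [show fanoLine 0 = {0, 1, 3} by rfl]
    simp [h0, h1, h3]
  · rw [show fanoLine 4 = {4, 5, 0} by rfl]
    simp only [Finset.image_insert, Finset.image_singleton, h0, h4, h5]
    ext x
    simp only [Finset.mem_insert, Finset.mem_singleton]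
    tauto

instance : Finite NeumaierVertex :=
  Finite.of_injective (β := Fin 7 ⊕ Finset (Fin 7) ⊕ Finset (Finset (Fin 7)))
    (fun
      | .point p => .inl p
      | .line l _ => .inr (.inl l)
      | .plane P _ => .inr (.inr P))
    (by rintro (p | ⟨l, hl⟩ | ⟨P, hP⟩) (q | ⟨l', hl'⟩ | ⟨Q, hQ⟩) h <;> simp_all)

namespace NeumaierVertex

theorem exists_point : ∀ {v : NeumaierVertex}, v.typ = 0 → ∃ p, v = point p
  | point p, _ => ⟨p, rfl⟩

theorem exists_line : ∀ {v : NeumaierVertex}, v.typ = 1 → ∃ l hl, v = line l hl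
  | line l hl, _ => ⟨l, hl, rfl⟩

theorem exists_plane : ∀ {v : NeumaierVertex}, v.typ = 2 → ∃ P hP, v = plane P hP
  | plane P hP, _ => ⟨P, hP, rfl⟩

end NeumaierVertex

open NeumaierVertex

/-! ### The Neumaier geometry is intermediate and saturated -/

namespace IncGeometry

variable {I V : Type} {Γ : IncGeometry I V} {M : CoxeterMatrix I}

/-- The Neumaier geometry, as a geometry over the types `I`. -/
def neumaierGeometry (e : I ≃ Fin 3) : IncGeometry I NeumaierVertex where
  typ v := e.symm v.typ
  inc := NeumaierVertex.inc
  symm {x y} h := by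
    cases x <;> cases y <;> first | exact h | exact Eq.symm h
  inc_iff_eq {x y} h := by
    have h : x.typ = y.typ := e.symm.injective h
    cases x <;> cases y <;> simp_all [NeumaierVertex.typ, NeumaierVertex.inc]

variable {e : I ≃ Fin 3}

theorem neumaierGeometry_typ_eq (v : NeumaierVertex) (a : Fin 3) :
    (neumaierGeometry e).typ v = e.symm a ↔ v.typ = a := e.symm.injective.eq_iff

theorem neumaierGeometry_typ_eq_typ (u v : NeumaierVertex) :
    (neumaierGeometry e).typ u = (neumaierGeometry e).typ v ↔ u.typ = v.typ :=
  e.symm.injective.eq_iff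

theorem apply_symm_of_reindex (hM : M.reindex e = CoxeterMatrix.B 3) (a b : Fin 3) :
    M (e.symm a) (e.symm b) = CoxeterMatrix.B 3 a b := by
  rw [← hM]
  rfl

theorem coxeterMatrix_B_three (a b : Fin 3) : CoxeterMatrix.B 3 a b =
    (![![1, 3, 2], ![3, 1, 4], ![2, 4, 1] ] : Fin 3 → Fin 3 → ℕ) a b := by
  fin_cases a <;> fin_cases b <;> rfl

theorem eq_of_three_le_B : ∀ a b : Fin 3, 3 ≤ CoxeterMatrix.B 3 a b →
    a = 0 ∧ b = 1 ∨ a = 1 ∧ b = 0 ∨ a = 1 ∧ b = 2 ∨ a = 2 ∧ b = 1 := by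
  simp only [coxeterMatrix_B_three]
  decide

theorem eq_of_four_le_B : ∀ a b : Fin 3, 4 ≤ CoxeterMatrix.B 3 a b →
    a = 1 ∧ b = 2 ∨ a = 2 ∧ b = 1 := by
  simp only [coxeterMatrix_B_three]
  decide

theorem eq_of_B_eq_two : ∀ a b : Fin 3, CoxeterMatrix.B 3 a b = 2 →
    a = 0 ∧ b = 2 ∨ a = 2 ∧ b = 0 := by
  simp only [coxeterMatrix_B_three]
  decide

/-- A tight flag in the Neumaier geometry is a point or a plane. -/
theorem exists_mem_localSet_iff (hM : M.reindex e = CoxeterMatrix.B 3) {X : Set NeumaierVertex}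
    {a b c : Fin 3} (hX : (neumaierGeometry e).IsTightFlag M X (e.symm a) (e.symm b)) (hca : c ≠ a)
    (hcb : c ≠ b) (h : 3 ≤ CoxeterMatrix.B 3 c a ∨ 3 ≤ CoxeterMatrix.B 3 c b)
    (hall : ∀ d : Fin 3, d = a ∨ d = b ∨ d = c) : ∃ x : NeumaierVertex, x.typ = c ∧
      ∀ v, v ∈ (neumaierGeometry e).localSet X (e.symm a) (e.symm b) ↔
        (v.typ = a ∨ v.typ = b) ∧ x.inc v := by
  obtain ⟨x, hx, hxc⟩ := hX.exists_typ (e.symm c) (e.symm.injective.ne hca) (e.symm.injective.ne hcb)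
    (by rwa [apply_symm_of_reindex hM, apply_symm_of_reindex hM])
  rw [neumaierGeometry_typ_eq] at hxc
  refine ⟨x, hxc, fun v => ?_⟩
  rw [hX.mem_localSet, neumaierGeometry_typ_eq, neumaierGeometry_typ_eq]
  refine and_congr_right fun _ => ⟨fun h => h x hx, fun h y hy => ?_⟩
  have h1 := hX.typ_ne y hy
  simp only [ne_eq, neumaierGeometry_typ_eq] at h1
  have h2 : y.typ = c := by
    have := hall y.typ
    tauto
  rwa [hX.isFlag.eq_of_typ_eq hy hx ((neumaierGeometry_typ_eq_typ y x).2 (h2.trans hxc.symm))]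

theorem exists_plane_localSet (hM : M.reindex e = CoxeterMatrix.B 3) {X : Set NeumaierVertex}
    (hX : (neumaierGeometry e).IsTightFlag M X (e.symm 0) (e.symm 1)) : ∃ P hP,
      ∀ v, v ∈ (neumaierGeometry e).localSet X (e.symm 0) (e.symm 1) ↔
        (v.typ = 0 ∨ v.typ = 1) ∧ (plane P hP).inc v := by
  obtain ⟨x, hx, h⟩ := exists_mem_localSet_iff hM hX (c := 2) (by decide) (by decide) (by decide)
    (by decide)
  obtain ⟨P, hP, rfl⟩ := exists_plane hx
  exact ⟨P, hP, h⟩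

theorem exists_point_localSet (hM : M.reindex e = CoxeterMatrix.B 3) {X : Set NeumaierVertex}
    (hX : (neumaierGeometry e).IsTightFlag M X (e.symm 1) (e.symm 2)) : ∃ p,
      ∀ v, v ∈ (neumaierGeometry e).localSet X (e.symm 1) (e.symm 2) ↔
        (v.typ = 1 ∨ v.typ = 2) ∧ (point p).inc v := by
  obtain ⟨x, hx, h⟩ := exists_mem_localSet_iff hM hX (c := 0) (by decide) (by decide) (by decide)
    (by decide)
  obtain ⟨p, rfl⟩ := exists_point hx
  exact ⟨p, h⟩

theorem localGraph_neumaierGeometry_adj {X : Set NeumaierVertex} {a b : Fin 3} {u v : NeumaierVertex}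
    (h : ((neumaierGeometry e).localGraph X (e.symm a) (e.symm b) univ).Adj u v) :
    (u.typ = a ∧ v.typ = b ∨ u.typ = b ∧ v.typ = a) ∧ u.inc v := by
  have := localGraph_adj_typ h
  simp only [ne_eq, neumaierGeometry_typ_eq, neumaierGeometry_typ_eq_typ] at this
  refine ⟨?_, h.2.2.2⟩
  grind

/-- Only cycles of length 4 have to be excluded: two points of a Fano plane are on only one line of
it. -/
theorem noShortCycle_neumaierGeometry_of_plane (hM : M.reindex e = CoxeterMatrix.B 3)
    {X : Set NeumaierVertex}
    (hX : (neumaierGeometry e).IsTightFlag M X (e.symm 0) (e.symm 1)) :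
    ((neumaierGeometry e).localGraph X (e.symm 0) (e.symm 1) univ).NoShortCycle 3 := by
  obtain ⟨P, hP, hloc⟩ := exists_plane_localSet hM hX
  refine SimpleGraph.noShortCycle_of_bipartite (fun u v h => localGraph_adj_typ h)
    fun k hk n v hv hn => ?_
  have h3 := hv.three_le
  obtain rfl : n = 4 := by omega
  clear hn h3 hk
  wlog h0 : (v 0).typ = 0 generalizing v
  · refine this _ (hv.rotate 1) ?_
    have := localGraph_neumaierGeometry_adj (hv.adj 0)
    grind
  have a0 := hv.adj 0
  have a1 := localGraph_neumaierGeometry_adj (hv.adj 1)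
  have a2 := localGraph_neumaierGeometry_adj (hv.adj 2)
  have a3 := localGraph_neumaierGeometry_adj (hv.adj 3)
  have m1 := ((hloc _).1 (hv.adj 1).1.1).2
  have m3 := ((hloc _).1 (hv.adj 3).1.1).2
  have n02 := hv.add_two_ne 0
  have n13 := hv.add_two_ne 1
  have a0 := localGraph_neumaierGeometry_adj a0
  have hper := hv.periodic 0
  simp only [Nat.zero_add, Nat.reduceAdd] at *
  rw [hper] at a3
  obtain ⟨p, hp⟩ := exists_point h0
  obtain ⟨l, hl, hl'⟩ := exists_line (v := v 1) (by grind)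
  obtain ⟨q, hq⟩ := exists_point (v := v 2) (by grind)
  obtain ⟨m, hm, hm'⟩ := exists_line (v := v 3) (by grind)
  rw [hp, hl'] at a0
  rw [hl', hq] at a1
  rw [hq, hm'] at a2
  rw [hm', hp] at a3
  rw [hl'] at m1
  rw [hm'] at m3
  refine n13 ?_
  rw [hl', hm']
  have : l = m := hP.eq_of_mem m1 m3 (fun e => n02 (by rw [hp, hq, e])) a0.2 a3.2 a1.2 a2.2
  subst this
  rfl

/-- Cycles of length 4 are excluded because two planes have at most one common line, and cycles of
length 6 because three pairwise coplanar lines on `p` lie in one plane. -/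
theorem noShortCycle_neumaierGeometry_of_point (hM : M.reindex e = CoxeterMatrix.B 3)
    {X : Set NeumaierVertex}
    (hX : (neumaierGeometry e).IsTightFlag M X (e.symm 1) (e.symm 2)) :
    ((neumaierGeometry e).localGraph X (e.symm 1) (e.symm 2) univ).NoShortCycle 4 := by
  obtain ⟨p, hloc⟩ := exists_point_localSet hM hX
  refine SimpleGraph.noShortCycle_of_bipartite (fun u v h => localGraph_adj_typ h)
    fun k hk n v hv hn => ?_
  have h3 := hv.three_le
  have hn : n = 4 ∨ n = 6 := by omega
  clear h3 hk
  wlog h0 : (v 0).typ = 1 generalizing v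
  · refine this _ (hv.rotate 1) ?_
    have := localGraph_neumaierGeometry_adj (hv.adj 0)
    grind
  have ha := fun k => localGraph_neumaierGeometry_adj (hv.adj k)
  have hl : ∀ k, (v (2 * k)).typ = 1 ∧ (v (2 * k + 1)).typ = 2 := by
    intro k
    induction k with
    | zero =>
      have := ha 0
      simp only [Nat.mul_zero, Nat.zero_add] at *
      grind
    | succ k ih =>
      have h1 := ha (2 * k + 1)
      have h2 := ha (2 * k + 2)
      rw [Nat.mul_succ]
      grind
  have hline : ∀ k, ∃ l hl, v (2 * k) = line l hl := fun k => exists_line (hl k).1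
  have hplane : ∀ k, ∃ P hP, v (2 * k + 1) = plane P hP := fun k => exists_plane (hl k).2
  choose l hl hl' using hline
  choose P hP hP' using hplane
  have hpl : ∀ k, p ∈ l k := fun k => by
    have := ((hloc _).1 (hv.adj (2 * k)).1.1).2
    rwa [hl'] at this
  have h1 : ∀ k, l k ∈ P k := fun k => by
    have := (ha (2 * k)).2
    rwa [hl', hP'] at this
  have h2 : ∀ k, l (k + 1) ∈ P k := fun k => by
    have := (ha (2 * k + 1)).2
    rw [hP', show 2 * k + 1 + 1 = 2 * (k + 1) by ring, hl'] at this
    exact this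
  have hll : ∀ j k, l j = l k → v (2 * j) = v (2 * k) := fun j k e => by
    rw [hl', hl']
    congr
  have hPP : ∀ j k, P j = P k → v (2 * j + 1) = v (2 * k + 1) := fun j k e => by
    rw [hP', hP']
    congr
  have hne : ∀ k, l k ≠ l (k + 1) := fun k e => hv.add_two_ne (2 * k) (hll k (k + 1) e).symm
  have hPne : ∀ k, P k ≠ P (k + 1) := fun k e => hv.add_two_ne (2 * k + 1) (hPP k (k + 1) e).symm
  have hlp : ∀ j, 2 * j = n → l j = l 0 := fun j hj => by
    have := hv.periodic 0
    rw [Nat.zero_add, ← hj, hl', show v 0 = line (l 0) (hl 0) from hl' 0] at this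
    injection this
  rcases hn with rfl | rfl
  · have e := hlp 2 rfl
    exact hPne 0 ((hP 0).eq_of_two_lines (hP 1) (h1 0) (h2 0) (hne 0) (e ▸ h2 1) (h1 1))
  · have e := hlp 3 rfl
    have := (hP 0).mem_of_triangle (hP 2) (hP 1) (hpl 0) (hpl 1) (hpl 2) (hne 0)
      (fun e' => hne 2 (e'.symm.trans e.symm)) (hne 1) (h1 0) (h2 0) (e ▸ h2 2) (h1 2) (h1 1) (h2 1)
    exact hPne 0 ((hP 0).eq_of_two_lines (hP 1) (h2 0) this (hne 1) (h1 1) (h2 1))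

theorem isIntermediateOn_neumaierGeometry (hM : M.reindex e = CoxeterMatrix.B 3) :
    (neumaierGeometry e).IsIntermediateOn M univ where
  propF u _ v _ h := by
    rcases eq_of_B_eq_two u.typ v.typ ((apply_symm_of_reindex hM _ _).symm.trans h) with
      ⟨h1, h2⟩ | ⟨h1, h2⟩
    · obtain ⟨p, rfl⟩ := exists_point h1
      obtain ⟨P, hP, rfl⟩ := exists_plane h2
      trivial
    · obtain ⟨p, rfl⟩ := exists_point h2
      obtain ⟨P, hP, rfl⟩ := exists_plane h1
      trivial
  propP i j X _ hX := by
    obtain ⟨a, rfl⟩ := e.symm.surjective i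
    obtain ⟨b, rfl⟩ := e.symm.surjective j
    have h := hX.adj
    rw [apply_symm_of_reindex hM] at h ⊢
    rcases eq_of_three_le_B a b h with ⟨rfl, rfl⟩ | ⟨rfl, rfl⟩ | ⟨rfl, rfl⟩ | ⟨rfl, rfl⟩
    · exact noShortCycle_neumaierGeometry_of_plane hM hX
    · rw [localGraph_comm]
      exact noShortCycle_neumaierGeometry_of_plane hM hX.symm
    · exact noShortCycle_neumaierGeometry_of_point hM hX
    · rw [localGraph_comm]
      exact noShortCycle_neumaierGeometry_of_point hM hX.symm
  propD x _ x' _ z _ z' _ hx hz h4 h1 h2 h3 h5 := by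
    rw [neumaierGeometry_typ_eq_typ] at hx hz
    rcases eq_of_four_le_B x.typ z.typ (h4.trans_eq (apply_symm_of_reindex hM _ _)) with
      ⟨e1, e2⟩ | ⟨e1, e2⟩
    all_goals
      by_contra! hne
      obtain ⟨l, hl, rfl⟩ := exists_line (by assumption)
      obtain ⟨P, hP, rfl⟩ := exists_plane (by assumption)
    · obtain ⟨l', hl', rfl⟩ := exists_line (hx.symm.trans e1)
      obtain ⟨P', hP', rfl⟩ := exists_plane (hz.symm.trans e2)
      have hll : l ≠ l' := by rintro rfl; exact hne.1 rfl
      have := hP.eq_of_two_lines hP' h1 h3 hll h2 h5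
      subst this
      exact hne.2 rfl
    · obtain ⟨l', hl', rfl⟩ := exists_line (hz.symm.trans e2)
      obtain ⟨P', hP', rfl⟩ := exists_plane (hx.symm.trans e1)
      have hll : l ≠ l' := by rintro rfl; exact hne.2 rfl
      have := hP.eq_of_two_lines hP' h1 h2 hll h3 h5
      subst this
      exact hne.1 rfl

theorem exists_isPathSeq_of_plane (hM : M.reindex e = CoxeterMatrix.B 3) {X : Set NeumaierVertex}
    (hX : (neumaierGeometry e).IsTightFlag M X (e.symm 0) (e.symm 1)) {x y : NeumaierVertex}
    (hx : x ∈ (neumaierGeometry e).localSet X (e.symm 0) (e.symm 1))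
    (hy : y ∈ (neumaierGeometry e).localSet X (e.symm 0) (e.symm 1)) (hxy : y.typ = x.typ) :
    ∃ l b, l < 3 ∧ ((neumaierGeometry e).localGraph X (e.symm 0) (e.symm 1) univ).IsPathSeq l b ∧
      b 0 = x ∧ b l = y := by
  obtain ⟨P, hP, hloc⟩ := exists_plane_localSet hM hX
  suffices h : ∃ w : ((neumaierGeometry e).localGraph X (e.symm 0) (e.symm 1) univ).Walk x y,
      w.length < 3 by
    obtain ⟨w, hw⟩ := h
    obtain ⟨l, b, hl, h⟩ := w.exists_isPathSeq
    exact ⟨l, b, hl.trans_lt hw, h⟩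
  by_cases hne : x = y
  · subst hne
    exact ⟨.nil, by simp⟩
  obtain ⟨z, hz, hzt, hxz, hzy⟩ : ∃ z ∈ (neumaierGeometry e).localSet X (e.symm 0) (e.symm 1),
      z.typ ≠ x.typ ∧ x.inc z ∧ z.inc y := by
    have hx' := (hloc x).1 hx
    have hy' := (hloc y).1 hy
    rcases hx'.1 with h0 | h1
    · obtain ⟨p, rfl⟩ := exists_point h0
      obtain ⟨q, rfl⟩ := exists_point (hxy.trans h0)
      obtain ⟨l, hl, hp, hq⟩ := hP.exists_mem (x := p) (y := q) (by rintro rfl; exact hne rfl)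
      exact ⟨line l (hP.card_eq hl), (hloc _).2 ⟨Or.inr rfl, hl⟩, by simp [NeumaierVertex.typ], hp, hq⟩
    · obtain ⟨l, hl, rfl⟩ := exists_line h1
      obtain ⟨m, hm, rfl⟩ := exists_line (hxy.trans h1)
      obtain ⟨p, hp⟩ := Finset.card_eq_one.1
        (hP.card_inter hx'.2 hy'.2 (by rintro rfl; exact hne rfl))
      have := Finset.mem_inter.1 (hp ▸ Finset.mem_singleton_self p)
      exact ⟨point p, (hloc _).2 ⟨Or.inl rfl, trivial⟩, by simp [NeumaierVertex.typ], this.1, this.2⟩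
  have ht : ∀ {u v : NeumaierVertex}, u.typ ≠ v.typ → u ≠ v := fun h e => h (congrArg _ e)
  have hxz : ((neumaierGeometry e).localGraph X (e.symm 0) (e.symm 1) univ).Adj x z :=
    ⟨⟨hx, mem_univ _⟩, ⟨hz, mem_univ _⟩, ht hzt.symm, hxz⟩
  have hzy : ((neumaierGeometry e).localGraph X (e.symm 0) (e.symm 1) univ).Adj z y :=
    ⟨⟨hz, mem_univ _⟩, ⟨hy, mem_univ _⟩, ht (hxy ▸ hzt), hzy⟩
  exact ⟨.cons hxz (.cons hzy .nil), by simp⟩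

/-- The axiom of a generalized quadrangle has to be verified: for a line `l` on `p` that is not in
the plane `P`, there are a line `m` of `P` on `p` and a plane `Q` that contains both `l` and `m`. -/
theorem exists_isPathSeq_of_point (hM : M.reindex e = CoxeterMatrix.B 3) {X : Set NeumaierVertex}
    (hX : (neumaierGeometry e).IsTightFlag M X (e.symm 1) (e.symm 2)) {x y : NeumaierVertex}
    (hx : x ∈ (neumaierGeometry e).localSet X (e.symm 1) (e.symm 2))
    (hy : y ∈ (neumaierGeometry e).localSet X (e.symm 1) (e.symm 2)) (hxy : y.typ ≠ x.typ) :
    ∃ l b, l < 4 ∧ ((neumaierGeometry e).localGraph X (e.symm 1) (e.symm 2) univ).IsPathSeq l b ∧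
      b 0 = x ∧ b l = y := by
  obtain ⟨p, hloc⟩ := exists_point_localSet hM hX
  suffices h : ∃ w : ((neumaierGeometry e).localGraph X (e.symm 1) (e.symm 2) univ).Walk x y,
      w.length < 4 by
    obtain ⟨w, hw⟩ := h
    obtain ⟨l, b, hl, h⟩ := w.exists_isPathSeq
    exact ⟨l, b, hl.trans_lt hw, h⟩
  wlog h1 : x.typ = 1 generalizing x y
  · have hx' := (hloc x).1 hx
    have hy' := (hloc y).1 hy
    obtain ⟨w, hw⟩ := this hy hx hxy.symm (by grind)
    exact ⟨w.reverse, by simpa using hw⟩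
  obtain ⟨hx1, hpl⟩ := (hloc x).1 hx
  obtain ⟨hy1, -⟩ := (hloc y).1 hy
  obtain ⟨l, hl, rfl⟩ := exists_line h1
  obtain ⟨P, hP, rfl⟩ := exists_plane (hy1.resolve_left fun h => hxy (h.trans h1.symm))
  have adj : ∀ {m Q} hm hQ, p ∈ m → m ∈ Q →
      ((neumaierGeometry e).localGraph X (e.symm 1) (e.symm 2) univ).Adj (line m hm) (plane Q hQ) :=
    fun hm hQ hpm hmQ => ⟨⟨(hloc _).2 ⟨Or.inl rfl, hpm⟩, mem_univ _⟩,
      ⟨(hloc _).2 ⟨Or.inr rfl, trivial⟩, mem_univ _⟩, by simp, hmQ⟩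
  by_cases hlP : l ∈ P
  · exact ⟨(adj hl hP hpl hlP).toWalk, by simp⟩
  obtain ⟨m, hm, Q, hQ, hpm, hmP, hlQ, hmQ⟩ : ∃ m : Finset (Fin 7), ∃ _ : m.card = 3,
      ∃ Q, ∃ _ : IsNeumaierPlane Q, p ∈ m ∧ m ∈ P ∧ l ∈ Q ∧ m ∈ Q := by
    have hpl : p ∈ l := hpl
    obtain ⟨a, b, hab, h⟩ := Finset.card_eq_two.1 ((Finset.card_erase_of_mem hpl).trans (by rw [hl]))
    have ha : a ∈ l.erase p := by simp [h]
    have hb : b ∈ l.erase p := by simp [h]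
    have hpa := (Finset.ne_of_mem_erase ha).symm
    have hpb := (Finset.ne_of_mem_erase hb).symm
    have hle : l = {p, a, b} := by rw [← h, Finset.insert_erase hpl]
    obtain ⟨A, hA, hpA, haA⟩ := hP.exists_mem hpa
    obtain ⟨B, hB, hpB, hbB⟩ := hP.exists_mem hpb
    -- The lines of `P` that join `p` to the other points of `l` cover at most five points. A third
    -- line of `P` on `p` therefore meets `l` only in `p`, and it is coplanar with `l`.
    have hcard : (A ∪ B).card ≤ 5 := by
      have h1 := Finset.card_union_add_card_inter A B
      have h2 : 1 ≤ (A ∩ B).card := Finset.card_pos.2 ⟨p, Finset.mem_inter.2 ⟨hpA, hpB⟩⟩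
      rw [hP.card_eq hA, hP.card_eq hB] at h1
      omega
    obtain ⟨x, -, hx⟩ := Finset.exists_mem_notMem_of_card_lt_card
      (s := A ∪ B) (t := Finset.univ) (by rw [Finset.card_univ, Fintype.card_fin]; omega)
    rw [Finset.mem_union, not_or] at hx
    have hpx : p ≠ x := by rintro rfl; exact hx.1 hpA
    obtain ⟨m, hm, hpm, hxm⟩ := hP.exists_mem hpx
    have ham : a ∉ m := fun h => hx.1 (hP.eq_of_mem hm hA hpa hpm hpA h haA ▸ hxm)
    have hbm : b ∉ m := fun h => hx.2 (hP.eq_of_mem hm hB hpb hpm hpB h hbB ▸ hxm)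
    have hm3 := hP.card_eq hm
    obtain ⟨c, d, hpc, hpd, hcd, rfl⟩ := hP.exists_eq_insert hm hpm
    simp only [Finset.mem_insert, Finset.mem_singleton, not_or] at ham hbm
    obtain ⟨Q, hQ, h1, h2⟩ := exists_isNeumaierPlane (p := p) (a := a) (b := b) (c := c) (d := d)
      (by simp; tauto)
    exact ⟨_, hm3, Q, hQ, hpm, hm, hle ▸ h1, h2⟩
  exact ⟨.cons (adj hl hQ hpl hlQ) (.cons (adj hm hQ hpm hmQ).symm
    (.cons (adj hm hP hpm hmP) .nil)), by simp⟩

theorem isSaturatedOn_neumaierGeometry (hM : M.reindex e = CoxeterMatrix.B 3) :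
    (neumaierGeometry e).IsSaturatedOn M univ := by
  intro X i j _ hX x hx y hy hxy
  obtain ⟨a, rfl⟩ := e.symm.surjective i
  obtain ⟨b, rfl⟩ := e.symm.surjective j
  have h := hX.adj
  rw [apply_symm_of_reindex hM] at h hxy ⊢
  rw [neumaierGeometry_typ_eq_typ] at hxy
  have h3 : CoxeterMatrix.B 3 0 1 = 3 := rfl
  have h3' : CoxeterMatrix.B 3 1 0 = 3 := rfl
  have h4 : CoxeterMatrix.B 3 1 2 = 4 := rfl
  have h4' : CoxeterMatrix.B 3 2 1 = 4 := rfl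
  rcases eq_of_three_le_B a b h with ⟨rfl, rfl⟩ | ⟨rfl, rfl⟩ | ⟨rfl, rfl⟩ | ⟨rfl, rfl⟩
  · rw [h3] at hxy ⊢
    exact exists_isPathSeq_of_plane hM hX hx.1 hy.1 (hxy.2 (by decide))
  · rw [h3'] at hxy ⊢
    rw [localSet_comm] at hx hy
    rw [localGraph_comm]
    exact exists_isPathSeq_of_plane hM hX.symm hx.1 hy.1 (hxy.2 (by decide))
  · rw [h4] at hxy ⊢
    exact exists_isPathSeq_of_point hM hX hx.1 hy.1 fun h => absurd (hxy.1 h) (by decide)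
  · rw [h4'] at hxy ⊢
    rw [localSet_comm] at hx hy
    rw [localGraph_comm]
    exact exists_isPathSeq_of_point hM hX.symm hx.1 hy.1 fun h => absurd (hxy.1 h) (by decide)

end IncGeometry

/-! ### Neumaier geometries in the limit -/

namespace IncGeometry

variable {I V V' : Type} {Γ : IncGeometry I V} {Γ' : IncGeometry I V'} {M : CoxeterMatrix I}

theorem isNeumaierOn_iff {e : I ≃ Fin 3} {S : Set V} : Γ.IsNeumaierOn e S ↔
    ∃ θ, IsoOn (neumaierGeometry e) Γ θ univ ∧ range θ = S := by
  constructor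
  · rintro ⟨φ, ht, hinc⟩
    refine ⟨fun u => φ u, ⟨fun u _ v _ h => φ.injective (Subtype.ext h), fun u _ => ?_,
      fun u _ v _ => hinc u v⟩, ?_⟩
    · exact (Equiv.eq_symm_apply e).2 (ht u)
    · exact (range_comp Subtype.val φ).trans (by simp)
  · rintro ⟨θ, h, rfl⟩
    exact ⟨Equiv.ofInjective θ (injOn_univ.1 h.inj), fun u => (Equiv.eq_symm_apply e).1
      (h.typ u trivial), fun u v => h.inc u trivial v trivial⟩

/-- With the constant chain, the Neumaier geometry embeds in its own completion. Since it is
saturated, its image is closed there, hence a finite substructure, which belongs to the age of `F`.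
-/
theorem exists_isNeumaierOn [Finite I] (hM : M.IsAdmissible) {F : Type}
    [(geomLanguage M).Structure F] [Countable F] {Δ : IncGeometry I F}
    (hF : IsFraisseLimit (geomClass M) F) (hΔ : Δ.IsReduct (M := M)) {e : I ≃ Fin 3}
    (he : M.reindex e = CoxeterMatrix.B 3) :
    ∃ S : (geomLanguage M).Substructure F, Δ.IsNeumaierOn e S := by
  classical
  have hint := isIntermediateOn_neumaierGeometry he
  obtain ⟨V, -, Γ, C, f, hc⟩ := hM.completions NeumaierVertex (neumaierGeometry e) hint
  obtain ⟨φ, hφ, hcl⟩ := hc.exists_embedding hM (U := fun _ => univ) (ε := id) (fun _ => Or.inl rfl)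
    (iUnion_const _) hint ⟨injOn_id _, fun _ _ => rfl, fun _ _ _ _ => Iff.rfl⟩ range_id
  let _ := Γ.toStructure M
  obtain ⟨T, hT⟩ := (hcl univ (isClosedIn_self _) (isSaturatedOn_neumaierGeometry he)).exists_substructure
    hM hc.isFull.isNearFull
  have : Finite T := by
    have := (toFinite (univ : Set NeumaierVertex)).image φ
    rw [← hT] at this
    exact this
  have hTm : Bundled.mk T ∈ (geomLanguage M).age F := hF.age.symm ▸
    mem_geomClass_of_full hM hc.isFull hc.finite hc.chain hc.iUnion
      ((Substructure.fg_iff_structure_fg T).1 Substructure.FG.of_finite) (Substructure.subtype T)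
  obtain ⟨κ⟩ := hTm.2
  have hφT : ∀ u, φ u ∈ T := fun u => by
    have : φ u ∈ (T : Set V) := hT ▸ mem_image_of_mem φ trivial
    exact this
  obtain ⟨ψ, hψ⟩ : ∃ ψ : V → F, ∀ x (hx : x ∈ T), ψ x = κ ⟨x, hx⟩ :=
    ⟨fun x => if h : x ∈ T then κ ⟨x, h⟩ else κ ⟨_, hφT (.point 0)⟩, fun x hx => dif_pos hx⟩
  refine ⟨(Embedding.toHom κ).range, isNeumaierOn_iff.2
    ⟨ψ ∘ φ, hφ.trans (hΔ.isoOn_symm κ (ψ := ψ) ?_), ?_⟩⟩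
  · rw [← hT]
    exact fun x hx => ⟨hx, hψ x hx⟩
  · ext y
    constructor
    · rintro ⟨u, rfl⟩
      exact ⟨⟨φ u, hφT u⟩, (hψ _ (hφT u)).symm⟩
    · rintro ⟨⟨x, hx⟩, rfl⟩
      obtain ⟨u, -, rfl⟩ : x ∈ φ '' univ := hT ▸ hx
      exact ⟨u, hψ _ hx⟩

/-- Two such substructures are finite closed sets that are isomorphic as geometries, which is all
that ultrahomogeneity requires. -/
theorem IsNeumaierOn.exists_automorphism [Finite I] (hM : M.IsAdmissible) (hΓ : Γ.IsNearFull M)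
    (hu : letI := Γ.toStructure M; (geomLanguage M).IsUltrahomogeneous V) {e : I ≃ Fin 3} :
    letI := Γ.toStructure M
    ∀ S T : (geomLanguage M).Substructure V, Γ.IsNeumaierOn e S → Γ.IsNeumaierOn e T →
      ∃ g : V ≃[geomLanguage M] V, g '' (S : Set V) = T := by
  let _ := Γ.toStructure M
  intro S T hS hT
  obtain ⟨θ, hθ, hθS⟩ := isNeumaierOn_iff.1 hS
  obtain ⟨η, hη, hηT⟩ := isNeumaierOn_iff.1 hT
  obtain ⟨ψ, hψ, hψθ⟩ := hθ.exists_inverse ⟨.point 0, trivial⟩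
  rw [image_univ, hθS] at hψ
  have himg : (η ∘ ψ) '' (S : Set V) = T := by
    rw [← hθS, ← hηT, ← range_comp]
    exact congrArg range (funext fun u => congrArg η (hψθ u trivial))
  obtain ⟨g, hg⟩ := IsoOn.exists_automorphism hM hΓ hu (hψ.trans (hη.mono (subset_univ _)))
    (hθS ▸ finite_range θ) (isClosedIn_substructure hM hΓ S)
    (himg ▸ isClosedIn_substructure hM hΓ T)
  exact ⟨g, (image_congr hg).trans himg⟩

end IncGeometry

/-! ### The main theorem -/

open IncGeometry in
theorem mainTheorem3 {I : Type} [Finite I] (M : CoxeterMatrix I)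
    (hM : M.HasDiagram (CoxeterMatrix.B 3) ∨ M.HasDiagram CoxeterMatrix.H₃ ∨
      M.HasDiagram CoxeterMatrix.F₄) :
    Hereditary (geomClass M) ∧ JointEmbedding (geomClass M) ∧ Amalgamation (geomClass M) ∧
    -- the Fraïssé limit exists
    (∃ (F : Type) (_ : (geomLanguage M).Structure F) (_ : Countable F),
      IsFraisseLimit (geomClass M) F) ∧
    ∀ (F : Type) [instF : (geomLanguage M).Structure F] [Countable F],
      IsFraisseLimit (geomClass M) F →
      -- it is the structure of a geometry of type `M`
      ∃ Γ : IncGeometry I F, Γ.toStructure M = instF ∧ Γ.IsOfType M ∧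
        -- flags of each type exist and are permuted transitively
        (∀ J : Set I, ∃ X : Set F, Γ.IsFlag X ∧ Γ.typ '' X = J) ∧
        (∀ X Y : Set F, Γ.IsFlag X → Γ.IsFlag Y → Γ.typ '' X = Γ.typ '' Y →
          ∃ g : F ≃[geomLanguage M] F, g '' X = Y) ∧
        -- for type `C₃`, the same holds for embedded Neumaier geometries
        (∀ e : I ≃ Fin 3, M.reindex e = CoxeterMatrix.B 3 →
          (∃ S : (geomLanguage M).Substructure F, Γ.IsNeumaierOn e S) ∧
          ∀ S T : (geomLanguage M).Substructure F, Γ.IsNeumaierOn e S → Γ.IsNeumaierOn e T →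
            ∃ g : F ≃[geomLanguage M] F, g '' (S : Set F) = T) ∧
        -- every isomorphism of finitely generated substructures extends to an automorphism
        ∀ S T : (geomLanguage M).Substructure F, S.FG → T.FG →
          ∀ e : S ≃[geomLanguage M] T, ∃ g : F ≃[geomLanguage M] F, ∀ s : S, g s = e s := by
  have hM := CoxeterMatrix.isAdmissible_of_hasDiagram hM
  refine ⟨geomClass_hereditary, geomClass_jointEmbedding hM, geomClass_amalgamation hM,
    exists_isFraisseLimit (geomClass_isFraisse hM), fun F instF _ hF => ?_⟩
  obtain ⟨Γ, ht, hi⟩ := exists_limitGeometry hM hF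
  have hΓ : Γ.IsReduct (M := M) := ⟨ht, hi⟩
  have hfull := isFull_limitGeometry hM hF hΓ
  have hinst := toStructure_limitGeometry hM hF hΓ
  have hN := fun e => exists_isNeumaierOn (e := e) hM hF hΓ
  have hu := hF.ultrahomogeneous
  -- From here on, the structure on `F` is the one defined by `Γ`, so that the results on
  -- homogeneous geometries apply.
  subst hinst
  exact ⟨Γ, rfl, hfull.isOfType hM.good hM.linked, hfull.rich.exists_isFlag,
    fun X Y hX hY hXY => hX.exists_automorphism hM hfull.isNearFull hu hY hXY,
    fun e he => ⟨hN e he, IsNeumaierOn.exists_automorphism hM hfull.isNearFull hu⟩,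
    fun S T hS _ e => exists_automorphism_of_equiv hu S T hS e⟩
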